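/- Let $n\ge 0$ be an integer and let $\|B\|=\max_l\sum_s|B_{ls}|$ on $\mathbb C^{n\times n}$. Consider two boundary value problems $L=L(Q,A,h)$ and $\widetilde L=L(\widetilde Q,A,\widetilde h)$ with the same matrix $A$: here $L(Q,A,h)$ is the equation $-Y''+Q(x)Y=\lambda Y$, $x>0$, with the boundary condition $A(Y'(0)-hY(0))-A^\perp Y(0)=0$, where $Q\in L^1((0,\infty);\mathbb C^{n\times n})$, $A^\dagger=A=A^2$, $A^\perp=I-A$, and $h=AhA=Ah=hA$ (neither $Q$ nor $h$ need be self-adjoint). Put $\lambda=\rho^2$ and $\Omega=\{\rho:\operatorname{Im}\rho\ge 0,\ \rho\ne 0\}$; via $\lambda=\rho^2$ the set $\Omega$ represents the $\lambda$-plane with a two-sided cut along $\lambda>0$, without $0$. For $\rho\in\Omega$ let $e(x,\rho)$ be the Jost solution, i.e. the continuous solution, with $e^{-i\rho x}e(x,\rho)$ bounded on $[0,\infty)$, of $e(x,\rho)=e^{i\rho x}I+\int_x^\infty\frac{\sin\rho(t-x)}{\rho}Q(t)e(t,\rho)\,dt$. Put $J(\rho)=A(e'(0,\rho)-he(0,\rho))-A^\perp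 e(0,\rho)$, $\Lambda=\{\rho^2:\rho\in\Omega,\ \det J(\rho)=0\}$, and let $M(\lambda)=[Ae(0,\rho)+A^\perp e'(0,\rho)]J(\rho)^{-1}$ be the Weyl matrix. Let $\varphi(x,\lambda)$ be the solution of $-\varphi''+Q\varphi=\lambda\varphi$ and $\varphi^*(x,\lambda)$ the solution of $-\varphi^{*\prime\prime}+\varphi^*Q=\lambda\varphi^*$ with $\varphi(0,\lambda)=\varphi^*(0,\lambda)=A$ and $\varphi'(0,\lambda)=\varphi^{*\prime}(0,\lambda)=A^\perp+h$. A tilde denotes the corresponding objects of $\widetilde L$. Put $\hat M=M-\widetilde M$ and $$r(x,\lambda,\mu)=\hat M(\mu)\int_0^x\varphi^*(t,\mu)\varphi(t,\lambda)\,dt,\qquad \widetilde r(x,\lambda,\mu)=\hat M(\mu)\int_0^x\widetilde\varphi^*(t,\mu)\widetilde\varphi(t,\lambda)\,dt .$$ Let $\gamma=\gamma'\cup\gamma''$, traversed counterclockwise, where $\gamma'$ is a piecewise smooth closed curve in the $\lambda$-plane that meets $[0,\infty)$ in exactly one point $a^2$ ($a>0$), passes through no point of $\Lambda\cup\widetilde\Lambda\cup\{0\}$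 and has winding number $1$ about every point of this set, and $\gamma''$ is the two-sided cut along $\{\lambda\ge a^2\}$. In terms of $\rho\in\Omega$, $\gamma$ runs from $+\infty$ to $a$ along the real axis, from $a$ to $-a$ along an arc in $\operatorname{Im}\rho>0$, and from $-a$ to $-\infty$ along the real axis; the two sides of the cut are regarded as different points of $\gamma$. Let $X$ be the Banach space of the continuous functions $z:\gamma\to\mathbb C^{n\times n}$ for which $z(\lambda)(A+i\rho A^\perp)$ is bounded on $\gamma$, with the norm $\|z\|_X=\sup_{\lambda\in\gamma}\|z(\lambda)(A+i\rho A^\perp)\|$. **Theorem.** Let $x\ge 0$ be fixed. For all $z\in X$ and $\lambda\in\gamma$ the integrals $\int_\gamma z(\mu)\widetilde r(x,\lambda,\mu)\,d\mu$ and $\int_\gamma z(\mu)r(x,\lambda,\mu)\,d\mu$ converge absolutely. The main equation $$\widetilde\varphi(x,\lambda)=z(\lambda)+\frac1{2\pi i}\int_\gamma z(\mu)\,\widetilde r(x,\lambda,\mu)\,d\mu,\qquad \lambda\in\gamma,$$ has exactly one solution $z\in X$, namely $z=\varphi(x,\cdot)$ (in particular $\varphi(x,\cdot)\in X$). Moreover,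 the operator $$z\mapsto z+\frac1{2\pi i}\int_\gamma z(\mu)\,\widetilde r(x,\cdot,\mu)\,d\mu$$ is a bounded linear bijection of $X$ onto itself, with the bounded inverse $$z\mapsto z-\frac1{2\pi i}\int_\gamma z(\mu)\,r(x,\cdot,\mu)\,d\mu .$$ -/

import Mathlib

/-! Matrices carry the norm `‖B‖ = max_l ∑_s |B_ls|`. Its topology is the entrywise one; the
instances of the latter are switched off so that only one path to the topology is left. -/
attribute [local instance] Matrix.linftyOpNormedRing Matrix.linftyOpNormedAlgebra
attribute [-instance] instTopologicalSpaceMatrix Matrix.instUniformSpace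

noncomputable section

namespace MatrixSchrodinger

open MeasureTheory Set

/-- The space of complex `n × n` matrices. -/
abbrev Mat (n : ℕ) : Type := Matrix (Fin n) (Fin n) ℂ

/-- The data of the problem `L(Q, A, h)` on the half-line: `-Y'' + Q Y = λ Y` with the boundary
condition `A (Y'(0) - h Y(0)) - A^⊥ Y(0) = 0`. The potential is integrable on `(0, ∞)` (not
necessarily self-adjoint), `A` is an orthogonal projection, and `h = A h = h A` (hence
`h = A h A`). -/
structure Problem (n : ℕ) where
  /-- the potential -/
  Q : ℝ → Mat n
  /-- the orthogonal projection in the boundary condition -/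
  A : Mat n
  /-- the matrix coefficient in the boundary condition -/
  h : Mat n
  integrable_Q : IntegrableOn Q (Ioi 0)
  A_conjTranspose : A.conjTranspose = A
  A_mul_self : A * A = A
  A_mul_h : A * h = h
  h_mul_A : h * A = h

/-- `Ω = {ρ : Im ρ ≥ 0, ρ ≠ 0}`; through `λ = ρ²` it parametrizes the `λ`-plane with the two-sided
cut along the positive half-line (and without the point `0`). -/
def Omega : Set ℂ := {ρ | 0 ≤ ρ.im ∧ ρ ≠ 0}

/-- `Y` is a solution on `[0, ∞)` of `-Y'' + Q Y = lam Y`, `Y(0) = Y₀`, `Y'(0) = Y₁`, with `Y'`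
locally absolutely continuous and the equation holding almost everywhere (written in integrated
form). -/
def IsCauchySolution {n : ℕ} (Q : ℝ → Mat n) (lam : ℂ) (Y₀ Y₁ : Mat n) (Y : ℝ → Mat n) : Prop :=
  Y 0 = Y₀ ∧ ∃ Y' : ℝ → Mat n,
    (∀ x, 0 ≤ x → HasDerivWithinAt Y (Y' x) (Ici 0) x) ∧
    (∀ x, 0 ≤ x → Y' x = Y₁ + ∫ t in (0 : ℝ)..x, (Q t * Y t - lam • Y t))

/-- `Z` is a solution on `[0, ∞)` of the equation `-Z'' + Z Q = lam Z` with coefficients on the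
right, `Z(0) = Z₀`, `Z'(0) = Z₁`. -/
def IsCauchySolutionStar {n : ℕ} (Q : ℝ → Mat n) (lam : ℂ) (Z₀ Z₁ : Mat n) (Z : ℝ → Mat n) :
    Prop :=
  Z 0 = Z₀ ∧ ∃ Z' : ℝ → Mat n,
    (∀ x, 0 ≤ x → HasDerivWithinAt Z (Z' x) (Ici 0) x) ∧
    (∀ x, 0 ≤ x → Z' x = Z₁ + ∫ t in (0 : ℝ)..x, (Z t * Q t - lam • Z t))

/-- `e` is the Jost solution `e(·, ρ)`: it is continuous on `[0, ∞)`, `e^{-iρx} e(x)` is bounded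
there, and `e(x) = e^{iρx} I + ∫_x^∞ (sin ρ(t - x) / ρ) Q(t) e(t) dt`. -/
def IsJostSolution {n : ℕ} (Q : ℝ → Mat n) (ρ : ℂ) (e : ℝ → Mat n) : Prop :=
  ContinuousOn e (Ici 0) ∧
  (∃ C : ℝ, ∀ x : ℝ, 0 ≤ x → ‖Complex.exp (-(Complex.I * ρ * x)) • e x‖ ≤ C) ∧
  ∀ x : ℝ, 0 ≤ x → e x = Complex.exp (Complex.I * ρ * x) • (1 : Mat n) +
    ∫ t in Ioi x, (Complex.sin (ρ * ((t : ℂ) - (x : ℂ))) / ρ) • (Q t * e t)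

namespace Problem

variable {n : ℕ} (L : Problem n)

/-- `A^⊥ = I - A`. -/
def Aperp : Mat n := 1 - L.A

/-- `φ(x, λ)`: the solution with `φ(0, λ) = A`, `φ'(0, λ) = A^⊥ + h`. -/
def phi (x : ℝ) (lam : ℂ) : Mat n :=
  Classical.epsilon (IsCauchySolution L.Q lam L.A (L.Aperp + L.h)) x

/-- `φ*(x, λ)`: the solution of the equation with `Q` on the right with the same initial values. -/
def phiStar (x : ℝ) (lam : ℂ) : Mat n :=
  Classical.epsilon (IsCauchySolutionStar L.Q lam L.A (L.Aperp + L.h)) x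

/-- The Jost solution `e(x, ρ)`. -/
def jost (x : ℝ) (ρ : ℂ) : Mat n := Classical.epsilon (IsJostSolution L.Q ρ) x

/-- `e'(0, ρ)` (derivative in `x` from the right). -/
def jostDerivZero (ρ : ℂ) : Mat n := derivWithin (fun x => L.jost x ρ) (Ici 0) 0

/-- The Jost matrix `J(ρ) = A (e'(0, ρ) - h e(0, ρ)) - A^⊥ e(0, ρ)`. -/
def jostMatrix (ρ : ℂ) : Mat n :=
  L.A * (L.jostDerivZero ρ - L.h * L.jost 0 ρ) - L.Aperp * L.jost 0 ρ

/-- The Weyl matrix `M(λ) = [A e(0, ρ) + A^⊥ e'(0, ρ)] J(ρ)⁻¹`, as a function of `ρ ∈ Ω`. -/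
def weylMatrix (ρ : ℂ) : Mat n :=
  (L.A * L.jost 0 ρ + L.Aperp * L.jostDerivZero ρ) * (L.jostMatrix ρ)⁻¹

/-- `Λ = {ρ² : ρ ∈ Ω, det J(ρ) = 0}`. -/
def Lam : Set ℂ := {w | ∃ ρ ∈ Omega, (L.jostMatrix ρ).det = 0 ∧ w = ρ ^ 2}

/-- `D(x, λ, μ) = ∫_0^x φ*(t, μ) φ(t, λ) dt`. -/
def D (x : ℝ) (lam mu : ℂ) : Mat n := ∫ t in (0 : ℝ)..x, L.phiStar t mu * L.phi t lam

/-- The weight `A + i ρ A^⊥`. -/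
def weight (ρ : ℂ) : Mat n := L.A + (Complex.I * ρ) • L.Aperp

/-- The inverse `A + (i ρ)⁻¹ A^⊥` of the weight. -/
def weightInv (ρ : ℂ) : Mat n := L.A + (Complex.I * ρ)⁻¹ • L.Aperp

lemma Aperp_mul_self : L.Aperp * L.Aperp = L.Aperp := by
  simp only [Aperp, sub_mul, mul_sub, L.A_mul_self, one_mul, mul_one]; abel

lemma A_mul_Aperp : L.A * L.Aperp = 0 := by
  simp only [Aperp, mul_sub, L.A_mul_self, mul_one]; abel

lemma Aperp_mul_A : L.Aperp * L.A = 0 := by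
  simp only [Aperp, sub_mul, L.A_mul_self, one_mul]; abel

lemma weight_mul_weightInv {ρ : ℂ} (hρ : ρ ≠ 0) : L.weight ρ * L.weightInv ρ = 1 := by
  have h : Complex.I * ρ ≠ 0 := mul_ne_zero Complex.I_ne_zero hρ
  simp only [weight, weightInv, add_mul, mul_add, smul_mul_assoc, mul_smul_comm, L.A_mul_self,
    A_mul_Aperp, Aperp_mul_A, Aperp_mul_self, smul_zero, add_zero, zero_add]
  rw [inv_smul_smul₀ h, Aperp, add_sub_cancel]

lemma weightInv_mul_weight {ρ : ℂ} (hρ : ρ ≠ 0) : L.weightInv ρ * L.weight ρ = 1 := by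
  have h : Complex.I * ρ ≠ 0 := mul_ne_zero Complex.I_ne_zero hρ
  simp only [weight, weightInv, add_mul, mul_add, smul_mul_assoc, mul_smul_comm, L.A_mul_self,
    A_mul_Aperp, Aperp_mul_A, Aperp_mul_self, smul_zero, add_zero, zero_add]
  rw [smul_inv_smul₀ h, Aperp, add_sub_cancel]

end Problem

/-- `M̂(μ) D₀(x, λ, μ)` at `μ = τ²`, where `M̂ = M - M̃` is the difference of the Weyl matrices of `L`
and `L'` and `D₀` is the function `D` of the problem `K`. So `kernel L L' L` is `r` and
`kernel L L' L'` is `r̃`. -/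
def kernel {n : ℕ} (L L' K : Problem n) (x : ℝ) (lam τ : ℂ) : Mat n :=
  (L.weylMatrix τ - L'.weylMatrix τ) * K.D x lam (τ ^ 2)

/-- `f` is piecewise continuously differentiable on `[0, 1]`. -/
def IsPiecewiseC1 (f : ℝ → ℂ) : Prop :=
  ∃ (k : ℕ) (t : ℕ → ℝ), Monotone t ∧ t 0 = 0 ∧ t k = 1 ∧
    ∀ j < k, ContDiffOn ℝ 1 f (Icc (t j) (t (j + 1)))

/-- The contour `γ = γ' ∪ γ''` around the bounded set `S` and the positive half-line, described by
the variable `ρ ∈ Ω` with `λ = ρ²`, so that the two sides of the cut are kept apart.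
It runs along `ρ : ℝ → ℂ`:
for `s ≤ 0` along the upper side of the cut `[a², ∞)`, from `+∞` to `a²` (`ρ = a - s > 0`);
for `0 ≤ s ≤ 1` along the piecewise smooth closed curve `γ' = {ρ(s)²}`, which meets the positive
half-line at `a²` only and winds exactly once counterclockwise around each point of `S`;
for `s ≥ 1` along the lower side of the cut, from `a²` to `+∞` (`ρ = -a - (s - 1) < 0`). -/
structure Contour (S : Set ℂ) where
  /-- the contour in the variable `ρ` -/
  ρ : ℝ → ℂ
  /-- the square root of the point where `γ'` meets the positive half-line -/
  a : ℝ
  a_pos : 0 < a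
  ρ_upper : ∀ s : ℝ, s ≤ 0 → ρ s = ((a - s : ℝ) : ℂ)
  ρ_lower : ∀ s : ℝ, 1 ≤ s → ρ s = ((-a - (s - 1) : ℝ) : ℂ)
  im_pos : ∀ s : ℝ, 0 < s → s < 1 → 0 < (ρ s).im
  piecewise : IsPiecewiseC1 ρ
  avoids : ∀ w ∈ S, ∀ s ∈ Icc (0 : ℝ) 1, ρ s ^ 2 ≠ w
  encircles : ∀ w ∈ S, (2 * (Real.pi : ℂ) * Complex.I)⁻¹ *
    (∫ s in (0 : ℝ)..1, deriv (fun t => ρ t ^ 2) s / (ρ s ^ 2 - w)) = 1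

namespace Contour

variable {S : Set ℂ} (Γ : Contour S)

/-- The set of points of the contour, in the variable `ρ`. -/
def support : Set ℂ := range Γ.ρ

/-- The parametrization as a map to the set of points of the contour. -/
def pt (s : ℝ) : Γ.support := ⟨Γ.ρ s, mem_range_self s⟩

lemma ne_zero (p : Γ.support) : (p : ℂ) ≠ 0 := by
  obtain ⟨w, s, hs⟩ := p
  change w ≠ 0
  rw [← hs]
  have ha := Γ.a_pos
  rcases le_or_gt s 0 with h | h
  · rw [Γ.ρ_upper s h]
    exact Complex.ofReal_ne_zero.mpr (by linarith)
  rcases lt_or_ge s 1 with h1 | h1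
  · intro h0
    have := Γ.im_pos s h h1
    rw [h0] at this
    simp at this
  · rw [Γ.ρ_lower s h1]
    exact Complex.ofReal_ne_zero.mpr (by linarith)

/-- The pulled back form `F dμ`, with `μ = ρ(s)²`. -/
def form {n : ℕ} (F : Γ.support → Mat n) (s : ℝ) : Mat n :=
  deriv (fun t => Γ.ρ t ^ 2) s • F (Γ.pt s)

/-- The integral of `F` over `γ` converges absolutely. -/
def AbsConv {n : ℕ} (F : Γ.support → Mat n) : Prop := Integrable (Γ.form F)

/-- `∫_γ F(μ) dμ`. -/
def integral {n : ℕ} (F : Γ.support → Mat n) : Mat n := ∫ s : ℝ, Γ.form F s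

end Contour

variable {n : ℕ} {S : Set ℂ}

/-- The continuous functions `z` on `γ` for which `z(λ) (A + i ρ A^⊥)` is bounded. -/
def xSubmodule (L : Problem n) (Γ : Contour S) : Submodule ℂ C(Γ.support, Mat n) where
  carrier := {z | ∃ C : ℝ, ∀ p, ‖z p * L.weight p‖ ≤ C}
  zero_mem' := ⟨0, fun p => by simp⟩
  add_mem' := by
    rintro z w ⟨C, hC⟩ ⟨C', hC'⟩
    exact ⟨C + C', fun p => by
      simpa [add_mul] using (norm_add_le _ _).trans (add_le_add (hC p) (hC' p))⟩
  smul_mem' := by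
    rintro c z ⟨C, hC⟩
    refine ⟨‖c‖ * C, fun p => ?_⟩
    simpa [smul_mul_assoc, norm_smul] using mul_le_mul_of_nonneg_left (hC p) (norm_nonneg c)

/-- The space `X`, to be normed by `‖z‖ = sup_γ ‖z(λ) (A + i ρ A^⊥)‖`. -/
def XSpace (L : Problem n) (Γ : Contour S) : Type := xSubmodule L Γ

namespace XSpace

variable {L : Problem n} {Γ : Contour S}

instance : AddCommGroup (XSpace L Γ) := inferInstanceAs (AddCommGroup (xSubmodule L Γ))

instance : Module ℂ (XSpace L Γ) := inferInstanceAs (Module ℂ (xSubmodule L Γ))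

instance : CoeFun (XSpace L Γ) fun _ => Γ.support → Mat n := ⟨fun z => z.1⟩

lemma continuous_weight : Continuous fun p : Γ.support => L.weight (p : ℂ) := by
  unfold Problem.weight
  fun_prop

/-- The bounded continuous function `λ ↦ z(λ) (A + i ρ A^⊥)` on `γ`. -/
def weighted : XSpace L Γ →ₗ[ℂ] BoundedContinuousFunction Γ.support (Mat n) where
  toFun z := BoundedContinuousFunction.ofNormedAddCommGroup (fun p => z p * L.weight p)
    ((z.1.continuous).mul continuous_weight) z.2.choose z.2.choose_spec
  map_add' z w := by
    ext1 p
    exact add_mul (z p) (w p) (L.weight p)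
  map_smul' c z := by
    ext1 p
    exact smul_mul_assoc c (z p) (L.weight p)

lemma weighted_apply (z : XSpace L Γ) (p : Γ.support) : weighted z p = z p * L.weight p := rfl

lemma weighted_injective : Function.Injective (weighted : XSpace L Γ →ₗ[ℂ] _) := by
  intro z w hzw
  apply Subtype.ext
  ext1 p
  have h := congrArg (fun f => f p * L.weightInv (p : ℂ)) hzw
  simpa [weighted_apply, mul_assoc, L.weight_mul_weightInv (Γ.ne_zero p)] using h

instance : NormedAddCommGroup (XSpace L Γ) :=
  NormedAddCommGroup.induced _ _ (weighted : XSpace L Γ →ₗ[ℂ] _) weighted_injective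

instance : NormedSpace ℂ (XSpace L Γ) :=
  NormedSpace.induced ℂ _ _ (weighted : XSpace L Γ →ₗ[ℂ] _)

lemma norm_eq (z : XSpace L Γ) : ‖z‖ = ⨆ p : Γ.support, ‖z p * L.weight p‖ :=
  (weighted z).norm_eq_iSup_norm

lemma weighted_surjective : Function.Surjective (weighted : XSpace L Γ →ₗ[ℂ] _) := by
  intro f
  have hc : Continuous fun p : Γ.support => L.weightInv (p : ℂ) := by
    unfold Problem.weightInv
    have : Continuous fun p : Γ.support => (Complex.I * (p : ℂ))⁻¹ :=
      Continuous.inv₀ (by fun_prop) fun p => mul_ne_zero Complex.I_ne_zero (Γ.ne_zero p)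
    fun_prop
  have key : ∀ p : Γ.support, f p * L.weightInv (p : ℂ) * L.weight (p : ℂ) = f p := fun p => by
    rw [mul_assoc, L.weightInv_mul_weight (Γ.ne_zero p), mul_one]
  refine ⟨⟨⟨fun p => f p * L.weightInv (p : ℂ), f.continuous.mul hc⟩, ‖f‖, fun p => ?_⟩, ?_⟩
  · simpa [key p] using f.norm_coe_le_norm p
  · ext1 p
    exact key p

/-- `X` is a Banach space. -/
instance : CompleteSpace (XSpace L Γ) := by
  have hi : Isometry (weighted : XSpace L Γ →ₗ[ℂ] _) :=
    AddMonoidHomClass.isometry_of_norm (weighted : XSpace L Γ →ₗ[ℂ] _) fun _ => rfl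
  exact (IsometryEquiv.mk (Equiv.ofBijective _ ⟨weighted_injective, weighted_surjective⟩)
    hi).completeSpace

end XSpace

/-- The main equation at the point `x` for the unknown `z`: for all `λ ∈ γ`,
`φ̃(x, λ) = z(λ) + (1 / 2πi) ∫_γ z(μ) r̃(x, λ, μ) dμ`. -/
def SolvesMainEquation (L L' : Problem n) (Γ : Contour S) (x : ℝ) (z : XSpace L Γ) : Prop :=
  ∀ p : Γ.support, L'.phi x ((p : ℂ) ^ 2) = z p + (2 * (Real.pi : ℂ) * Complex.I)⁻¹ •
    Γ.integral fun q => z q * kernel L L' L' x ((p : ℂ) ^ 2) q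

end MatrixSchrodinger

end

noncomputable section

namespace MatrixSchrodinger

open MeasureTheory Set Filter Topology

/-! Write `D` and `D̃` for `∫₀ˣ φ*φ` and `∫₀ˣ φ̃*φ̃`; in the lemmas the problem with the tilde is
mostly called `K`. The theorem rests on one contour integral, one product rule in `x`, and one bound
for kernels.

The contour integral. The Weyl solution `W = e J⁻¹` equals `ψ + φM`, where `ψ` and `φ` are entire in
the spectral parameter. Wronskians express `(λ - μ) D̃` and the corresponding integral with the
starred Weyl solution of the second problem by boundary values at `x`. Combining the two
(`weyl_identity`) shows that `φ(x, μ) M̂(μ) D̃(x, λ, μ)` is the sum of an entire function of `μ`, of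
`(λ - μ)⁻¹ (φ(x, μ) - φ̃(x, λ))`, and of `(λ - μ)⁻¹ O(ρ⁻¹)`. The last estimate (`remOne_asymp`,
`remTwo_asymp`) uses that both problems have the same `A`. Since `M̂` is holomorphic off the
encircled set, `γ` can be deformed to a large circle `|μ| = R²` (`Contour.integral_eq_arc`). There
the entire part integrates to zero, Cauchy's formula gives `2πi (φ̃ - φ)`, and the error tends to
zero. The result, `Contour.integral_sol_mul_D`, is the main equation for `z = φ`. The curve `γ'` is
known only through its winding numbers, so the deformation is done in the variable `ρ` with the
homology form of Cauchy's theorem, after a small shift into the open half-plane.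

The inverse. Transposing the coefficients turns `φ*` into `φ` and `M` into its transpose
(`weylMatrix_tr`), so the same formula holds for the starred solutions (`Contour.integral_star`).
Differentiating `D M̂ D̃` in `x` gives two terms, and the two formulas evaluate their integrals over
`γ`; the outcome telescopes to `(1 / 2πi) ∫_γ D M̂ D̃ dμ = D̃ - D` (`Contour.integral_D_mul_D`).
Multiplication by `M̂` from the left gives the resolvent identity `(1 / 2πi) ∫_γ r r̃ = r̃ - r`, and
exchanging the two problems gives the identity for the other order. Hence the two operators of the
theorem are inverse to each other, and uniqueness follows.

The bound. With the weights `A + iρA^⊥`, the kernel with arguments `ρ` and `τ` is at most a constant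
times `(1 + |τ|)⁻² (1 + ||ρ| - |τ||)⁻¹`. The first factor comes from `M̂`, whose leading term
depends on `A` alone and cancels. The second comes from `D`, by the Wronskian formula away from `|ρ|
= |τ|` and by boundedness of the solutions near it. As `dμ = 2τ dτ`, the integral over `γ` is
bounded uniformly in `ρ`; this gives absolute convergence, boundedness on `X` and Fubini's theorem.

Existence, uniqueness, continuity and holomorphy of `φ`, `ψ` and the Jost solution all come from one
theory of Volterra equations with a complex parameter. Large-`ρ` estimates are stated through the
filter `far`, uniformly in `x ≥ 0`; on the bounded part of the contour compactness supplies the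
constants. -/

set_option linter.unusedSectionVars false


/-! ### Primitives of locally integrable functions with values in a Banach algebra. -/

section Primitives

variable {𝔸 : Type*} [NormedRing 𝔸] [NormedAlgebra ℝ 𝔸] [CompleteSpace 𝔸]

/-- `F` is on `[0, ∞)` a primitive of the locally integrable function `f`. -/
structure IsPrim (F f : ℝ → 𝔸) : Prop where
  int : ∀ x, 0 ≤ x → IntervalIntegrable f volume 0 x
  eq : ∀ x, 0 ≤ x → F x = F 0 + ∫ t in (0 : ℝ)..x, f t

/-- Carries absolute continuity from a scalar majorant, in practice the primitive of a bound for the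
derivative, to a vector-valued function. -/
theorem absolutelyContinuous_of_dist_le {X : Type*} [PseudoMetricSpace X] {F : ℝ → X} {h : ℝ → ℝ}
    {a b : ℝ} (hh : AbsolutelyContinuousOnInterval h a b)
    (hF : ∀ x ∈ uIcc a b, ∀ y ∈ uIcc a b, dist (F x) (F y) ≤ dist (h x) (h y)) :
    AbsolutelyContinuousOnInterval F a b := by
  rw [absolutelyContinuousOnInterval_iff] at hh ⊢
  intro ε hε
  obtain ⟨δ, hδ, H⟩ := hh ε hε
  refine ⟨δ, hδ, fun E hE hlt => lt_of_le_of_lt (Finset.sum_le_sum fun i hi => ?_) (H E hE hlt)⟩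
  exact hF _ (hE.1 i hi).1 _ (hE.1 i hi).2

namespace IsPrim

variable {F G f g : ℝ → 𝔸}

theorem sub_eq (hF : IsPrim F f) {x y : ℝ} (hx : 0 ≤ x) (hy : 0 ≤ y) :
    F y - F x = ∫ t in x..y, f t := by
  rw [hF.eq x hx, hF.eq y hy, add_sub_add_left_eq_sub,
    intervalIntegral.integral_interval_sub_left (hF.int y hy) (hF.int x hx)]

theorem congr (hF : IsPrim F f) (hFG : ∀ x, 0 ≤ x → G x = F x) (hfg : ∀ x, 0 ≤ x → g x = f x) :
    IsPrim G g := by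
  have h : ∀ x, 0 ≤ x → EqOn f g (uIoc 0 x) := fun x hx t ht => by
    rw [uIoc_of_le hx] at ht; exact (hfg t ht.1.le).symm
  refine ⟨fun x hx => (hF.int x hx).congr (h x hx), fun x hx => ?_⟩
  rw [hFG x hx, hFG 0 le_rfl, hF.eq x hx]
  congr 1
  refine intervalIntegral.integral_congr fun t ht => ?_
  rw [uIcc_of_le hx] at ht
  exact (hfg t ht.1).symm

theorem continuousOn (hF : IsPrim F f) : ContinuousOn F (Ici 0) := by
  intro x hx
  have hx' : (0 : ℝ) ≤ x := hx
  have h1 : ContinuousOn (fun y => F 0 + ∫ t in (0 : ℝ)..y, f t) (uIcc 0 (x + 1)) :=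
    continuousOn_const.add (intervalIntegral.continuousOn_primitive_interval'
      (hF.int (x + 1) (by linarith)) left_mem_uIcc)
  rw [uIcc_of_le (by linarith)] at h1
  have h2 : ContinuousOn F (Icc 0 (x + 1)) := h1.congr fun y hy => hF.eq y hy.1
  refine (h2 x ⟨hx', by linarith⟩).mono_of_mem_nhdsWithin ?_
  rw [← Ici_inter_Iic]
  exact inter_mem_nhdsWithin _ (Iic_mem_nhds (by linarith))

theorem continuousOn_Icc (hF : IsPrim F f) (x : ℝ) : ContinuousOn F (Icc 0 x) :=
  hF.continuousOn.mono Icc_subset_Ici_self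

/-- The potential is only integrable, so the product rule holds almost everywhere at best. The
difference between `F G` and the expected primitive is absolutely continuous and has derivative zero
almost everywhere, hence is constant. All Wronskian identities and integrations by parts go back to
this lemma. -/
theorem mul (hF : IsPrim F f) (hG : IsPrim G g) :
    IsPrim (fun t => F t * G t) (fun t => f t * G t + F t * g t) := by
  have hint : ∀ x, 0 ≤ x →
      IntervalIntegrable (fun t => f t * G t + F t * g t) volume 0 x := by
    intro x hx
    have h1 := (hF.int x hx).mul_continuousOn (by
      rw [uIcc_of_le hx]; exact hG.continuousOn_Icc x)
    have h2 := (hG.int x hx).continuousOn_mul (by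
      rw [uIcc_of_le hx]; exact hF.continuousOn_Icc x)
    exact h1.add h2
  refine ⟨hint, fun b hb => ?_⟩
  obtain ⟨C, hC⟩ := isCompact_Icc.exists_bound_of_continuousOn (hF.continuousOn_Icc b)
  obtain ⟨D, hD⟩ := isCompact_Icc.exists_bound_of_continuousOn (hG.continuousOn_Icc b)
  have hC0 : 0 ≤ C := (norm_nonneg _).trans (hC 0 ⟨le_rfl, hb⟩)
  have hD0 : 0 ≤ D := (norm_nonneg _).trans (hD 0 ⟨le_rfl, hb⟩)
  set P : ℝ → 𝔸 := fun x => ∫ t in (0 : ℝ)..x, (f t * G t + F t * g t) with hP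
  set H : ℝ → 𝔸 := fun x => F x * G x - P x with hH
  have hnf := (hF.int b hb).norm
  have hng := (hG.int b hb).norm
  -- The factor 2 appears because the increment of `F G` and that of the integral `P` are each at
  -- most the integral of `D ‖f‖ + C ‖g‖`.
  have hk : IntervalIntegrable (fun t => 2 * (D * ‖f t‖ + C * ‖g t‖)) volume 0 b :=
    ((hnf.const_mul D).add (hng.const_mul C)).const_mul 2
  have hAC := hk.absolutelyContinuousOnInterval_intervalIntegral (c := 0) left_mem_uIcc
  have hsub : ∀ {x y : ℝ}, x ∈ Icc 0 b → y ∈ Icc 0 b → ∀ {k : ℝ → ℝ},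
      IntervalIntegrable k volume 0 b → IntervalIntegrable k volume x y := by
    intro x y hx hy k hk
    refine hk.mono_set ?_
    rw [uIcc_of_le hb]
    exact uIcc_subset_Icc hx hy
  have key : ∀ x ∈ Icc 0 b, ∀ y ∈ Icc 0 b, x ≤ y →
      ‖H y - H x‖ ≤ ∫ t in x..y, 2 * (D * ‖f t‖ + C * ‖g t‖) := by
    intro x hx y hy hxy
    have e1 : F y * G y - F x * G x = (F y - F x) * G y + F x * (G y - G x) := by
      noncomm_ring
    have e2 : P y - P x = ∫ t in x..y, (f t * G t + F t * g t) :=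
      intervalIntegral.integral_interval_sub_left (hint y hy.1) (hint x hx.1)
    have e3 : H y - H x = (F y - F x) * G y + F x * (G y - G x)
        - ∫ t in x..y, (f t * G t + F t * g t) := by
      rw [← e1, ← e2]; simp only [hH]; abel
    have b1 : ‖F y - F x‖ ≤ ∫ t in x..y, ‖f t‖ := by
      rw [hF.sub_eq hx.1 hy.1]
      exact intervalIntegral.norm_integral_le_integral_norm hxy
    have b2 : ‖G y - G x‖ ≤ ∫ t in x..y, ‖g t‖ := by
      rw [hG.sub_eq hx.1 hy.1]
      exact intervalIntegral.norm_integral_le_integral_norm hxy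
    have i1 := hsub hx hy hnf
    have i2 := hsub hx hy hng
    have b3 : ‖∫ t in x..y, (f t * G t + F t * g t)‖ ≤ ∫ t in x..y, (D * ‖f t‖ + C * ‖g t‖) := by
      refine intervalIntegral.norm_integral_le_of_norm_le hxy ?_
        ((i1.const_mul D).add (i2.const_mul C))
      refine Eventually.of_forall fun t ht => ?_
      have ht' : t ∈ Icc 0 b := ⟨hx.1.trans ht.1.le, ht.2.trans hy.2⟩
      refine (norm_add_le _ _).trans (add_le_add ((norm_mul_le _ _).trans ?_)
        ((norm_mul_le _ _).trans ?_))
      · rw [mul_comm D]; exact mul_le_mul_of_nonneg_left (hD t ht') (norm_nonneg _)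
      · exact mul_le_mul_of_nonneg_right (hC t ht') (norm_nonneg _)
    have b4 : ∫ t in x..y, (D * ‖f t‖ + C * ‖g t‖)
        = D * (∫ t in x..y, ‖f t‖) + C * ∫ t in x..y, ‖g t‖ := by
      rw [intervalIntegral.integral_add (i1.const_mul D) (i2.const_mul C),
        intervalIntegral.integral_const_mul, intervalIntegral.integral_const_mul]
    rw [intervalIntegral.integral_const_mul, e3]
    refine (norm_sub_le _ _).trans ?_
    have b5 : ‖(F y - F x) * G y + F x * (G y - G x)‖
        ≤ D * (∫ t in x..y, ‖f t‖) + C * ∫ t in x..y, ‖g t‖ := by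
      refine (norm_add_le _ _).trans (add_le_add ((norm_mul_le _ _).trans ?_)
        ((norm_mul_le _ _).trans ?_))
      · rw [mul_comm D]
        exact mul_le_mul b1 (hD y hy) (norm_nonneg _) ((norm_nonneg _).trans b1)
      · exact mul_le_mul (hC x hx) b2 (norm_nonneg _) hC0
    linarith
  have hHAC : AbsolutelyContinuousOnInterval H 0 b := by
    refine absolutelyContinuous_of_dist_le hAC ?_
    rw [uIcc_of_le hb]
    have key' : ∀ x ∈ Icc 0 b, ∀ y ∈ Icc 0 b, x ≤ y → dist (H y) (H x) ≤
        dist (∫ t in (0 : ℝ)..y, 2 * (D * ‖f t‖ + C * ‖g t‖))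
          (∫ t in (0 : ℝ)..x, 2 * (D * ‖f t‖ + C * ‖g t‖)) := by
      intro x hx y hy hxy
      rw [dist_eq_norm, Real.dist_eq, intervalIntegral.integral_interval_sub_left
        (hsub ⟨le_rfl, hb⟩ hy hk) (hsub ⟨le_rfl, hb⟩ hx hk)]
      exact (key x hx y hy hxy).trans (le_abs_self _)
    intro x hx y hy
    rcases le_total x y with h | h
    · rw [dist_comm (H x), dist_comm (∫ t in (0 : ℝ)..x, _)]
      exact key' x hx y hy h
    · exact key' y hy x hx h
  -- Lebesgue's differentiation theorem for `f`, `g` and the integrand of `P`. The point 0 is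
  -- removed because `F` and `G` agree with their integral formulas only on `[0, ∞)`.
  have hz : ∀ᵐ x, x ∈ uIcc 0 b → HasDerivAt H 0 x := by
    have n0 : ∀ᵐ x : ℝ, x ≠ 0 := by simp [ae_iff, measure_singleton]
    have nb : ∀ᵐ x : ℝ, x ≠ b := by simp [ae_iff, measure_singleton]
    filter_upwards [(hF.int b hb).ae_hasDerivAt_integral, (hG.int b hb).ae_hasDerivAt_integral,
      (hint b hb).ae_hasDerivAt_integral, n0, nb] with x h1 h2 h3 hx0 hxb hx
    have d1 := h1 hx 0 left_mem_uIcc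
    have d2 := h2 hx 0 left_mem_uIcc
    have d3 := h3 hx 0 left_mem_uIcc
    rw [uIcc_of_le hb] at hx
    have hpos : ∀ᶠ y in 𝓝 x, 0 ≤ y :=
      (lt_mem_nhds (lt_of_le_of_ne hx.1 (Ne.symm hx0))).mono fun y hy => le_of_lt hy
    have d1' : HasDerivAt F (f x) x :=
      (d1.const_add (F 0)).congr_of_eventuallyEq (hpos.mono fun y hy => hF.eq y hy)
    have d2' : HasDerivAt G (g x) x :=
      (d2.const_add (G 0)).congr_of_eventuallyEq (hpos.mono fun y hy => hG.eq y hy)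
    have := (d1'.mul d2').sub d3
    rwa [sub_self] at this
  obtain ⟨c, hc⟩ := hHAC.const_of_ae_hasDerivAt_zero hz
  have h0 := hc 0 left_mem_uIcc
  have h1 := hc b right_mem_uIcc
  simp only [hH, hP, intervalIntegral.integral_same, sub_zero] at h0 h1
  rw [h0]
  exact eq_add_of_sub_eq h1

theorem add (hF : IsPrim F f) (hG : IsPrim G g) :
    IsPrim (fun t => F t + G t) (fun t => f t + g t) := by
  refine ⟨fun x hx => (hF.int x hx).add (hG.int x hx), fun x hx => ?_⟩
  rw [intervalIntegral.integral_add (hF.int x hx) (hG.int x hx), hF.eq x hx, hG.eq x hx]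
  abel

theorem sub (hF : IsPrim F f) (hG : IsPrim G g) :
    IsPrim (fun t => F t - G t) (fun t => f t - g t) := by
  refine ⟨fun x hx => (hF.int x hx).sub (hG.int x hx), fun x hx => ?_⟩
  rw [intervalIntegral.integral_sub (hF.int x hx) (hG.int x hx), hF.eq x hx, hG.eq x hx]
  abel

theorem const (c : 𝔸) : IsPrim (fun _ => c) (fun _ => 0) :=
  ⟨fun x _ => by simp, fun x _ => by simp⟩

theorem of_hasDerivWithinAt (hd : ∀ x, 0 ≤ x → HasDerivWithinAt F (f x) (Ici 0) x)
    (hf : ContinuousOn f (Ici 0)) : IsPrim F f := by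
  have hi : ∀ x, 0 ≤ x → IntervalIntegrable f volume 0 x := fun x hx =>
    (hf.mono (by rw [uIcc_of_le hx]; exact Icc_subset_Ici_self)).intervalIntegrable
  refine ⟨hi, fun x hx => ?_⟩
  rw [intervalIntegral.integral_eq_sub_of_hasDeriv_right_of_le hx
    (fun t ht => ((hd t ht.1).continuousWithinAt).mono Icc_subset_Ici_self)
    (fun t ht => (hd t ht.1.le).mono fun y hy => ht.1.le.trans (le_of_lt hy)) (hi x hx)]
  abel

theorem of_hasDerivAt (hd : ∀ x, HasDerivAt F (f x) x) (hf : Continuous f) : IsPrim F f :=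
  of_hasDerivWithinAt (fun x _ => (hd x).hasDerivWithinAt) hf.continuousOn

theorem hasDerivWithinAt (hF : IsPrim F f) (hf : ContinuousOn f (Ici 0)) {x : ℝ} (hx : 0 ≤ x) :
    HasDerivWithinAt F (f x) (Ici 0) x := by
  -- A constant continuation to the left makes the integrand continuous on the whole line, so the
  -- two-sided fundamental theorem applies also at 0.
  set f' : ℝ → 𝔸 := fun t => f (max t 0) with hf'
  have hc : Continuous f' := hf.comp_continuous (by fun_prop) fun t => le_max_right t 0
  have h1 : HasDerivAt (fun y => F 0 + ∫ t in (0 : ℝ)..y, f' t) (f' x) x :=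
    (hc.integral_hasStrictDerivAt 0 x).hasDerivAt.const_add _
  have e : ∀ y, 0 ≤ y → F y = F 0 + ∫ t in (0 : ℝ)..y, f' t := fun y hy => by
    rw [hF.eq y hy]
    congr 1
    refine intervalIntegral.integral_congr fun t ht => ?_
    rw [uIcc_of_le hy] at ht
    simp [hf', max_eq_left ht.1]
  have : f' x = f x := by simp [hf', max_eq_left hx]
  rw [← this]
  exact h1.hasDerivWithinAt.congr (fun y hy => e y hy) (e x hx)

theorem of_integral (c : 𝔸) (hf : ∀ x, 0 ≤ x → IntervalIntegrable f volume 0 x) :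
    IsPrim (fun x => c + ∫ t in (0 : ℝ)..x, f t) f :=
  ⟨hf, fun x _ => by simp⟩

end IsPrim

theorem isPrim_pow {F f : ℝ → ℝ} (hF : IsPrim F f) (N : ℕ) :
    IsPrim (fun t => F t ^ (N + 1)) (fun t => (N + 1) * (f t * F t ^ N)) := by
  induction N with
  | zero => simpa using hF
  | succ N ih =>
    refine (ih.mul hF).congr (fun x _ => by ring) (fun x _ => ?_)
    push_cast
    ring

end Primitives

/-! ### Holomorphic dependence of integrals on a parameter. -/

section ParametricIntegral

variable {E : Type*} [NormedAddCommGroup E] [NormedSpace ℂ E] [CompleteSpace E]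
  {α : Type*} [MeasurableSpace α] {μ : Measure α}

/-- An integral of functions depending holomorphically on a parameter is holomorphic, if the
functions have a locally uniform integrable bound. -/
theorem differentiableOn_integral {U : Set ℂ} (hU : IsOpen U) {F : ℂ → α → E}
    (hm : ∀ z ∈ U, AEStronglyMeasurable (F z) μ)
    (hd : ∀ᵐ a ∂μ, DifferentiableOn ℂ (fun z => F z a) U)
    (hb : ∀ z₀ ∈ U, ∃ b : α → ℝ, Integrable b μ ∧
      ∀ᶠ z in 𝓝 z₀, ∀ᵐ a ∂μ, ‖F z a‖ ≤ b a) :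
    DifferentiableOn ℂ (fun z => ∫ a, F z a ∂μ) U := by
  intro z₀ hz₀
  obtain ⟨b, hbi, hbb⟩ := hb z₀ hz₀
  obtain ⟨r₁, hr₁, h₁⟩ := Metric.mem_nhds_iff.mp (hbb.and (hU.mem_nhds hz₀))
  set r := r₁ / 2 with hr
  have hr0 : 0 < r := by positivity
  have hcb : Metric.closedBall z₀ r ⊆ Metric.ball z₀ r₁ :=
    Metric.closedBall_subset_ball (by linarith)
  -- a countable dense set of parameters gives a bound for all parameters
  have hdense : ∀ᵐ a ∂μ, ∀ z ∈ Metric.closedBall z₀ r, ‖F z a‖ ≤ b a := by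
    obtain ⟨s, hsc, hsd⟩ := TopologicalSpace.exists_countable_dense ℂ
    have hall : ∀ᵐ a ∂μ, ∀ z ∈ s, z ∈ Metric.ball z₀ r₁ → ‖F z a‖ ≤ b a := by
      rw [ae_ball_iff hsc]
      intro z _
      by_cases hz : z ∈ Metric.ball z₀ r₁
      · filter_upwards [(h₁ hz).1] with a ha _ using ha
      · exact Eventually.of_forall fun a h => absurd h hz
    filter_upwards [hall, hd] with a ha hda z hz
    have hzb := hcb hz
    have hcont : ContinuousAt (fun z => ‖F z a‖) z :=
      ((hda z (h₁ hzb).2).differentiableAt (hU.mem_nhds (h₁ hzb).2)).continuousAt.norm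
    by_contra hlt
    push Not at hlt
    have hev : ∀ᶠ y in 𝓝 z, b a < ‖F y a‖ ∧ y ∈ Metric.ball z₀ r₁ :=
      (hcont.eventually (lt_mem_nhds hlt)).and (Metric.isOpen_ball.mem_nhds hzb)
    obtain ⟨y, hys, hy⟩ := (hsd.inter_nhds_nonempty (hev)).imp fun y h => h
    exact absurd (ha y hys hy.2) (not_le.mpr hy.1)
  have hr2 : 0 < r / 2 := by positivity
  have hsub : ∀ x ∈ Metric.ball z₀ (r / 2), Metric.closedBall x (r / 2) ⊆
      Metric.closedBall z₀ r := fun x hx =>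
    Metric.closedBall_subset_closedBall' (by rw [Metric.mem_ball] at hx; linarith)
  have hdiff : ∀ᵐ a ∂μ, ∀ x ∈ Metric.ball z₀ (r / 2),
      HasDerivAt (fun z => F z a) (deriv (fun z => F z a) x) x := by
    filter_upwards [hd] with a ha x hx
    have hx' : x ∈ U := (h₁ (hcb (hsub x hx (Metric.mem_closedBall_self hr2.le)))).2
    exact ((ha x hx').differentiableAt (hU.mem_nhds hx')).hasDerivAt
  -- The derivative in the parameter is an almost everywhere limit of difference quotients along a
  -- sequence, and so is measurable.
  have hmeas : AEStronglyMeasurable (fun a => deriv (fun z => F z a) z₀) μ := by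
    set c : ℕ → ℂ := fun k => ((r / 2 / (k + 2) : ℝ) : ℂ) with hc
    have hc0 : ∀ k, c k ≠ 0 := fun k => by
      simp only [hc]; exact_mod_cast (by positivity : r / 2 / ((k : ℝ) + 2) ≠ 0)
    have hclim : Tendsto c atTop (𝓝[≠] 0) := by
      rw [tendsto_nhdsWithin_iff]
      refine ⟨?_, Eventually.of_forall hc0⟩
      have : Tendsto (fun k : ℕ => r / 2 / ((k : ℝ) + 2)) atTop (𝓝 0) :=
        tendsto_const_nhds.div_atTop (tendsto_atTop_add_const_right _ _ tendsto_natCast_atTop_atTop)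
      have h := (Complex.continuous_ofReal.tendsto 0).comp this
      rw [Complex.ofReal_zero] at h
      exact h
    refine aestronglyMeasurable_of_tendsto_ae atTop
      (f := fun k a => (c k)⁻¹ • (F (z₀ + c k) a - F z₀ a)) (fun k => ?_) ?_
    · refine ((hm _ ?_).sub (hm _ hz₀)).const_smul _
      refine (h₁ (hcb ?_)).2
      rw [Metric.mem_closedBall, dist_eq_norm, add_sub_cancel_left]
      simp only [hc, Complex.norm_real, Real.norm_eq_abs]
      rw [abs_of_nonneg (by positivity)]
      refine (div_le_self (by positivity) (by linarith [Nat.cast_nonneg (α := ℝ) k])).trans (by linarith)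
    · filter_upwards [hdiff] with a ha
      exact (hasDerivAt_iff_tendsto_slope_zero.mp (ha z₀ (Metric.mem_ball_self hr2))).comp hclim
  -- Cauchy's estimate on circles of radius `r / 2` turns the bound `b` of the functions into the
  -- bound `b / (r / 2)` of their derivatives, so nothing has to be assumed on derivatives.
  have := hasDerivAt_integral_of_dominated_loc_of_deriv_le (μ := μ) (F := F)
    (F' := fun z a => deriv (fun z => F z a) z) (x₀ := z₀) (bound := fun a => b a / (r / 2))
    (Metric.ball_mem_nhds z₀ hr2)
    (eventually_of_mem (hU.mem_nhds hz₀) fun z hz => hm z hz)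
    (hbi.mono' (hm z₀ hz₀) (h₁ (Metric.mem_ball_self hr₁)).1) hmeas
    (by
      filter_upwards [hd, hdense] with a ha hba x hx
      refine Complex.norm_deriv_le_of_forall_mem_sphere_norm_le hr2 ?_ fun z hz =>
        hba z (hsub x hx (Metric.sphere_subset_closedBall hz))
      refine DifferentiableOn.diffContOnCl ?_
      rw [closure_ball _ hr2.ne']
      exact ha.mono fun z hz => (h₁ (hcb (hsub x hx hz))).2)
    (hbi.div_const _) hdiff
  exact this.2.differentiableAt.differentiableWithinAt

end ParametricIntegral

/-! ### Volterra equations with a complex parameter. -/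

section Volterra

variable {𝔸 : Type*} [NormedRing 𝔸] [NormedAlgebra ℂ 𝔸] [CompleteSpace 𝔸]

/-- The tail `q` of `w` satisfies `-q' = w`, so `w q^N` is the derivative of `-q^(N+1) / (N+1)`.
This is the source of the factorials in the Volterra series. -/
theorem integral_Ioi_mul_pow_le {w : ℝ → ℝ} (hw : ∀ t, 0 ≤ w t)
    (hi : ∀ x, IntegrableOn w (Ioi x)) (N : ℕ) (x : ℝ) :
    IntegrableOn (fun t => w t * (∫ s in Ioi t, w s) ^ N) (Ioi x) ∧
    ∫ t in Ioi x, w t * (∫ s in Ioi t, w s) ^ N ≤ (∫ s in Ioi x, w s) ^ (N + 1) / (N + 1) := by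
  set q : ℝ → ℝ := fun t => ∫ s in Ioi t, w s with hq
  have q0 : ∀ t, 0 ≤ q t := fun t => integral_nonneg fun s => hw s
  have hii : ∀ a b : ℝ, IntervalIntegrable w volume a b := fun a b => by
    rw [intervalIntegrable_iff]
    exact (hi (min a b)).mono_set fun t ht => ht.1
  have hqi : ∀ a b, q a - q b = ∫ t in a..b, w t := fun a b =>
    intervalIntegral.integral_Ioi_sub_Ioi' (hi a) (hi b)
  have hqc : Continuous q := by
    have : q = fun b => q x - ∫ t in x..b, w t := by
      funext b; rw [← hqi]; ring
    rw [this]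
    exact continuous_const.sub (intervalIntegral.continuous_primitive hii x)
  have hqle : ∀ t, x ≤ t → q t ≤ q x := fun t ht => by
    have := hqi x t
    have h2 : 0 ≤ ∫ s in x..t, w s := intervalIntegral.integral_nonneg ht fun s _ => hw s
    linarith
  have hint : IntegrableOn (fun t => w t * q t ^ N) (Ioi x) := by
    refine Integrable.mono' ((hi x).mul_const (q x ^ N))
      ((hi x).aestronglyMeasurable.mul (hqc.pow N).aestronglyMeasurable) ?_
    filter_upwards [ae_restrict_mem measurableSet_Ioi] with t ht
    rw [Real.norm_of_nonneg (mul_nonneg (hw t) (pow_nonneg (q0 t) N))]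
    exact mul_le_mul_of_nonneg_left (pow_le_pow_left₀ (q0 t) (hqle t (le_of_lt ht)) N) (hw t)
  refine ⟨hint, ?_⟩
  -- A translation by `x`, because `IsPrim` refers to the base point 0.
  have hp : IsPrim (fun s => q (x + s)) (fun s => -w (x + s)) := by
    refine ⟨fun y _ => ?_, fun y _ => ?_⟩
    · have := (hii x (x + y)).comp_add_left x
      simp only [sub_self, add_sub_cancel_left] at this
      exact this.neg
    · simp only [add_zero, intervalIntegral.integral_neg]
      rw [intervalIntegral.integral_comp_add_left, add_zero, ← hqi]
      ring
  have hfin : ∀ b, x ≤ b → ∫ t in x..b, w t * q t ^ N ≤ q x ^ (N + 1) / (N + 1) := by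
    intro b hb
    have h1 := (isPrim_pow hp N).eq (b - x) (by linarith)
    have h2 : ∫ s in (0 : ℝ)..(b - x), (N + 1) * (-w (x + s) * q (x + s) ^ N)
        = - ((N + 1) * ∫ t in x..b, w t * q t ^ N) := by
      have := intervalIntegral.integral_comp_add_left (a := 0) (b := b - x)
        (fun t => ((N : ℝ) + 1) * (-w t * q t ^ N)) x
      rw [this, intervalIntegral.integral_const_mul]
      simp [neg_mul]
    rw [h2] at h1
    simp only [add_sub_cancel, add_zero] at h1
    rw [le_div_iff₀ (by positivity)]
    have := pow_nonneg (q0 b) (N + 1)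
    linarith
  exact le_of_tendsto (intervalIntegral_tendsto_integral_Ioi x hint tendsto_id)
    ((eventually_ge_atTop x).mono hfin)

/-- A kernel of Volterra type: `K p x t` vanishes for `t ≤ x` and is dominated by a function that
is integrable on half-lines. -/
structure IsVolterra (D : Set ℂ) (w : ℝ → ℝ) (K : ℂ → ℝ → ℝ → 𝔸) : Prop where
  nonneg : ∀ t, 0 ≤ w t
  int : ∀ x, IntegrableOn w (Ioi x)
  zero : ∀ p x t, t ≤ x → K p x t = 0
  bound : ∀ p₀ ∈ D, ∀ x₀, ∃ C, 0 ≤ C ∧ ∀ᶠ p in 𝓝[D] p₀, ∀ x, x₀ ≤ x → ∀ t, ‖K p x t‖ ≤ C * w t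
  meas : ∀ p ∈ D, ∀ x, AEStronglyMeasurable (K p x) volume
  cont : ∀ t, ContinuousOn (fun z : ℂ × ℝ => K z.1 z.2 t) (D ×ˢ univ)

/-- The iterates of the Volterra operator with kernel `K` on `g`. -/
def volterraTerm (K : ℂ → ℝ → ℝ → 𝔸) (g : ℂ → ℝ → 𝔸) : ℕ → ℂ → ℝ → 𝔸
  | 0 => g
  | N + 1 => fun p x => ∫ t, K p x t * volterraTerm K g N p t

/-- The solution of `u = g + ∫ K u`. -/
def volterraSol (K : ℂ → ℝ → ℝ → 𝔸) (g : ℂ → ℝ → 𝔸) (p : ℂ) (x : ℝ) : 𝔸 :=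
  ∑' N, volterraTerm K g N p x

/-- The induction step of the Volterra estimate: one more integration raises the power of `C q` by
one and divides by `N + 1`. The norm stands inside the integral because the interchange of sum and
integral in `sol_eq` needs this stronger form. -/
theorem norm_integral_volterra_le {w : ℝ → ℝ} (hw : ∀ t, 0 ≤ w t)
    (hi : ∀ x, IntegrableOn w (Ioi x)) {k : ℝ → ℝ → 𝔸} {f : ℝ → 𝔸} {x₀ B C : ℝ} {N : ℕ}
    (hB : 0 ≤ B) (hC : 0 ≤ C) (hk0 : ∀ x t, t ≤ x → k x t = 0)
    (hk : ∀ x, x₀ ≤ x → ∀ t, ‖k x t‖ ≤ C * w t)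
    (hf : ∀ t, x₀ ≤ t → ‖f t‖ ≤ B * (C * ∫ s in Ioi t, w s) ^ N / N.factorial) (x : ℝ) (hx : x₀ ≤ x) :
    ∫ t, ‖k x t * f t‖ ≤ B * (C * ∫ s in Ioi x, w s) ^ (N + 1) / (N + 1).factorial := by
  obtain ⟨h1, h2⟩ := integral_Ioi_mul_pow_le hw hi N x
  set q : ℝ → ℝ := fun t => ∫ s in Ioi t, w s with hq
  have q0 : ∀ t, 0 ≤ q t := fun t => integral_nonneg fun s => hw s
  have e0 : ∫ t, ‖k x t * f t‖ = ∫ t in Ioi x, ‖k x t * f t‖ := by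
    refine (setIntegral_eq_integral_of_forall_compl_eq_zero fun t ht => ?_).symm
    rw [hk0 x t (not_lt.mp ht), zero_mul, norm_zero]
  have hN : (0 : ℝ) < N.factorial := by exact_mod_cast N.factorial_pos
  have hle : ∫ t in Ioi x, ‖k x t * f t‖ ≤
      ∫ t in Ioi x, (B * C ^ (N + 1) / N.factorial) * (w t * q t ^ N) := by
    refine integral_mono_of_nonneg (Eventually.of_forall fun t => norm_nonneg _)
      (h1.const_mul _) ?_
    filter_upwards [ae_restrict_mem measurableSet_Ioi] with t ht
    refine (norm_mul_le _ _).trans ?_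
    have := mul_le_mul (hk x hx t) (hf t (hx.trans (le_of_lt ht))) (norm_nonneg _)
      (mul_nonneg hC (hw t))
    refine this.trans (le_of_eq ?_)
    simp only [hq]
    rw [mul_pow]
    ring
  rw [e0]
  refine hle.trans ?_
  rw [integral_const_mul]
  have hfac : (((N + 1).factorial : ℕ) : ℝ) = (N + 1) * N.factorial := by
    rw [Nat.factorial_succ]; push_cast; ring
  refine (mul_le_mul_of_nonneg_left h2 (by positivity)).trans (le_of_eq ?_)
  rw [hfac, mul_pow]
  field_simp

/-- A bounded solution of the homogeneous equation inherits the bound `B (C q)^N / N!` for every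
`N`, and this tends to zero. All uniqueness statements for solutions rest on it. -/
theorem eq_zero_of_volterra {w : ℝ → ℝ} (hw : ∀ t, 0 ≤ w t)
    (hi : ∀ x, IntegrableOn w (Ioi x)) {k : ℝ → ℝ → 𝔸} {f : ℝ → 𝔸} {x₀ B C : ℝ}
    (hC : 0 ≤ C) (hk0 : ∀ x t, t ≤ x → k x t = 0)
    (hk : ∀ x, x₀ ≤ x → ∀ t, ‖k x t‖ ≤ C * w t) (hB : ∀ x, x₀ ≤ x → ‖f x‖ ≤ B)
    (hf : ∀ x, x₀ ≤ x → f x = ∫ t, k x t * f t) (x : ℝ) (hx : x₀ ≤ x) : f x = 0 := by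
  have hB0 : 0 ≤ B := (norm_nonneg _).trans (hB x hx)
  have key : ∀ N : ℕ, ∀ x, x₀ ≤ x → ‖f x‖ ≤ B * (C * ∫ s in Ioi x, w s) ^ N / N.factorial := by
    intro N
    induction N with
    | zero => intro x hx; simpa using hB x hx
    | succ N ih =>
      intro x hx
      rw [hf x hx]
      exact (norm_integral_le_integral_norm _).trans
        (norm_integral_volterra_le hw hi hB0 hC hk0 hk ih x hx)
  have hlim : Tendsto (fun N : ℕ => B * ((C * ∫ s in Ioi x, w s) ^ N / N.factorial)) atTop
      (𝓝 (B * 0)) := (FloorSemiring.tendsto_pow_div_factorial_atTop _).const_mul B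
  rw [mul_zero] at hlim
  have := ge_of_tendsto hlim (Eventually.of_forall fun N => by
    have := key N x hx
    rwa [mul_div_assoc] at this)
  exact norm_le_zero_iff.mp this

namespace IsVolterra

variable {D : Set ℂ} {w : ℝ → ℝ} {K : ℂ → ℝ → ℝ → 𝔸} {g : ℂ → ℝ → 𝔸}

/-- `g` is continuous and locally bounded, uniformly on half-lines. -/
structure IsData (D : Set ℂ) (g : ℂ → ℝ → 𝔸) : Prop where
  cont : ContinuousOn (fun z : ℂ × ℝ => g z.1 z.2) (D ×ˢ univ)
  bound : ∀ p₀ ∈ D, ∀ x₀, ∃ G, 0 ≤ G ∧ ∀ᶠ p in 𝓝[D] p₀, ∀ x, x₀ ≤ x → ‖g p x‖ ≤ G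

theorem tail_nonneg (hK : IsVolterra D w K) (x : ℝ) : 0 ≤ ∫ s in Ioi x, w s :=
  integral_nonneg fun s => hK.nonneg s

theorem tail_anti (hK : IsVolterra D w K) {x y : ℝ} (h : x ≤ y) :
    ∫ s in Ioi y, w s ≤ ∫ s in Ioi x, w s :=
  setIntegral_mono_set (hK.int x) (Eventually.of_forall fun s => hK.nonneg s)
    (Ioi_subset_Ioi h).eventuallyLE

theorem norm_term_le (hK : IsVolterra D w K) {x₀ G C : ℝ} {p : ℂ} (hG : 0 ≤ G) (hC : 0 ≤ C)
    (hg : ∀ x, x₀ ≤ x → ‖g p x‖ ≤ G) (hk : ∀ x, x₀ ≤ x → ∀ t, ‖K p x t‖ ≤ C * w t) (N : ℕ) :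
    ∀ x, x₀ ≤ x → ‖volterraTerm K g N p x‖ ≤ G * (C * ∫ s in Ioi x, w s) ^ N / N.factorial := by
  induction N with
  | zero => intro x hx; simpa [volterraTerm] using hg x hx
  | succ N ih =>
    intro x hx
    exact (norm_integral_le_integral_norm _).trans
      (norm_integral_volterra_le hK.nonneg hK.int hG hC (hK.zero p) hk ih x hx)

theorem norm_term_le' (hK : IsVolterra D w K) {x₀ G C : ℝ} {p : ℂ} (hG : 0 ≤ G) (hC : 0 ≤ C)
    (hg : ∀ x, x₀ ≤ x → ‖g p x‖ ≤ G) (hk : ∀ x, x₀ ≤ x → ∀ t, ‖K p x t‖ ≤ C * w t) (N : ℕ)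
    (x : ℝ) (hx : x₀ ≤ x) :
    ‖volterraTerm K g N p x‖ ≤ G * ((C * ∫ s in Ioi x₀, w s) ^ N / N.factorial) := by
  refine (hK.norm_term_le hG hC hg hk N x hx).trans ?_
  rw [mul_div_assoc]
  have h0 := hK.tail_nonneg x
  have h1 := hK.tail_anti hx
  gcongr

theorem exists_bounds (hK : IsVolterra D w K) (hg : IsData D g) {p₀ : ℂ} (hp : p₀ ∈ D) (x₀ : ℝ) :
    ∃ G C, 0 ≤ G ∧ 0 ≤ C ∧ ∀ᶠ p in 𝓝[D] p₀, (∀ x, x₀ ≤ x → ‖g p x‖ ≤ G) ∧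
      (∀ x, x₀ ≤ x → ∀ t, ‖K p x t‖ ≤ C * w t) ∧ p ∈ D := by
  obtain ⟨G, hG, h1⟩ := hg.bound p₀ hp x₀
  obtain ⟨C, hC, h2⟩ := hK.bound p₀ hp x₀
  exact ⟨G, C, hG, hC, h1.and (h2.and self_mem_nhdsWithin)⟩

theorem norm_integrand_le (hK : IsVolterra D w K) {x₀ C B : ℝ} {p : ℂ} {f : ℝ → 𝔸}
    (hC : 0 ≤ C) (hk : ∀ x, x₀ ≤ x → ∀ t, ‖K p x t‖ ≤ C * w t) (hf : ∀ x, x₀ ≤ x → ‖f x‖ ≤ B)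
    {x : ℝ} (hx : x₀ ≤ x) (t : ℝ) :
    ‖K p x t * f t‖ ≤ (Ioi x₀).indicator (fun t => C * w t * B) t := by
  by_cases ht : t ∈ Ioi x₀
  · rw [indicator_of_mem ht]
    exact (norm_mul_le _ _).trans (mul_le_mul (hk x hx t) (hf t (le_of_lt ht)) (norm_nonneg _)
      (mul_nonneg hC (hK.nonneg t)))
  · rw [indicator_of_notMem ht, hK.zero p x t ((not_lt.mp ht).trans hx), zero_mul, norm_zero]

theorem integrable_bound (hK : IsVolterra D w K) (x₀ C B : ℝ) :
    Integrable ((Ioi x₀).indicator (fun t => C * w t * B)) := by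
  rw [integrable_indicator_iff measurableSet_Ioi]
  exact ((hK.int x₀).const_mul C).mul_const B

theorem continuousOn_right {f : ℂ → ℝ → 𝔸}
    (hf : ContinuousOn (fun z : ℂ × ℝ => f z.1 z.2) (D ×ˢ univ)) {p : ℂ} (hp : p ∈ D) :
    Continuous (f p) :=
  hf.comp_continuous (f := fun t : ℝ => (p, t)) (by fun_prop) fun t => ⟨hp, mem_univ _⟩

theorem continuousOn_left {f : ℂ → ℝ → 𝔸}
    (hf : ContinuousOn (fun z : ℂ × ℝ => f z.1 z.2) (D ×ˢ univ)) (x : ℝ) :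
    ContinuousOn (fun p => f p x) D :=
  hf.comp (f := fun p : ℂ => (p, x)) (by fun_prop) fun p hp => ⟨hp, mem_univ _⟩

theorem continuousOn_term (hK : IsVolterra D w K) (hg : IsData D g) (N : ℕ) :
    ContinuousOn (fun z : ℂ × ℝ => volterraTerm K g N z.1 z.2) (D ×ˢ univ) := by
  induction N with
  | zero => exact hg.cont
  | succ N ih =>
    rintro ⟨p₀, x₀⟩ hz
    -- The bounds are taken on `[x₀ - 1, ∞)` so that they hold for all `x` near `x₀`.
    obtain ⟨G, C, hG, hC, hev⟩ := hK.exists_bounds hg hz.1 (x₀ - 1)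
    set B := G * ((C * ∫ s in Ioi (x₀ - 1), w s) ^ N / N.factorial)
    have hev2 : ∀ᶠ z : ℂ × ℝ in 𝓝[D ×ˢ univ] (p₀, x₀), ((∀ x, x₀ - 1 ≤ x → ‖g z.1 x‖ ≤ G) ∧
      (∀ x, x₀ - 1 ≤ x → ∀ t, ‖K z.1 x t‖ ≤ C * w t) ∧ z.1 ∈ D) ∧ x₀ - 1 ≤ z.2 := by
      rw [nhdsWithin_prod_eq, nhdsWithin_univ]
      exact hev.prod_mk (Ici_mem_nhds (by linarith))
    refine continuousWithinAt_of_dominated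
      (bound := (Ioi (x₀ - 1)).indicator (fun t => C * w t * B)) ?_ ?_
      (hK.integrable_bound _ _ _) ?_
    · filter_upwards [hev2] with z hz2
      exact (hK.meas z.1 hz2.1.2.2 z.2).mul
        (continuousOn_right ih hz2.1.2.2).aestronglyMeasurable
    · filter_upwards [hev2] with z hz2
      exact Eventually.of_forall fun t => hK.norm_integrand_le hC hz2.1.2.1
        (hK.norm_term_le' hG hC hz2.1.1 hz2.1.2.1 N) hz2.2 t
    · refine Eventually.of_forall fun t => ?_
      refine ((hK.cont t).mul ?_) (p₀, x₀) hz
      exact (continuousOn_left ih t).comp continuousOn_fst fun z hz => hz.1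

theorem summable_bound (G C : ℝ) : Summable fun N : ℕ => G * (C ^ N / N.factorial) :=
  (Real.summable_pow_div_factorial C).mul_left G

theorem continuousOn_sol (hK : IsVolterra D w K) (hg : IsData D g) :
    ContinuousOn (fun z : ℂ × ℝ => volterraSol K g z.1 z.2) (D ×ˢ univ) := by
  rintro ⟨p₀, x₀⟩ hz
  obtain ⟨G, C, hG, hC, hev⟩ := hK.exists_bounds hg hz.1 (x₀ - 1)
  set s : Set (ℂ × ℝ) := {z | ((∀ x, x₀ - 1 ≤ x → ‖g z.1 x‖ ≤ G) ∧
      (∀ x, x₀ - 1 ≤ x → ∀ t, ‖K z.1 x t‖ ≤ C * w t) ∧ z.1 ∈ D) ∧ x₀ - 1 ≤ z.2} with hs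
  have hs2 : s ∈ 𝓝[D ×ˢ univ] (p₀, x₀) := by
    rw [nhdsWithin_prod_eq, nhdsWithin_univ]
    exact hev.prod_mk (Ici_mem_nhds (by linarith))
  have h1 : ContinuousOn (fun z : ℂ × ℝ => volterraSol K g z.1 z.2) s := by
    refine continuousOn_tsum (fun N => (hK.continuousOn_term hg N).mono fun z hz => ⟨hz.1.2.2, mem_univ _⟩)
      (summable_bound G (C * ∫ s in Ioi (x₀ - 1), w s)) fun N z hz => ?_
    exact hK.norm_term_le' hG hC hz.1.1 hz.1.2.1 N z.2 hz.2
  exact (h1 (p₀, x₀) (mem_of_mem_nhdsWithin hz hs2)).mono_of_mem_nhdsWithin hs2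

theorem norm_sol_le (hK : IsVolterra D w K) (hg : IsData D g) {p₀ : ℂ} (hp : p₀ ∈ D) (x₀ : ℝ) :
    ∃ B, 0 ≤ B ∧ ∀ᶠ p in 𝓝[D] p₀, ∀ x, x₀ ≤ x → ‖volterraSol K g p x‖ ≤ B := by
  obtain ⟨G, C, hG, hC, hev⟩ := hK.exists_bounds hg hp x₀
  have hs := summable_bound G (C * ∫ s in Ioi x₀, w s)
  have h0 := hK.tail_nonneg x₀
  refine ⟨∑' N : ℕ, G * ((C * ∫ s in Ioi x₀, w s) ^ N / N.factorial),
    tsum_nonneg fun N => by positivity, hev.mono fun p hp x hx => ?_⟩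
  exact tsum_of_norm_bounded hs.hasSum fun N => hK.norm_term_le' hG hC hp.1 hp.2.1 N x hx

theorem integrable_mul (hK : IsVolterra D w K) {p : ℂ} (hp : p ∈ D) {f : ℝ → 𝔸} {x₀ B : ℝ}
    (hf : Continuous f) (hB : ∀ t, x₀ ≤ t → ‖f t‖ ≤ B) :
    Integrable (fun t => K p x₀ t * f t) := by
  obtain ⟨C, hC, hev⟩ := hK.bound p hp x₀
  have hk := mem_of_mem_nhdsWithin hp hev
  exact (hK.integrable_bound x₀ C B).mono' ((hK.meas p hp x₀).mul hf.aestronglyMeasurable)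
    (Eventually.of_forall fun t =>
      hK.norm_integrand_le hC hk hB le_rfl t)

/-- The kernel maps each iterate to the next one, so the series without its first term is the kernel
applied to the series. The factorial bounds make the integrals of the norms summable, which permits
the interchange. -/
theorem sol_eq (hK : IsVolterra D w K) (hg : IsData D g) {p : ℂ} (hp : p ∈ D) (x : ℝ) :
    volterraSol K g p x = g p x + ∫ t, K p x t * volterraSol K g p t := by
  obtain ⟨G, C, hG, hC, hev⟩ := hK.exists_bounds hg hp x
  obtain ⟨hg', hk, -⟩ := mem_of_mem_nhdsWithin hp hev
  have hs := summable_bound G (C * ∫ s in Ioi x, w s)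
  have hb := hK.norm_term_le' hG hC hg' hk
  have hsum : ∀ y, x ≤ y → Summable fun N => volterraTerm K g N p y := fun y hy =>
    Summable.of_norm_bounded hs fun N => hb N y hy
  have hi : ∀ N, Integrable (fun t => K p x t * volterraTerm K g N p t) := fun N =>
    hK.integrable_mul hp (continuousOn_right (hK.continuousOn_term hg N) hp) (hb N)
  have hsi : Summable fun N => ∫ t, ‖K p x t * volterraTerm K g N p t‖ := by
    refine Summable.of_nonneg_of_le (fun N => integral_nonneg fun t => norm_nonneg _)
      (fun N => norm_integral_volterra_le hK.nonneg hK.int hG hC (hK.zero p) hk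
        (hK.norm_term_le hG hC hg' hk N) x le_rfl) ?_
    refine ((summable_nat_add_iff 1).mpr hs).congr fun N => ?_
    rw [mul_div_assoc]
  have h1 := hasSum_integral_of_summable_integral_norm hi hsi
  have h2 : (fun t => ∑' N, K p x t * volterraTerm K g N p t)
      = fun t => K p x t * volterraSol K g p t := by
    funext t
    rcases le_or_gt t x with ht | ht
    · simp [hK.zero p x t ht]
    · exact (hsum t ht.le).tsum_mul_left _
  rw [h2] at h1
  rw [volterraSol, (hsum x le_rfl).tsum_eq_zero_add, ← h1.tsum_eq]
  rfl

/-- Each iterate is a holomorphic parametric integral, and the series is dominated by an exponential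
series locally uniformly in the parameter. -/
theorem differentiableOn_sol (hK : IsVolterra D w K) (hg : IsData D g) {U : Set ℂ} (hU : IsOpen U)
    (hUD : U ⊆ D) (hKd : ∀ x t, DifferentiableOn ℂ (fun p => K p x t) U)
    (hgd : ∀ x, DifferentiableOn ℂ (fun p => g p x) U) (x : ℝ) :
    DifferentiableOn ℂ (fun p => volterraSol K g p x) U := by
  have hnhds : ∀ p₀ ∈ U, 𝓝[D] p₀ = 𝓝 p₀ := fun p₀ hp =>
    nhdsWithin_eq_nhds.mpr (mem_of_superset (hU.mem_nhds hp) hUD)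
  have hterm : ∀ N x, DifferentiableOn ℂ (fun p => volterraTerm K g N p x) U := by
    intro N
    induction N with
    | zero => exact hgd
    | succ N ih =>
      intro x
      refine differentiableOn_integral hU (fun p hp => (hK.meas p (hUD hp) x).mul
        (continuousOn_right (hK.continuousOn_term hg N) (hUD hp)).aestronglyMeasurable)
        (Eventually.of_forall fun t => (hKd x t).mul (ih t)) fun p₀ hp => ?_
      obtain ⟨G, C, hG, hC, hev⟩ := hK.exists_bounds hg (hUD hp) x
      rw [hnhds p₀ hp] at hev
      refine ⟨_, hK.integrable_bound x C _, hev.mono fun p hp => Eventually.of_forall fun t =>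
        hK.norm_integrand_le hC hp.2.1 (hK.norm_term_le' hG hC hp.1 hp.2.1 N) le_rfl t⟩
  intro p₀ hp
  obtain ⟨G, C, hG, hC, hev⟩ := hK.exists_bounds hg (hUD hp) x
  rw [hnhds p₀ hp] at hev
  obtain ⟨V, hV, hVo, hpV⟩ := mem_nhds_iff.mp (hev.and (hU.mem_nhds hp))
  have h1 : DifferentiableOn ℂ (fun p => volterraSol K g p x) V := by
    refine Complex.differentiableOn_tsum_of_summable_norm
      (summable_bound G (C * ∫ s in Ioi x, w s))
      (fun N => (hterm N x).mono fun p hp => (hV hp).2) hVo fun N p hp => ?_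
    exact hK.norm_term_le' hG hC (hV hp).1.1 (hV hp).1.2.1 N x le_rfl
  exact (h1.differentiableAt (hVo.mem_nhds hpV)).differentiableWithinAt

end IsVolterra

end Volterra

/-! ### The Cauchy problem for the matrix Schrödinger equation. -/

variable {n : ℕ}

/-- `Y` solves `-Y'' + Q Y = lam Y` on `[0, ∞)`, with the derivative `Y'`. -/
structure IsSol (Q : ℝ → Mat n) (lam : ℂ) (Y Y' : ℝ → Mat n) : Prop where
  prim : IsPrim Y Y'
  prim' : IsPrim Y' (fun t => Q t * Y t - lam • Y t)

/-- `Z` solves `-Z'' + Z Q = lam Z` on `[0, ∞)`, with the derivative `Z'`. -/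
structure IsSolStar (Q : ℝ → Mat n) (lam : ℂ) (Z Z' : ℝ → Mat n) : Prop where
  prim : IsPrim Z Z'
  prim' : IsPrim Z' (fun t => Z t * Q t - lam • Z t)

theorem intervalIntegrable_Q {Q : ℝ → Mat n} (hQ : IntegrableOn Q (Ioi 0)) {x : ℝ} (hx : 0 ≤ x) :
    IntervalIntegrable Q volume 0 x := by
  rw [intervalIntegrable_iff_integrableOn_Ioc_of_le hx]
  exact hQ.mono_set Ioc_subset_Ioi_self

theorem intervalIntegrable_rhs {Q Y : ℝ → Mat n} (hQ : IntegrableOn Q (Ioi 0)) (lam : ℂ)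
    (hY : ContinuousOn Y (Ici 0)) {x : ℝ} (hx : 0 ≤ x) :
    IntervalIntegrable (fun t => Q t * Y t - lam • Y t) volume 0 x := by
  have hY' : ContinuousOn Y (uIcc 0 x) := hY.mono (by
    rw [uIcc_of_le hx]; exact Icc_subset_Ici_self)
  exact ((intervalIntegrable_Q hQ hx).mul_continuousOn hY').sub (hY'.const_smul lam).intervalIntegrable

/-- The derivative is continuous as a primitive of an integrable function, so the pointwise form of
`Y' = dY/dx` and its integrated form agree. From here on solutions are handled through `IsPrim`, for
which the product rule is available. -/
theorem isCauchySolution_iff {Q Y : ℝ → Mat n} (hQ : IntegrableOn Q (Ioi 0)) {lam : ℂ}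
    {Y₀ Y₁ : Mat n} : IsCauchySolution Q lam Y₀ Y₁ Y ↔
      ∃ Y', IsSol Q lam Y Y' ∧ Y 0 = Y₀ ∧ Y' 0 = Y₁ := by
  constructor
  · rintro ⟨h0, Y', hd, he⟩
    have hc : ContinuousOn Y (Ici 0) := fun x hx => (hd x hx).continuousWithinAt
    have h1 : IsPrim Y' (fun t => Q t * Y t - lam • Y t) :=
      (IsPrim.of_integral Y₁ fun x hx => intervalIntegrable_rhs hQ lam hc hx).congr he
        fun x _ => rfl
    exact ⟨Y', ⟨IsPrim.of_hasDerivWithinAt hd h1.continuousOn, h1⟩, h0, by simpa using he 0 le_rfl⟩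
  · rintro ⟨Y', h, h0, h1⟩
    refine ⟨h0, Y', fun x hx => h.prim.hasDerivWithinAt h.prim'.continuousOn hx, fun x hx => ?_⟩
    rw [h.prim'.eq x hx, h1]

theorem IsPrim.transpose {F f : ℝ → Mat n} (hF : IsPrim F f) :
    IsPrim (fun t => (F t).transpose) (fun t => (f t).transpose) := by
  let T : Mat n →L[ℝ] Mat n :=
    LinearMap.toContinuousLinearMap
      { toFun := Matrix.transpose, map_add' := Matrix.transpose_add,
        map_smul' := fun c A => Matrix.transpose_smul c A }
  refine ⟨fun x hx => ?_, fun x hx => ?_⟩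
  · have h := hF.int x hx
    rw [intervalIntegrable_iff] at h ⊢
    exact T.integrable_comp h
  · have h := T.intervalIntegral_comp_comm (hF.int x hx)
    change ∫ t in (0 : ℝ)..x, (f t).transpose = (∫ t in (0 : ℝ)..x, f t).transpose at h
    rw [h, hF.eq x hx, Matrix.transpose_add]

/-- Transposition reverses products and moves the potential to the other side. This reduces every
statement on starred solutions to one on ordinary solutions of the transposed problem. -/
theorem IsSol.transpose {Q Y Y' : ℝ → Mat n} {lam : ℂ} (h : IsSol Q lam Y Y') :
    IsSolStar (fun t => (Q t).transpose) lam (fun t => (Y t).transpose)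
      (fun t => (Y' t).transpose) :=
  ⟨h.prim.transpose, h.prim'.transpose.congr (fun _ _ => rfl) fun x _ => by
    simp [Matrix.transpose_sub, Matrix.transpose_mul, Matrix.transpose_smul]⟩

theorem IsSolStar.transpose {Q Z Z' : ℝ → Mat n} {lam : ℂ} (h : IsSolStar Q lam Z Z') :
    IsSol (fun t => (Q t).transpose) lam (fun t => (Z t).transpose) (fun t => (Z' t).transpose) :=
  ⟨h.prim.transpose, h.prim'.transpose.congr (fun _ _ => rfl) fun x _ => by
    simp [Matrix.transpose_sub, Matrix.transpose_mul, Matrix.transpose_smul]⟩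

theorem isCauchySolutionStar_iff {Q Z : ℝ → Mat n} (hQ : IntegrableOn Q (Ioi 0)) {lam : ℂ}
    {Z₀ Z₁ : Mat n} : IsCauchySolutionStar Q lam Z₀ Z₁ Z ↔
      ∃ Z', IsSolStar Q lam Z Z' ∧ Z 0 = Z₀ ∧ Z' 0 = Z₁ := by
  constructor
  · rintro ⟨h0, Z', hd, he⟩
    have hc : ContinuousOn Z (Ici 0) := fun x hx => (hd x hx).continuousWithinAt
    have h1 : IsPrim Z' (fun t => Z t * Q t - lam • Z t) := by
      refine (IsPrim.of_integral Z₁ fun x hx => ?_).congr he fun x _ => rfl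
      have hZ' : ContinuousOn Z (uIcc 0 x) := hc.mono (by
        rw [uIcc_of_le hx]; exact Icc_subset_Ici_self)
      exact ((intervalIntegrable_Q hQ hx).continuousOn_mul hZ').sub
        (hZ'.const_smul lam).intervalIntegrable
    exact ⟨Z', ⟨IsPrim.of_hasDerivWithinAt hd h1.continuousOn, h1⟩, h0, by simpa using he 0 le_rfl⟩
  · rintro ⟨Z', h, h0, h1⟩
    refine ⟨h0, Z', fun x hx => h.prim.hasDerivWithinAt h.prim'.continuousOn hx, fun x hx => ?_⟩
    rw [h.prim'.eq x hx, h1]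

/-- The Volterra kernel of the Cauchy problem, in the variable `ξ = -x`. -/
def cauchyKernel (Q : ℝ → Mat n) (lam : ℂ) (ξ t : ℝ) : Mat n :=
  ((max (t - ξ) 0 : ℝ) : ℂ) • (Iio (0 : ℝ)).indicator (fun t => Q (-t) - lam • (1 : Mat n)) t

/-- The majorant of the Volterra kernel of the Cauchy problem. -/
def cauchyWeight (Q : ℝ → Mat n) (t : ℝ) : ℝ := (Iio (0 : ℝ)).indicator (fun t => ‖Q (-t)‖ + 1) t

theorem integrableOn_Q_neg {Q : ℝ → Mat n} (hQ : IntegrableOn Q (Ioi 0)) :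
    IntegrableOn (fun t => Q (-t)) (Iio 0) := by
  have := (Measure.measurePreserving_neg (volume : Measure ℝ)).integrableOn_comp_preimage
    (Homeomorph.neg ℝ).measurableEmbedding (f := Q) (s := Ioi 0)
  have h2 := this.mpr hQ
  have e : (Neg.neg ⁻¹' Ioi (0 : ℝ)) = Iio 0 := by ext; simp
  rw [e] at h2
  exact h2

/-- The reflection `ξ = -x` turns integration over `(0, x)` into integration over `(ξ, 0)`, to the
right of `ξ`, as in the general scheme. The majorant may contain the constant 1 because it is cut
off at 0. -/
theorem isVolterra_cauchyKernel {Q : ℝ → Mat n} (hQ : IntegrableOn Q (Ioi 0)) :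
    IsVolterra univ (cauchyWeight Q) (cauchyKernel Q) where
  nonneg t := indicator_nonneg (fun t _ => by positivity) t
  int x := by
    have e : cauchyWeight Q = (Iio (0 : ℝ)).indicator (fun t => ‖Q (-t)‖ + 1) := rfl
    rw [IntegrableOn, e, integrable_indicator_iff measurableSet_Iio, IntegrableOn,
      Measure.restrict_restrict measurableSet_Iio]
    refine Integrable.add (IntegrableOn.mono_set (integrableOn_Q_neg hQ).norm inter_subset_left) ?_
    have : Iio (0 : ℝ) ∩ Ioi x ⊆ Ioo x 0 := fun t ht => ⟨ht.2, ht.1⟩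
    exact (integrableOn_const (by simp) (by simp)).mono_set this
  zero p x t h := by simp [cauchyKernel, max_eq_right (sub_nonpos.mpr h)]
  bound p₀ _ x₀ := by
    refine ⟨|x₀| * (1 + (‖p₀‖ + 1) * ‖(1 : Mat n)‖), by positivity, ?_⟩
    rw [nhdsWithin_univ]
    filter_upwards [Metric.ball_mem_nhds p₀ one_pos] with p hp x hx t
    have hp' : ‖p‖ ≤ ‖p₀‖ + 1 := by
      rw [Metric.mem_ball, dist_eq_norm] at hp
      linarith [norm_le_norm_add_norm_sub' p p₀]
    unfold cauchyKernel cauchyWeight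
    by_cases ht : t ∈ Iio (0 : ℝ)
    · rw [indicator_of_mem ht, indicator_of_mem ht, norm_smul, Complex.norm_real, mul_assoc]
      have ht0 : t < 0 := ht
      have h1 : ‖max (t - x) 0‖ ≤ |x₀| := by
        rw [Real.norm_of_nonneg (le_max_right _ _)]
        exact max_le (by linarith [neg_abs_le x₀]) (abs_nonneg _)
      refine mul_le_mul h1 ?_ (norm_nonneg _) (abs_nonneg _)
      refine (norm_sub_le _ _).trans ?_
      have h2 : ‖p • (1 : Mat n)‖ ≤ (‖p₀‖ + 1) * ‖(1 : Mat n)‖ := by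
        rw [norm_smul]; gcongr
      have h3 : 0 ≤ (‖p₀‖ + 1) * ‖(1 : Mat n)‖ := by positivity
      nlinarith [norm_nonneg (Q (-t))]
    · simp [indicator_of_notMem ht]
  meas p _ x := by
    unfold cauchyKernel
    refine AEStronglyMeasurable.smul
      (f := fun t : ℝ => ((max (t - x) 0 : ℝ) : ℂ)) (Continuous.aestronglyMeasurable (by fun_prop)) ?_
    rw [aestronglyMeasurable_indicator_iff measurableSet_Iio]
    exact (integrableOn_Q_neg hQ).aestronglyMeasurable.sub aestronglyMeasurable_const
  cont t := by
    refine Continuous.continuousOn ?_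
    unfold cauchyKernel
    by_cases ht : t ∈ Iio (0 : ℝ)
    · simp only [indicator_of_mem ht]; fun_prop
    · simp only [indicator_of_notMem ht]; fun_prop

/-- The free solution of the Cauchy problem, in the variable `ξ = -x`. -/
def cauchyData (Y₀ Y₁ : Mat n) (_lam : ℂ) (ξ : ℝ) : Mat n := Y₀ + ((max (-ξ) 0 : ℝ) : ℂ) • Y₁

theorem isData_cauchyData (Y₀ Y₁ : Mat n) : IsVolterra.IsData univ (cauchyData Y₀ Y₁) where
  cont := by unfold cauchyData; fun_prop
  bound p₀ _ x₀ := by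
    refine ⟨‖Y₀‖ + |x₀| * ‖Y₁‖, by positivity, Eventually.of_forall fun p x hx => ?_⟩
    refine (norm_add_le _ _).trans ?_
    rw [norm_smul, Complex.norm_real, Real.norm_of_nonneg (le_max_right _ _)]
    gcongr
    exact max_le (by linarith [neg_abs_le x₀]) (abs_nonneg _)

/-- The solution of the Cauchy problem. -/
def cauchySol (Q : ℝ → Mat n) (Y₀ Y₁ : Mat n) (lam : ℂ) (x : ℝ) : Mat n :=
  volterraSol (cauchyKernel Q) (cauchyData Y₀ Y₁) lam (-x)

theorem continuous_cauchySol {Q : ℝ → Mat n} (hQ : IntegrableOn Q (Ioi 0)) (Y₀ Y₁ : Mat n) :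
    Continuous fun z : ℂ × ℝ => cauchySol Q Y₀ Y₁ z.1 z.2 :=
  ((isVolterra_cauchyKernel hQ).continuousOn_sol (isData_cauchyData Y₀ Y₁)).comp_continuous
    (f := fun z : ℂ × ℝ => (z.1, -z.2)) (by fun_prop) fun z => ⟨mem_univ _, mem_univ _⟩

theorem differentiable_cauchySol {Q : ℝ → Mat n} (hQ : IntegrableOn Q (Ioi 0)) (Y₀ Y₁ : Mat n)
    (x : ℝ) : Differentiable ℂ fun lam => cauchySol Q Y₀ Y₁ lam x := by
  rw [← differentiableOn_univ]
  refine (isVolterra_cauchyKernel hQ).differentiableOn_sol (isData_cauchyData Y₀ Y₁) isOpen_univ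
    subset_rfl (fun x t => ?_) (fun x => ?_) (-x)
  · unfold cauchyKernel
    by_cases ht : t ∈ Iio (0 : ℝ)
    · simp only [indicator_of_mem ht]; fun_prop
    · simp only [indicator_of_notMem ht]; fun_prop
  · unfold cauchyData; fun_prop

theorem integral_cauchyKernel (Q f : ℝ → Mat n) (lam : ℂ) {x : ℝ} (hx : 0 ≤ x) :
    ∫ t, cauchyKernel Q lam (-x) t * f (-t)
      = ∫ t in (0 : ℝ)..x, ((x - t : ℝ) : ℂ) • (Q t * f t - lam • f t) := by
  rw [intervalIntegral.integral_of_le hx, integral_Ioc_eq_integral_Ioo,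
    ← integral_indicator measurableSet_Ioo, ← integral_neg_eq_self]
  refine integral_congr_ae (Eventually.of_forall fun t => ?_)
  simp only [cauchyKernel, neg_neg]
  by_cases h0 : 0 < t
  · by_cases h1 : t < x
    · rw [indicator_of_mem (by simpa using h0 : -t ∈ Iio (0 : ℝ)), indicator_of_mem (show t ∈ Ioo 0 x from ⟨h0, h1⟩),
        max_eq_left (by linarith), neg_neg, smul_mul_assoc, sub_mul, smul_mul_assoc, one_mul,
        show -t - -x = x - t by ring]
    · rw [indicator_of_notMem (by simp [h1] : t ∉ Ioo 0 x), max_eq_right (by linarith)]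
      simp
  · rw [indicator_of_notMem (by simpa using h0 : -t ∉ Iio (0 : ℝ)),
      indicator_of_notMem (by simp [h0] : t ∉ Ioo 0 x)]
    simp

/-- Integration by parts: a repeated primitive is an integral against `x - t`. -/
theorem integral_sub_smul {P F : ℝ → Mat n} (hP : IsPrim P F) (h0 : P 0 = 0) {x : ℝ} (hx : 0 ≤ x) :
    ∫ t in (0 : ℝ)..x, ((x - t : ℝ) : ℂ) • F t = ∫ t in (0 : ℝ)..x, P t := by
  have h1 : IsPrim (fun t : ℝ => ((x - t : ℝ) : ℂ) • (1 : Mat n)) (fun _ => -1) := by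
    refine IsPrim.of_hasDerivAt (fun t => ?_) continuous_const
    have h2 : HasDerivAt (fun t : ℝ => ((x - t : ℝ) : ℂ)) (-1) t := by
      have := ((hasDerivAt_id t).const_sub x).ofReal_comp
      simpa using this
    simpa using h2.smul_const (1 : Mat n)
  have h := (h1.mul hP).eq x hx
  simp only [sub_self, Complex.ofReal_zero, zero_smul, zero_mul, h0, mul_zero, zero_add, neg_mul,
    one_mul, smul_mul_assoc] at h
  have hi : IntervalIntegrable P volume 0 x :=
    (hP.continuousOn.mono (by rw [uIcc_of_le hx]; exact Icc_subset_Ici_self)).intervalIntegrable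
  have hi2 : IntervalIntegrable (fun t => ((x - t : ℝ) : ℂ) • F t) volume 0 x :=
    (hP.int x hx).continuousOn_smul (by fun_prop)
  have h3 := intervalIntegral.integral_add hi.neg hi2
  simp only [Pi.neg_apply, intervalIntegral.integral_neg] at h3
  rw [h3] at h
  exact (neg_add_eq_zero.mp h.symm).symm

theorem IsSol.eq_integral {Q Y Y' : ℝ → Mat n} {lam : ℂ} (h : IsSol Q lam Y Y') {x : ℝ}
    (hx : 0 ≤ x) : Y x = Y 0 + (x : ℂ) • Y' 0 +
      ∫ t in (0 : ℝ)..x, ((x - t : ℝ) : ℂ) • (Q t * Y t - lam • Y t) := by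
  have h1 := h.prim'.sub (IsPrim.const (Y' 0))
  simp only [sub_zero] at h1
  rw [integral_sub_smul h1 (sub_self _) hx, h.prim.eq x hx, intervalIntegral.integral_sub
    (h.prim.int x hx) (by simp), intervalIntegral.integral_const]
  simp only [sub_zero, Complex.coe_smul]
  abel

/-- By `IsSol.eq_integral`, the reflected difference of two solutions with the same Cauchy data
solves a homogeneous Volterra equation. -/
theorem IsSol.eq_of_eq {Q Y Y' Z Z' : ℝ → Mat n} (hQ : IntegrableOn Q (Ioi 0)) {lam : ℂ}
    (h : IsSol Q lam Y Y') (h2 : IsSol Q lam Z Z') (h0 : Y 0 = Z 0) (h1 : Y' 0 = Z' 0) {x : ℝ}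
    (hx : 0 ≤ x) : Y x = Z x := by
  have hc : ContinuousOn (fun t => Y t - Z t) (Ici 0) :=
    h.prim.continuousOn.sub h2.prim.continuousOn
  -- Truncation at 0 makes `d` bounded on all of `[-x, ∞)`. For `ξ ≥ 0` it is constant, equal to the
  -- difference of the initial values, which is zero.
  set d : ℝ → Mat n := fun ξ => Y (max (-ξ) 0) - Z (max (-ξ) 0) with hd
  have hV := isVolterra_cauchyKernel hQ
  obtain ⟨C, hC, hev⟩ := hV.bound lam (mem_univ _) (-x)
  have hk := mem_of_mem_nhdsWithin (mem_univ _) hev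
  obtain ⟨B, hB⟩ := (isCompact_Icc (a := (0 : ℝ)) (b := x)).exists_bound_of_continuousOn
    (hc.mono Icc_subset_Ici_self)
  have key := eq_zero_of_volterra hV.nonneg hV.int (f := d) (B := B) hC (hV.zero lam) hk
    (fun ξ hξ => hB _ ⟨le_max_right _ _, max_le (by linarith) hx⟩) (fun ξ hξ => ?_) (-x) le_rfl
  · simp only [hd, neg_neg, max_eq_left hx] at key
    exact sub_eq_zero.mp key
  · set y := max (-ξ) 0 with hy
    have hy0 : 0 ≤ y := le_max_right _ _
    have e1 : ∫ t, cauchyKernel Q lam ξ t * d t =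
        ∫ t, cauchyKernel Q lam (-y) t * (fun s => Y s - Z s) (-t) := by
      refine integral_congr_ae (Eventually.of_forall fun t => ?_)
      by_cases ht : t ∈ Iio (0 : ℝ)
      · have ht0 : t < 0 := ht
        have e2 : max (t - ξ) 0 = max (t - -y) 0 := by
          rcases le_total 0 (-ξ) with h | h
          · rw [hy, max_eq_left h, neg_neg]
          · rw [hy, max_eq_right h, max_eq_right (by linarith), max_eq_right (by linarith)]
        simp only [cauchyKernel, e2, hd, max_eq_left (by linarith : 0 ≤ -t)]
      · simp [cauchyKernel, indicator_of_notMem ht]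
    have hmem : IntervalIntegrable (fun t => ((y - t : ℝ) : ℂ) • (Q t * Y t - lam • Y t)) volume 0 y :=
      (h.prim'.int y hy0).continuousOn_smul (by fun_prop)
    have hmem2 : IntervalIntegrable (fun t => ((y - t : ℝ) : ℂ) • (Q t * Z t - lam • Z t)) volume 0 y :=
      (h2.prim'.int y hy0).continuousOn_smul (by fun_prop)
    rw [e1, integral_cauchyKernel Q (fun s => Y s - Z s) lam hy0]
    have e3 : ∀ t, ((y - t : ℝ) : ℂ) • (Q t * (Y t - Z t) - lam • (Y t - Z t))
        = ((y - t : ℝ) : ℂ) • (Q t * Y t - lam • Y t) - ((y - t : ℝ) : ℂ) • (Q t * Z t - lam • Z t) := by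
      intro t
      rw [← smul_sub]
      congr 1
      rw [mul_sub, smul_sub]
      abel
    simp only [e3]
    rw [intervalIntegral.integral_sub hmem hmem2]
    simp only [hd]
    rw [h.eq_integral hy0, h2.eq_integral hy0, h0, h1]
    abel

/-- The derivative of the solution of the Cauchy problem. -/
def cauchyDer (Q : ℝ → Mat n) (Y₀ Y₁ : Mat n) (lam : ℂ) (x : ℝ) : Mat n :=
  Y₁ + ∫ t in (0 : ℝ)..x, (Q t * cauchySol Q Y₀ Y₁ lam t - lam • cauchySol Q Y₀ Y₁ lam t)

theorem continuous_cauchySol_right {Q : ℝ → Mat n} (hQ : IntegrableOn Q (Ioi 0)) (Y₀ Y₁ : Mat n)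
    (lam : ℂ) : Continuous (cauchySol Q Y₀ Y₁ lam) :=
  (continuous_cauchySol hQ Y₀ Y₁).comp (by fun_prop : Continuous fun x : ℝ => (lam, x))

theorem isSol_cauchySol {Q : ℝ → Mat n} (hQ : IntegrableOn Q (Ioi 0)) (Y₀ Y₁ : Mat n) (lam : ℂ) :
    IsSol Q lam (cauchySol Q Y₀ Y₁ lam) (cauchyDer Q Y₀ Y₁ lam) ∧
      cauchySol Q Y₀ Y₁ lam 0 = Y₀ ∧ cauchyDer Q Y₀ Y₁ lam 0 = Y₁ := by
  have hc := continuous_cauchySol_right hQ Y₀ Y₁ lam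
  have h1 : IsPrim (cauchyDer Q Y₀ Y₁ lam)
      (fun t => Q t * cauchySol Q Y₀ Y₁ lam t - lam • cauchySol Q Y₀ Y₁ lam t) :=
    IsPrim.of_integral _ fun x hx => intervalIntegrable_rhs hQ lam hc.continuousOn hx
  have hd0 : cauchyDer Q Y₀ Y₁ lam 0 = Y₁ := by simp [cauchyDer]
  have e : ∀ x, 0 ≤ x → cauchySol Q Y₀ Y₁ lam x = Y₀ + ∫ t in (0 : ℝ)..x, cauchyDer Q Y₀ Y₁ lam t := by
    intro x hx
    have h2 := (isVolterra_cauchyKernel hQ).sol_eq (isData_cauchyData Y₀ Y₁) (mem_univ lam) (-x)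
    have e2 : ∫ t, cauchyKernel Q lam (-x) t * volterraSol (cauchyKernel Q) (cauchyData Y₀ Y₁) lam t
        = ∫ t, cauchyKernel Q lam (-x) t * cauchySol Q Y₀ Y₁ lam (-t) := by
      simp [cauchySol]
    have h3 := h1.sub (IsPrim.const Y₁)
    simp only [sub_zero] at h3
    rw [e2, integral_cauchyKernel Q _ lam hx, integral_sub_smul h3 (by simp [hd0]) hx,
      intervalIntegral.integral_sub ?_ (by simp), intervalIntegral.integral_const] at h2
    · change cauchySol Q Y₀ Y₁ lam x = _ at h2
      rw [h2, cauchyData, neg_neg, max_eq_left hx]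
      simp only [sub_zero, Complex.coe_smul]
      abel
    · exact (h1.continuousOn.mono (by rw [uIcc_of_le hx]; exact Icc_subset_Ici_self)).intervalIntegrable
  have h0 : cauchySol Q Y₀ Y₁ lam 0 = Y₀ := by simpa using e 0 le_rfl
  refine ⟨⟨⟨fun x hx => ?_, fun x hx => by rw [h0]; exact e x hx⟩, h1⟩, h0, hd0⟩
  exact (h1.continuousOn.mono (by rw [uIcc_of_le hx]; exact Icc_subset_Ici_self)).intervalIntegrable

/-! ### Wronskians and variation of constants. -/

section Wronskian

variable {n : ℕ}

theorem IsPrim.wronskian {Y Y' F Z Z' G : ℝ → Mat n} (hY : IsPrim Y Y') (hY' : IsPrim Y' F)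
    (hZ : IsPrim Z Z') (hZ' : IsPrim Z' G) :
    IsPrim (fun t => Z' t * Y t - Z t * Y' t) (fun t => G t * Y t - Z t * F t) :=
  ((hZ'.mul hY).sub (hZ.mul hY')).congr (fun _ _ => rfl) fun x _ => by abel

/-- The two terms `Z Q Y` cancel, and only the spectral parameters remain. Wronskians thus express
the integrals `D` and `psiD` by values at the end-points, and they link the Jost solutions of a
problem and its transpose. -/
theorem IsSol.wronskian {Q Y Y' Z Z' : ℝ → Mat n} {lam mu : ℂ} (hY : IsSol Q lam Y Y')
    (hZ : IsSolStar Q mu Z Z') :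
    IsPrim (fun t => Z' t * Y t - Z t * Y' t) (fun t => (lam - mu) • (Z t * Y t)) :=
  (hY.prim.wronskian hY.prim' hZ.prim hZ.prim').congr (fun _ _ => rfl) fun x _ => by
    rw [sub_mul, mul_sub, sub_smul, mul_assoc, smul_mul_assoc, mul_smul_comm]
    abel

/-- Variation of constants. -/
theorem IsSol.variation {Q Y Y' : ℝ → Mat n} {ρ : ℂ} (hY : IsSol Q (ρ ^ 2) Y Y') {c c' : ℝ → ℂ}
    (hc : ∀ t, HasDerivAt c (c' t) t) (hc' : ∀ t, HasDerivAt c' (-(ρ ^ 2 * c t)) t) {x : ℝ}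
    (hx : 0 ≤ x) :
    c' x • Y x - c x • Y' x = c' 0 • Y 0 - c 0 • Y' 0 - ∫ t in (0 : ℝ)..x, c t • (Q t * Y t) := by
  have hcc : Continuous c := continuous_iff_continuousAt.mpr fun t => (hc t).continuousAt
  have hcc' : Continuous c' := continuous_iff_continuousAt.mpr fun t => (hc' t).continuousAt
  have h1 : IsPrim (fun t => c t • (1 : Mat n)) (fun t => c' t • (1 : Mat n)) :=
    IsPrim.of_hasDerivAt (fun t => (hc t).smul_const _) (by fun_prop)
  have h2 : IsPrim (fun t => c' t • (1 : Mat n)) (fun t => (-(ρ ^ 2 * c t)) • (1 : Mat n)) :=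
    IsPrim.of_hasDerivAt (fun t => (hc' t).smul_const _) (by fun_prop)
  have h := (hY.prim.wronskian hY.prim' h1 h2).eq x hx
  simp only [smul_mul_assoc, one_mul] at h
  rw [h, sub_eq_add_neg _ (∫ t in (0 : ℝ)..x, c t • (Q t * Y t)), ← intervalIntegral.integral_neg]
  congr 1
  refine intervalIntegral.integral_congr fun t _ => ?_
  simp only [smul_sub, neg_smul, smul_smul, mul_comm (c t)]
  abel

theorem IsSol.eq_variation {Q Y Y' : ℝ → Mat n} {ρ : ℂ} (hρ : ρ ≠ 0) (hY : IsSol Q (ρ ^ 2) Y Y')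
    {x : ℝ} (hx : 0 ≤ x) :
    Y x = Complex.cos (ρ * x) • Y 0 + (Complex.sin (ρ * x) / ρ) • Y' 0 +
      ∫ t in (0 : ℝ)..x, (Complex.sin (ρ * (x - t)) / ρ) • (Q t * Y t) := by
  have hl : ∀ t : ℝ, HasDerivAt (fun t : ℝ => ρ * ((x : ℂ) - t)) (-ρ) t := fun t => by
    simpa using ((Complex.ofRealCLM.hasDerivAt (x := t)).const_sub (x : ℂ)).const_mul ρ
  -- This solution of the free equation vanishes at `t = x` with derivative `-1`, so the Wronskian
  -- at `x` is `-Y x`. In `deriv_eq_variation` the cosine isolates `Y' x` in the same way.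
  have h := hY.variation (c := fun t => Complex.sin (ρ * (x - t)) / ρ)
    (c' := fun t => -Complex.cos (ρ * (x - t))) (fun t => by
      refine (((Complex.hasDerivAt_sin _).comp t (hl t)).div_const ρ).congr_deriv ?_
      field_simp) (fun t => by
      refine (((Complex.hasDerivAt_cos _).comp t (hl t)).neg).congr_deriv ?_
      field_simp) hx
  simp only [sub_self, mul_zero, Complex.cos_zero, Complex.sin_zero, zero_div, zero_smul, sub_zero,
    Complex.ofReal_zero, neg_smul, one_smul] at h
  rw [← neg_inj, h]
  abel

theorem IsSol.deriv_eq_variation {Q Y Y' : ℝ → Mat n} {ρ : ℂ} (hY : IsSol Q (ρ ^ 2) Y Y')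
    {x : ℝ} (hx : 0 ≤ x) :
    Y' x = (-(ρ * Complex.sin (ρ * x))) • Y 0 + Complex.cos (ρ * x) • Y' 0 +
      ∫ t in (0 : ℝ)..x, Complex.cos (ρ * (x - t)) • (Q t * Y t) := by
  have hl : ∀ t : ℝ, HasDerivAt (fun t : ℝ => ρ * ((x : ℂ) - t)) (-ρ) t := fun t => by
    simpa using ((Complex.ofRealCLM.hasDerivAt (x := t)).const_sub (x : ℂ)).const_mul ρ
  have h := hY.variation (c := fun t => Complex.cos (ρ * (x - t)))
    (c' := fun t => ρ * Complex.sin (ρ * (x - t))) (fun t => by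
      refine ((Complex.hasDerivAt_cos _).comp t (hl t)).congr_deriv ?_
      ring) (fun t => by
      refine (((Complex.hasDerivAt_sin _).comp t (hl t)).const_mul ρ).congr_deriv ?_
      ring) hx
  simp only [sub_self, mul_zero, Complex.cos_zero, Complex.sin_zero, zero_smul, sub_zero,
    Complex.ofReal_zero, one_smul, zero_sub] at h
  rw [← neg_inj, h, neg_smul]
  abel

end Wronskian

/-! ### Free solutions multiplied by the decaying exponential. -/

section FreeSolutions

/-- `e^{iρs} cos ρs`. -/
def cosE (ρ : ℂ) (s : ℝ) : ℂ := Complex.exp (Complex.I * ρ * s) * Complex.cos (ρ * s)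

/-- `i e^{iρs} sin ρs`. -/
def sinE (ρ : ℂ) (s : ℝ) : ℂ :=
  Complex.exp (Complex.I * ρ * s) * (Complex.I * Complex.sin (ρ * s))

theorem norm_exp_le {ρ : ℂ} (hρ : 0 ≤ ρ.im) {s : ℝ} (hs : 0 ≤ s) :
    ‖Complex.exp (Complex.I * ρ * s)‖ ≤ 1 := by
  rw [Complex.norm_exp, Real.exp_le_one_iff]
  simp only [Complex.mul_re, Complex.mul_im, Complex.I_re, Complex.I_im, Complex.ofReal_re,
    Complex.ofReal_im]
  nlinarith [mul_nonneg hρ hs]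

theorem cosE_eq (ρ : ℂ) (s : ℝ) :
    cosE ρ s = (Complex.exp (Complex.I * ρ * s) * Complex.exp (Complex.I * ρ * s) + 1) / 2 := by
  rw [cosE, Complex.cos, ← mul_div_assoc, mul_add, ← Complex.exp_add, ← Complex.exp_add,
    ← Complex.exp_add]
  ring_nf
  simp
  ring

theorem sinE_eq (ρ : ℂ) (s : ℝ) :
    sinE ρ s = (Complex.exp (Complex.I * ρ * s) * Complex.exp (Complex.I * ρ * s) - 1) / 2 := by
  have h : Complex.I * Complex.sin (ρ * s) =
      (Complex.exp (ρ * s * Complex.I) - Complex.exp (-(ρ * s) * Complex.I)) / 2 := by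
    rw [Complex.sin]
    linear_combination (Complex.exp (-(ρ * s) * Complex.I) - Complex.exp (ρ * s * Complex.I)) / 2 *
      Complex.I_sq
  rw [sinE, h, ← mul_div_assoc, mul_sub, ← Complex.exp_add, ← Complex.exp_add, ← Complex.exp_add]
  ring_nf
  simp
  ring

theorem norm_cosE_le {ρ : ℂ} (hρ : 0 ≤ ρ.im) {s : ℝ} (hs : 0 ≤ s) : ‖cosE ρ s‖ ≤ 1 := by
  have h := norm_exp_le hρ hs
  rw [cosE_eq, norm_div, Complex.norm_ofNat, div_le_one two_pos]
  refine (norm_add_le _ _).trans ?_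
  rw [norm_mul, norm_one]
  nlinarith [norm_nonneg (Complex.exp (Complex.I * ρ * s))]

theorem norm_sinE_le {ρ : ℂ} (hρ : 0 ≤ ρ.im) {s : ℝ} (hs : 0 ≤ s) : ‖sinE ρ s‖ ≤ 1 := by
  have h := norm_exp_le hρ hs
  rw [sinE_eq, norm_div, Complex.norm_ofNat, div_le_one two_pos]
  refine (norm_sub_le _ _).trans ?_
  rw [norm_mul, norm_one]
  nlinarith [norm_nonneg (Complex.exp (Complex.I * ρ * s))]

/-- This is `e^{iz} (cos z - i sin z) = 1`. It produces the constant `-1` in `sub_mul_lead` and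
thereby the Cauchy kernel in the contour integral. -/
theorem cosE_sub_sinE (ρ : ℂ) (s : ℝ) : cosE ρ s - sinE ρ s = 1 := by
  rw [cosE_eq, sinE_eq]; ring

end FreeSolutions

/-! ### Bounds for solutions that are uniform on the half-line. -/

section Bounds

variable {n : ℕ}

theorem norm_setIntegral_Q_le {Q f : ℝ → Mat n} (hQ : IntegrableOn Q (Ioi 0)) {B x : ℝ}
    (hB : 0 ≤ B) (hx : 0 ≤ x) {c : ℝ → ℂ} {b : ℝ} (hb : 0 ≤ b)
    (hc : ∀ t ∈ Ioc 0 x, ‖c t‖ ≤ b) (hf : ∀ t ∈ Ioc 0 x, ‖f t‖ ≤ B) :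
    ‖∫ t in (0 : ℝ)..x, c t • (Q t * f t)‖ ≤ b * B * ∫ t in Ioi 0, ‖Q t‖ := by
  have hi : IntervalIntegrable (fun t => b * B * ‖Q t‖) volume 0 x :=
    (intervalIntegrable_Q hQ hx).norm.const_mul _
  refine (intervalIntegral.norm_integral_le_of_norm_le hx ?_ hi).trans ?_
  · refine Eventually.of_forall fun t ht => ?_
    rw [norm_smul]
    calc ‖c t‖ * ‖Q t * f t‖ ≤ b * (‖Q t‖ * B) :=
          mul_le_mul (hc t ht) ((norm_mul_le _ _).trans
            (mul_le_mul_of_nonneg_left (hf t ht) (norm_nonneg _))) (norm_nonneg _) hb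
      _ = b * B * ‖Q t‖ := by ring
  · rw [intervalIntegral.integral_const_mul, intervalIntegral.integral_of_le hx]
    refine mul_le_mul_of_nonneg_left ?_ (by positivity)
    exact setIntegral_mono_set hQ.norm (Eventually.of_forall fun t => norm_nonneg _)
      Ioc_subset_Ioi_self.eventuallyLE

/-- The factor `e^{iρx}` is split as `e^{iρ(x - t)} e^{iρt}`: the first part tames the growth of the
free kernel, the second that of `Y`. -/
theorem exp_smul_variation {Q Y : ℝ → Mat n} {ρ : ℂ} (x : ℝ) (c : ℂ → ℂ) :
    Complex.exp (Complex.I * ρ * x) • ∫ t in (0 : ℝ)..x, c (ρ * (x - t)) • (Q t * Y t)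
      = ∫ t in (0 : ℝ)..x, (Complex.exp (Complex.I * ρ * ((x - t : ℝ) : ℂ)) *
        c (ρ * ((x - t : ℝ) : ℂ))) • (Q t * (Complex.exp (Complex.I * ρ * t) • Y t)) := by
  rw [← intervalIntegral.integral_smul]
  refine intervalIntegral.integral_congr fun t _ => ?_
  simp only [mul_smul_comm, smul_smul]
  congr 1
  have : Complex.exp (Complex.I * ρ * x) =
      Complex.exp (Complex.I * ρ * ((x - t : ℝ) : ℂ)) * Complex.exp (Complex.I * ρ * t) := by
    rw [← Complex.exp_add]; congr 1; push_cast; ring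
  rw [this]
  push_cast
  ring

/-- After multiplication by `e^{iρx}` the free part is at most `2a` and the kernel at most `‖Q‖ /
|ρ|`. For `|ρ|` at least twice the integral of `‖Q‖`, the integral term is absorbed, which doubles
the free bound to `4a`; putting this bound back gives the two error estimates. -/
theorem IsSol.bounds {Q Y Y' : ℝ → Mat n} (hQ : IntegrableOn Q (Ioi 0)) {ρ : ℂ}
    (hY : IsSol Q (ρ ^ 2) Y Y') (him : 0 ≤ ρ.im) {a : ℝ} (h0 : ‖Y 0‖ ≤ a) (h1 : ‖Y' 0‖ ≤ a * ‖ρ‖)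
    (hρ : 1 ≤ ‖ρ‖) (hρ2 : 2 * ∫ t in Ioi 0, ‖Q t‖ ≤ ‖ρ‖) {x : ℝ} (hx : 0 ≤ x) :
    ‖Complex.exp (Complex.I * ρ * x) • Y x‖ ≤ 4 * a ∧
    ‖Complex.exp (Complex.I * ρ * x) • Y x - (cosE ρ x • Y 0 + sinE ρ x • (Complex.I * ρ)⁻¹ • Y' 0)‖
      ≤ 4 * a * (∫ t in Ioi 0, ‖Q t‖) / ‖ρ‖ ∧
    ‖Complex.exp (Complex.I * ρ * x) • Y' x - (sinE ρ x • (Complex.I * ρ) • Y 0 + cosE ρ x • Y' 0)‖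
      ≤ 4 * a * ∫ t in Ioi 0, ‖Q t‖ := by
  set q := ∫ t in Ioi 0, ‖Q t‖ with hq
  have hq0 : 0 ≤ q := integral_nonneg fun t => norm_nonneg _
  have hρ0 : ρ ≠ 0 := fun h => by rw [h, norm_zero] at hρ; linarith
  have hρp : 0 < ‖ρ‖ := norm_pos_iff.mpr hρ0
  have ha : 0 ≤ a := (norm_nonneg _).trans h0
  set v : ℝ → Mat n := fun t => Complex.exp (Complex.I * ρ * t) • Y t with hv
  have hvc : ContinuousOn v (Ici 0) := ContinuousOn.smul
    (f := fun t : ℝ => Complex.exp (Complex.I * ρ * t)) (by fun_prop) hY.prim.continuousOn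
  have hIr : Complex.I * ρ ≠ 0 := mul_ne_zero Complex.I_ne_zero hρ0
  have e1 : ∀ y, 0 ≤ y → v y - (cosE ρ y • Y 0 + sinE ρ y • (Complex.I * ρ)⁻¹ • Y' 0) =
      ∫ t in (0 : ℝ)..y, (Complex.exp (Complex.I * ρ * ((y - t : ℝ) : ℂ)) *
        (Complex.sin (ρ * ((y - t : ℝ) : ℂ)) / ρ)) • (Q t * v t) := by
    intro y hy
    rw [← exp_smul_variation y (fun z => Complex.sin z / ρ)]
    simp only [hv]
    conv_lhs => rw [hY.eq_variation hρ0 hy]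
    rw [smul_add, smul_add, smul_smul, smul_smul, smul_smul]
    have : Complex.exp (Complex.I * ρ * y) * (Complex.sin (ρ * y) / ρ) =
        sinE ρ y * (Complex.I * ρ)⁻¹ := by
      rw [sinE]; field_simp
    rw [this, cosE]
    abel
  have hb1 : ∀ y, 0 ≤ y → ‖cosE ρ y • Y 0 + sinE ρ y • (Complex.I * ρ)⁻¹ • Y' 0‖ ≤ 2 * a := by
    intro y hy
    refine (norm_add_le _ _).trans ?_
    rw [norm_smul, norm_smul, norm_smul, norm_inv, norm_mul, Complex.norm_I, one_mul]
    have i1 : ‖cosE ρ y‖ * ‖Y 0‖ ≤ 1 * a :=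
      mul_le_mul (norm_cosE_le him hy) h0 (norm_nonneg _) zero_le_one
    have i2 : ‖ρ‖⁻¹ * ‖Y' 0‖ ≤ a := by
      rw [inv_mul_le_iff₀ hρp, mul_comm]; exact h1
    have i3 : ‖sinE ρ y‖ * (‖ρ‖⁻¹ * ‖Y' 0‖) ≤ 1 * a :=
      mul_le_mul (norm_sinE_le him hy) i2 (by positivity) zero_le_one
    linarith
  have hs : ∀ s : ℝ, 0 ≤ s → ‖Complex.exp (Complex.I * ρ * s) * (Complex.sin (ρ * s) / ρ)‖ ≤ ‖ρ‖⁻¹ := by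
    intro s hs
    have := norm_sinE_le him hs
    rw [sinE, norm_mul, norm_mul, Complex.norm_I, one_mul] at this
    rw [norm_mul, norm_div, ← mul_div_assoc, div_eq_mul_inv]
    exact mul_le_of_le_one_left (by positivity) this
  -- At a point where `‖v‖` is maximal on `[0, X]`, the integral term is at most half of the
  -- maximum. The bound does not depend on `X`.
  have hbd : ∀ X, 0 ≤ X → ∀ y ∈ Icc 0 X, ‖v y‖ ≤ 4 * a := by
    intro X hX
    obtain ⟨y₀, hy₀, hmax⟩ := isCompact_Icc.exists_isMaxOn (nonempty_Icc.mpr hX)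
      (hvc.mono Icc_subset_Ici_self).norm
    have hle : ∀ y ∈ Icc 0 X, ‖v y‖ ≤ ‖v y₀‖ := fun y hy => hmax hy
    have h3 := norm_setIntegral_Q_le hQ (f := v) (norm_nonneg (v y₀)) hy₀.1
      (c := fun t => Complex.exp (Complex.I * ρ * ((y₀ - t : ℝ) : ℂ)) *
        (Complex.sin (ρ * ((y₀ - t : ℝ) : ℂ)) / ρ)) (b := ‖ρ‖⁻¹) (by positivity)
      (fun t ht => hs _ (by linarith [ht.2])) (fun t ht => hle t ⟨ht.1.le, ht.2.trans hy₀.2⟩)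
    rw [← e1 y₀ hy₀.1, ← hq] at h3
    have h4 : ‖ρ‖⁻¹ * ‖v y₀‖ * q ≤ ‖v y₀‖ / 2 := by
      have : ‖ρ‖⁻¹ * q ≤ 1 / 2 := by
        rw [inv_mul_le_iff₀ hρp]; linarith
      nlinarith [norm_nonneg (v y₀)]
    have h5 := norm_le_norm_add_norm_sub' (v y₀)
      (cosE ρ y₀ • Y 0 + sinE ρ y₀ • (Complex.I * ρ)⁻¹ • Y' 0)
    have h6 := hb1 y₀ hy₀.1
    intro y hy
    have h7 := hle y hy
    linarith
  have hbx := fun t (ht : t ∈ Ioc 0 x) => hbd x hx t ⟨ht.1.le, ht.2⟩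
  refine ⟨hbd x hx x ⟨hx, le_rfl⟩, ?_, ?_⟩
  · change ‖v x - _‖ ≤ _
    rw [e1 x hx]
    refine (norm_setIntegral_Q_le hQ (B := 4 * a) (b := ‖ρ‖⁻¹) (by positivity) hx (by positivity)
      (fun t ht => hs _ (by linarith [ht.2])) hbx).trans (le_of_eq ?_)
    rw [← hq]
    field_simp
  · have e2 : Complex.exp (Complex.I * ρ * x) • Y' x -
        (sinE ρ x • (Complex.I * ρ) • Y 0 + cosE ρ x • Y' 0) =
        ∫ t in (0 : ℝ)..x, (Complex.exp (Complex.I * ρ * ((x - t : ℝ) : ℂ)) *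
          Complex.cos (ρ * ((x - t : ℝ) : ℂ))) • (Q t * v t) := by
      rw [← exp_smul_variation x Complex.cos]
      conv_lhs => rw [hY.deriv_eq_variation hx]
      rw [smul_add, smul_add, smul_smul, smul_smul, smul_smul]
      have : Complex.exp (Complex.I * ρ * x) * (-(ρ * Complex.sin (ρ * x))) =
          sinE ρ x * (Complex.I * ρ) := by
        rw [sinE]
        linear_combination (-(Complex.exp (Complex.I * ρ * x) * ρ * Complex.sin (ρ * x))) *
          Complex.I_sq
      rw [this, cosE]
      abel
    rw [e2]
    refine (norm_setIntegral_Q_le hQ (B := 4 * a) (b := 1) (by positivity) hx zero_le_one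
      (fun t ht => ?_) hbx).trans (le_of_eq ?_)
    · exact norm_cosE_le him (by linarith [ht.2] : 0 ≤ x - t)
    · rw [← hq, one_mul]

end Bounds

/-! ### The Jost solution. -/

section Jost

variable {n : ℕ}

/-- `(e^{2iρs} - 1) / 2iρ`. -/
def jostFactor (ρ : ℂ) (s : ℝ) : ℂ :=
  (Complex.exp (Complex.I * ρ * s) * Complex.exp (Complex.I * ρ * s) - 1) / (2 * (Complex.I * ρ))

theorem norm_jostFactor_le {ρ : ℂ} (hρ : 0 ≤ ρ.im) {s : ℝ} (hs : 0 ≤ s) :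
    ‖jostFactor ρ s‖ ≤ ‖ρ‖⁻¹ := by
  have h : jostFactor ρ s = sinE ρ s * (Complex.I * ρ)⁻¹ := by
    rw [jostFactor, sinE_eq, div_mul_eq_mul_div, ← div_eq_mul_inv, div_div, mul_comm 2]
  rw [h, norm_mul, norm_inv, norm_mul, Complex.norm_I, one_mul]
  exact mul_le_of_le_one_left (by positivity) (norm_sinE_le hρ hs)

/-- The Volterra kernel of the equation for `e^{-iρx} e(x, ρ)`. -/
def jostKernel (Q : ℝ → Mat n) (ρ : ℂ) (x t : ℝ) : Mat n :=
  jostFactor ρ (max (t - x) 0) • (Ioi (0 : ℝ)).indicator Q t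

/-- The majorant of the Volterra kernel of the Jost solution. -/
def jostWeight (Q : ℝ → Mat n) (t : ℝ) : ℝ := (Ioi (0 : ℝ)).indicator (fun t => ‖Q t‖) t

theorem continuousOn_jostFactor :
    ContinuousOn (fun z : ℂ × ℝ => jostFactor z.1 z.2) (Omega ×ˢ univ) := by
  unfold jostFactor
  exact ContinuousOn.div (by fun_prop) (by fun_prop) fun z hz =>
    mul_ne_zero two_ne_zero (mul_ne_zero Complex.I_ne_zero hz.1.2)

/-- For `Im ρ ≥ 0` and `t ≥ x` the factor `(e^{2iρ(t - x)} - 1) / 2iρ` is at most `1 / |ρ|`. The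
bound is locally uniform in `Ω`, from which 0 is excluded. -/
theorem isVolterra_jostKernel {Q : ℝ → Mat n} (hQ : IntegrableOn Q (Ioi 0)) :
    IsVolterra Omega (jostWeight Q) (jostKernel Q) where
  nonneg t := indicator_nonneg (fun t _ => norm_nonneg _) t
  int x := ((integrable_indicator_iff measurableSet_Ioi).mpr hQ.norm).integrableOn
  zero p x t h := by simp [jostKernel, max_eq_right (sub_nonpos.mpr h), jostFactor]
  bound p₀ hp₀ x₀ := by
    have h0 : 0 < ‖p₀‖ := norm_pos_iff.mpr hp₀.2
    refine ⟨(‖p₀‖ / 2)⁻¹, by positivity, ?_⟩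
    have hev : ∀ᶠ p in 𝓝[Omega] p₀, ‖p₀‖ / 2 < ‖p‖ :=
      nhdsWithin_le_nhds (continuous_norm.continuousAt.eventually (lt_mem_nhds (by linarith)))
    filter_upwards [hev, self_mem_nhdsWithin] with p hp hpO x hx t
    unfold jostKernel jostWeight
    rw [norm_smul, norm_indicator_eq_indicator_norm]
    refine mul_le_mul_of_nonneg_right ?_ (indicator_nonneg (fun t _ => norm_nonneg _) t)
    refine (norm_jostFactor_le hpO.1 (le_max_right _ _)).trans ?_
    gcongr
  meas p hp x := by
    unfold jostKernel
    refine AEStronglyMeasurable.smul (f := fun t : ℝ => jostFactor p (max (t - x) 0)) ?_ ?_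
    · have : Continuous fun s : ℝ => jostFactor p s :=
        IsVolterra.continuousOn_right continuousOn_jostFactor hp
      exact (this.comp (by fun_prop : Continuous fun t : ℝ => max (t - x) 0)).aestronglyMeasurable
    · rw [aestronglyMeasurable_indicator_iff measurableSet_Ioi]
      exact hQ.aestronglyMeasurable
  cont t := by
    unfold jostKernel
    refine ContinuousOn.smul (f := fun z : ℂ × ℝ => jostFactor z.1 (max (t - z.2) 0))
      (g := fun _ => (Ioi (0 : ℝ)).indicator Q t) ?_ continuousOn_const
    exact continuousOn_jostFactor.comp
      (f := fun z : ℂ × ℝ => (z.1, max (t - z.2) 0)) (by fun_prop) fun z hz => ⟨hz.1, mem_univ _⟩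

theorem isData_one : IsVolterra.IsData Omega (fun _ _ => (1 : Mat n)) where
  cont := continuousOn_const (c := (1 : Mat n))
  bound _ _ _ := ⟨‖(1 : Mat n)‖, norm_nonneg _, Eventually.of_forall fun _ _ _ => le_rfl⟩

/-- `e^{-iρx} e(x, ρ)`. -/
def jostU (Q : ℝ → Mat n) (ρ : ℂ) (x : ℝ) : Mat n := volterraSol (jostKernel Q) (fun _ _ => 1) ρ x

/-- `e^{-iρx} e'(x, ρ)`. -/
def jostV (Q : ℝ → Mat n) (ρ : ℂ) (x : ℝ) : Mat n := (Complex.I * ρ) • (1 : Mat n) -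
  ∫ t in Ioi x, ((Complex.exp (2 * (Complex.I * ρ) * ((t - x : ℝ) : ℂ)) + 1) / 2) • (Q t * jostU Q ρ t)

theorem continuousOn_jostU {Q : ℝ → Mat n} (hQ : IntegrableOn Q (Ioi 0)) :
    ContinuousOn (fun z : ℂ × ℝ => jostU Q z.1 z.2) (Omega ×ˢ univ) :=
  (isVolterra_jostKernel hQ).continuousOn_sol isData_one

theorem continuous_jostU {Q : ℝ → Mat n} (hQ : IntegrableOn Q (Ioi 0)) {ρ : ℂ} (hρ : ρ ∈ Omega) :
    Continuous (jostU Q ρ) :=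
  IsVolterra.continuousOn_right (continuousOn_jostU hQ) hρ

theorem jostU_bound {Q : ℝ → Mat n} (hQ : IntegrableOn Q (Ioi 0)) {ρ : ℂ} (hρ : ρ ∈ Omega) :
    ∃ B, 0 ≤ B ∧ ∀ᶠ p in 𝓝[Omega] ρ, ∀ x, 0 ≤ x → ‖jostU Q p x‖ ≤ B :=
  (isVolterra_jostKernel hQ).norm_sol_le isData_one hρ 0

theorem isOpen_upper : IsOpen {ρ : ℂ | 0 < ρ.im} := isOpen_lt continuous_const Complex.continuous_im

theorem upper_subset_Omega : {ρ : ℂ | 0 < ρ.im} ⊆ Omega := fun ρ hρ =>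
  ⟨le_of_lt hρ, fun h => by simp [h] at hρ⟩

theorem differentiableOn_jostU {Q : ℝ → Mat n} (hQ : IntegrableOn Q (Ioi 0)) (x : ℝ) :
    DifferentiableOn ℂ (fun ρ => jostU Q ρ x) {ρ | 0 < ρ.im} := by
  refine (isVolterra_jostKernel hQ).differentiableOn_sol isData_one isOpen_upper
    upper_subset_Omega (fun x t => ?_) (fun x => differentiableOn_const _) x
  unfold jostKernel jostFactor
  refine DifferentiableOn.smul_const ?_ _
  exact DifferentiableOn.div (by fun_prop) (by fun_prop) fun z hz =>
    mul_ne_zero two_ne_zero (mul_ne_zero Complex.I_ne_zero (upper_subset_Omega hz).2)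

theorem integral_jostKernel (Q f : ℝ → Mat n) (ρ : ℂ) {x : ℝ} (hx : 0 ≤ x) :
    ∫ t, jostKernel Q ρ x t * f t = ∫ t in Ioi x, jostFactor ρ (t - x) • (Q t * f t) := by
  rw [← integral_indicator measurableSet_Ioi]
  refine integral_congr_ae (Eventually.of_forall fun t => ?_)
  simp only [jostKernel]
  by_cases ht : x < t
  · rw [indicator_of_mem (show t ∈ Ioi (0 : ℝ) from hx.trans_lt ht), indicator_of_mem (show t ∈ Ioi x from ht),
      max_eq_left (by linarith), smul_mul_assoc]
  · rw [indicator_of_notMem (show t ∉ Ioi x from ht), max_eq_right (by linarith)]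
    simp [jostFactor]

theorem jostU_eq {Q : ℝ → Mat n} (hQ : IntegrableOn Q (Ioi 0)) {ρ : ℂ} (hρ : ρ ∈ Omega) {x : ℝ}
    (hx : 0 ≤ x) :
    jostU Q ρ x = 1 + ∫ t in Ioi x, jostFactor ρ (t - x) • (Q t * jostU Q ρ t) := by
  rw [← integral_jostKernel Q _ ρ hx]
  exact (isVolterra_jostKernel hQ).sol_eq isData_one hρ x

theorem integrableOn_Q_mul {Q f : ℝ → Mat n} (hQ : IntegrableOn Q (Ioi 0)) {B : ℝ}
    (hf : ContinuousOn f (Ici 0)) (hB : ∀ x, 0 ≤ x → ‖f x‖ ≤ B) :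
    IntegrableOn (fun t => Q t * f t) (Ioi 0) := by
  refine Integrable.mono' (hQ.norm.mul_const B) (hQ.aestronglyMeasurable.mul
    ((hf.mono Ioi_subset_Ici_self).aestronglyMeasurable measurableSet_Ioi)) ?_
  filter_upwards [ae_restrict_mem measurableSet_Ioi] with t ht
  exact (norm_mul_le _ _).trans (mul_le_mul_of_nonneg_left (hB t (le_of_lt ht)) (norm_nonneg _))

theorem integrableOn_smul_Q_mul {Q f : ℝ → Mat n} (hQ : IntegrableOn Q (Ioi 0)) {B x : ℝ}
    (hf : ContinuousOn f (Ici 0)) (hB : ∀ x, 0 ≤ x → ‖f x‖ ≤ B) (hx : 0 ≤ x) {c : ℝ → ℂ} {b : ℝ}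
    (hc : ContinuousOn c (Ioi x)) (hb : ∀ t, x < t → ‖c t‖ ≤ b) :
    IntegrableOn (fun t => c t • (Q t * f t)) (Ioi x) := by
  have h := (integrableOn_Q_mul hQ hf hB).mono_set (Ioi_subset_Ioi hx)
  refine Integrable.mono' (h.norm.const_mul b)
    ((hc.aestronglyMeasurable measurableSet_Ioi).smul h.aestronglyMeasurable) ?_
  filter_upwards [ae_restrict_mem measurableSet_Ioi] with t ht
  rw [norm_smul]
  exact mul_le_mul_of_nonneg_right (hb t ht) (norm_nonneg _)

theorem norm_integral_smul_Q_mul_le {Q f : ℝ → Mat n} (hQ : IntegrableOn Q (Ioi 0)) {B x : ℝ}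
    (hB : ∀ x, 0 ≤ x → ‖f x‖ ≤ B) (hx : 0 ≤ x) {c : ℝ → ℂ} {b : ℝ} (hb0 : 0 ≤ b)
    (hb : ∀ t, x < t → ‖c t‖ ≤ b) :
    ‖∫ t in Ioi x, c t • (Q t * f t)‖ ≤ b * B * ∫ t in Ioi x, ‖Q t‖ := by
  rw [← integral_const_mul]
  refine norm_integral_le_of_norm_le (Integrable.const_mul (IntegrableOn.mono_set hQ.norm (Ioi_subset_Ioi hx)) _) ?_
  filter_upwards [ae_restrict_mem measurableSet_Ioi] with t ht
  rw [norm_smul]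
  calc ‖c t‖ * ‖Q t * f t‖ ≤ b * (‖Q t‖ * B) :=
        mul_le_mul (hb t ht) ((norm_mul_le _ _).trans (mul_le_mul_of_nonneg_left
          (hB t (hx.trans (le_of_lt ht))) (norm_nonneg _))) (norm_nonneg _) hb0
    _ = b * B * ‖Q t‖ := by ring

theorem norm_cosFactor_le {ρ : ℂ} (hρ : 0 ≤ ρ.im) {s : ℝ} (hs : 0 ≤ s) :
    ‖(Complex.exp (2 * (Complex.I * ρ) * (s : ℂ)) + 1) / 2‖ ≤ 1 := by
  have : (Complex.exp (2 * (Complex.I * ρ) * (s : ℂ)) + 1) / 2 = cosE ρ s := by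
    rw [cosE_eq, ← Complex.exp_add]; ring_nf
  rw [this]
  exact norm_cosE_le hρ hs

theorem continuous_jostFactor {ρ : ℂ} (hρ : ρ ∈ Omega) : Continuous (jostFactor ρ) :=
  IsVolterra.continuousOn_right continuousOn_jostFactor hρ

theorem tail_isPrim {f : ℝ → Mat n} (hf : IntegrableOn f (Ioi 0)) :
    IsPrim (fun x => ∫ t in Ioi x, f t) (fun t => -f t) := by
  refine ⟨fun x hx => ?_, fun x hx => ?_⟩
  · rw [intervalIntegrable_iff_integrableOn_Ioc_of_le hx]
    exact (hf.mono_set Ioc_subset_Ioi_self).neg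
  · rw [intervalIntegral.integral_neg, ← intervalIntegral.integral_Ioi_sub_Ioi' hf
      (hf.mono_set (Ioi_subset_Ioi hx))]
    abel

/-- Differentiation under an integral with moving end-point is avoided: the splitting `e^{2iρ(t -
x)} = e^{2iρt} e^{-2iρx}` writes `e` and `e'` as sums of products of exponentials and tails of
integrable functions. The product rule for `IsPrim` then gives both derivatives. -/
theorem isSol_jost {Q : ℝ → Mat n} (hQ : IntegrableOn Q (Ioi 0)) {ρ : ℂ} (hρ : ρ ∈ Omega) :
    IsSol Q (ρ ^ 2) (fun x => Complex.exp (Complex.I * ρ * x) • jostU Q ρ x)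
      (fun x => Complex.exp (Complex.I * ρ * x) • jostV Q ρ x) := by
  obtain ⟨B, hB, hev⟩ := jostU_bound hQ hρ
  have hb := mem_of_mem_nhdsWithin hρ hev
  have hk : Complex.I * ρ ≠ 0 := mul_ne_zero Complex.I_ne_zero hρ.2
  set k := Complex.I * ρ with hkdef
  have hu := (continuous_jostU hQ hρ).continuousOn (s := Ici 0)
  set g : ℝ → Mat n := fun t => Q t * jostU Q ρ t with hg
  have i1 : IntegrableOn g (Ioi 0) := integrableOn_Q_mul hQ hu hb
  have hE : ∀ t : ℝ, 0 ≤ t → ‖Complex.exp (2 * k * t)‖ ≤ 1 := fun t ht => by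
    have h1 := norm_exp_le hρ.1 ht
    have : Complex.exp (2 * k * t) = Complex.exp (Complex.I * ρ * t) * Complex.exp (Complex.I * ρ * t) := by
      rw [← Complex.exp_add, hkdef]; ring_nf
    rw [this, norm_mul]
    nlinarith [norm_nonneg (Complex.exp (Complex.I * ρ * t))]
  have i2 : ∀ x, 0 ≤ x → IntegrableOn (fun t : ℝ => Complex.exp (2 * k * t) • g t) (Ioi x) :=
    fun x hx => integrableOn_smul_Q_mul hQ hu hb hx (by fun_prop) (b := 1)
      fun t ht => hE t (hx.trans ht.le)
  have pα := ((IsPrim.const ((2 * k) • (1 : Mat n))).sub (tail_isPrim i1))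
  have pβ := tail_isPrim (i2 0 le_rfl)
  have hexp : ∀ c : ℂ, IsPrim (fun t : ℝ => Complex.exp (c * t) • (1 : Mat n))
      (fun t : ℝ => (c * Complex.exp (c * t)) • (1 : Mat n)) := fun c =>
    IsPrim.of_hasDerivAt (fun t => by
      have h1 : HasDerivAt (fun t : ℝ => c * (t : ℂ)) c t := by
        simpa using (Complex.ofRealCLM.hasDerivAt (x := t)).const_mul c
      have h2 : HasDerivAt (fun t : ℝ => Complex.exp (c * t)) (Complex.exp (c * t) * c) t :=
        (Complex.hasDerivAt_exp (c * t)).comp t h1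
      rw [mul_comm c]
      exact h2.smul_const _) (by fun_prop)
  have p1 := (hexp k).mul pα
  have p2 := (hexp (-k)).mul pβ
  have c2k : (IsPrim (fun _ : ℝ => (2 * k)⁻¹ • (1 : Mat n)) (fun _ => 0)) := IsPrim.const _
  have c2 : (IsPrim (fun _ : ℝ => (2 : ℂ)⁻¹ • (1 : Mat n)) (fun _ => 0)) := IsPrim.const _
  have hsplit : ∀ x : ℝ, 0 ≤ x → ∀ c d : ℂ,
      ∫ t in Ioi x, (c * Complex.exp (2 * k * ((t - x : ℝ) : ℂ)) + d) • g t =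
        (c * Complex.exp (-(2 * k * x))) • (∫ t in Ioi x, Complex.exp (2 * k * t) • g t) +
          d • ∫ t in Ioi x, g t := by
    intro x hx c d
    have h1 : IntegrableOn (fun t : ℝ => (c * Complex.exp (-(2 * k * x))) •
        Complex.exp (2 * k * t) • g t) (Ioi x) :=
      Integrable.smul (c * Complex.exp (-(2 * k * x))) (i2 x hx)
    have h2 : IntegrableOn (fun t => d • g t) (Ioi x) :=
      Integrable.smul d (i1.mono_set (Ioi_subset_Ioi hx))
    rw [← integral_smul, ← integral_smul, ← integral_add h1 h2]
    refine integral_congr_ae (Eventually.of_forall fun t => ?_)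
    simp only [smul_smul, ← add_smul]
    congr 2
    rw [mul_assoc c, ← Complex.exp_add]
    congr 3
    push_cast
    ring
  have hexp2 : ∀ x : ℝ, Complex.exp (-k * x) =
      Complex.exp (k * x) * Complex.exp (-(2 * k * x)) := fun x => by
    rw [← Complex.exp_add]; congr 1; ring
  have hexp3 : ∀ x : ℝ, Complex.exp (-k * x) * Complex.exp (2 * k * x) =
      Complex.exp (k * x) := fun x => by
    rw [← Complex.exp_add]; congr 1; ring
  have eU : ∀ x : ℝ, 0 ≤ x → jostU Q ρ x = (1 : Mat n) + (2 * k)⁻¹ •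
      (Complex.exp (-(2 * k * x)) • (∫ t in Ioi x, Complex.exp (2 * k * t) • g t) -
        ∫ t in Ioi x, g t) := by
    intro x hx
    have h := hsplit x hx (2 * k)⁻¹ (-(2 * k)⁻¹)
    conv_lhs => rw [jostU_eq hQ hρ hx]
    congr 1
    rw [smul_sub, smul_smul, sub_eq_add_neg, ← neg_smul, ← h]
    refine integral_congr_ae (Eventually.of_forall fun t => ?_)
    simp only [hg, jostFactor, ← hkdef]
    congr 1
    have : Complex.exp (2 * k * ((t - x : ℝ) : ℂ)) =
        Complex.exp (k * ((t - x : ℝ) : ℂ)) * Complex.exp (k * ((t - x : ℝ) : ℂ)) := by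
      rw [← Complex.exp_add]; ring_nf
    rw [this]
    field_simp
    ring
  have eV : ∀ x : ℝ, 0 ≤ x → jostV Q ρ x = k • (1 : Mat n) - (2 : ℂ)⁻¹ •
      (Complex.exp (-(2 * k * x)) • (∫ t in Ioi x, Complex.exp (2 * k * t) • g t) +
        ∫ t in Ioi x, g t) := by
    intro x hx
    have h := hsplit x hx 2⁻¹ 2⁻¹
    rw [jostV, smul_add, smul_smul, ← h]
    congr 1
    refine integral_congr_ae (Eventually.of_forall fun t => ?_)
    simp only [hg, ← hkdef]
    congr 1
    ring
  have hρk : ρ ^ 2 = -k ^ 2 := by rw [hkdef, mul_pow, Complex.I_sq]; ring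
  rw [hρk]
  refine ⟨(c2k.mul (p1.add p2)).congr (fun x hx => ?_) (fun x hx => ?_),
    (c2.mul (p1.sub p2)).congr (fun x hx => ?_) (fun x hx => ?_)⟩
  · simp only [eU x hx, smul_mul_assoc, one_mul, hexp2]
    match_scalars <;> field_simp
  · simp only [eV x hx, smul_mul_assoc, one_mul, zero_mul, zero_add, zero_sub, neg_neg, mul_neg,
      smul_smul _ _ (g x), hexp3]
    simp only [hexp2]
    match_scalars <;> field_simp
    ring
  · simp only [eV x hx, smul_mul_assoc, one_mul, hexp2]
    match_scalars <;> field_simp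
  · have : Q x * (Complex.exp (Complex.I * ρ * x) • jostU Q ρ x) = Complex.exp (k * x) • g x :=
      mul_smul_comm _ _ _
    rw [this]
    simp only [eU x hx, smul_mul_assoc, one_mul, zero_mul, zero_add, zero_sub, neg_neg, mul_neg,
      smul_smul _ _ (g x), hexp3]
    simp only [hexp2]
    match_scalars <;> field_simp
    ring

theorem exp_mul_jostFactor {ρ : ℂ} (x t : ℝ) :
    Complex.exp (Complex.I * ρ * x) * jostFactor ρ (t - x) =
      Complex.sin (ρ * ((t : ℂ) - (x : ℂ))) / ρ * Complex.exp (Complex.I * ρ * t) := by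
  have h : sinE ρ (t - x) = jostFactor ρ (t - x) * (Complex.I * ρ) ∨ ρ = 0 := by
    by_cases hρ : ρ = 0
    · exact Or.inr hρ
    · left
      rw [jostFactor, sinE_eq]
      field_simp
  rcases h with h | h
  · by_cases hρ : ρ = 0
    · simp [hρ, jostFactor]
    have h2 : jostFactor ρ (t - x) = Complex.exp (Complex.I * ρ * ((t - x : ℝ) : ℂ)) *
        Complex.sin (ρ * ((t - x : ℝ) : ℂ)) / ρ := by
      rw [sinE] at h
      have hI := Complex.I_ne_zero
      field_simp
      refine mul_left_cancel₀ hI ?_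
      rw [← mul_assoc]
      linear_combination -h
    rw [h2, show (Complex.I * ρ * t : ℂ) =
      Complex.I * ρ * x + Complex.I * ρ * ((t - x : ℝ) : ℂ) by push_cast; ring, Complex.exp_add]
    push_cast
    ring
  · simp [h, jostFactor]

/-- Removing the factor `e^{iρx}` turns the defining equation into the Volterra equation of `jostU`,
and a bounded solution of that equation is unique. The values at negative arguments stay free. -/
theorem isJostSolution_iff {Q e : ℝ → Mat n} (hQ : IntegrableOn Q (Ioi 0)) {ρ : ℂ}
    (hρ : ρ ∈ Omega) : IsJostSolution Q ρ e ↔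
      ∀ x, 0 ≤ x → e x = Complex.exp (Complex.I * ρ * x) • jostU Q ρ x := by
  have hint : ∀ f : ℝ → Mat n, ∀ x : ℝ,
      Complex.exp (Complex.I * ρ * x) • ∫ t in Ioi x, jostFactor ρ (t - x) • (Q t * f t) =
      ∫ t in Ioi x, (Complex.sin (ρ * ((t : ℂ) - (x : ℂ))) / ρ) •
        (Q t * (Complex.exp (Complex.I * ρ * t) • f t)) := by
    intro f x
    rw [← integral_smul]
    refine integral_congr_ae (Eventually.of_forall fun t => ?_)
    simp only [mul_smul_comm, smul_smul]
    rw [exp_mul_jostFactor]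
  have hexp : ∀ x : ℝ, Complex.exp (-(Complex.I * ρ * x)) * Complex.exp (Complex.I * ρ * x) = 1 :=
    fun x => by rw [← Complex.exp_add, neg_add_cancel, Complex.exp_zero]
  have hexp' : ∀ x : ℝ, Complex.exp (Complex.I * ρ * x) * Complex.exp (-(Complex.I * ρ * x)) = 1 :=
    fun x => by rw [mul_comm, hexp]
  obtain ⟨B, hB, hev⟩ := jostU_bound hQ hρ
  have hb := mem_of_mem_nhdsWithin hρ hev
  have hu := (continuous_jostU hQ hρ).continuousOn (s := Ici 0)
  constructor
  · rintro ⟨hc, ⟨C, hC⟩, he⟩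
    set v : ℝ → Mat n := fun x => Complex.exp (-(Complex.I * ρ * x)) • e x with hv
    have hvc : ContinuousOn v (Ici 0) := ContinuousOn.smul
      (f := fun x : ℝ => Complex.exp (-(Complex.I * ρ * x))) (by fun_prop) hc
    have hev : ∀ x, e x = Complex.exp (Complex.I * ρ * x) • v x := fun x => by
      simp only [hv]; rw [smul_smul, hexp', one_smul]
    have hveq : ∀ x, 0 ≤ x → v x = 1 + ∫ t in Ioi x, jostFactor ρ (t - x) • (Q t * v t) := by
      intro x hx
      have h1 := he x hx
      have h2 := hint v x
      simp only [← hev] at h2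
      rw [← h2, ← smul_add] at h1
      simp only [hv]
      rw [h1, smul_smul, hexp, one_smul]
    have hV := isVolterra_jostKernel hQ
    obtain ⟨K, hK, hevK⟩ := hV.bound ρ hρ 0
    have hk := mem_of_mem_nhdsWithin hρ hevK
    intro x hx
    rw [hev x]
    congr 1
    refine sub_eq_zero.mp (eq_zero_of_volterra hV.nonneg hV.int (f := fun x => v x - jostU Q ρ x)
      (B := C + B) hK (hV.zero ρ) hk (fun y hy => (norm_sub_le _ _).trans
      (add_le_add (hC y hy) (hb y hy))) (fun y hy => ?_) x hx)
    have hi : ∀ f : ℝ → Mat n, ∀ D, ContinuousOn f (Ici 0) → (∀ x, 0 ≤ x → ‖f x‖ ≤ D) →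
        IntegrableOn (fun t => jostFactor ρ (t - y) • (Q t * f t)) (Ioi y) := fun f D hf hD =>
      integrableOn_smul_Q_mul hQ hf hD hy
        ((continuous_jostFactor hρ).comp (continuous_sub_right y)).continuousOn
        fun t ht => norm_jostFactor_le hρ.1 (by linarith)
    rw [integral_jostKernel Q (fun x => v x - jostU Q ρ x) ρ hy]
    simp only [mul_sub, smul_sub]
    rw [integral_sub (hi v C hvc hC) (hi _ B hu hb), hveq y hy, jostU_eq hQ hρ hy]
    abel
  · intro h
    refine ⟨?_, ⟨B, fun x hx => ?_⟩, fun x hx => ?_⟩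
    · exact (ContinuousOn.smul (f := fun x : ℝ => Complex.exp (Complex.I * ρ * x)) (by fun_prop)
        hu).congr fun x hx => h x hx
    · rw [h x hx, smul_smul, hexp, one_smul]
      exact hb x hx
    · rw [h x hx]
      conv_lhs => rw [jostU_eq hQ hρ hx]
      rw [smul_add, hint]
      congr 1
      refine setIntegral_congr_fun measurableSet_Ioi fun t ht => ?_
      rw [h t (hx.trans (le_of_lt ht))]

theorem jostV_eq {Q : ℝ → Mat n} (ρ : ℂ) (x : ℝ) : jostV Q ρ x - (Complex.I * ρ) • (1 : Mat n) =
    -∫ t in Ioi x, ((Complex.exp (2 * (Complex.I * ρ) * ((t - x : ℝ) : ℂ)) + 1) / 2) •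
      (Q t * jostU Q ρ t) := by
  rw [jostV]; abel

theorem norm_jost_sub_le {Q : ℝ → Mat n} (hQ : IntegrableOn Q (Ioi 0)) {ρ : ℂ} (hρ : ρ ∈ Omega)
    {B : ℝ} (hB : ∀ x, 0 ≤ x → ‖jostU Q ρ x‖ ≤ B) {x : ℝ} (hx : 0 ≤ x) :
    ‖jostU Q ρ x - 1‖ ≤ ‖ρ‖⁻¹ * B * (∫ t in Ioi x, ‖Q t‖) ∧
    ‖jostV Q ρ x - (Complex.I * ρ) • (1 : Mat n)‖ ≤ B * ∫ t in Ioi x, ‖Q t‖ := by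
  constructor
  · rw [jostU_eq hQ hρ hx, add_sub_cancel_left]
    exact norm_integral_smul_Q_mul_le hQ hB hx (by positivity)
      fun t ht => norm_jostFactor_le hρ.1 (by linarith)
  · rw [jostV_eq, norm_neg, ← one_mul B]
    exact norm_integral_smul_Q_mul_le hQ hB hx zero_le_one
      fun t ht => norm_cosFactor_le hρ.1 (by linarith)

theorem tail_le {Q : ℝ → Mat n} (hQ : IntegrableOn Q (Ioi 0)) {x : ℝ} (hx : 0 ≤ x) :
    ∫ t in Ioi x, ‖Q t‖ ≤ ∫ t in Ioi 0, ‖Q t‖ :=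
  setIntegral_mono_set hQ.norm (Eventually.of_forall fun _ => norm_nonneg _)
    (Ioi_subset_Ioi hx).eventuallyLE

/-- The supremum `M` over the half-line satisfies `M ≤ ‖1‖ + M / 2`. The norm of the identity is
kept because it vanishes for `n = 0`. -/
theorem norm_jostU_le {Q : ℝ → Mat n} (hQ : IntegrableOn Q (Ioi 0)) {ρ : ℂ} (hρ : ρ ∈ Omega)
    (hl : 2 * ∫ t in Ioi 0, ‖Q t‖ ≤ ‖ρ‖) {x : ℝ} (hx : 0 ≤ x) :
    ‖jostU Q ρ x‖ ≤ 2 * ‖(1 : Mat n)‖ := by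
  obtain ⟨B, hB, hev⟩ := jostU_bound hQ hρ
  have hb := mem_of_mem_nhdsWithin hρ hev
  have hρ0 : 0 < ‖ρ‖ := norm_pos_iff.mpr hρ.2
  have step : ∀ M, (∀ x, 0 ≤ x → ‖jostU Q ρ x‖ ≤ M) → ∀ x, 0 ≤ x →
      ‖jostU Q ρ x‖ ≤ ‖(1 : Mat n)‖ + M / 2 := by
    intro M hM x hx
    have h1 := (norm_jost_sub_le hQ hρ hM hx).1
    have h2 := tail_le hQ hx
    have hM0 : 0 ≤ M := (norm_nonneg _).trans (hM x hx)
    have h3 : ‖ρ‖⁻¹ * M * (∫ t in Ioi x, ‖Q t‖) ≤ M / 2 := by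
      rw [mul_assoc, inv_mul_le_iff₀ hρ0]
      nlinarith
    have h4 := norm_le_norm_add_norm_sub' (jostU Q ρ x) 1
    linarith
  have hbdd : BddAbove (range fun y : Ici (0 : ℝ) => ‖jostU Q ρ y‖) :=
    ⟨B, by rintro _ ⟨y, rfl⟩; exact hb y y.2⟩
  have hS := fun y (hy : 0 ≤ y) => le_ciSup hbdd ⟨y, hy⟩
  have h1 := ciSup_le fun y : Ici (0 : ℝ) => step _ hS y y.2
  linarith [hS x hx]

/-- The derivative of the Jost solution at `0` depends continuously on `ρ ∈ Ω`. -/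
theorem continuousOn_jostV_zero {Q : ℝ → Mat n} (hQ : IntegrableOn Q (Ioi 0)) :
    ContinuousOn (fun ρ => jostV Q ρ 0) Omega := by
  unfold jostV
  refine ContinuousOn.sub (by fun_prop) fun ρ hρ => ?_
  obtain ⟨B, hB, hev⟩ := jostU_bound hQ hρ
  refine continuousWithinAt_of_dominated (bound := fun t => ‖Q t‖ * B) ?_ ?_ (hQ.norm.mul_const B) ?_
  · filter_upwards [hev, self_mem_nhdsWithin] with p hp hpO
    exact (integrableOn_smul_Q_mul hQ (continuous_jostU hQ hpO).continuousOn hp le_rfl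
      (by fun_prop) fun _ ht => norm_cosFactor_le hpO.1 (by linarith)).aestronglyMeasurable
  · filter_upwards [hev, self_mem_nhdsWithin] with p hp hpO
    filter_upwards [ae_restrict_mem measurableSet_Ioi] with t ht
    have ht0 : 0 < t := ht
    rw [norm_smul]
    refine (mul_le_of_le_one_left (norm_nonneg _) (norm_cosFactor_le hpO.1 (by linarith))).trans ?_
    exact (norm_mul_le _ _).trans (mul_le_mul_of_nonneg_left (hp t ht0.le) (norm_nonneg _))
  · refine Eventually.of_forall fun t => ContinuousWithinAt.smul (f := fun ρ : ℂ =>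
      (Complex.exp (2 * (Complex.I * ρ) * ((t - 0 : ℝ) : ℂ)) + 1) / 2) (by fun_prop) ?_
    exact continuousWithinAt_const.mul
      (IsVolterra.continuousOn_left (continuousOn_jostU hQ) t ρ hρ)

theorem differentiableOn_jostV_zero {Q : ℝ → Mat n} (hQ : IntegrableOn Q (Ioi 0)) :
    DifferentiableOn ℂ (fun ρ => jostV Q ρ 0) {ρ | 0 < ρ.im} := by
  unfold jostV
  refine DifferentiableOn.sub (by fun_prop) ?_
  refine differentiableOn_integral isOpen_upper (fun p hp => ?_) (Eventually.of_forall fun t => ?_)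
    fun ρ hρ => ?_
  · have hpO := upper_subset_Omega hp
    obtain ⟨B, hB, hev⟩ := jostU_bound hQ hpO
    have hb := mem_of_mem_nhdsWithin hpO hev
    exact (integrableOn_smul_Q_mul hQ (continuous_jostU hQ hpO).continuousOn hb le_rfl
      (by fun_prop) fun _ ht => norm_cosFactor_le hpO.1 (by linarith)).aestronglyMeasurable
  · refine DifferentiableOn.smul (c := fun ρ : ℂ =>
      (Complex.exp (2 * (Complex.I * ρ) * ((t - 0 : ℝ) : ℂ)) + 1) / 2) (by fun_prop) ?_
    exact (differentiableOn_const _).mul (differentiableOn_jostU hQ t)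
  · have hρO := upper_subset_Omega hρ
    obtain ⟨B, hB, hev⟩ := jostU_bound hQ hρO
    rw [nhdsWithin_eq_nhds.mpr (mem_of_superset (isOpen_upper.mem_nhds hρ) upper_subset_Omega)] at hev
    refine ⟨fun t => ‖Q t‖ * B, hQ.norm.mul_const B, ?_⟩
    filter_upwards [hev, isOpen_upper.mem_nhds hρ] with p hp hpO
    filter_upwards [ae_restrict_mem measurableSet_Ioi] with t ht
    have ht0 : 0 < t := ht
    rw [norm_smul]
    refine (mul_le_of_le_one_left (norm_nonneg _)
      (norm_cosFactor_le (upper_subset_Omega hpO).1 (by linarith))).trans ?_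
    exact (norm_mul_le _ _).trans (mul_le_mul_of_nonneg_left (hp t ht0.le) (norm_nonneg _))

end Jost

/-! ### Identification of the chosen Jost solution with the Volterra series. -/

namespace Problem

variable {n : ℕ} (L : Problem n)

/-- `Classical.epsilon` selects some function with the defining property. Existence shows that the
property holds for it, and uniqueness fixes its values on `[0, ∞)`. The same argument serves
`phi_eq` and `phiStar_eq`. -/
theorem jost_eq {ρ : ℂ} (hρ : ρ ∈ Omega) {x : ℝ} (hx : 0 ≤ x) :
    L.jost x ρ = Complex.exp (Complex.I * ρ * x) • jostU L.Q ρ x := by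
  have h : ∃ e, IsJostSolution L.Q ρ e :=
    ⟨_, (isJostSolution_iff L.integrable_Q hρ).mpr fun x _ => rfl⟩
  exact (isJostSolution_iff L.integrable_Q hρ).mp (Classical.epsilon_spec h) x hx

theorem jost_zero {ρ : ℂ} (hρ : ρ ∈ Omega) : L.jost 0 ρ = jostU L.Q ρ 0 := by
  simp [L.jost_eq hρ le_rfl]

theorem jostDerivZero_eq {ρ : ℂ} (hρ : ρ ∈ Omega) : L.jostDerivZero ρ = jostV L.Q ρ 0 := by
  have h := isSol_jost L.integrable_Q hρ
  have h1 := (h.prim.hasDerivWithinAt h.prim'.continuousOn le_rfl).congr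
    (fun x hx => L.jost_eq hρ hx) (L.jost_eq hρ le_rfl)
  rw [jostDerivZero, h1.derivWithin (uniqueDiffWithinAt_Ici 0)]
  simp

end Problem

/-! ### The transposed problem, Wronskian formulas, and the Weyl solution. -/

section Transpose

variable {n : ℕ}

/-- Transposition as a continuous linear map. -/
def transposeCLM (n : ℕ) : Mat n →L[ℂ] Mat n :=
  LinearMap.toContinuousLinearMap
    { toFun := Matrix.transpose, map_add' := Matrix.transpose_add,
      map_smul' := fun c A => Matrix.transpose_smul c A }

@[simp] theorem transposeCLM_apply (B : Mat n) : transposeCLM n B = B.transpose := rfl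

theorem IsSol.add {Q Y Y' Z Z' : ℝ → Mat n} {lam : ℂ} (hY : IsSol Q lam Y Y')
    (hZ : IsSol Q lam Z Z') : IsSol Q lam (fun x => Y x + Z x) (fun x => Y' x + Z' x) :=
  ⟨hY.prim.add hZ.prim, (hY.prim'.add hZ.prim').congr (fun _ _ => rfl) fun x _ => by
    rw [mul_add, smul_add]; abel⟩

theorem IsSol.mul_const {Q Y Y' : ℝ → Mat n} {lam : ℂ} (hY : IsSol Q lam Y Y') (B : Mat n) :
    IsSol Q lam (fun x => Y x * B) (fun x => Y' x * B) :=
  ⟨(hY.prim.mul (IsPrim.const B)).congr (fun _ _ => rfl) fun x _ => by simp,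
    (hY.prim'.mul (IsPrim.const B)).congr (fun _ _ => rfl) fun x _ => by
      rw [mul_zero, add_zero, sub_mul, mul_assoc, smul_mul_assoc]⟩

/-- Two solutions with the same initial values have the same derivatives. -/
theorem IsSol.deriv_eq_of_eq {Q Y Y' Z Z' : ℝ → Mat n} (hQ : IntegrableOn Q (Ioi 0)) {lam : ℂ}
    (h : IsSol Q lam Y Y') (h2 : IsSol Q lam Z Z') (h0 : Y 0 = Z 0) (h1 : Y' 0 = Z' 0) {x : ℝ}
    (hx : 0 ≤ x) : Y' x = Z' x := by
  rw [h.prim'.eq x hx, h2.prim'.eq x hx, h1]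
  congr 1
  refine intervalIntegral.integral_congr fun t ht => ?_
  rw [uIcc_of_le hx] at ht
  simp only [h.eq_of_eq hQ h2 h0 h1 ht.1]

namespace Problem

variable (L : Problem n)

/-- The problem with the transposed coefficients. -/
def tr : Problem n where
  Q x := (L.Q x).transpose
  A := L.A.transpose
  h := L.h.transpose
  integrable_Q := (transposeCLM n).integrable_comp L.integrable_Q
  A_conjTranspose := by
    ext i j
    have h := congrFun (congrFun L.A_conjTranspose j) i
    simpa using h
  A_mul_self := by rw [← Matrix.transpose_mul, L.A_mul_self]
  A_mul_h := by rw [← Matrix.transpose_mul, L.h_mul_A]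
  h_mul_A := by rw [← Matrix.transpose_mul, L.A_mul_h]

theorem tr_tr : L.tr.tr = L := by
  cases L; simp [tr]

theorem tr_Aperp : L.tr.Aperp = L.Aperp.transpose := by
  simp [Aperp, tr, Matrix.transpose_sub]

theorem tr_weight (ρ : ℂ) : L.tr.weight ρ = (L.weight ρ).transpose := by
  rw [weight, weight, tr_Aperp, Matrix.transpose_add, Matrix.transpose_smul]
  rfl

/-- The solution `φ`, defined by a Volterra series. -/
def sol (lam : ℂ) (x : ℝ) : Mat n := cauchySol L.Q L.A (L.Aperp + L.h) lam x

/-- The derivative of `φ`. -/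
def solDer (lam : ℂ) (x : ℝ) : Mat n := cauchyDer L.Q L.A (L.Aperp + L.h) lam x

/-- The solution `ψ` with `ψ(0) = -A^⊥`, `ψ'(0) = A`. -/
def psi (lam : ℂ) (x : ℝ) : Mat n := cauchySol L.Q (-L.Aperp) L.A lam x

theorem isSol_sol (lam : ℂ) : IsSol L.Q lam (L.sol lam) (L.solDer lam) ∧
    L.sol lam 0 = L.A ∧ L.solDer lam 0 = L.Aperp + L.h :=
  isSol_cauchySol L.integrable_Q _ _ lam

theorem phi_eq {x : ℝ} (hx : 0 ≤ x) (lam : ℂ) : L.phi x lam = L.sol lam x := by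
  obtain ⟨h1, h2, h3⟩ := L.isSol_sol lam
  have h : ∃ Y, IsCauchySolution L.Q lam L.A (L.Aperp + L.h) Y :=
    ⟨L.sol lam, (isCauchySolution_iff L.integrable_Q).mpr ⟨_, h1, h2, h3⟩⟩
  obtain ⟨Y', hY, hY0, hY1⟩ := (isCauchySolution_iff L.integrable_Q).mp (Classical.epsilon_spec h)
  exact hY.eq_of_eq L.integrable_Q h1 (hY0.trans h2.symm) (hY1.trans h3.symm) hx

/-- The solution `φ*`, the transpose of the solution of the transposed problem. -/
def solStar (lam : ℂ) (x : ℝ) : Mat n := (L.tr.sol lam x).transpose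

/-- The derivative of `φ*`. -/
def solStarDer (lam : ℂ) (x : ℝ) : Mat n := (L.tr.solDer lam x).transpose

theorem isSol_solStar (lam : ℂ) : IsSolStar L.Q lam (L.solStar lam) (L.solStarDer lam) ∧
    L.solStar lam 0 = L.A ∧ L.solStarDer lam 0 = L.Aperp + L.h := by
  obtain ⟨h1, h2, h3⟩ := L.tr.isSol_sol lam
  refine ⟨?_, ?_, ?_⟩
  · have := h1.transpose
    have e : (fun t => (L.tr.Q t).transpose) = L.Q := by
      funext t; exact Matrix.transpose_transpose _
    rwa [e] at this
  · rw [solStar, h2]; exact Matrix.transpose_transpose _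
  · rw [solStarDer, h3, tr_Aperp, Matrix.transpose_add, Matrix.transpose_transpose]
    congr 1

theorem phiStar_eq {x : ℝ} (hx : 0 ≤ x) (lam : ℂ) : L.phiStar x lam = L.solStar lam x := by
  obtain ⟨h1, h2, h3⟩ := L.isSol_solStar lam
  have h : ∃ Y, IsCauchySolutionStar L.Q lam L.A (L.Aperp + L.h) Y :=
    ⟨L.solStar lam, (isCauchySolutionStar_iff L.integrable_Q).mpr ⟨_, h1, h2, h3⟩⟩
  obtain ⟨Y', hY, hY0, hY1⟩ :=
    (isCauchySolutionStar_iff L.integrable_Q).mp (Classical.epsilon_spec h)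
  have e := hY.transpose.eq_of_eq L.tr.integrable_Q h1.transpose
    (congrArg Matrix.transpose (hY0.trans h2.symm)) (congrArg Matrix.transpose (hY1.trans h3.symm)) hx
  exact Matrix.transpose_injective e

theorem continuous_sol : Continuous fun z : ℂ × ℝ => L.sol z.1 z.2 :=
  continuous_cauchySol L.integrable_Q _ _

theorem continuous_solStar : Continuous fun z : ℂ × ℝ => L.solStar z.1 z.2 :=
  (transposeCLM n).continuous.comp L.tr.continuous_sol

theorem D_eq {x : ℝ} (hx : 0 ≤ x) (lam mu : ℂ) :
    L.D x lam mu = ∫ t in (0 : ℝ)..x, L.solStar mu t * L.sol lam t := by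
  refine intervalIntegral.integral_congr fun t ht => ?_
  rw [uIcc_of_le hx] at ht
  simp only [L.phiStar_eq ht.1, L.phi_eq ht.1]

/-- `(λ - μ) D(x, λ, μ)` is a Wronskian. -/
theorem sub_smul_D {x : ℝ} (hx : 0 ≤ x) (lam mu : ℂ) : (lam - mu) • L.D x lam mu =
    L.solStarDer mu x * L.sol lam x - L.solStar mu x * L.solDer lam x := by
  obtain ⟨h1, h2, h3⟩ := L.isSol_solStar mu
  obtain ⟨k1, k2, k3⟩ := L.isSol_sol lam
  have h := (k1.wronskian h1).eq x hx
  -- The contribution of the end-point 0 vanishes because `φ` and `φ*` have the same initial values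
  -- and these commute.
  have e0 : (L.Aperp + L.h) * L.A - L.A * (L.Aperp + L.h) = 0 := by
    rw [add_mul, mul_add, L.Aperp_mul_A, L.A_mul_Aperp, L.h_mul_A, L.A_mul_h, sub_self]
  rw [h2, h3, k2, k3, e0, zero_add, intervalIntegral.integral_smul] at h
  rw [h, L.D_eq hx]

theorem jostMatrix_eq {ρ : ℂ} (hρ : ρ ∈ Omega) : L.jostMatrix ρ =
    L.A * (jostV L.Q ρ 0 - L.h * jostU L.Q ρ 0) - L.Aperp * jostU L.Q ρ 0 := by
  rw [jostMatrix, L.jost_zero hρ, L.jostDerivZero_eq hρ]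

theorem weylMatrix_eq {ρ : ℂ} (hρ : ρ ∈ Omega) : L.weylMatrix ρ =
    (L.A * jostU L.Q ρ 0 + L.Aperp * jostV L.Q ρ 0) * (L.jostMatrix ρ)⁻¹ := by
  rw [weylMatrix, L.jost_zero hρ, L.jostDerivZero_eq hρ]

/-- The Wronskian of the Jost solutions of the problem and of the transposed problem. -/
theorem jost_wronskian {ρ : ℂ} (hρ : ρ ∈ Omega) :
    (jostV L.tr.Q ρ 0).transpose * jostU L.Q ρ 0 =
      (jostU L.tr.Q ρ 0).transpose * jostV L.Q ρ 0 := by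
  have h1 := isSol_jost L.integrable_Q hρ
  have h2 := (isSol_jost L.tr.integrable_Q hρ).transpose
  have e : (fun t => (L.tr.Q t).transpose) = L.Q := by
    funext t; exact Matrix.transpose_transpose _
  rw [e] at h2
  have hw := h1.wronskian h2
  simp only [sub_self, zero_smul] at hw
  set w : ℝ → Mat n := fun x => (jostV L.tr.Q ρ x).transpose * jostU L.Q ρ x -
    (jostU L.tr.Q ρ x).transpose * jostV L.Q ρ x with hwdef
  -- The Wronskian is constant, so `w 0 = e^{2iρx} w x`. The exponential is bounded, and `w x → 0`
  -- because the normalized solutions tend to `1` and their derivatives to `iρ`; hence `w 0 = 0`.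
  have hc : ∀ x : ℝ, 0 ≤ x → w 0 = Complex.exp (Complex.I * ρ * x) •
      Complex.exp (Complex.I * ρ * x) • w x := by
    intro x hx
    have := hw.eq x hx
    simp only [intervalIntegral.integral_zero, add_zero, Matrix.transpose_smul, smul_mul_smul_comm,
      Complex.ofReal_zero, mul_zero, Complex.exp_zero, one_smul, ← smul_sub] at this
    rw [smul_smul]
    exact this.symm
  have htail : ∀ K : Problem n, Tendsto (jostU K.Q ρ) atTop (𝓝 1) ∧
      Tendsto (jostV K.Q ρ) atTop (𝓝 ((Complex.I * ρ) • (1 : Mat n))) := by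
    intro K
    obtain ⟨B, hB, hev⟩ := jostU_bound K.integrable_Q hρ
    have hb := mem_of_mem_nhdsWithin hρ hev
    have ht : Tendsto (fun x => ∫ t in Ioi x, ‖K.Q t‖) atTop (𝓝 0) := by
      have h3 := intervalIntegral_tendsto_integral_Ioi 0 K.integrable_Q.norm tendsto_id
      have h4 := h3.const_sub (∫ t in Ioi 0, ‖K.Q t‖)
      rw [sub_self] at h4
      refine h4.congr' ?_
      filter_upwards [eventually_ge_atTop 0] with x hx
      have := intervalIntegral.integral_Ioi_sub_Ioi' K.integrable_Q.norm
        (IntegrableOn.mono_set K.integrable_Q.norm (Ioi_subset_Ioi hx))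
      rw [id, ← this]
      ring
    constructor
    · rw [tendsto_iff_norm_sub_tendsto_zero]
      refine squeeze_zero' (Eventually.of_forall fun x => norm_nonneg _)
        ((eventually_ge_atTop 0).mono fun x hx => (norm_jost_sub_le K.integrable_Q hρ hb hx).1) ?_
      simpa using ht.const_mul (‖ρ‖⁻¹ * B)
    · rw [tendsto_iff_norm_sub_tendsto_zero]
      refine squeeze_zero' (Eventually.of_forall fun x => norm_nonneg _)
        ((eventually_ge_atTop 0).mono fun x hx => (norm_jost_sub_le K.integrable_Q hρ hb hx).2) ?_
      simpa using ht.const_mul B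
  have hlim : Tendsto w atTop (𝓝 0) := by
    have hT := (transposeCLM n).continuous
    have h3 := (((hT.tendsto _).comp (htail L.tr).2).mul (htail L).1).sub
      (((hT.tendsto _).comp (htail L.tr).1).mul (htail L).2)
    have e : transposeCLM n ((Complex.I * ρ) • (1 : Mat n)) * 1 -
        transposeCLM n 1 * ((Complex.I * ρ) • (1 : Mat n)) = 0 := by
      simp
    rw [e] at h3
    exact h3
  have hz : w 0 = 0 := by
    have h3 : Tendsto (fun _ : ℝ => w 0) atTop (𝓝 0) := by
      rw [tendsto_zero_iff_norm_tendsto_zero] at hlim ⊢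
      refine squeeze_zero' (Eventually.of_forall fun x => norm_nonneg _) ?_ hlim
      filter_upwards [eventually_ge_atTop 0] with x hx
      have h4 := norm_exp_le hρ.1 hx
      rw [hc x hx, norm_smul, norm_smul, ← mul_assoc]
      exact mul_le_of_le_one_left (norm_nonneg _) (mul_le_one₀ h4 (norm_nonneg _) h4)
    exact tendsto_nhds_unique tendsto_const_nhds h3
  exact sub_eq_zero.mp hz

/-- The Weyl matrix of the transposed problem is the transposed Weyl matrix. -/
theorem weylMatrix_tr {ρ : ℂ} (hρ : ρ ∈ Omega) (h1 : IsUnit (L.jostMatrix ρ))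
    (h2 : IsUnit (L.tr.jostMatrix ρ)) : (L.tr.weylMatrix ρ).transpose = L.weylMatrix ρ := by
  have hw := L.jost_wronskian hρ
  set u := jostU L.Q ρ 0
  set v := jostV L.Q ρ 0
  set us := (jostU L.tr.Q ρ 0).transpose with hus
  set vs := (jostV L.tr.Q ρ 0).transpose with hvs
  have eJ : (L.tr.jostMatrix ρ).transpose = (vs - us * L.h) * L.A - us * L.Aperp := by
    rw [L.tr.jostMatrix_eq hρ, tr_Aperp, hus, hvs]
    simp [Matrix.transpose_sub, Matrix.transpose_mul, tr]
  have eK : (L.tr.A * jostU L.tr.Q ρ 0 + L.tr.Aperp * jostV L.tr.Q ρ 0).transpose =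
      us * L.A + vs * L.Aperp := by
    rw [tr_Aperp, hus, hvs]
    simp [Matrix.transpose_add, Matrix.transpose_mul, tr]
  have hJ2 : IsUnit (L.tr.jostMatrix ρ).transpose.det := by
    rw [Matrix.det_transpose]; exact (Matrix.isUnit_iff_isUnit_det _).mp h2
  have hJ1 : IsUnit (L.jostMatrix ρ).det := (Matrix.isUnit_iff_isUnit_det _).mp h1
  rw [L.tr.weylMatrix_eq hρ, Matrix.transpose_mul, eK, Matrix.transpose_nonsing_inv,
    L.weylMatrix_eq hρ]
  -- After expansion the two sides differ by `vs u - us v`, the Wronskian of the Jost solutions,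
  -- which is zero.
  have key : (L.tr.jostMatrix ρ).transpose * (L.A * u + L.Aperp * v) =
      (us * L.A + vs * L.Aperp) * L.jostMatrix ρ := by
    rw [eJ, L.jostMatrix_eq hρ]
    have a1 := L.A_mul_self
    have a2 := L.A_mul_Aperp
    have a3 := L.Aperp_mul_A
    have a4 := L.Aperp_mul_self
    have a5 := L.A_mul_h
    have a6 := L.h_mul_A
    have a7 : L.Aperp = 1 - L.A := rfl
    have l1 : ((vs - us * L.h) * L.A - us * L.Aperp) * (L.A * u + L.Aperp * v) =
        vs * (L.A * L.A) * u - us * ((L.h * L.A) * L.A) * u + vs * (L.A * L.Aperp) * v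
        - us * (L.h * (L.A * L.Aperp)) * v - us * (L.Aperp * L.A) * u
        - us * (L.Aperp * L.Aperp) * v := by noncomm_ring
    have l2 : (us * L.A + vs * L.Aperp) * (L.A * (v - L.h * u) - L.Aperp * u) =
        us * (L.A * L.A) * v - us * (L.A * (L.A * L.h)) * u - us * (L.A * L.Aperp) * u
        + vs * (L.Aperp * L.A) * v - vs * (L.Aperp * L.A) * L.h * u
        - vs * (L.Aperp * L.Aperp) * u := by noncomm_ring
    rw [l1, l2, a1, a2, a3, a4, a6, a6, a5, a5, a7]
    have l3 : vs * L.A * u - us * L.h * u + vs * 0 * v - us * (L.h * 0) * v - us * 0 * u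
        - us * (1 - L.A) * v - (us * L.A * v - us * L.h * u - us * 0 * u + vs * 0 * v
        - vs * 0 * L.h * u - vs * (1 - L.A) * u) = vs * u - us * v := by noncomm_ring
    rw [← sub_eq_zero, l3, sub_eq_zero]
    exact hw
  calc (L.tr.jostMatrix ρ).transpose⁻¹ * (us * L.A + vs * L.Aperp)
      = (L.tr.jostMatrix ρ).transpose⁻¹ * ((us * L.A + vs * L.Aperp) * L.jostMatrix ρ)
        * (L.jostMatrix ρ)⁻¹ := by
        rw [mul_assoc, mul_assoc (us * L.A + vs * L.Aperp), Matrix.mul_nonsing_inv _ hJ1, mul_one]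
    _ = (L.A * u + L.Aperp * v) * (L.jostMatrix ρ)⁻¹ := by
        rw [← key, ← mul_assoc, Matrix.nonsing_inv_mul _ hJ2, one_mul]

/-- The Weyl solution is `ψ + φ M`. -/
theorem weyl_solution {ρ : ℂ} (hρ : ρ ∈ Omega) (hJ : IsUnit (L.jostMatrix ρ)) :
    ∃ P' : ℝ → Mat n, IsSol L.Q (ρ ^ 2)
      (fun x => L.psi (ρ ^ 2) x + L.sol (ρ ^ 2) x * L.weylMatrix ρ) P' ∧
      P' 0 = L.A + (L.Aperp + L.h) * L.weylMatrix ρ ∧ ∀ x, 0 ≤ x →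
      (L.psi (ρ ^ 2) x + L.sol (ρ ^ 2) x * L.weylMatrix ρ =
        Complex.exp (Complex.I * ρ * x) • (jostU L.Q ρ x * (L.jostMatrix ρ)⁻¹) ∧
      P' x = Complex.exp (Complex.I * ρ * x) • (jostV L.Q ρ x * (L.jostMatrix ρ)⁻¹)) := by
  obtain ⟨k1, k2, k3⟩ := L.isSol_sol (ρ ^ 2)
  obtain ⟨p1, p2, p3⟩ := isSol_cauchySol L.integrable_Q (-L.Aperp) L.A (ρ ^ 2)
  have hJ1 : IsUnit (L.jostMatrix ρ).det := (Matrix.isUnit_iff_isUnit_det _).mp hJ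
  have hs := p1.add (k1.mul_const (L.weylMatrix ρ))
  have he := (isSol_jost L.integrable_Q hρ).mul_const (L.jostMatrix ρ)⁻¹
  have hJe := L.jostMatrix_eq hρ
  have hMe := L.weylMatrix_eq hρ
  set u := jostU L.Q ρ 0
  set v := jostV L.Q ρ 0
  set J := L.jostMatrix ρ
  have hJJ : J * J⁻¹ = 1 := Matrix.mul_nonsing_inv _ hJ1
  -- The two components of `J` show that `ψ + φM` and `e J⁻¹` have the same Cauchy data `u J⁻¹`, `v
  -- J⁻¹` at 0, so they are the same solution.
  have c1 : L.Aperp * J = -(L.Aperp * u) := by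
    rw [hJe, mul_sub, ← mul_assoc, ← mul_assoc, L.Aperp_mul_A, L.Aperp_mul_self]; simp
  have c2 : L.A * J = L.A * v - L.h * u := by
    rw [hJe, mul_sub, ← mul_assoc, ← mul_assoc, L.A_mul_self, L.A_mul_Aperp, mul_sub, ← mul_assoc,
      L.A_mul_h]; simp
  have e0 : -L.Aperp + L.A * L.weylMatrix ρ = u * J⁻¹ := by
    have h3 : -L.Aperp = L.Aperp * u * J⁻¹ := by
      rw [← neg_eq_iff_eq_neg.mpr c1, neg_mul, mul_assoc, hJJ, mul_one]
    rw [h3, hMe, ← mul_assoc, mul_add, ← mul_assoc, ← mul_assoc, L.A_mul_self, L.A_mul_Aperp,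
      zero_mul, add_zero, ← add_mul, ← add_mul, Aperp, sub_add_cancel, one_mul]
  have e1 : L.A + (L.Aperp + L.h) * L.weylMatrix ρ = v * J⁻¹ := by
    have h3 : L.A = (L.A * v - L.h * u) * J⁻¹ := by
      rw [← c2, mul_assoc, hJJ, mul_one]
    have h4 : (L.Aperp + L.h) * (L.A * u + L.Aperp * v) = L.h * u + L.Aperp * v := by
      have hp : L.h * L.Aperp = 0 := by rw [Aperp, mul_sub, mul_one, L.h_mul_A, sub_self]
      have : (L.Aperp + L.h) * (L.A * u + L.Aperp * v) = L.Aperp * L.A * u + L.Aperp * L.Aperp * v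
        + L.h * L.A * u + L.h * L.Aperp * v := by noncomm_ring
      rw [this, L.Aperp_mul_A, L.Aperp_mul_self, L.h_mul_A, hp]
      simp [add_comm]
    nth_rewrite 1 [h3]
    rw [hMe, ← mul_assoc, h4, ← add_mul]
    congr 1
    rw [Aperp, sub_mul, one_mul]
    abel
  refine ⟨_, hs, ?_, fun x hx => ⟨?_, ?_⟩⟩
  · simp only [p3, k3]
  · have := hs.eq_of_eq L.integrable_Q he (by simp only [p2, k2, e0]; simp [u]) (by simp only [p3, k3, e1]; simp [v]) hx
    rw [smul_mul_assoc] at this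
    exact this
  · have := hs.deriv_eq_of_eq L.integrable_Q he (by simp only [p2, k2, e0]; simp [u]) (by simp only [p3, k3, e1]; simp [v]) hx
    rw [smul_mul_assoc] at this
    exact this

end Problem

end Transpose

/-! ### Asymptotics for large `ρ` in the closed half-plane, uniform in `x ≥ 0`. -/

open Asymptotics

/-- `ρ → ∞` in `Ω`, uniformly in `x ≥ 0`. -/
def far : Filter (ℂ × ℝ) := (Bornology.cobounded ℂ ⊓ 𝓟 Omega) ×ˢ 𝓟 (Ici 0)

theorem eventually_far_iff {p : ℂ × ℝ → Prop} : (∀ᶠ z in far, p z) ↔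
    ∃ R, 1 ≤ R ∧ ∀ ρ ∈ Omega, R ≤ ‖ρ‖ → ∀ x, 0 ≤ x → p (ρ, x) := by
  have h := ((hasBasis_cobounded_norm (E := ℂ)).inf_principal Omega).prod_principal (Ici (0 : ℝ))
  rw [far, h.eventually_iff]
  constructor
  · rintro ⟨R, -, hR⟩
    exact ⟨max R 1, le_max_right _ _, fun ρ hρ hn x hx =>
      hR (show (ρ, x) ∈ _ from ⟨⟨(le_max_left _ _).trans hn, hρ⟩, hx⟩)⟩
  · rintro ⟨R, -, hR⟩
    exact ⟨R, trivial, fun z hz => hR z.1 hz.1.2 hz.1.1 z.2 hz.2⟩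

theorem isBigO_far_iff {E : Type*} [NormedAddCommGroup E] {f : ℂ × ℝ → E} {g : ℂ × ℝ → ℂ} :
    f =O[far] g ↔ ∃ C R, 0 ≤ C ∧ 1 ≤ R ∧ ∀ ρ ∈ Omega, R ≤ ‖ρ‖ → ∀ x, 0 ≤ x →
      ‖f (ρ, x)‖ ≤ C * ‖g (ρ, x)‖ := by
  constructor
  · intro h
    obtain ⟨C, hC, hb⟩ := h.exists_nonneg
    obtain ⟨R, hR, h⟩ := eventually_far_iff.mp hb.bound
    exact ⟨C, R, hC, hR, h⟩
  · rintro ⟨C, R, -, hR, h⟩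
    exact IsBigO.of_bound C (eventually_far_iff.mpr ⟨R, hR, h⟩)

theorem far_mem : ∀ᶠ z in far, z.1 ∈ Omega ∧ 1 ≤ ‖z.1‖ ∧ 0 ≤ z.2 :=
  eventually_far_iff.mpr ⟨1, le_rfl, fun _ h1 h2 _ h3 => ⟨h1, h2, h3⟩⟩

theorem isBigO_far_const {E : Type*} [NormedAddCommGroup E] (c : E) :
    (fun _ : ℂ × ℝ => c) =O[far] (fun _ => (1 : ℂ)) := isBigO_const_const c one_ne_zero far

theorem isBigO_far_inv_one : (fun z : ℂ × ℝ => z.1⁻¹) =O[far] (fun _ => (1 : ℂ)) := by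
  refine IsBigO.of_bound 1 (far_mem.mono fun z hz => ?_)
  rw [norm_inv, norm_one, mul_one]
  exact inv_le_one_of_one_le₀ hz.2.1

theorem tendsto_far_inv : Tendsto (fun z : ℂ × ℝ => z.1⁻¹) far (𝓝 0) :=
  (tendsto_inv₀_cobounded.mono_left inf_le_left).comp tendsto_fst

theorem isBigO_far_I_inv : (fun z : ℂ × ℝ => (Complex.I * z.1)⁻¹) =O[far] (fun z => z.1⁻¹) :=
  IsBigO.of_bound 1 (Eventually.of_forall fun z => by simp)

section

variable {n : ℕ}

theorem IsBigO.far_transpose {f : ℂ × ℝ → Mat n} {g : ℂ × ℝ → ℂ} (h : f =O[far] g) :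
    (fun z => (f z).transpose) =O[far] g :=
  ((transposeCLM n).isBigO_comp f far).trans h

theorem IsBigO.far_I_inv_smul {f : ℂ × ℝ → Mat n} (h : f =O[far] fun _ => (1 : ℂ)) :
    (fun z => (Complex.I * z.1)⁻¹ • f z) =O[far] fun z => z.1⁻¹ := by
  simpa using isBigO_far_I_inv.smul h

end

namespace Problem

variable {n : ℕ} (L : Problem n)

theorem h_mul_Aperp : L.h * L.Aperp = 0 := by
  rw [Aperp, mul_sub, mul_one, L.h_mul_A, sub_self]

theorem A_add_Aperp : L.A + L.Aperp = 1 := by rw [Aperp]; abel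

theorem A_mul_weight (ρ : ℂ) : L.A * L.weight ρ = L.A := by
  rw [weight, mul_add, L.A_mul_self, mul_smul_comm, L.A_mul_Aperp, smul_zero, add_zero]

/-- `e^{iρx} φ(x, ρ²) (A + iρA^⊥)`. -/
def solW (z : ℂ × ℝ) : Mat n :=
  Complex.exp (Complex.I * z.1 * z.2) • (L.sol (z.1 ^ 2) z.2 * L.weight z.1)

/-- `e^{iρx} φ'(x, ρ²) (A + iρA^⊥)`. -/
def solDerW (z : ℂ × ℝ) : Mat n :=
  Complex.exp (Complex.I * z.1 * z.2) • (L.solDer (z.1 ^ 2) z.2 * L.weight z.1)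

/-- The leading term of `solW`. -/
def lead (z : ℂ × ℝ) : Mat n := cosE z.1 z.2 • L.A + sinE z.1 z.2 • L.Aperp

/-- The leading term of `solDerW`, divided by `iρ`. -/
def leadDer (z : ℂ × ℝ) : Mat n := sinE z.1 z.2 • L.A + cosE z.1 z.2 • L.Aperp

/-- The weight on the right turns the initial values into `A` and `iρA^⊥ + h`, of orders 1 and
`|ρ|`, as `IsSol.bounds` requires. The matrix `h` contributes to the error only. -/
theorem solW_asymp : (fun z => L.solW z - L.lead z) =O[far] (fun z => z.1⁻¹) ∧
    (fun z => L.solDerW z - (Complex.I * z.1) • L.leadDer z) =O[far] (fun _ => (1 : ℂ)) := by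
  set a := ‖L.A‖ + ‖L.Aperp‖ + ‖L.h‖ with ha
  set q := ∫ t in Ioi 0, ‖L.Q t‖ with hq
  have hq0 : 0 ≤ q := integral_nonneg fun t => norm_nonneg _
  have key : ∀ z : ℂ × ℝ, z.1 ∈ Omega → max 1 (2 * q) ≤ ‖z.1‖ → 0 ≤ z.2 →
      ‖L.solW z - L.lead z‖ ≤ (4 * a * q + ‖L.h‖) * ‖z.1⁻¹‖ ∧
      ‖L.solDerW z - (Complex.I * z.1) • L.leadDer z‖ ≤ (4 * a * q + ‖L.h‖) * ‖(1 : ℂ)‖ := by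
    rintro ⟨ρ, x⟩ hρ hn hx
    simp only at hρ hn hx
    obtain ⟨k1, k2, k3⟩ := L.isSol_sol (ρ ^ 2)
    have hk := k1.mul_const (L.weight ρ)
    have hI : Complex.I * ρ ≠ 0 := mul_ne_zero Complex.I_ne_zero hρ.2
    have hn1 : 1 ≤ ‖ρ‖ := (le_max_left _ _).trans hn
    have hn2 : 2 * q ≤ ‖ρ‖ := (le_max_right _ _).trans hn
    have i0 : L.sol (ρ ^ 2) 0 * L.weight ρ = L.A := by rw [k2, L.A_mul_weight]
    have i1 : L.solDer (ρ ^ 2) 0 * L.weight ρ = (Complex.I * ρ) • L.Aperp + L.h := by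
      rw [k3, weight, mul_add, add_mul, add_mul, L.Aperp_mul_A, L.h_mul_A, mul_smul_comm,
        mul_smul_comm, L.Aperp_mul_self, L.h_mul_Aperp]
      simp [add_comm]
    have hb := hk.bounds L.integrable_Q hρ.1 (a := a)
      (by simp only [i0]; rw [ha]; linarith [norm_nonneg L.Aperp, norm_nonneg L.h])
      (by
        simp only [i1]
        refine (norm_add_le _ _).trans ?_
        rw [norm_smul, norm_mul, Complex.norm_I, one_mul, ha]
        nlinarith [norm_nonneg L.A, norm_nonneg L.h, norm_nonneg L.Aperp]) hn1 hn2 hx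
    obtain ⟨-, b1, b2⟩ := hb
    simp only [i0, i1] at b1 b2
    have e1 : cosE ρ x • L.A + sinE ρ x • (Complex.I * ρ)⁻¹ • ((Complex.I * ρ) • L.Aperp + L.h) =
        L.lead (ρ, x) + sinE ρ x • (Complex.I * ρ)⁻¹ • L.h := by
      rw [smul_add (Complex.I * ρ)⁻¹, inv_smul_smul₀ hI, lead]
      simp only [smul_add]
      abel
    have e2 : sinE ρ x • (Complex.I * ρ) • L.A + cosE ρ x • ((Complex.I * ρ) • L.Aperp + L.h) =
        (Complex.I * ρ) • L.leadDer (ρ, x) + cosE ρ x • L.h := by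
      rw [leadDer]
      simp only [smul_add, smul_smul]
      rw [mul_comm (sinE ρ x), mul_comm (cosE ρ x)]
      abel
    rw [e1] at b1
    rw [e2] at b2
    constructor
    · have e3 : L.solW (ρ, x) - L.lead (ρ, x) = (L.solW (ρ, x) -
          (L.lead (ρ, x) + sinE ρ x • (Complex.I * ρ)⁻¹ • L.h)) +
          sinE ρ x • (Complex.I * ρ)⁻¹ • L.h := by abel
      rw [e3]
      refine (norm_add_le _ _).trans ((add_le_add b1 (?_ : _ ≤ ‖L.h‖ * ‖ρ⁻¹‖)).trans (le_of_eq ?_))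
      · rw [norm_smul, norm_smul, norm_inv, norm_inv, norm_mul, Complex.norm_I, one_mul, mul_comm ‖L.h‖]
        exact mul_le_of_le_one_left (by positivity) (norm_sinE_le hρ.1 hx)
      · rw [norm_inv, ← hq]; ring
    · have e3 : L.solDerW (ρ, x) - (Complex.I * ρ) • L.leadDer (ρ, x) = (L.solDerW (ρ, x) -
          ((Complex.I * ρ) • L.leadDer (ρ, x) + cosE ρ x • L.h)) + cosE ρ x • L.h := by abel
      rw [e3]
      refine (norm_add_le _ _).trans ((add_le_add b2 (?_ : _ ≤ ‖L.h‖)).trans (le_of_eq ?_))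
      · rw [norm_smul]
        exact mul_le_of_le_one_left (norm_nonneg _) (norm_cosE_le hρ.1 hx)
      · rw [norm_one, mul_one]
  refine ⟨isBigO_far_iff.mpr ⟨4 * a * q + ‖L.h‖, max 1 (2 * q), by positivity, le_max_left _ _,
    fun ρ hρ hn x hx => (key (ρ, x) hρ hn hx).1⟩, isBigO_far_iff.mpr ⟨4 * a * q + ‖L.h‖,
    max 1 (2 * q), by positivity, le_max_left _ _, fun ρ hρ hn x hx => (key (ρ, x) hρ hn hx).2⟩⟩

theorem isBigO_cosE : (fun z : ℂ × ℝ => cosE z.1 z.2) =O[far] (fun _ => (1 : ℂ)) :=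
  IsBigO.of_bound 1 (far_mem.mono fun z hz => by
    rw [norm_one, mul_one]; exact norm_cosE_le hz.1.1 hz.2.2)

theorem isBigO_sinE : (fun z : ℂ × ℝ => sinE z.1 z.2) =O[far] (fun _ => (1 : ℂ)) :=
  IsBigO.of_bound 1 (far_mem.mono fun z hz => by
    rw [norm_one, mul_one]; exact norm_sinE_le hz.1.1 hz.2.2)

theorem lead_isBigO : L.lead =O[far] (fun _ => (1 : ℂ)) := by
  have h1 := isBigO_cosE.smul (isBigO_far_const L.A)
  have h2 := isBigO_sinE.smul (isBigO_far_const L.Aperp)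
  simp only [smul_eq_mul, mul_one] at h1 h2
  exact h1.add h2

theorem leadDer_isBigO : L.leadDer =O[far] (fun _ => (1 : ℂ)) := by
  have h1 := isBigO_sinE.smul (isBigO_far_const L.A)
  have h2 := isBigO_cosE.smul (isBigO_far_const L.Aperp)
  simp only [smul_eq_mul, mul_one] at h1 h2
  exact h1.add h2

theorem solW_isBigO : L.solW =O[far] (fun _ => (1 : ℂ)) := by
  have := (L.solW_asymp.1.trans isBigO_far_inv_one).add L.lead_isBigO
  simpa using this

theorem solDerW_isBigO : (fun z => (Complex.I * z.1)⁻¹ • L.solDerW z) =O[far] (fun _ => (1 : ℂ)) := by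
  have h1 := ((IsBigO.far_I_inv_smul L.solW_asymp.2).trans isBigO_far_inv_one).add L.leadDer_isBigO
  refine h1.congr' (far_mem.mono fun z hz => ?_) EventuallyEq.rfl
  have hI : Complex.I * z.1 ≠ 0 := mul_ne_zero Complex.I_ne_zero hz.1.2
  simp only
  rw [smul_sub, inv_smul_smul₀ hI, sub_add_cancel]

theorem jost_asymp : (fun z : ℂ × ℝ => jostU L.Q z.1 z.2 - 1) =O[far] (fun z => z.1⁻¹) ∧
    (fun z : ℂ × ℝ => (Complex.I * z.1)⁻¹ • jostV L.Q z.1 z.2 - 1) =O[far] (fun z => z.1⁻¹) := by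
  set q := ∫ t in Ioi 0, ‖L.Q t‖ with hq
  have hq0 : 0 ≤ q := integral_nonneg fun t => norm_nonneg _
  have key : ∀ ρ ∈ Omega, max 1 (2 * q) ≤ ‖ρ‖ → ∀ x, 0 ≤ x →
      ‖jostU L.Q ρ x - 1‖ ≤ 2 * ‖(1 : Mat n)‖ * q * ‖ρ⁻¹‖ ∧
      ‖jostV L.Q ρ x - (Complex.I * ρ) • (1 : Mat n)‖ ≤ 2 * ‖(1 : Mat n)‖ * q * ‖(1 : ℂ)‖ := by
    intro ρ hρ hn x hx
    have hb := fun y hy => norm_jostU_le L.integrable_Q hρ ((le_max_right _ _).trans hn) (x := y) hy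
    obtain ⟨h1, h2⟩ := norm_jost_sub_le L.integrable_Q hρ hb hx
    have h3 := tail_le L.integrable_Q hx
    constructor
    · refine h1.trans ?_
      rw [norm_inv]
      calc _ ≤ ‖ρ‖⁻¹ * (2 * ‖(1 : Mat n)‖) * q := by gcongr
        _ = _ := by ring
    · refine h2.trans ?_
      rw [show ‖(1 : ℂ)‖ = 1 from norm_one, mul_one]
      gcongr
  have h2 : (fun z : ℂ × ℝ => jostV L.Q z.1 z.2 - (Complex.I * z.1) • (1 : Mat n)) =O[far]
      (fun _ => (1 : ℂ)) := isBigO_far_iff.mpr ⟨2 * ‖(1 : Mat n)‖ * q, max 1 (2 * q),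
      by positivity, le_max_left _ _, fun ρ hρ hn x hx => (key ρ hρ hn x hx).2⟩
  refine ⟨isBigO_far_iff.mpr ⟨2 * ‖(1 : Mat n)‖ * q, max 1 (2 * q), by positivity, le_max_left _ _,
    fun ρ hρ hn x hx => (key ρ hρ hn x hx).1⟩, ?_⟩
  refine (IsBigO.far_I_inv_smul h2).congr' (far_mem.mono fun z hz => ?_) EventuallyEq.rfl
  have hI : Complex.I * z.1 ≠ 0 := mul_ne_zero Complex.I_ne_zero hz.1.2
  simp only
  rw [smul_sub, inv_smul_smul₀ hI]

/-- The leading term `iρA - A^⊥` of the Jost matrix. -/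
def jostLead (ρ : ℂ) : Mat n := (Complex.I * ρ) • L.A - L.Aperp

/-- The inverse of `jostLead`. -/
def jostLeadInv (ρ : ℂ) : Mat n := (Complex.I * ρ)⁻¹ • L.A - L.Aperp

theorem jostLead_mul_inv {ρ : ℂ} (hρ : ρ ≠ 0) : L.jostLead ρ * L.jostLeadInv ρ = 1 := by
  have hI : Complex.I * ρ ≠ 0 := mul_ne_zero Complex.I_ne_zero hρ
  simp only [jostLead, jostLeadInv, sub_mul, mul_sub, smul_mul_assoc, mul_smul_comm, L.A_mul_self,
    A_mul_Aperp, Aperp_mul_A, Aperp_mul_self, smul_zero, sub_zero, zero_sub, sub_neg_eq_add]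
  rw [inv_smul_smul₀ hI, A_add_Aperp]

theorem jostLead_inv_mul {ρ : ℂ} (hρ : ρ ≠ 0) : L.jostLeadInv ρ * L.jostLead ρ = 1 := by
  have hI : Complex.I * ρ ≠ 0 := mul_ne_zero Complex.I_ne_zero hρ
  simp only [jostLead, jostLeadInv, sub_mul, mul_sub, smul_mul_assoc, mul_smul_comm, L.A_mul_self,
    A_mul_Aperp, Aperp_mul_A, Aperp_mul_self, smul_zero, sub_zero, zero_sub, sub_neg_eq_add]
  rw [smul_inv_smul₀ hI, A_add_Aperp]

theorem jostLeadInv_mul_weightInv (ρ : ℂ) :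
    L.jostLeadInv ρ * L.weightInv ρ = (Complex.I * ρ)⁻¹ • (L.A - L.Aperp) := by
  simp only [jostLeadInv, weightInv, sub_mul, mul_add, smul_mul_assoc, mul_smul_comm,
    L.A_mul_self, A_mul_Aperp, Aperp_mul_A, Aperp_mul_self]
  module

theorem weightInv_mul_jostLeadInv (ρ : ℂ) :
    L.weightInv ρ * L.jostLeadInv ρ = (Complex.I * ρ)⁻¹ • (L.A - L.Aperp) := by
  simp only [jostLeadInv, weightInv, mul_sub, add_mul, smul_mul_assoc, mul_smul_comm,
    L.A_mul_self, A_mul_Aperp, Aperp_mul_A, Aperp_mul_self]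
  module

theorem jostLeadInv_mul_jostMatrix {ρ : ℂ} (hρ : ρ ∈ Omega) :
    L.jostLeadInv ρ * L.jostMatrix ρ - 1 = L.A * ((Complex.I * ρ)⁻¹ • jostV L.Q ρ 0 - 1) -
      (Complex.I * ρ)⁻¹ • (L.h * jostU L.Q ρ 0) + L.Aperp * (jostU L.Q ρ 0 - 1) := by
  rw [L.jostMatrix_eq hρ, jostLeadInv]
  set u := jostU L.Q ρ 0
  set v := jostV L.Q ρ 0
  have c1 : L.Aperp * (L.A * (v - L.h * u) - L.Aperp * u) = -(L.Aperp * u) := by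
    rw [mul_sub, ← mul_assoc, ← mul_assoc, L.Aperp_mul_A, L.Aperp_mul_self]; simp
  have c2 : L.A * (L.A * (v - L.h * u) - L.Aperp * u) = L.A * v - L.h * u := by
    rw [mul_sub, ← mul_assoc, ← mul_assoc, L.A_mul_self, L.A_mul_Aperp, mul_sub, ← mul_assoc,
      L.A_mul_h]; simp
  rw [sub_mul, smul_mul_assoc, c1, c2, mul_sub, mul_sub, mul_smul_comm, smul_sub, mul_one, mul_one,
    ← L.A_add_Aperp]
  abel

theorem isBigO_at_zero {f : ℂ × ℝ → Mat n} {g : ℂ → ℂ} (h : f =O[far] fun z => g z.1) :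
    (fun z : ℂ × ℝ => f (z.1, 0)) =O[far] fun z => g z.1 := by
  obtain ⟨C, R, hC, hR, hb⟩ := isBigO_far_iff.mp h
  exact isBigO_far_iff.mpr ⟨C, R, hC, hR, fun ρ hρ hn x _ => hb ρ hρ hn 0 le_rfl⟩

theorem far_one_mul {f g : ℂ × ℝ → Mat n} {c d : ℂ × ℝ → ℂ} (hf : f =O[far] c) (hg : g =O[far] d) :
    (fun z => f z * g z) =O[far] fun z => c z * d z := hf.mul hg

theorem jostMatrix_asymp : (fun z : ℂ × ℝ => L.jostLeadInv z.1 * L.jostMatrix z.1 - 1) =O[far]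
    (fun z => z.1⁻¹) := by
  have hU := isBigO_at_zero (g := fun ρ => ρ⁻¹) L.jost_asymp.1
  have hV := isBigO_at_zero (g := fun ρ => ρ⁻¹) L.jost_asymp.2
  have hU1 : (fun z : ℂ × ℝ => jostU L.Q z.1 0) =O[far] (fun _ => (1 : ℂ)) := by
    simpa using (hU.trans isBigO_far_inv_one).add (isBigO_far_const (1 : Mat n))
  have h1 := far_one_mul (isBigO_far_const L.A) hV
  have h2 := far_one_mul (isBigO_far_const L.h) hU1
  have h3 := far_one_mul (isBigO_far_const L.Aperp) hU
  simp only [one_mul] at h1 h2 h3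
  refine ((h1.sub (IsBigO.far_I_inv_smul h2)).add h3).congr' (far_mem.mono fun z hz => ?_)
    EventuallyEq.rfl
  simp only
  rw [L.jostLeadInv_mul_jostMatrix hz.1]

/-- A Neumann series: the product of `jostLeadInv` and the Jost matrix tends to the identity. The
bound `1 / 2` is used again for the inverse in `jostB_asymp`. -/
theorem isUnit_jostMatrix_far : ∀ᶠ z : ℂ × ℝ in far, IsUnit (L.jostMatrix z.1) ∧
    ‖L.jostLeadInv z.1 * L.jostMatrix z.1 - 1‖ ≤ 1 / 2 := by
  have h := L.jostMatrix_asymp.trans_tendsto tendsto_far_inv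
  have h1 := (tendsto_zero_iff_norm_tendsto_zero.mp h).eventually (Iic_mem_nhds (by norm_num : (0 : ℝ) < 1 / 2))
  filter_upwards [h1, far_mem] with z hz hz2
  refine ⟨?_, hz⟩
  have hz' : ‖1 - L.jostLeadInv z.1 * L.jostMatrix z.1‖ < 1 := by
    rw [norm_sub_rev]; exact lt_of_le_of_lt hz (by norm_num)
  have hu : IsUnit (L.jostLeadInv z.1 * L.jostMatrix z.1) := by
    have := (Units.oneSub _ hz').isUnit
    rwa [Units.val_oneSub, sub_sub_cancel] at this
  have hN : IsUnit (L.jostLead z.1) :=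
    ⟨⟨_, _, L.jostLead_mul_inv hz2.1.2, L.jostLead_inv_mul hz2.1.2⟩, rfl⟩
  have := hN.mul hu
  rwa [← mul_assoc, L.jostLead_mul_inv hz2.1.2, one_mul] at this

/-- `J(ρ)⁻¹ (iρA - A^⊥)`. -/
def jostB (ρ : ℂ) : Mat n := (L.jostMatrix ρ)⁻¹ * L.jostLead ρ

theorem jostMatrix_inv_eq {ρ : ℂ} (hρ : ρ ≠ 0) :
    (L.jostMatrix ρ)⁻¹ = L.jostB ρ * L.jostLeadInv ρ := by
  rw [jostB, mul_assoc, L.jostLead_mul_inv hρ, mul_one]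

/-- With `B = jostB` and `E` the small deviation of the normalized Jost matrix from 1, one has `B -
1 = -B E`. Since `‖E‖ ≤ 1 / 2`, this first bounds `B` and then gives the rate. -/
theorem jostB_asymp : (fun z : ℂ × ℝ => L.jostB z.1 - 1) =O[far] (fun z => z.1⁻¹) := by
  have he : ∀ᶠ z : ℂ × ℝ in far, L.jostB z.1 - 1 =
      -(L.jostB z.1 * (L.jostLeadInv z.1 * L.jostMatrix z.1 - 1)) := by
    filter_upwards [L.isUnit_jostMatrix_far, far_mem] with z hz hz2
    have h1 : L.jostB z.1 * (L.jostLeadInv z.1 * L.jostMatrix z.1) = 1 := by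
      rw [← mul_assoc, ← L.jostMatrix_inv_eq hz2.1.2,
        Matrix.nonsing_inv_mul _ ((Matrix.isUnit_iff_isUnit_det _).mp hz.1)]
    rw [mul_sub, h1, mul_one]
    abel
  have hB : (fun z : ℂ × ℝ => L.jostB z.1) =O[far] (fun _ => (1 : ℂ)) := by
    refine IsBigO.of_bound (2 * ‖(1 : Mat n)‖) ?_
    filter_upwards [he, L.isUnit_jostMatrix_far] with z hz hz2
    have h1 : ‖L.jostB z.1 - 1‖ ≤ ‖L.jostB z.1‖ * (1 / 2) := by
      rw [hz, norm_neg]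
      exact (norm_mul_le _ _).trans (mul_le_mul_of_nonneg_left hz2.2 (norm_nonneg _))
    have h2 := norm_le_norm_add_norm_sub' (L.jostB z.1) 1
    rw [show ‖(1 : ℂ)‖ = 1 from norm_one, mul_one]
    linarith
  have := far_one_mul hB L.jostMatrix_asymp
  simp only [one_mul] at this
  exact this.neg_left.congr' (he.mono fun z hz => hz.symm) EventuallyEq.rfl

theorem far_mul_one_asymp {f g : ℂ × ℝ → Mat n} (hf : (fun z => f z - 1) =O[far] (fun z => z.1⁻¹))
    (hg : (fun z => g z - 1) =O[far] (fun z => z.1⁻¹)) :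
    (fun z => f z * g z - 1) =O[far] (fun z => z.1⁻¹) := by
  have hg1 : g =O[far] (fun _ => (1 : ℂ)) := by
    simpa using (hg.trans isBigO_far_inv_one).add (isBigO_far_const (1 : Mat n))
  have h := far_one_mul hf hg1
  simp only [mul_one] at h
  refine (h.add hg).congr_left fun z => ?_
  rw [sub_mul, one_mul]; abel

/-- The asymptotics of the Weyl solution. -/
theorem weylSol_asymp :
    (fun z : ℂ × ℝ => jostU L.Q z.1 z.2 * L.jostB z.1 - 1) =O[far] (fun z => z.1⁻¹) ∧
    (fun z : ℂ × ℝ => ((Complex.I * z.1)⁻¹ • jostV L.Q z.1 z.2) * L.jostB z.1 - 1) =O[far]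
      (fun z => z.1⁻¹) :=
  ⟨far_mul_one_asymp L.jost_asymp.1 L.jostB_asymp, far_mul_one_asymp L.jost_asymp.2 L.jostB_asymp⟩

theorem weylMatrix_asymp :
    (fun z : ℂ × ℝ => L.weightInv z.1 * L.weylMatrix z.1 * L.weightInv z.1 -
      (Complex.I * z.1)⁻¹ • (L.A - L.Aperp)) =O[far] (fun z => z.1⁻¹ * z.1⁻¹) := by
  have hU := isBigO_at_zero (g := fun ρ => ρ⁻¹) L.jost_asymp.1
  have hV := isBigO_at_zero (g := fun ρ => ρ⁻¹) L.jost_asymp.2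
  have h1 := far_one_mul (isBigO_far_const L.A) hU
  have h2 := far_one_mul (isBigO_far_const L.Aperp) hV
  simp only [one_mul] at h1 h2
  have h3 : (fun z : ℂ × ℝ => (L.A * jostU L.Q z.1 0 +
      L.Aperp * ((Complex.I * z.1)⁻¹ • jostV L.Q z.1 0)) - 1) =O[far] (fun z => z.1⁻¹) := by
    refine (h1.add h2).congr_left fun z => ?_
    rw [mul_sub, mul_sub, mul_one, mul_one, ← L.A_add_Aperp]
    abel
  have h4 := far_mul_one_asymp h3 L.jostB_asymp
  have h5 := far_one_mul h4 (IsBigO.far_I_inv_smul (isBigO_far_const (L.A - L.Aperp)))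
  refine h5.congr' (far_mem.mono fun z hz => ?_) EventuallyEq.rfl
  have h6 : L.weightInv z.1 * (L.A * jostU L.Q z.1 0 + L.Aperp * jostV L.Q z.1 0) =
      L.A * jostU L.Q z.1 0 + L.Aperp * ((Complex.I * z.1)⁻¹ • jostV L.Q z.1 0) := by
    simp only [weightInv, mul_add, add_mul, ← mul_assoc, smul_mul_assoc, L.A_mul_self,
      L.A_mul_Aperp, L.Aperp_mul_A, L.Aperp_mul_self, mul_smul_comm, smul_zero, zero_add,
      add_zero]
  have h7 : ∀ a b c d e : Mat n, a * (b * (c * d)) * e = a * b * c * (d * e) := fun a b c d e => by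
    simp only [mul_assoc]
  simp only
  rw [L.weylMatrix_eq hz.1, L.jostMatrix_inv_eq hz.1.2, h7, h6, L.jostLeadInv_mul_weightInv,
    sub_mul, one_mul]

/-- The leading term in `weylMatrix_asymp` depends only on `A` and cancels. The power of `ρ` gained
here makes the kernels integrable along the contour. -/
theorem weylMatrix_sub_asymp (L' : Problem n) (hA : L'.A = L.A) :
    (fun z : ℂ × ℝ => L.weightInv z.1 * (L.weylMatrix z.1 - L'.weylMatrix z.1) * L.weightInv z.1)
      =O[far] (fun z => z.1⁻¹ * z.1⁻¹) := by
  have hw : ∀ ρ, L'.weightInv ρ = L.weightInv ρ := fun ρ => by simp only [weightInv, Aperp, hA]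
  refine (L.weylMatrix_asymp.sub L'.weylMatrix_asymp).congr_left fun z => ?_
  simp only [hw, Aperp, hA]
  noncomm_ring

end Problem

/-! ### The homology form of Cauchy's theorem for closed paths. -/

section HomologyCauchy

variable {E : Type*} [NormedAddCommGroup E] [NormedSpace ℂ E] [CompleteSpace E]

/-- `γ` is a path on `[a, b]`, absolutely continuous with derivative `k`. -/
structure IsPath (γ k : ℝ → ℂ) (a b : ℝ) : Prop where
  le : a ≤ b
  cont : ContinuousOn γ (Icc a b)
  deriv : ∃ s : Set ℝ, s.Countable ∧ ∀ x ∈ Ioo a b \ s, HasDerivAt γ (k x) x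
  int : IntervalIntegrable k volume a b

namespace IsPath

variable {γ k : ℝ → ℂ} {a b : ℝ}

/-- The points of the path. -/
def trace (γ : ℝ → ℂ) (a b : ℝ) : Set ℂ := γ '' Icc a b

theorem isCompact_trace (h : IsPath γ k a b) : IsCompact (trace γ a b) :=
  isCompact_Icc.image_of_continuousOn h.cont

theorem trace_nonempty (h : IsPath γ k a b) : (trace γ a b).Nonempty :=
  (nonempty_Icc.mpr h.le).image _

theorem add_const (h : IsPath γ k a b) (c : ℂ) : IsPath (fun s => γ s + c) k a b where
  le := h.le
  cont := h.cont.add continuousOn_const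
  deriv := by
    obtain ⟨s, hs, hd⟩ := h.deriv
    exact ⟨s, hs, fun x hx => (hd x hx).add_const c⟩
  int := h.int

theorem intervalIntegrable_smul (h : IsPath γ k a b) {f : ℂ → E}
    (hf : ContinuousOn f (trace γ a b)) :
    IntervalIntegrable (fun s => k s • f (γ s)) volume a b :=
  h.int.smul_continuousOn (by
    rw [uIcc_of_le h.le]
    exact hf.comp h.cont (mapsTo_image γ (Icc a b)))

theorem integrable_smul (h : IsPath γ k a b) {f : ℂ → E} (hf : ContinuousOn f (trace γ a b)) :
    IntegrableOn (fun s => k s • f (γ s)) (Ioc a b) :=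
  (intervalIntegrable_iff_integrableOn_Ioc_of_le h.le).mp (h.intervalIntegrable_smul hf)

theorem mem_trace {s : ℝ} (hs : s ∈ Ioc a b) : γ s ∈ trace γ a b :=
  mem_image_of_mem _ (Ioc_subset_Icc_self hs)

/-- The fundamental theorem of calculus along a path. -/
theorem integral_eq_sub (h : IsPath γ k a b) {F f : ℂ → E}
    (hF : ∀ z ∈ trace γ a b, HasDerivAt F (f z) z) (hf : ContinuousOn f (trace γ a b)) :
    ∫ s in a..b, k s • f (γ s) = F (γ b) - F (γ a) := by
  obtain ⟨s, hs, hd⟩ := h.deriv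
  refine MeasureTheory.integral_eq_of_hasDerivAt_off_countable_of_le (fun s => F (γ s)) _ h.le hs
    ?_ ?_ (h.intervalIntegrable_smul hf)
  · exact ContinuousOn.comp (fun z hz => (hF z hz).continuousAt.continuousWithinAt) h.cont
      (mapsTo_image γ (Icc a b))
  · intro x hx
    exact (hF _ (mem_image_of_mem _ (Ioo_subset_Icc_self hx.1))).scomp x (hd x hx)

/-- The constant `c` rotates `z - ζ` into the slit plane, where the logarithm is a single-valued
primitive along the closed path. -/
theorem integral_log (h : IsPath γ k a b) (hc : γ a = γ b) {c ζ : ℂ} (h0 : c ≠ 0)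
    (hs : ∀ z ∈ trace γ a b, c * (z - ζ) ∈ Complex.slitPlane) :
    ∫ s in a..b, k s • (γ s - ζ)⁻¹ = 0 := by
  have hne : ∀ z ∈ trace γ a b, z - ζ ≠ 0 := fun z hz h0 => by
    have := Complex.slitPlane_ne_zero (hs z hz)
    rw [h0, mul_zero] at this
    exact this rfl
  rw [h.integral_eq_sub (F := fun z => Complex.log (c * (z - ζ))) (f := fun z => (z - ζ)⁻¹), hc,
    sub_self]
  · intro z hz
    have h1 : HasDerivAt (fun z : ℂ => c * (z - ζ)) c z := by
      simpa using ((hasDerivAt_id z).sub_const ζ).const_mul c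
    have h2 := h1.clog (hs z hz)
    exact h2.congr_deriv (div_mul_cancel_left₀ h0 _)
  · exact ContinuousOn.inv₀ (by fun_prop) hne

/-- The integral of `1 / (z - w)` over a closed path is locally constant off the path. -/
theorem integral_inv_eq (h : IsPath γ k a b) (hc : γ a = γ b) {w w₀ : ℂ}
    (hw : ∀ z ∈ trace γ a b, ‖w - w₀‖ < ‖z - w₀‖) :
    ∫ s in a..b, k s • (γ s - w)⁻¹ = ∫ s in a..b, k s • (γ s - w₀)⁻¹ := by
  have hne₀ : ∀ z ∈ trace γ a b, z - w₀ ≠ 0 := fun z hz h0 => by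
    have := hw z hz
    rw [h0, norm_zero] at this
    exact absurd this (not_lt.mpr (norm_nonneg _))
  have hne : ∀ z ∈ trace γ a b, z - w ≠ 0 := fun z hz h0 => by
    have := hw z hz
    rw [sub_eq_zero.mp h0] at this
    exact lt_irrefl _ this
  have c1 : ContinuousOn (fun z : ℂ => (z - w)⁻¹) (trace γ a b) :=
    ContinuousOn.inv₀ (by fun_prop) hne
  have c2 : ContinuousOn (fun z : ℂ => (z - w₀)⁻¹) (trace γ a b) :=
    ContinuousOn.inv₀ (by fun_prop) hne₀
  rw [← sub_eq_zero, ← intervalIntegral.integral_sub (h.intervalIntegrable_smul c1)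
    (h.intervalIntegrable_smul c2)]
  simp only [← smul_sub]
  -- The quotient differs from 1 by less than 1 on the path, so the principal logarithm is a
  -- primitive there.
  rw [h.integral_eq_sub (F := fun z => Complex.log ((z - w) / (z - w₀)))
    (f := fun z => (z - w)⁻¹ - (z - w₀)⁻¹), hc, sub_self]
  · intro z hz
    have n1 := hne z hz
    have n2 := hne₀ z hz
    have h1 : HasDerivAt (fun z : ℂ => (z - w) / (z - w₀))
        ((1 * (z - w₀) - (z - w) * 1) / (z - w₀) ^ 2) z :=
      ((hasDerivAt_id z).sub_const w).div ((hasDerivAt_id z).sub_const w₀) n2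
    have hs : (z - w) / (z - w₀) ∈ Complex.slitPlane := by
      have e : (z - w) / (z - w₀) = 1 + -((w - w₀) / (z - w₀)) := by field_simp; ring
      rw [e]
      refine Complex.mem_slitPlane_of_norm_lt_one ?_
      rw [norm_neg, norm_div, div_lt_one (norm_pos_iff.mpr n2)]
      exact hw z hz
    refine (h1.clog hs).congr_deriv ?_
    show _ = (z - w)⁻¹ - (z - w₀)⁻¹
    field_simp
  · exact c1.sub c2

theorem differentiableOn_cauchyTransform (h : IsPath γ k a b) {f : ℂ → E}
    (hf : ContinuousOn f (trace γ a b)) :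
    DifferentiableOn ℂ (fun w => ∫ s in a..b, k s • (γ s - w)⁻¹ • f (γ s)) (trace γ a b)ᶜ := by
  simp only [intervalIntegral.integral_of_le h.le]
  have hcl := h.isCompact_trace.isClosed
  have hsm : ∀ w ∈ (trace γ a b)ᶜ, ContinuousOn (fun z => (z - w)⁻¹ • f z) (trace γ a b) :=
    fun w hw => ContinuousOn.smul (ContinuousOn.inv₀ (by fun_prop) fun z hz h0 =>
      hw (sub_eq_zero.mp h0 ▸ hz)) hf
  refine differentiableOn_integral hcl.isOpen_compl (fun w hw =>
    (h.integrable_smul (hsm w hw)).aestronglyMeasurable) ?_ ?_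
  · refine (ae_restrict_iff' measurableSet_Ioc).mpr (Eventually.of_forall fun s hs => ?_)
    have h1 : DifferentiableOn ℂ (fun w => (γ s - w)⁻¹) (trace γ a b)ᶜ :=
      DifferentiableOn.inv (by fun_prop) fun w hw h0 => hw (sub_eq_zero.mp h0 ▸ mem_trace hs)
    exact (h1.smul_const _).const_smul _
  · intro w₀ hw₀
    obtain ⟨r, hr, hb⟩ := Metric.mem_nhds_iff.mp (hcl.isOpen_compl.mem_nhds hw₀)
    refine ⟨fun s => (r / 2)⁻¹ * ‖k s • f (γ s)‖, ((h.integrable_smul hf).norm.const_mul _),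
      Filter.mem_of_superset (Metric.ball_mem_nhds w₀ (half_pos hr)) fun w hw =>
      (ae_restrict_iff' measurableSet_Ioc).mpr (Eventually.of_forall fun s hs => ?_)⟩
    rw [smul_comm, norm_smul, norm_inv]
    refine mul_le_mul_of_nonneg_right (inv_anti₀ (half_pos hr) ?_) (norm_nonneg _)
    have h1 : r ≤ ‖γ s - w₀‖ := by
      by_contra! h2
      exact hb (mem_ball_iff_norm.mpr h2) (mem_trace hs)
    have h2 : ‖w - w₀‖ < r / 2 := mem_ball_iff_norm.mp hw
    have h3 : γ s - w₀ = (γ s - w) + (w - w₀) := by ring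
    have h4 := norm_add_le (γ s - w) (w - w₀)
    rw [← h3] at h4
    linarith

theorem _root_.MatrixSchrodinger.dslope_comm (f : ℂ → E) (z w : ℂ) : dslope f z w = dslope f w z := by
  rcases eq_or_ne z w with rfl | h
  · rfl
  · rw [dslope_of_ne _ h, dslope_of_ne _ h.symm, slope_comm]

/-- `dslope f w z` is bounded for `w` near a point and `z` in a compact set. -/
theorem _root_.MatrixSchrodinger.eventually_norm_dslope_le {U : Set ℂ} (hU : IsOpen U) {f : ℂ → E} (hf : DifferentiableOn ℂ f U)
    {K : Set ℂ} (hK : IsCompact K) (hKU : K ⊆ U) {w₀ : ℂ} (hw₀ : w₀ ∈ U) :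
    ∃ C, ∀ᶠ w in 𝓝 w₀, ∀ z ∈ K, ‖dslope f w z‖ ≤ C := by
  obtain ⟨r, hr, hb⟩ := Metric.mem_nhds_iff.mp (hU.mem_nhds hw₀)
  have hcb : Metric.closedBall w₀ (r / 2) ⊆ U :=
    (Metric.closedBall_subset_ball (by linarith)).trans hb
  obtain ⟨C₁, hC₁⟩ := (isCompact_closedBall w₀ (r / 2)).exists_bound_of_continuousOn
    ((hf.continuousOn).mono hcb)
  obtain ⟨C₂, hC₂⟩ := hK.exists_bound_of_continuousOn (hf.continuousOn.mono hKU)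
  obtain ⟨C₃, hC₃⟩ := (isCompact_closedBall w₀ (r / 2)).exists_bound_of_continuousOn
    ((hf.deriv hU).continuousOn.mono hcb)
  refine ⟨max C₃ ((r / 4)⁻¹ * (C₂ + C₁)), Filter.mem_of_superset
    (Metric.ball_mem_nhds w₀ (show 0 < r / 4 by positivity)) fun w hw z hz => ?_⟩
  have hw' : ‖w - w₀‖ < r / 4 := mem_ball_iff_norm.mp hw
  have hwb : w ∈ Metric.closedBall w₀ (r / 2) := mem_closedBall_iff_norm.mpr (by linarith)
  -- Near `w₀` the mean value inequality bounds the slope by the derivative; elsewhere the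
  -- denominator is at least `r / 4`.
  by_cases hzb : z ∈ Metric.closedBall w₀ (r / 2)
  · refine le_trans ?_ (le_max_left _ _)
    rcases eq_or_ne z w with rfl | hne
    · rw [dslope_same]; exact hC₃ _ hzb
    · rw [dslope_of_ne _ hne, slope_def_module, norm_smul, norm_inv]
      have := (convex_closedBall w₀ (r / 2)).norm_image_sub_le_of_norm_deriv_le
        (fun x hx => hf.differentiableAt (hU.mem_nhds (hcb hx))) hC₃ hwb hzb
      rw [inv_mul_le_iff₀ (norm_pos_iff.mpr (sub_ne_zero.mpr hne))]
      linarith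
  · refine le_trans ?_ (le_max_right _ _)
    have h1 : r / 2 < ‖z - w₀‖ := by
      by_contra! h
      exact hzb (mem_closedBall_iff_norm.mpr h)
    have h2 : r / 4 ≤ ‖z - w‖ := by
      have h3 : z - w₀ = (z - w) + (w - w₀) := by ring
      have h4 := norm_add_le (z - w) (w - w₀)
      rw [← h3] at h4
      linarith
    have hne : z ≠ w := fun h => by
      rw [h, sub_self, norm_zero] at h2; linarith
    rw [dslope_of_ne _ hne, slope_def_module, norm_smul, norm_inv]
    have h5 : ‖f z - f w‖ ≤ C₂ + C₁ := (norm_sub_le _ _).trans (add_le_add (hC₂ z hz) (hC₁ w hwb))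
    have h6 : 0 ≤ C₂ + C₁ := (norm_nonneg _).trans h5
    exact mul_le_mul (inv_anti₀ (by positivity) h2) h5 (norm_nonneg _) (by positivity)

theorem differentiableOn_integral_dslope (h : IsPath γ k a b) {U : Set ℂ} (hU : IsOpen U)
    (hγ : trace γ a b ⊆ U) {f : ℂ → E} (hf : DifferentiableOn ℂ f U) :
    DifferentiableOn ℂ (fun w => ∫ s in a..b, k s • dslope f w (γ s)) U := by
  simp only [intervalIntegral.integral_of_le h.le]
  refine differentiableOn_integral hU (fun w hw => (h.integrable_smul ?_).aestronglyMeasurable) ?_ ?_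
  · exact ((continuousOn_dslope (hU.mem_nhds hw)).mpr ⟨hf.continuousOn,
      hf.differentiableAt (hU.mem_nhds hw)⟩).mono hγ
  · refine (ae_restrict_iff' measurableSet_Ioc).mpr (Eventually.of_forall fun s hs => ?_)
    simp only [dslope_comm f _ (γ s)]
    exact ((Complex.differentiableOn_dslope (hU.mem_nhds (hγ (mem_trace hs)))).mpr hf).const_smul _
  · intro w₀ hw₀
    obtain ⟨C, hC⟩ := eventually_norm_dslope_le hU hf h.isCompact_trace hγ hw₀
    refine ⟨fun s => ‖k s‖ * C, (((intervalIntegrable_iff_integrableOn_Ioc_of_le h.le).mp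
      h.int).norm.mul_const C), hC.mono fun w hw => (ae_restrict_iff' measurableSet_Ioc).mpr
      (Eventually.of_forall fun s hs => ?_)⟩
    rw [norm_smul]
    exact mul_le_mul_of_nonneg_left (hw _ (mem_trace hs)) (norm_nonneg _)

theorem tendsto_cauchyTransform (h : IsPath γ k a b) {f : ℂ → E}
    (hf : ContinuousOn f (trace γ a b)) :
    Tendsto (fun w => ∫ s in a..b, k s • (γ s - w)⁻¹ • f (γ s)) (cocompact ℂ) (𝓝 0) := by
  obtain ⟨B, hB⟩ := h.isCompact_trace.exists_bound_of_continuousOn (continuousOn_id)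
  have hB0 : 0 ≤ B := (norm_nonneg _).trans (hB _ h.trace_nonempty.some_mem)
  set I := ∫ s in a..b, ‖k s • f (γ s)‖ with hI
  have hlim : Tendsto (fun w : ℂ => (‖w‖ - B)⁻¹ * I) (cocompact ℂ) (𝓝 0) := by
    have : Tendsto (fun w : ℂ => ‖w‖ - B) (cocompact ℂ) atTop :=
      tendsto_atTop_add_const_right _ _ (tendsto_norm_cocompact_atTop)
    simpa using (tendsto_inv_atTop_zero.comp this).mul_const I
  refine squeeze_zero_norm' ?_ hlim
  have hev : ∀ᶠ w : ℂ in cocompact ℂ, B + 1 ≤ ‖w‖ :=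
    tendsto_norm_cocompact_atTop.eventually_ge_atTop (B + 1)
  filter_upwards [hev] with w hw
  rw [hI, ← intervalIntegral.integral_const_mul]
  refine intervalIntegral.norm_integral_le_of_norm_le h.le ?_
    ((h.intervalIntegrable_smul hf).norm.const_mul _)
  refine Eventually.of_forall fun s hs => ?_
  rw [smul_comm, norm_smul, norm_inv]
  refine mul_le_mul_of_nonneg_right (inv_anti₀ (by linarith) ?_) (norm_nonneg _)
  have h1 := hB _ (mem_trace hs)
  rw [norm_sub_rev]
  have := norm_sub_norm_le w (γ s)
  simp only [id] at h1
  linarith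

/-- **The homology form of Cauchy's theorem**: a closed path in `U` with winding number `0` about
all points outside of `U`. -/
theorem integral_eq_zero (h : IsPath γ k a b) (hc : γ a = γ b) {U : Set ℂ} (hU : IsOpen U)
    (hγ : trace γ a b ⊆ U) (hn : ∀ ζ ∉ U, ∫ s in a..b, k s • (γ s - ζ)⁻¹ = 0) {f : ℂ → E}
    (hf : DifferentiableOn ℂ f U) : ∫ s in a..b, k s • f (γ s) = 0 := by
  have hcl := h.isCompact_trace.isClosed
  -- Dixon's argument. The integral of the difference quotient on `U` and the Cauchy transform on
  -- the open set `V` of winding number zero agree on the overlap, and `U` and `V` cover the plane.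
  -- The resulting entire function tends to zero at infinity and vanishes by Liouville's theorem.
  have key : ∀ g : ℂ → E, DifferentiableOn ℂ g U → ∀ w ∈ U,
      ∫ s in a..b, k s • dslope g w (γ s) = 0 := by
    intro g hg
    set V : Set ℂ := {w | w ∉ trace γ a b ∧ ∫ s in a..b, k s • (γ s - w)⁻¹ = 0} with hV
    have hVo : IsOpen V := by
      rw [isOpen_iff_mem_nhds]
      rintro w ⟨hw, hw0⟩
      obtain ⟨r, hr, hb⟩ := Metric.mem_nhds_iff.mp (hcl.isOpen_compl.mem_nhds hw)
      refine Filter.mem_of_superset (Metric.ball_mem_nhds w hr) fun v hv => ⟨fun h' => hb hv h', ?_⟩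
      rw [h.integral_inv_eq hc (w₀ := w), hw0]
      intro z hz
      refine lt_of_lt_of_le (mem_ball_iff_norm.mp hv) ?_
      by_contra! h'
      exact hb (mem_ball_iff_norm.mpr h') hz
    have hUV : ∀ w, w ∉ U → w ∈ V := fun w hw => ⟨fun h' => hw (hγ h'), hn w hw⟩
    have hgγ := hg.continuousOn.mono hγ
    classical
    set F : ℂ → E := fun w => if w ∈ U then ∫ s in a..b, k s • dslope g w (γ s) else
      ∫ s in a..b, k s • (γ s - w)⁻¹ • g (γ s) with hF
    have hFU : EqOn F (fun w => ∫ s in a..b, k s • dslope g w (γ s)) U := fun w hw => if_pos hw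
    have hFV : EqOn F (fun w => ∫ s in a..b, k s • (γ s - w)⁻¹ • g (γ s)) V := by
      intro w hw
      by_cases hwU : w ∈ U
      · simp only [hF, if_pos hwU]
        have hne : ∀ z ∈ trace γ a b, z - w ≠ 0 := fun z hz h0 => hw.1 (sub_eq_zero.mp h0 ▸ hz)
        have c1 : ContinuousOn (fun z : ℂ => (z - w)⁻¹) (trace γ a b) :=
          ContinuousOn.inv₀ (by fun_prop) hne
        have e1 : ∫ s in a..b, k s • dslope g w (γ s) = ∫ s in a..b,
            (k s • (γ s - w)⁻¹ • g (γ s) - k s • (γ s - w)⁻¹ • g w) := by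
          refine intervalIntegral.integral_congr fun s hs => ?_
          rw [uIcc_of_le h.le] at hs
          have : γ s ≠ w := fun h' => hw.1 (h' ▸ mem_image_of_mem _ hs)
          rw [dslope_of_ne _ this, slope_def_module, smul_sub, smul_sub]
        have i1 : IntervalIntegrable (fun s => k s • (γ s - w)⁻¹ • g (γ s)) volume a b :=
          h.intervalIntegrable_smul (f := fun z => (z - w)⁻¹ • g z) (c1.smul hgγ)
        have i2 : IntervalIntegrable (fun s => k s • (γ s - w)⁻¹ • g w) volume a b :=
          h.intervalIntegrable_smul (f := fun z => (z - w)⁻¹ • g w) (c1.smul continuousOn_const)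
        rw [e1, intervalIntegral.integral_sub i1 i2]
        simp only [← smul_assoc (k _) _ (g w)]
        rw [intervalIntegral.integral_smul_const, hw.2, zero_smul, sub_zero]
      · exact if_neg hwU
    have hFd : Differentiable ℂ F := by
      intro w
      by_cases hw : w ∈ U
      · exact (((h.differentiableOn_integral_dslope hU hγ hg).congr hFU).differentiableAt
          (hU.mem_nhds hw))
      · have hwV := hUV w hw
        exact ((((h.differentiableOn_cauchyTransform hgγ).mono fun v hv => hv.1).congr hFV
          ).differentiableAt (hVo.mem_nhds hwV))
    have hFlim : Tendsto F (cocompact ℂ) (𝓝 0) := by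
      refine (h.tendsto_cauchyTransform hgγ).congr' ?_
      obtain ⟨B, hB⟩ := h.isCompact_trace.exists_bound_of_continuousOn (continuousOn_id)
      have hev : ∀ᶠ w : ℂ in cocompact ℂ, B + 1 ≤ ‖w‖ :=
        tendsto_norm_cocompact_atTop.eventually_ge_atTop (B + 1)
      filter_upwards [hev] with w hw
      refine (hFV ⟨fun h' => ?_, ?_⟩).symm
      · have := hB w h'
        simp only [id] at this
        linarith
      · have hw0 : w ≠ 0 := fun h0 => by
          have := (norm_nonneg _).trans (hB _ h.trace_nonempty.some_mem)
          rw [h0, norm_zero] at hw; linarith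
        refine h.integral_log hc (c := -w⁻¹) (neg_ne_zero.mpr (inv_ne_zero hw0)) fun z hz => ?_
        have e : -w⁻¹ * (z - w) = 1 + -(z / w) := by field_simp; ring
        rw [e]
        refine Complex.mem_slitPlane_of_norm_lt_one ?_
        have h1 := hB z hz
        simp only [id] at h1
        rw [norm_neg, norm_div, div_lt_one (norm_pos_iff.mpr hw0)]
        linarith
    intro w hw
    refine (hFU hw).symm.trans ?_
    exact hFd.apply_eq_of_tendsto_cocompact w hFlim
  set w := γ a with hw
  have hwU : w ∈ U := hγ (mem_image_of_mem _ (left_mem_Icc.mpr h.le))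
  -- The difference quotient of `(z - w) f` at `w` is `f` itself, so the statement for quotients
  -- contains the theorem.
  have hk := key (fun z => (z - w) • f z) ((by fun_prop : DifferentiableOn ℂ (fun z => z - w) U).smul hf) w hwU
  rw [← hk]
  refine intervalIntegral.integral_congr fun s hs => ?_
  rw [uIcc_of_le h.le] at hs
  have hsU := hγ (mem_image_of_mem γ hs)
  congr 1
  rcases eq_or_ne (γ s) w with h1 | h1
  · rw [h1, dslope_same]
    have h2 : HasDerivAt (fun z => (z - w) • f z) ((w - w) • _root_.deriv f w + (1 : ℂ) • f w) w :=
      ((hasDerivAt_id w).sub_const w).smul (hf.differentiableAt (hU.mem_nhds hwU)).hasDerivAt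
    rw [h2.deriv]; simp
  · rw [dslope_of_ne _ h1, slope_def_module]
    simp [inv_smul_smul₀ (sub_ne_zero.mpr h1)]

end IsPath

end HomologyCauchy

/-! ### Regularity of the contour and its position relative to the encircled set. -/

namespace Contour

variable {S : Set ℂ} (Γ : Contour S)

theorem ρ_zero : Γ.ρ 0 = (Γ.a : ℂ) := by rw [Γ.ρ_upper 0 le_rfl, sub_zero]

theorem ρ_one : Γ.ρ 1 = -(Γ.a : ℂ) := by rw [Γ.ρ_lower 1 le_rfl]; push_cast; ring

theorem exists_mem_Ioo {t : ℕ → ℝ} {k : ℕ} {x : ℝ} (h0 : t 0 ≤ x) (h1 : x < t k)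
    (hx : x ∉ range t) : ∃ j < k, x ∈ Ioo (t j) (t (j + 1)) := by
  induction k with
  | zero => exact absurd h0 (not_le.mpr h1)
  | succ k ih =>
    rcases lt_or_ge x (t k) with h | h
    · obtain ⟨j, hj, hxj⟩ := ih h
      exact ⟨j, hj.trans (Nat.lt_succ_self k), hxj⟩
    · exact ⟨k, Nat.lt_succ_self k, lt_of_le_of_ne h fun h' => hx ⟨k, h'⟩, h1⟩

theorem continuous_ρ : Continuous Γ.ρ := by
  obtain ⟨k, t, hm, h0, h1, hd⟩ := Γ.piecewise
  have hp : ∀ j ≤ k, ContinuousOn Γ.ρ (Icc 0 (t j)) := by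
    intro j
    induction j with
    | zero => intro _; rw [h0, Icc_self]; exact continuousOn_singleton _ _
    | succ j ih =>
      intro hj
      have h2 : 0 ≤ t j := h0 ▸ hm (Nat.zero_le j)
      rw [← Icc_union_Icc_eq_Icc h2 (hm (Nat.le_succ j))]
      exact (ih (by omega)).union_of_isClosed (hd j (by omega)).continuousOn isClosed_Icc
        isClosed_Icc
  have hI := hp k le_rfl
  rw [h1] at hI
  have c0 : ContinuousOn Γ.ρ (Iic 0) := ContinuousOn.congr (f := fun s : ℝ => ((Γ.a - s : ℝ) : ℂ))
    (by fun_prop) fun s hs => Γ.ρ_upper s hs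
  have c1 : ContinuousOn Γ.ρ (Ici 1) := ContinuousOn.congr
    (f := fun s : ℝ => ((-Γ.a - (s - 1) : ℝ) : ℂ)) (by fun_prop) fun s hs => Γ.ρ_lower s hs
  have := (c0.union_of_isClosed hI isClosed_Iic isClosed_Icc).union_of_isClosed c1
    (isClosed_Iic.union isClosed_Icc) isClosed_Ici
  rw [← continuousOn_univ]
  refine this.mono fun s _ => ?_
  rcases le_total s 0 with h | h
  · exact Or.inl (Or.inl h)
  · rcases le_total s 1 with h' | h'
    · exact Or.inl (Or.inr ⟨h, h'⟩)
    · exact Or.inr h'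

theorem hasDerivAt_upper {s : ℝ} (hs : s < 0) : HasDerivAt Γ.ρ (-1) s := by
  have h : HasDerivAt (fun s : ℝ => ((Γ.a - s : ℝ) : ℂ)) (((-1 : ℝ)) : ℂ) s :=
    ((hasDerivAt_id s).const_sub Γ.a).ofReal_comp
  simp only [Complex.ofReal_neg, Complex.ofReal_one] at h
  exact h.congr_of_eventuallyEq ((gt_mem_nhds hs).mono fun u hu => Γ.ρ_upper u hu.le)

theorem hasDerivAt_lower {s : ℝ} (hs : 1 < s) : HasDerivAt Γ.ρ (-1) s := by
  have h : HasDerivAt (fun s : ℝ => ((-Γ.a - (s - 1) : ℝ) : ℂ)) (((-1 : ℝ)) : ℂ) s :=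
    (((hasDerivAt_id s).sub_const 1).const_sub (-Γ.a)).ofReal_comp
  simp only [Complex.ofReal_neg, Complex.ofReal_one] at h
  exact h.congr_of_eventuallyEq ((lt_mem_nhds hs).mono fun u hu => Γ.ρ_lower u hu.le)

/-- The contour is differentiable with bounded derivative off a countable set. -/
theorem exists_deriv : ∃ N : Set ℝ, N.Countable ∧ ∃ C : ℝ, ∀ s ∉ N,
    DifferentiableAt ℝ Γ.ρ s ∧ ‖deriv Γ.ρ s‖ ≤ C := by
  obtain ⟨k, t, hm, h0, h1, hd⟩ := Γ.piecewise
  have hb : ∀ j, ∃ C : ℝ, 0 ≤ C ∧ (j < k → ∀ x ∈ Ioo (t j) (t (j + 1)),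
      DifferentiableAt ℝ Γ.ρ x ∧ ‖deriv Γ.ρ x‖ ≤ C) := by
    intro j
    by_cases hj : j < k
    · rcases lt_or_ge (t j) (t (j + 1)) with hlt | hge
      · have hc := (hd j hj).continuousOn_derivWithin (uniqueDiffOn_Icc hlt) le_rfl
        obtain ⟨C, hC⟩ := isCompact_Icc.exists_bound_of_continuousOn hc
        refine ⟨C, (norm_nonneg _).trans (hC (t j) (left_mem_Icc.mpr hlt.le)), fun _ x hx => ?_⟩
        have hn : Icc (t j) (t (j + 1)) ∈ 𝓝 x := Icc_mem_nhds hx.1 hx.2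
        refine ⟨((hd j hj).differentiableOn one_ne_zero).differentiableAt hn, ?_⟩
        rw [← derivWithin_of_mem_nhds hn]
        exact hC x (Ioo_subset_Icc_self hx)
      · exact ⟨0, le_rfl, fun _ x hx => absurd (hx.1.trans hx.2) (not_lt.mpr hge)⟩
    · exact ⟨0, le_rfl, fun h => absurd h hj⟩
  choose C hC0 hC using hb
  refine ⟨range t ∪ {0, 1}, (countable_range t).union (Set.toFinite _).countable,
    1 + ∑ j ∈ Finset.range k, C j, fun s hs => ?_⟩
  have hsum : 0 ≤ ∑ j ∈ Finset.range k, C j := Finset.sum_nonneg fun j _ => hC0 j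
  simp only [mem_union, mem_insert_iff, mem_singleton_iff, not_or] at hs
  obtain ⟨hs1, hs2, hs3⟩ := hs
  rcases lt_or_gt_of_ne hs2 with h | h
  · have := Γ.hasDerivAt_upper h
    refine ⟨this.differentiableAt, ?_⟩
    rw [this.deriv, norm_neg, norm_one]; linarith
  rcases lt_or_gt_of_ne hs3 with h' | h'
  · obtain ⟨j, hj, hx⟩ := exists_mem_Ioo (h0 ▸ h.le) (h1 ▸ h') hs1
    obtain ⟨d1, d2⟩ := hC j hj s hx
    refine ⟨d1, d2.trans ?_⟩
    have := Finset.single_le_sum (fun i _ => hC0 i) (Finset.mem_range.mpr hj)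
    linarith
  · have := Γ.hasDerivAt_lower h'
    refine ⟨this.differentiableAt, ?_⟩
    rw [this.deriv, norm_neg, norm_one]; linarith

theorem ae_deriv : ∃ C : ℝ, ∀ᵐ s, DifferentiableAt ℝ Γ.ρ s ∧ ‖deriv Γ.ρ s‖ ≤ C := by
  obtain ⟨N, hN, C, h⟩ := Γ.exists_deriv
  refine ⟨C, ?_⟩
  filter_upwards [hN.ae_notMem volume] with s hs using h s hs

theorem ae_deriv_sq : ∀ᵐ s, deriv (fun t => Γ.ρ t ^ 2) s = deriv Γ.ρ s * (2 * Γ.ρ s) := by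
  obtain ⟨C, h⟩ := Γ.ae_deriv
  filter_upwards [h] with s hs
  have h2 : HasDerivAt (fun t => Γ.ρ t ^ 2) _ s := hs.1.hasDerivAt.pow 2
  rw [h2.deriv]
  push_cast
  ring

theorem intervalIntegrable_deriv (a b : ℝ) : IntervalIntegrable (deriv Γ.ρ) volume a b := by
  obtain ⟨C, h⟩ := Γ.ae_deriv
  refine IntervalIntegrable.mono_fun (g := deriv Γ.ρ) (f := fun _ => C) intervalIntegrable_const
    (measurable_deriv _).aestronglyMeasurable (ae_restrict_of_ae (h.mono fun s hs => ?_))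
  exact hs.2.trans (le_abs_self C)

theorem isPath {a b : ℝ} (hab : a ≤ b) : IsPath Γ.ρ (deriv Γ.ρ) a b where
  le := hab
  cont := Γ.continuous_ρ.continuousOn
  deriv := by
    obtain ⟨N, hN, C, h⟩ := Γ.exists_deriv
    exact ⟨N, hN, fun x hx => (h x hx.2).1.hasDerivAt⟩
  int := Γ.intervalIntegrable_deriv a b

theorem ρ_mem_Omega (s : ℝ) : Γ.ρ s ∈ Omega := by
  refine ⟨?_, Γ.ne_zero (Γ.pt s)⟩
  rcases le_or_gt s 0 with h | h
  · rw [Γ.ρ_upper s h, Complex.ofReal_im]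
  rcases lt_or_ge s 1 with h1 | h1
  · exact (Γ.im_pos s h h1).le
  · rw [Γ.ρ_lower s h1, Complex.ofReal_im]

/-- The bounded set encircled by the contour contains no points of the cut. -/
theorem ofReal_sq_notMem {b : ℝ} (hb : Γ.a ≤ b) : (b : ℂ) ^ 2 ∉ S := by
  intro hS
  have ha := Γ.a_pos
  rcases eq_or_lt_of_le hb with h | h
  · exact Γ.avoids _ hS 0 (left_mem_Icc.mpr zero_le_one) (by rw [Γ.ρ_zero, h])
  have h1 := Γ.encircles _ hS
  have hsl : ∀ z ∈ IsPath.trace Γ.ρ 0 1, -Complex.I * (z - b) ∈ Complex.slitPlane ∧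
      -Complex.I * (z + b) ∈ Complex.slitPlane := by
    rintro z ⟨s, hs, rfl⟩
    have key : 0 < (Γ.ρ s).im ∨ (Γ.ρ s).re = Γ.a ∨ (Γ.ρ s).re = -Γ.a := by
      rcases eq_or_lt_of_le hs.1 with h0 | h0
      · right; left; rw [← h0, Γ.ρ_zero, Complex.ofReal_re]
      rcases eq_or_lt_of_le hs.2 with h1 | h1
      · right; right; rw [h1, Γ.ρ_one, Complex.neg_re, Complex.ofReal_re]
      · exact Or.inl (Γ.im_pos s h0 h1)
    simp only [Complex.mem_slitPlane_iff]
    constructor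
    · rcases key with k | k | k
      · left; simpa using k
      · right; simp [k]; linarith
      · right; simp [k]; linarith
    · rcases key with k | k | k
      · left; simpa using k
      · right; simp [k]; linarith
      · right; simp [k]; linarith
  have hne : ∀ z ∈ IsPath.trace Γ.ρ 0 1, z - b ≠ 0 ∧ z + b ≠ 0 := fun z hz =>
    ⟨right_ne_zero_of_mul (Complex.slitPlane_ne_zero (hsl z hz).1),
      right_ne_zero_of_mul (Complex.slitPlane_ne_zero (hsl z hz).2)⟩
  -- If `b²` belonged to `S`, then `γ'` would wind once around it. The sum of the two rotated
  -- logarithms is a primitive of `2z / (z² - b²)` along the arc and takes the same value at `a` and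
  -- at `-a`, so the winding number is 0.
  have hF := (Γ.isPath zero_le_one).integral_eq_sub
    (F := fun z => Complex.log (-Complex.I * (z - b)) + Complex.log (-Complex.I * (z + b)))
    (f := fun z => (z - b)⁻¹ + (z + b)⁻¹) (fun z hz => by
      have d1 : HasDerivAt (fun z : ℂ => -Complex.I * (z - b)) (-Complex.I) z := by
        simpa using ((hasDerivAt_id z).sub_const (b : ℂ)).const_mul (-Complex.I)
      have d2 : HasDerivAt (fun z : ℂ => -Complex.I * (z + b)) (-Complex.I) z := by
        simpa using ((hasDerivAt_id z).add_const (b : ℂ)).const_mul (-Complex.I)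
      refine ((d1.clog (hsl z hz).1).add (d2.clog (hsl z hz).2)).congr_deriv ?_
      have hI : -Complex.I ≠ 0 := neg_ne_zero.mpr Complex.I_ne_zero
      rw [div_mul_cancel_left₀ hI, div_mul_cancel_left₀ hI])
    (ContinuousOn.add (ContinuousOn.inv₀ (by fun_prop) fun z hz => (hne z hz).1)
      (ContinuousOn.inv₀ (by fun_prop) fun z hz => (hne z hz).2))
  have hI : ∫ s in (0 : ℝ)..1, deriv (fun t => Γ.ρ t ^ 2) s / (Γ.ρ s ^ 2 - (b : ℂ) ^ 2) =
      ∫ s in (0 : ℝ)..1, deriv Γ.ρ s • ((Γ.ρ s - b)⁻¹ + (Γ.ρ s + b)⁻¹) := by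
    refine intervalIntegral.integral_congr_ae ?_
    filter_upwards [Γ.ae_deriv_sq] with s hs hs1
    rw [hs, smul_eq_mul]
    rw [uIoc_of_le zero_le_one] at hs1
    obtain ⟨n1, n2⟩ := hne _ (IsPath.mem_trace hs1)
    have n3 : Γ.ρ s ^ 2 - (b : ℂ) ^ 2 ≠ 0 := by
      have : Γ.ρ s ^ 2 - (b : ℂ) ^ 2 = (Γ.ρ s - b) * (Γ.ρ s + b) := by ring
      rw [this]; exact mul_ne_zero n1 n2
    field_simp
    ring
  rw [hI, hF] at h1
  have e : ∀ {y : ℝ}, 0 < y → Complex.log (Complex.I * y) = Real.log y + Real.pi / 2 * Complex.I ∧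
      Complex.log (-Complex.I * y) = Real.log y - Real.pi / 2 * Complex.I := by
    intro y hy
    rw [mul_comm Complex.I, Complex.log_ofReal_mul hy Complex.I_ne_zero, mul_comm (-Complex.I),
      Complex.log_ofReal_mul hy (neg_ne_zero.mpr Complex.I_ne_zero), Complex.log_I,
      Complex.log_neg_I]
    exact ⟨rfl, by ring⟩
  have p1 : -Complex.I * (Γ.ρ 1 - b) = Complex.I * ((Γ.a + b : ℝ) : ℂ) := by
    rw [Γ.ρ_one]; push_cast; ring
  have p2 : -Complex.I * (Γ.ρ 1 + b) = -Complex.I * ((b - Γ.a : ℝ) : ℂ) := by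
    rw [Γ.ρ_one]; push_cast; ring
  have p3 : -Complex.I * (Γ.ρ 0 - b) = Complex.I * ((b - Γ.a : ℝ) : ℂ) := by
    rw [Γ.ρ_zero]; push_cast; ring
  have p4 : -Complex.I * (Γ.ρ 0 + b) = -Complex.I * ((Γ.a + b : ℝ) : ℂ) := by
    rw [Γ.ρ_zero]; push_cast; ring
  rw [p1, p2, p3, p4, (e (by linarith : 0 < Γ.a + b)).1, (e (by linarith : 0 < Γ.a + b)).2,
    (e (by linarith : 0 < b - Γ.a)).1, (e (by linarith : 0 < b - Γ.a)).2] at h1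
  refine zero_ne_one (α := ℂ) (Eq.trans ?_ h1)
  ring

/-- The condition `avoids` concerns `γ'` only. On the two rays the claim follows from the winding
numbers, through `ofReal_sq_notMem`. -/
theorem sq_notMem (s : ℝ) : Γ.ρ s ^ 2 ∉ S := by
  have ha := Γ.a_pos
  intro hS
  rcases le_or_gt s 0 with h | h
  · rw [Γ.ρ_upper s h] at hS
    exact Γ.ofReal_sq_notMem (by linarith) hS
  rcases le_or_gt s 1 with h1 | h1
  · exact Γ.avoids _ hS s ⟨h.le, h1⟩ rfl
  · rw [Γ.ρ_lower s h1.le, show ((-Γ.a - (s - 1) : ℝ) : ℂ) ^ 2 = ((Γ.a + (s - 1) : ℝ) : ℂ) ^ 2 by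
      push_cast; ring] at hS
    exact Γ.ofReal_sq_notMem (by linarith) hS

end Contour

/-! ### Closing the contour by a large arc and deforming it. -/

namespace Contour

variable {S : Set ℂ} (Γ : Contour S)

/-- The point `R e^{iθ}` of the arc. -/
def arc (R θ : ℝ) : ℂ := R * Complex.exp (Complex.I * θ)

theorem hasDerivAt_arc (R θ : ℝ) : HasDerivAt (arc R) (Complex.I * arc R θ) θ := by
  have h : HasDerivAt (fun θ : ℝ => Complex.I * (θ : ℂ)) (Complex.I * 1) θ :=
    (Complex.ofRealCLM.hasDerivAt (x := θ)).const_mul Complex.I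
  refine ((h.cexp).const_mul (R : ℂ)).congr_deriv ?_
  rw [arc]; ring

theorem continuous_arc (R : ℝ) : Continuous (arc R) := by unfold arc; fun_prop

theorem norm_arc {R : ℝ} (hR : 0 ≤ R) (θ : ℝ) : ‖arc R θ‖ = R := by
  rw [arc, norm_mul, mul_comm Complex.I, Complex.norm_exp_ofReal_mul_I, mul_one, Complex.norm_real,
    Real.norm_of_nonneg hR]

theorem arc_im (R θ : ℝ) : (arc R θ).im = R * Real.sin θ := by
  rw [arc, Complex.im_ofReal_mul, mul_comm Complex.I, Complex.exp_ofReal_mul_I_im]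

/-- The closed path which consists of the part `[-T, 1 + T]` of the contour and the arc of radius
`a + T`, traversed clockwise. -/
def loop (T s : ℝ) : ℂ := if s ≤ 1 + T then Γ.ρ s else arc (Γ.a + T) (Real.pi + 1 + T - s)

/-- The derivative of `loop`. -/
def loopDeriv (T s : ℝ) : ℂ := if s ≤ 1 + T then deriv Γ.ρ s else
  -(Complex.I * arc (Γ.a + T) (Real.pi + 1 + T - s))

theorem ρ_end {T : ℝ} (hT : 0 ≤ T) : Γ.ρ (1 + T) = arc (Γ.a + T) Real.pi := by
  rw [Γ.ρ_lower _ (by linarith), arc, mul_comm Complex.I, Complex.exp_pi_mul_I]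
  push_cast; ring

theorem ρ_start {T : ℝ} (hT : 0 ≤ T) : Γ.ρ (-T) = arc (Γ.a + T) 0 := by
  rw [Γ.ρ_upper _ (by linarith), arc]
  simp

theorem isPath_loop {T : ℝ} (hT : 0 ≤ T) :
    IsPath (Γ.loop T) (Γ.loopDeriv T) (-T) (1 + T + Real.pi) where
  le := by linarith [Real.pi_pos]
  cont := by
    have hc := continuous_arc (Γ.a + T)
    refine Continuous.continuousOn ?_
    unfold loop
    refine Γ.continuous_ρ.if_le (by fun_prop) continuous_id continuous_const fun s hs => ?_
    rw [show s = 1 + T from hs, Γ.ρ_end hT]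
    congr 1; ring
  deriv := by
    obtain ⟨N, hN, C, h⟩ := Γ.exists_deriv
    refine ⟨N ∪ {1 + T}, hN.union (countable_singleton _), fun s hs => ?_⟩
    simp only [Set.mem_sdiff, mem_union, mem_singleton_iff, not_or] at hs
    rcases lt_or_gt_of_ne hs.2.2 with h1 | h1
    · rw [loopDeriv, if_pos h1.le]
      exact (h s hs.2.1).1.hasDerivAt.congr_of_eventuallyEq
        ((gt_mem_nhds h1).mono fun u hu => if_pos hu.le)
    · rw [loopDeriv, if_neg (not_le.mpr h1)]
      have h2 := (hasDerivAt_arc (Γ.a + T) (Real.pi + 1 + T - s)).scomp s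
        ((hasDerivAt_id s).const_sub (Real.pi + 1 + T))
      rw [neg_one_smul] at h2
      exact h2.congr_of_eventuallyEq ((lt_mem_nhds h1).mono fun u hu => if_neg (not_le.mpr hu))
  int := by
    refine IntervalIntegrable.trans (b := 1 + T) ?_ ?_
    · refine (Γ.intervalIntegrable_deriv (-T) (1 + T)).congr fun s hs => ?_
      rw [uIoc_of_le (by linarith)] at hs
      exact (if_pos hs.2).symm
    · have hc := continuous_arc (Γ.a + T)
      have h1 : IntervalIntegrable (fun s => -(Complex.I * arc (Γ.a + T) (Real.pi + 1 + T - s)))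
          volume (1 + T) (1 + T + Real.pi) := Continuous.intervalIntegrable (by fun_prop) _ _
      refine h1.congr fun s hs => ?_
      rw [uIoc_of_le (by linarith [Real.pi_pos])] at hs
      exact (if_neg (not_le.mpr hs.1)).symm

theorem loop_closed {T : ℝ} (hT : 0 ≤ T) : Γ.loop T (-T) = Γ.loop T (1 + T + Real.pi) := by
  rw [loop, loop, if_pos (by linarith), if_neg (by linarith [Real.pi_pos]), Γ.ρ_start hT]
  congr 1; ring

variable {E : Type*} [NormedAddCommGroup E] [NormedSpace ℂ E] [CompleteSpace E]

theorem integral_loop {T : ℝ} (hT : 0 ≤ T) {f : ℂ → E}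
    (hf : ContinuousOn f (IsPath.trace (Γ.loop T) (-T) (1 + T + Real.pi))) :
    ∫ s in (-T)..(1 + T + Real.pi), Γ.loopDeriv T s • f (Γ.loop T s) =
      (∫ s in (-T)..(1 + T), deriv Γ.ρ s • f (Γ.ρ s)) -
      ∫ θ in (0 : ℝ)..Real.pi, (Complex.I * arc (Γ.a + T) θ) • f (arc (Γ.a + T) θ) := by
  have hp := Real.pi_pos
  have hi := (Γ.isPath_loop hT).intervalIntegrable_smul hf
  have h1 : IntervalIntegrable (fun s => Γ.loopDeriv T s • f (Γ.loop T s)) volume (-T) (1 + T) :=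
    hi.mono_set (by rw [uIcc_of_le (by linarith), uIcc_of_le (by linarith)]
                    exact Icc_subset_Icc le_rfl (by linarith))
  have h2 : IntervalIntegrable (fun s => Γ.loopDeriv T s • f (Γ.loop T s)) volume (1 + T)
      (1 + T + Real.pi) :=
    hi.mono_set (by rw [uIcc_of_le (by linarith), uIcc_of_le (by linarith)]
                    exact Icc_subset_Icc (by linarith) le_rfl)
  rw [← intervalIntegral.integral_add_adjacent_intervals h1 h2, sub_eq_add_neg]
  congr 1
  · refine intervalIntegral.integral_congr fun s hs => ?_
    rw [uIcc_of_le (by linarith)] at hs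
    simp only [loop, loopDeriv, if_pos hs.2]
  · have h3 := intervalIntegral.integral_comp_sub_left (a := 1 + T) (b := 1 + T + Real.pi)
      (fun θ => (Complex.I * arc (Γ.a + T) θ) • f (arc (Γ.a + T) θ)) (Real.pi + 1 + T)
    rw [show Real.pi + 1 + T - (1 + T + Real.pi) = 0 by ring,
      show Real.pi + 1 + T - (1 + T) = Real.pi by ring] at h3
    rw [← h3, ← intervalIntegral.integral_neg]
    refine intervalIntegral.integral_congr_ae (Eventually.of_forall fun s hs => ?_)
    rw [uIoc_of_le (by linarith)] at hs
    simp only [loop, loopDeriv, if_neg (not_le.mpr hs.1), neg_smul]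

theorem loop_mem {T : ℝ} (hT : 0 ≤ T) (hR : ∀ w ∈ S, ‖w‖ < (Γ.a + T) ^ 2) {z : ℂ}
    (hz : z ∈ IsPath.trace (Γ.loop T) (-T) (1 + T + Real.pi)) : z ∈ Omega ∧ z ^ 2 ∉ S := by
  have ha := Γ.a_pos
  have hR0 : 0 < Γ.a + T := by linarith
  obtain ⟨s, hs, rfl⟩ := hz
  by_cases h : s ≤ 1 + T
  · rw [loop, if_pos h]
    exact ⟨Γ.ρ_mem_Omega s, Γ.sq_notMem s⟩
  · rw [loop, if_neg h]
    have hn := norm_arc hR0.le (Real.pi + 1 + T - s)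
    refine ⟨⟨?_, fun h0 => ?_⟩, fun hS => ?_⟩
    · rw [arc_im]
      exact mul_nonneg hR0.le (Real.sin_nonneg_of_nonneg_of_le_pi (by linarith [hs.2])
        (by push Not at h; linarith))
    · rw [h0, norm_zero] at hn; linarith
    · have := hR _ hS
      rw [norm_pow, hn] at this
      exact lt_irrefl _ this

/-- Squaring maps the half circle of radius `R` in `ρ` onto the full circle of radius `R²` in `μ`.
-/
theorem integral_arc_inv {R : ℝ} {w : ℂ} (hw : ‖w‖ < R ^ 2) :
    ∫ θ in (0 : ℝ)..Real.pi, (Complex.I * arc R θ) • (2 * arc R θ / (arc R θ ^ 2 - w)) =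
      2 * Real.pi * Complex.I := by
  have h1 : w ∈ Metric.ball (0 : ℂ) (R ^ 2) := mem_ball_zero_iff.mpr hw
  rw [← circleIntegral.integral_sub_inv_of_mem_ball h1, circleIntegral]
  have h2 := intervalIntegral.smul_integral_comp_mul_left (a := 0) (b := Real.pi)
    (fun θ => deriv (circleMap 0 (R ^ 2)) θ • (circleMap 0 (R ^ 2) θ - w)⁻¹) 2
  rw [mul_zero] at h2
  rw [← h2, ← intervalIntegral.integral_smul]
  refine intervalIntegral.integral_congr fun θ _ => ?_
  have e : circleMap 0 (R ^ 2) (2 * θ) = arc R θ ^ 2 := by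
    rw [circleMap, arc, mul_pow, ← Complex.exp_nat_mul]
    push_cast
    ring_nf
  simp only [deriv_circleMap, e, smul_eq_mul, Complex.real_smul]
  push_cast
  ring

/-- The winding number of the loop about the square root of a point of `S`. -/
theorem winding_loop {T : ℝ} (hT : 0 ≤ T) (hR : ∀ w ∈ S, ‖w‖ < (Γ.a + T) ^ 2) {σ : ℂ}
    (hσ : σ ^ 2 ∈ S) (him : 0 < σ.im) :
    ∫ s in (-T)..(1 + T + Real.pi), Γ.loopDeriv T s • (Γ.loop T s - σ)⁻¹ = 0 := by
  have hpath := Γ.isPath_loop hT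
  have hmem := fun z => Γ.loop_mem hT hR (z := z)
  have ha := Γ.a_pos
  set K := IsPath.trace (Γ.loop T) (-T) (1 + T + Real.pi) with hK
  have hne : ∀ z ∈ K, z - σ ≠ 0 ∧ z + σ ≠ 0 ∧ z ^ 2 - σ ^ 2 ≠ 0 := by
    intro z hz
    have h3 : z ^ 2 - σ ^ 2 ≠ 0 := fun h => (hmem z hz).2 (sub_eq_zero.mp h ▸ hσ)
    have e : z ^ 2 - σ ^ 2 = (z - σ) * (z + σ) := by ring
    rw [e] at h3
    exact ⟨left_ne_zero_of_mul h3, right_ne_zero_of_mul h3, e ▸ h3⟩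
  -- The point `-σ` lies in the open lower half-plane and the loop in the closed upper one, so the
  -- winding number about `-σ` is zero.
  have h0 : ∫ s in (-T)..(1 + T + Real.pi), Γ.loopDeriv T s • (Γ.loop T s - (-σ))⁻¹ = 0 := by
    refine hpath.integral_log (Γ.loop_closed hT) (c := -Complex.I)
      (neg_ne_zero.mpr Complex.I_ne_zero) fun z hz => ?_
    rw [Complex.mem_slitPlane_iff]
    left
    have := (hmem z hz).1.1
    simp
    linarith
  simp only [sub_neg_eq_add] at h0
  have c1 : ContinuousOn (fun z : ℂ => (z - σ)⁻¹) K :=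
    ContinuousOn.inv₀ (by fun_prop) fun z hz => (hne z hz).1
  have c2 : ContinuousOn (fun z : ℂ => (z + σ)⁻¹) K :=
    ContinuousOn.inv₀ (by fun_prop) fun z hz => (hne z hz).2.1
  have c3 : ContinuousOn (fun z : ℂ => 2 * z / (z ^ 2 - σ ^ 2)) K :=
    ContinuousOn.div (by fun_prop) (by fun_prop) fun z hz => (hne z hz).2.2
  -- The windings about `σ` and `-σ` add up to that of the squared loop about `σ²`. The latter
  -- vanishes: `γ'` contributes `2πi`, the large arc, traversed clockwise, `-2πi`, and the two rays
  -- cancel.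
  refine (add_zero _).symm.trans ?_
  nth_rewrite 1 [← h0]
  rw [← intervalIntegral.integral_add (hpath.intervalIntegrable_smul c1)
      (hpath.intervalIntegrable_smul c2)]
  have e1 : ∫ s in (-T)..(1 + T + Real.pi), (Γ.loopDeriv T s • (Γ.loop T s - σ)⁻¹ +
      Γ.loopDeriv T s • (Γ.loop T s + σ)⁻¹) = ∫ s in (-T)..(1 + T + Real.pi), Γ.loopDeriv T s •
        (2 * Γ.loop T s / (Γ.loop T s ^ 2 - σ ^ 2)) := by
    refine intervalIntegral.integral_congr fun s hs => ?_
    rw [uIcc_of_le hpath.le] at hs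
    obtain ⟨n1, n2, n3⟩ := hne _ (mem_image_of_mem _ hs)
    simp only [← smul_add]
    congr 1
    field_simp
    ring
  have e2 := Γ.integral_loop hT c3
  rw [e1, e2, integral_arc_inv (hR _ hσ), sub_eq_zero]
  set q : ℝ → ℂ := fun s => deriv Γ.ρ s • (2 * Γ.ρ s / (Γ.ρ s ^ 2 - σ ^ 2)) with hq
  have hqi : ∀ c d : ℝ, IntervalIntegrable q volume c d := fun c d => by
    refine (Γ.intervalIntegrable_deriv c d).smul_continuousOn
      (g := fun s => 2 * Γ.ρ s / (Γ.ρ s ^ 2 - σ ^ 2)) ?_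
    have := Γ.continuous_ρ
    exact (Continuous.div (by fun_prop) (by fun_prop) fun s (h : Γ.ρ s ^ 2 - σ ^ 2 = 0) =>
      Γ.sq_notMem s (sub_eq_zero.mp h ▸ hσ)).continuousOn
  rw [← intervalIntegral.integral_add_adjacent_intervals (hqi (-T) 1) (hqi 1 (1 + T)),
    ← intervalIntegral.integral_add_adjacent_intervals (hqi (-T) 0) (hqi 0 1)]
  have e3 : ∫ s in (0 : ℝ)..1, q s = 2 * Real.pi * Complex.I := by
    have h1 := Γ.encircles _ hσ
    have hc : (2 * (Real.pi : ℂ) * Complex.I) ≠ 0 := Complex.two_pi_I_ne_zero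
    rw [inv_mul_eq_iff_eq_mul₀ hc, mul_one] at h1
    rw [← h1]
    refine intervalIntegral.integral_congr_ae ?_
    filter_upwards [Γ.ae_deriv_sq] with s hs _
    simp only [hs, hq, smul_eq_mul]
    ring
  -- In the variable `μ` the two sides of the cut are the same segment traversed in opposite
  -- directions; here the integrand is single-valued in `μ`.
  have e4 : ∫ s in (1 : ℝ)..(1 + T), q s = -∫ s in (-T)..(0 : ℝ), q s := by
    have h1 := intervalIntegral.integral_comp_sub_left (a := -T) (b := 0) q 1
    rw [sub_zero, sub_neg_eq_add] at h1
    rw [← h1, ← intervalIntegral.integral_neg]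
    refine intervalIntegral.integral_congr_ae ?_
    filter_upwards [Measure.ae_ne volume (0 : ℝ)] with s hs0 hs
    rw [uIoc_of_le (by linarith)] at hs
    have hs1 : s < 0 := lt_of_le_of_ne hs.2 hs0
    simp only [hq]
    rw [(Γ.hasDerivAt_upper hs1).deriv, (Γ.hasDerivAt_lower (by linarith : 1 < 1 - s)).deriv,
      Γ.ρ_upper s hs1.le, Γ.ρ_lower (1 - s) (by linarith)]
    rw [show ((-Γ.a - (1 - s - 1) : ℝ) : ℂ) = -((Γ.a - s : ℝ) : ℂ) by push_cast; ring]
    simp only [smul_eq_mul, even_two, Even.neg_pow]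
    ring
  rw [e3, e4]
  ring

/-- The contour may be deformed to an arc. -/
theorem integral_eq_arc (hS : IsClosed S) (h0 : (0 : ℂ) ∈ S) {T : ℝ} (hT : 0 ≤ T)
    (hR : ∀ w ∈ S, ‖w‖ < (Γ.a + T) ^ 2) {f : ℂ → E}
    (hc : ContinuousOn f {τ | τ ∈ Omega ∧ τ ^ 2 ∉ S})
    (hd : DifferentiableOn ℂ f {τ | 0 < τ.im ∧ τ ^ 2 ∉ S}) :
    ∫ s in (-T)..(1 + T), deriv Γ.ρ s • f (Γ.ρ s) =
      ∫ θ in (0 : ℝ)..Real.pi, (Complex.I * arc (Γ.a + T) θ) • f (arc (Γ.a + T) θ) := by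
  have hpath := Γ.isPath_loop hT
  have hmem := fun z => Γ.loop_mem hT hR (z := z)
  set K := IsPath.trace (Γ.loop T) (-T) (1 + T + Real.pi) with hK
  rw [← sub_eq_zero, ← Γ.integral_loop hT (hc.mono hmem)]
  have hO : IsOpen {τ : ℂ | τ ^ 2 ∉ S} := hS.isOpen_compl.preimage (by fun_prop)
  obtain ⟨δ, hδ, hKδ⟩ := hpath.isCompact_trace.exists_thickening_subset_open hO
    fun z hz => (hmem z hz).2
  have hKδ' : ∀ z ∈ K, ∀ w : ℂ, ‖w - z‖ < δ → w ^ 2 ∉ S := fun z hz w hw =>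
    hKδ (Metric.mem_thickening_iff.mpr ⟨z, hz, by rwa [dist_eq_norm]⟩)
  have hshift : ∀ z ∈ K, ∀ ε : ℝ, 0 ≤ ε → ε < δ →
      (z + Complex.I * ε) ∈ {τ | τ ∈ Omega ∧ τ ^ 2 ∉ S} := by
    intro z hz ε hε hεδ
    have h1 : (z + Complex.I * ε) ^ 2 ∉ S := hKδ' z hz _ (by
      rw [add_sub_cancel_left, norm_mul, Complex.norm_I, one_mul, Complex.norm_real,
        Real.norm_of_nonneg hε]; exact hεδ)
    refine ⟨⟨?_, fun h => h1 (by rw [h]; simpa using h0)⟩, h1⟩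
    have := (hmem z hz).1.1
    simp
    linarith
  -- On the real axis `f` is merely continuous, so the loop is moved up by `iε` into the domain of
  -- holomorphy. The winding numbers about excluded points do not change: in the upper half-plane
  -- these points are at distance at least `δ` from the loop, and all others lie below the shifted
  -- loop.
  have hzero : ∀ ε : ℝ, 0 < ε → ε < δ → ∫ s in (-T)..(1 + T + Real.pi),
      Γ.loopDeriv T s • f (Γ.loop T s + Complex.I * ε) = 0 := by
    intro ε hε hεδ
    have hp := hpath.add_const (Complex.I * ε)
    have htr : ∀ z ∈ IsPath.trace (fun s => Γ.loop T s + Complex.I * ε) (-T) (1 + T + Real.pi),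
        ∃ z' ∈ K, z = z' + Complex.I * ε := by
      rintro z ⟨s, hs, rfl⟩
      exact ⟨_, mem_image_of_mem _ hs, rfl⟩
    refine hp.integral_eq_zero (by rw [Γ.loop_closed hT])
      (U := {τ | 0 < τ.im ∧ τ ^ 2 ∉ S}) (isOpen_upper.inter hO) ?_ ?_ hd
    · intro z hz
      obtain ⟨z', hz', rfl⟩ := htr z hz
      refine ⟨?_, (hshift z' hz' ε hε.le hεδ).2⟩
      have := (hmem z' hz').1.1
      simp
      linarith
    · intro ζ hζ
      by_cases him : 0 < ζ.im
      · have hζS : ζ ^ 2 ∈ S := by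
          by_contra h
          exact hζ ⟨him, h⟩
        rw [← Γ.winding_loop hT hR hζS him]
        have h2 := hpath.integral_inv_eq (Γ.loop_closed hT) (w := ζ - Complex.I * ε) (w₀ := ζ)
          fun z hz => by
            rw [sub_sub_cancel_left, norm_neg, norm_mul, Complex.norm_I, one_mul, Complex.norm_real,
              Real.norm_of_nonneg hε.le, norm_sub_rev]
            refine lt_of_lt_of_le hεδ ?_
            by_contra! h
            exact hKδ' z hz ζ h hζS
        rw [← h2]
        refine intervalIntegral.integral_congr fun s _ => ?_
        congr 2
        ring
      · refine hp.integral_log (by rw [Γ.loop_closed hT]) (c := -Complex.I)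
          (neg_ne_zero.mpr Complex.I_ne_zero) fun z hz => ?_
        obtain ⟨z', hz', rfl⟩ := htr z hz
        rw [Complex.mem_slitPlane_iff]
        left
        have := (hmem z' hz').1.1
        simp
        linarith
  set W : Set ℂ := {τ | τ ∈ Omega ∧ τ ^ 2 ∉ S} with hW
  have hKc : IsCompact ((fun p : ℂ × ℝ => p.1 + Complex.I * p.2) '' (K ×ˢ Icc 0 (δ / 2))) :=
    (hpath.isCompact_trace.prod isCompact_Icc).image (by fun_prop)
  have hKW : ((fun p : ℂ × ℝ => p.1 + Complex.I * p.2) '' (K ×ˢ Icc 0 (δ / 2))) ⊆ W := by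
    rintro _ ⟨⟨z, ε⟩, ⟨hz, hε⟩, rfl⟩
    exact hshift z hz ε hε.1 (by linarith [hε.2])
  obtain ⟨C, hC⟩ := hKc.exists_bound_of_continuousOn (hc.mono hKW)
  have hev : ∀ᶠ ε : ℝ in 𝓝[>] 0, 0 < ε ∧ ε ≤ δ / 2 := by
    filter_upwards [self_mem_nhdsWithin, nhdsWithin_le_nhds (Iic_mem_nhds (half_pos hδ))] with ε h1 h2
    exact ⟨h1, h2⟩
  -- As `ε → 0` the shifted integrals converge to the original one, since `f` is continuous up to
  -- the boundary and bounded on the compact set swept by the loop.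
  have hlim : Tendsto (fun ε : ℝ => ∫ s in (-T)..(1 + T + Real.pi),
      Γ.loopDeriv T s • f (Γ.loop T s + Complex.I * ε)) (𝓝[>] 0)
      (𝓝 (∫ s in (-T)..(1 + T + Real.pi), Γ.loopDeriv T s • f (Γ.loop T s))) := by
    refine intervalIntegral.tendsto_integral_filter_of_dominated_convergence
      (fun s => ‖Γ.loopDeriv T s‖ * C) ?_ ?_ (hpath.int.norm.mul_const C) ?_
    · filter_upwards [hev] with ε hε
      rw [uIoc_of_le hpath.le]
      refine ((hpath.add_const (Complex.I * ε)).integrable_smul (f := f) (hc.mono ?_)).aestronglyMeasurable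
      rintro _ ⟨s, hs, rfl⟩
      exact hshift _ (mem_image_of_mem _ hs) ε hε.1.le (by linarith [hε.2])
    · filter_upwards [hev] with ε hε
      refine Eventually.of_forall fun s hs => ?_
      rw [uIoc_of_le hpath.le] at hs
      rw [norm_smul]
      exact mul_le_mul_of_nonneg_left (hC _ ⟨(_, ε), ⟨IsPath.mem_trace hs, hε.1.le, hε.2⟩, rfl⟩)
        (norm_nonneg _)
    · refine Eventually.of_forall fun s hs => ?_
      rw [uIoc_of_le hpath.le] at hs
      refine Tendsto.const_smul ?_ _
      have hz := IsPath.mem_trace hs (γ := Γ.loop T)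
      refine (hc _ (hmem _ hz)).tendsto.comp (tendsto_nhdsWithin_iff.mpr ⟨?_, ?_⟩)
      · have : Tendsto (fun ε : ℝ => Γ.loop T s + Complex.I * ε) (𝓝 0)
            (𝓝 (Γ.loop T s + Complex.I * (0 : ℝ))) := Continuous.tendsto (by fun_prop) 0
        simp only [Complex.ofReal_zero, mul_zero, add_zero] at this
        exact this.mono_left nhdsWithin_le_nhds
      · filter_upwards [hev] with ε hε
        exact hshift _ hz ε hε.1.le (by linarith [hε.2])
  refine tendsto_nhds_unique hlim (tendsto_const_nhds.congr' ?_)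
  filter_upwards [hev] with ε hε
  exact (hzero ε hε.1 (by linarith [hε.2])).symm

end Contour

/-! ### The integrand of the contour integral and its remainder terms. -/

open Asymptotics

theorem intervalIntegral_const_mul {n : ℕ} (c : Mat n) {f : ℝ → Mat n} {a b : ℝ}
    (hf : IntervalIntegrable f volume a b) : ∫ t in a..b, c * f t = c * ∫ t in a..b, f t :=
  (ContinuousLinearMap.mul ℂ (Mat n) c).intervalIntegral_comp_comm hf

theorem intervalIntegral_mul_const {n : ℕ} (c : Mat n) {f : ℝ → Mat n} {a b : ℝ}
    (hf : IntervalIntegrable f volume a b) : ∫ t in a..b, f t * c = (∫ t in a..b, f t) * c :=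
  ((ContinuousLinearMap.mul ℂ (Mat n)).flip c).intervalIntegral_comp_comm hf

namespace Problem

variable {n : ℕ} (L K : Problem n)

/-- The Weyl solution `e(x, ρ) J(ρ)⁻¹`. -/
def weylSol (z : ℂ × ℝ) : Mat n :=
  Complex.exp (Complex.I * z.1 * z.2) • (jostU L.Q z.1 z.2 * (L.jostMatrix z.1)⁻¹)

/-- The derivative of the Weyl solution. -/
def weylSolDer (z : ℂ × ℝ) : Mat n :=
  Complex.exp (Complex.I * z.1 * z.2) • (jostV L.Q z.1 z.2 * (L.jostMatrix z.1)⁻¹)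

theorem tr_A : L.tr.A = L.A.transpose := rfl

theorem tr_weightInv (ρ : ℂ) : L.tr.weightInv ρ = (L.weightInv ρ).transpose := by
  simp [weightInv, tr_Aperp, tr_A]

theorem tr_jostLeadInv (ρ : ℂ) : L.tr.jostLeadInv ρ = (L.jostLeadInv ρ).transpose := by
  simp [jostLeadInv, tr_Aperp, tr_A]

theorem tr_leadDer (z : ℂ × ℝ) : (L.tr.leadDer z).transpose = L.leadDer z := by
  simp [leadDer, tr_Aperp, tr_A]

/-- The trigonometric leading terms collapse by `cosE - sinE = 1` and `A + A^⊥ = 1`. -/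
theorem sub_mul_lead (z : ℂ × ℝ) :
    (L.A - L.Aperp) * L.leadDer z - L.lead z * (L.A - L.Aperp) = -1 := by
  have h := cosE_sub_sinE z.1 z.2
  simp only [lead, leadDer, sub_mul, mul_sub, mul_add, add_mul, smul_mul_assoc, mul_smul_comm,
    L.A_mul_self, L.A_mul_Aperp, L.Aperp_mul_A, L.Aperp_mul_self, smul_zero]
  rw [show (-1 : Mat n) = -((cosE z.1 z.2 - sinE z.1 z.2) • (L.A + L.Aperp)) by
    rw [h, one_smul, L.A_add_Aperp]]
  module

/-- The first remainder term. -/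
def remOne (z : ℂ × ℝ) : Mat n :=
  L.weylSol z * K.solStarDer (z.1 ^ 2) z.2 - L.sol (z.1 ^ 2) z.2 * (K.tr.weylSolDer z).transpose + 1

/-- The second remainder term. -/
def remTwo (z : ℂ × ℝ) : Mat n :=
  L.weylSol z * K.solStar (z.1 ^ 2) z.2 - L.sol (z.1 ^ 2) z.2 * (K.tr.weylSol z).transpose

theorem sol_eq_solW {z : ℂ × ℝ} (hz : z.1 ≠ 0) : L.sol (z.1 ^ 2) z.2 =
    (Complex.exp (Complex.I * z.1 * z.2))⁻¹ • (L.solW z * L.weightInv z.1) := by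
  rw [solW, smul_mul_assoc, inv_smul_smul₀ (Complex.exp_ne_zero _), mul_assoc,
    L.weight_mul_weightInv hz, mul_one]

theorem solDer_eq_solDerW {z : ℂ × ℝ} (hz : z.1 ≠ 0) : L.solDer (z.1 ^ 2) z.2 =
    (Complex.exp (Complex.I * z.1 * z.2))⁻¹ • (L.solDerW z * L.weightInv z.1) := by
  rw [solDerW, smul_mul_assoc, inv_smul_smul₀ (Complex.exp_ne_zero _), mul_assoc,
    L.weight_mul_weightInv hz, mul_one]

theorem solStar_eq_solW {z : ℂ × ℝ} (hz : z.1 ≠ 0) : L.solStar (z.1 ^ 2) z.2 =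
    (Complex.exp (Complex.I * z.1 * z.2))⁻¹ • (L.weightInv z.1 * (L.tr.solW z).transpose) := by
  rw [solStar, L.tr.sol_eq_solW hz, Matrix.transpose_smul, Matrix.transpose_mul, tr_weightInv,
    Matrix.transpose_transpose]

theorem solStarDer_eq_solDerW {z : ℂ × ℝ} (hz : z.1 ≠ 0) : L.solStarDer (z.1 ^ 2) z.2 =
    (Complex.exp (Complex.I * z.1 * z.2))⁻¹ • (L.weightInv z.1 * (L.tr.solDerW z).transpose) := by
  rw [solStarDer, L.tr.solDer_eq_solDerW hz, Matrix.transpose_smul, Matrix.transpose_mul,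
    tr_weightInv, Matrix.transpose_transpose]

theorem weylSol_eq {z : ℂ × ℝ} (hz : z.1 ≠ 0) : L.weylSol z = Complex.exp (Complex.I * z.1 * z.2) •
    (jostU L.Q z.1 z.2 * L.jostB z.1 * L.jostLeadInv z.1) := by
  rw [weylSol, L.jostMatrix_inv_eq hz]
  simp only [mul_assoc]

theorem weylSolDer_eq {z : ℂ × ℝ} (hz : z.1 ≠ 0) : L.weylSolDer z =
    Complex.exp (Complex.I * z.1 * z.2) •
      ((Complex.I * z.1) • (((Complex.I * z.1)⁻¹ • jostV L.Q z.1 z.2) * L.jostB z.1) *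
        L.jostLeadInv z.1) := by
  have hI : Complex.I * z.1 ≠ 0 := mul_ne_zero Complex.I_ne_zero hz
  rw [weylSolDer, L.jostMatrix_inv_eq hz]
  simp only [smul_mul_assoc]
  rw [smul_inv_smul₀ hI]
  simp only [mul_assoc]



theorem weightInv_congr (hA : K.A = L.A) (ρ : ℂ) : K.weightInv ρ = L.weightInv ρ := by
  simp only [weightInv, Aperp, hA]

theorem jostLeadInv_congr (hA : K.A = L.A) (ρ : ℂ) : K.jostLeadInv ρ = L.jostLeadInv ρ := by
  simp only [jostLeadInv, Aperp, hA]

/-- The exponentials of `φ` and of the Weyl solution cancel. The weight and the leading part of the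
Jost matrix, built from the same `A`, combine to `(iρ)⁻¹ (A - A^⊥)`, and only bounded factors
remain. -/
theorem remOne_eq (hA : K.A = L.A) {z : ℂ × ℝ} (hz : z.1 ≠ 0) : L.remOne K z =
    (jostU L.Q z.1 z.2 * L.jostB z.1) * (L.A - L.Aperp) *
      ((Complex.I * z.1)⁻¹ • K.tr.solDerW z).transpose -
    L.solW z * (L.A - L.Aperp) *
      (((Complex.I * z.1)⁻¹ • jostV K.tr.Q z.1 z.2) * K.tr.jostB z.1).transpose + 1 := by
  have hI : Complex.I * z.1 ≠ 0 := mul_ne_zero Complex.I_ne_zero hz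
  have h1 := L.jostLeadInv_mul_weightInv z.1
  have h2 := L.weightInv_mul_jostLeadInv z.1
  rw [remOne, L.weylSol_eq hz, K.solStarDer_eq_solDerW hz, L.sol_eq_solW hz,
    K.tr.weylSolDer_eq hz, weightInv_congr L K hA, Matrix.transpose_smul, Matrix.transpose_mul,
    tr_jostLeadInv, Matrix.transpose_transpose, jostLeadInv_congr L K hA]
  have e1 : ∀ a b c d : Mat n, a * b * (c * d) = a * (b * c) * d := fun a b c d => by
    simp only [mul_assoc]
  rw [smul_mul_smul_comm, smul_mul_smul_comm, mul_inv_cancel₀ (Complex.exp_ne_zero _),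
    inv_mul_cancel₀ (Complex.exp_ne_zero _), one_smul, one_smul,
    e1 (jostU L.Q z.1 z.2 * L.jostB z.1) (L.jostLeadInv z.1), e1 (L.solW z) (L.weightInv z.1), h1, h2,
    Matrix.transpose_smul, Matrix.transpose_smul]
  simp only [mul_smul_comm, smul_mul_assoc]
  rw [smul_inv_smul₀ hI]

theorem remTwo_eq (hA : K.A = L.A) {z : ℂ × ℝ} (hz : z.1 ≠ 0) : L.remTwo K z =
    (Complex.I * z.1)⁻¹ • ((jostU L.Q z.1 z.2 * L.jostB z.1) * (L.A - L.Aperp) *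
      (K.tr.solW z).transpose -
    L.solW z * (L.A - L.Aperp) * (jostU K.tr.Q z.1 z.2 * K.tr.jostB z.1).transpose) := by
  have h1 := L.jostLeadInv_mul_weightInv z.1
  have h2 := L.weightInv_mul_jostLeadInv z.1
  rw [remTwo, L.weylSol_eq hz, K.solStar_eq_solW hz, L.sol_eq_solW hz,
    K.tr.weylSol_eq hz, weightInv_congr L K hA, Matrix.transpose_smul, Matrix.transpose_mul,
    tr_jostLeadInv, Matrix.transpose_transpose, jostLeadInv_congr L K hA]
  have e1 : ∀ a b c d : Mat n, a * b * (c * d) = a * (b * c) * d := fun a b c d => by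
    simp only [mul_assoc]
  rw [smul_mul_smul_comm, smul_mul_smul_comm, mul_inv_cancel₀ (Complex.exp_ne_zero _),
    inv_mul_cancel₀ (Complex.exp_ne_zero _), one_smul, one_smul,
    e1 (jostU L.Q z.1 z.2 * L.jostB z.1) (L.jostLeadInv z.1), e1 (L.solW z) (L.weightInv z.1), h1, h2]
  simp only [mul_smul_comm, smul_mul_assoc]
  rw [← smul_sub]

theorem solDerW_asymp : (fun z => (Complex.I * z.1)⁻¹ • L.solDerW z - L.leadDer z) =O[far]
    (fun z => z.1⁻¹) := by
  refine (IsBigO.far_I_inv_smul L.solW_asymp.2).congr' (far_mem.mono fun z hz => ?_)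
    EventuallyEq.rfl
  have hI : Complex.I * z.1 ≠ 0 := mul_ne_zero Complex.I_ne_zero hz.1.2
  simp only
  rw [smul_sub, inv_smul_smul₀ hI]

theorem far_bdd_of_sub_one {f : ℂ × ℝ → Mat n} (hf : (fun z => f z - 1) =O[far] (fun z => z.1⁻¹)) :
    f =O[far] (fun _ => (1 : ℂ)) := by
  simpa using (hf.trans isBigO_far_inv_one).add (isBigO_far_const (1 : Mat n))

/-- Every factor is replaced by its leading term at the cost of `O(ρ⁻¹)`. The leading terms give
`-1` by `sub_mul_lead`, which the summand 1 in `remOne` cancels. -/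
theorem remOne_asymp (hA : K.A = L.A) : L.remOne K =O[far] (fun z => z.1⁻¹) := by
  set s := L.A - L.Aperp with hs
  have hsc := isBigO_far_const s
  have ha := L.weylSol_asymp.1
  have hc := IsBigO.far_transpose K.tr.weylSol_asymp.2
  have hp := IsBigO.far_transpose K.tr.solDerW_asymp
  have hp1 := IsBigO.far_transpose K.tr.solDerW_isBigO
  have t1 := far_one_mul (far_one_mul ha hsc) hp1
  have t2 := far_one_mul hsc hp
  have t3 := far_one_mul (far_one_mul L.solW_isBigO hsc) hc
  have t4 := far_one_mul L.solW_asymp.1 hsc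
  simp only [mul_one, one_mul] at t1 t2 t3 t4
  refine ((t1.add t2).sub (t3.add t4)).congr' (far_mem.mono fun z hz => ?_) EventuallyEq.rfl
  have hl : K.leadDer z = L.leadDer z := by simp only [leadDer, Aperp, hA]
  have h := L.sub_mul_lead z
  simp only
  rw [L.remOne_eq K hA hz.1.2, Matrix.transpose_sub, Matrix.transpose_sub, Matrix.transpose_one,
    tr_leadDer, hl, ← hs]
  rw [← hs] at h
  simp only [sub_mul, mul_sub, one_mul, mul_one]
  rw [sub_eq_iff_eq_add] at h
  rw [h]
  abel

theorem remTwo_asymp (hA : K.A = L.A) : L.remTwo K =O[far] (fun z => z.1⁻¹) := by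
  have hsc := isBigO_far_const (L.A - L.Aperp)
  have ha := far_bdd_of_sub_one L.weylSol_asymp.1
  have hc := IsBigO.far_transpose (far_bdd_of_sub_one K.tr.weylSol_asymp.1)
  have hp := IsBigO.far_transpose K.tr.solW_isBigO
  have t1 := far_one_mul (far_one_mul ha hsc) hp
  have t3 := far_one_mul (far_one_mul L.solW_isBigO hsc) hc
  simp only [mul_one] at t1 t3
  exact (IsBigO.far_I_inv_smul (t1.sub t3)).congr' (far_mem.mono fun z hz =>
    (L.remTwo_eq K hA hz.1.2).symm) EventuallyEq.rfl

/-- `∫_0^x ψ*(t, μ) φ(t, λ) dt`. -/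
def psiD (x : ℝ) (lam mu : ℂ) : Mat n :=
  ∫ t in (0 : ℝ)..x, (L.tr.psi mu t).transpose * L.sol lam t

theorem weylSol_eq_psi {ρ : ℂ} (hρ : ρ ∈ Omega) (hJ : IsUnit (L.jostMatrix ρ)) {x : ℝ}
    (hx : 0 ≤ x) : L.weylSol (ρ, x) = L.psi (ρ ^ 2) x + L.sol (ρ ^ 2) x * L.weylMatrix ρ := by
  obtain ⟨P', -, -, h⟩ := L.weyl_solution hρ hJ
  exact (h x hx).1.symm

/-- The Wronskian of the Weyl solution of the transposed problem and of `φ`. -/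
theorem weylStar_wronskian {ρ : ℂ} (hρ : ρ ∈ Omega) (hJ : IsUnit (L.jostMatrix ρ))
    (hJt : IsUnit (L.tr.jostMatrix ρ)) (lam : ℂ) {x : ℝ} (hx : 0 ≤ x) :
    (L.tr.weylSolDer (ρ, x)).transpose * L.sol lam x -
      (L.tr.weylSol (ρ, x)).transpose * L.solDer lam x =
    1 + (lam - ρ ^ 2) • (L.psiD x lam (ρ ^ 2) + L.weylMatrix ρ * L.D x lam (ρ ^ 2)) := by
  obtain ⟨P', h1, h2, h3⟩ := L.tr.weyl_solution hρ hJt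
  obtain ⟨k1, k2, k3⟩ := L.isSol_sol lam
  have hM := L.weylMatrix_tr hρ hJ hJt
  have e : (fun t => (L.tr.Q t).transpose) = L.Q := by
    funext t; exact Matrix.transpose_transpose _
  have h1' := h1.transpose
  rw [e] at h1'
  have hw := (k1.wronskian h1').eq x hx
  obtain ⟨p1, p2, p3⟩ := isSol_cauchySol L.tr.integrable_Q (-L.tr.Aperp) L.tr.A (ρ ^ 2)
  obtain ⟨q1, q2, q3⟩ := L.tr.isSol_sol (ρ ^ 2)
  rw [weylSol, weylSolDer, ← (h3 x hx).1, ← (h3 x hx).2]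
  rw [hw]
  congr 1
  · rw [h2, k2, k3, q2, psi, p2]
    simp only [Matrix.transpose_add, Matrix.transpose_mul, Matrix.transpose_neg, tr_Aperp, tr_A,
      Matrix.transpose_transpose, hM]
    rw [show L.tr.h.transpose = L.h from Matrix.transpose_transpose _]
    have a1 := L.A_mul_self
    have a2 := L.A_mul_h
    have a3 := L.h_mul_A
    have a4 := L.Aperp_mul_A
    have a5 := L.A_mul_Aperp
    have a6 := L.Aperp_mul_self
    have a7 : L.Aperp * L.h = 0 := by rw [Aperp, sub_mul, one_mul, a2, sub_self]
    simp only [add_mul, mul_add, mul_assoc, neg_mul, a1, a2, a3, a4, a5, a6, a7, mul_zero,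
      ← L.A_add_Aperp]
    abel
  · rw [intervalIntegral.integral_smul]
    congr 1
    rw [psiD, L.D_eq hx]
    have c1 := L.continuous_sol.comp (by fun_prop : Continuous fun t : ℝ => (lam, t))
    have c2 := L.continuous_solStar.comp (by fun_prop : Continuous fun t : ℝ => (ρ ^ 2, t))
    have c3 : Continuous fun t => (L.tr.psi (ρ ^ 2) t).transpose :=
      (transposeCLM n).continuous.comp (continuous_cauchySol_right L.tr.integrable_Q _ _ (ρ ^ 2))
    have i1 : IntervalIntegrable (fun t => (L.tr.psi (ρ ^ 2) t).transpose * L.sol lam t) volume 0 x :=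
      (c3.mul c1).intervalIntegrable _ _
    have i2 : IntervalIntegrable (fun t => L.solStar (ρ ^ 2) t * L.sol lam t) volume 0 x :=
      (c2.mul c1).intervalIntegrable _ _
    rw [← intervalIntegral_const_mul _ i2, ← intervalIntegral.integral_add i1 (i2.const_mul _)]
    refine intervalIntegral.integral_congr fun t _ => ?_
    simp only [Matrix.transpose_add, Matrix.transpose_mul, hM, add_mul, mul_assoc, solStar]

/-- The integrand of the contour integral on a large arc. -/
theorem weyl_identity {ρ : ℂ} (hρ : ρ ∈ Omega) (hL : IsUnit (L.jostMatrix ρ))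
    (hK : IsUnit (K.jostMatrix ρ)) (hKt : IsUnit (K.tr.jostMatrix ρ)) (lam : ℂ) {x : ℝ}
    (hx : 0 ≤ x) : (lam - ρ ^ 2) • (L.sol (ρ ^ 2) x * (L.weylMatrix ρ - K.weylMatrix ρ) *
      K.D x lam (ρ ^ 2)) = (lam - ρ ^ 2) • (L.sol (ρ ^ 2) x * K.psiD x lam (ρ ^ 2) -
        L.psi (ρ ^ 2) x * K.D x lam (ρ ^ 2)) + (L.sol (ρ ^ 2) x - K.sol lam x) +
      (L.remOne K (ρ, x) * K.sol lam x - L.remTwo K (ρ, x) * K.solDer lam x) := by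
  have h1 := L.weylSol_eq_psi hρ hL hx
  have h2 := K.weylStar_wronskian hρ hK hKt lam hx
  have h3 := K.sub_smul_D hx lam (ρ ^ 2)
  -- The combination of `W (λ - μ) D̃` with `φ` times the starred Wronskian is computed twice: by
  -- boundary values it gives the remainder terms, and by the decomposition of both Weyl solutions
  -- it contains `(λ - μ) φ M̂ D̃`.
  have h4 : L.weylSol (ρ, x) * ((lam - ρ ^ 2) • K.D x lam (ρ ^ 2)) -
      L.sol (ρ ^ 2) x * ((K.tr.weylSolDer (ρ, x)).transpose * K.sol lam x -
      (K.tr.weylSol (ρ, x)).transpose * K.solDer lam x) + L.sol (ρ ^ 2) x - K.sol lam x +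
      K.sol lam x =
      L.remOne K (ρ, x) * K.sol lam x - L.remTwo K (ρ, x) * K.solDer lam x - K.sol lam x +
        L.sol (ρ ^ 2) x := by
    rw [h3, remOne, remTwo]
    simp only [mul_sub, sub_mul, add_mul, one_mul, mul_assoc]
    abel
  rw [h2, h1] at h4
  have h5 : L.remOne K (ρ, x) * K.sol lam x - L.remTwo K (ρ, x) * K.solDer lam x =
      (L.psi (ρ ^ 2) x + L.sol (ρ ^ 2) x * L.weylMatrix ρ) * ((lam - ρ ^ 2) • K.D x lam (ρ ^ 2)) -
      L.sol (ρ ^ 2) x * (1 + (lam - ρ ^ 2) • (K.psiD x lam (ρ ^ 2) +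
        K.weylMatrix ρ * K.D x lam (ρ ^ 2))) + K.sol lam x := by
    have := eq_sub_of_add_eq h4.symm
    rw [sub_eq_iff_eq_add] at this
    rw [this]
    abel
  rw [h5]
  simp only [mul_sub, sub_mul, add_mul, mul_add, mul_one, mul_assoc, mul_smul_comm, smul_sub,
    smul_add]
  abel

end Problem

/-! ### Analyticity of the Weyl matrix and compactness of the exceptional set. -/

open Asymptotics

namespace Problem

variable {n : ℕ} (L K : Problem n)

theorem continuousOn_jostMatrix : ContinuousOn L.jostMatrix Omega := by
  have hU : ContinuousOn (fun ρ => jostU L.Q ρ 0) Omega :=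
    IsVolterra.continuousOn_left (continuousOn_jostU L.integrable_Q) 0
  have hV := continuousOn_jostV_zero L.integrable_Q
  exact ContinuousOn.congr ((continuousOn_const.mul (hV.sub (continuousOn_const.mul hU))).sub
    (continuousOn_const.mul hU)) fun ρ hρ => L.jostMatrix_eq hρ

theorem differentiableOn_jostMatrix : DifferentiableOn ℂ L.jostMatrix {ρ | 0 < ρ.im} := by
  have hU := differentiableOn_jostU L.integrable_Q 0
  have hV := differentiableOn_jostV_zero L.integrable_Q
  exact DifferentiableOn.congr ((hV.sub (hU.const_mul L.h)).const_mul L.A |>.sub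
    (hU.const_mul L.Aperp)) fun ρ hρ => L.jostMatrix_eq (upper_subset_Omega hρ)

theorem continuousOn_weylMatrix :
    ContinuousOn L.weylMatrix {ρ | ρ ∈ Omega ∧ IsUnit (L.jostMatrix ρ)} := by
  have hU : ContinuousOn (fun ρ => jostU L.Q ρ 0) Omega :=
    IsVolterra.continuousOn_left (continuousOn_jostU L.integrable_Q) 0
  have hV := continuousOn_jostV_zero L.integrable_Q
  have hs : {ρ | ρ ∈ Omega ∧ IsUnit (L.jostMatrix ρ)} ⊆ Omega := fun ρ hρ => hρ.1
  refine ContinuousOn.congr (f := fun ρ => (L.A * jostU L.Q ρ 0 + L.Aperp * jostV L.Q ρ 0) *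
    Ring.inverse (L.jostMatrix ρ)) (((continuousOn_const.mul (hU.mono hs)).add
    (continuousOn_const.mul (hV.mono hs))).mul fun ρ hρ => ?_) fun ρ hρ => by
      rw [L.weylMatrix_eq hρ.1, Matrix.nonsing_inv_eq_ringInverse]
  obtain ⟨u, hu⟩ := hρ.2
  have h1 := NormedRing.inverse_continuousAt u
  rw [hu] at h1
  exact h1.comp_continuousWithinAt ((L.continuousOn_jostMatrix ρ hρ.1).mono hs)

theorem differentiableOn_weylMatrix :
    DifferentiableOn ℂ L.weylMatrix {ρ | 0 < ρ.im ∧ IsUnit (L.jostMatrix ρ)} := by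
  have hs : {ρ | 0 < ρ.im ∧ IsUnit (L.jostMatrix ρ)} ⊆ {ρ : ℂ | 0 < ρ.im} := fun ρ hρ => hρ.1
  have hU := (differentiableOn_jostU L.integrable_Q 0).mono hs
  have hV := (differentiableOn_jostV_zero L.integrable_Q).mono hs
  refine DifferentiableOn.congr (f := fun ρ => (L.A * jostU L.Q ρ 0 + L.Aperp * jostV L.Q ρ 0) *
    Ring.inverse (L.jostMatrix ρ)) (((hU.const_mul L.A).add (hV.const_mul L.Aperp)).mul
    fun ρ hρ => ?_) fun ρ hρ => by
      rw [L.weylMatrix_eq (upper_subset_Omega hρ.1), Matrix.nonsing_inv_eq_ringInverse]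
  exact (differentiableAt_inverse hρ.2).comp_differentiableWithinAt ρ
    ((L.differentiableOn_jostMatrix ρ hρ.1).mono hs)

theorem isUnit_jostMatrix {ρ : ℂ} (hρ : ρ ∈ Omega) (h : ρ ^ 2 ∉ L.Lam) :
    IsUnit (L.jostMatrix ρ) := by
  rw [Matrix.isUnit_iff_isUnit_det, isUnit_iff_ne_zero]
  exact fun h0 => h ⟨ρ, hρ, h0, rfl⟩

/-- The set `Λ` is bounded, and closed up to the point `0`. -/
theorem isCompact_insert_Lam : IsCompact (insert 0 L.Lam) := by
  set Z : Set ℂ := {ρ | 0 ≤ ρ.im ∧ (ρ = 0 ∨ ¬IsUnit (L.jostMatrix ρ))} with hZ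
  have hI : (fun ρ : ℂ => ρ ^ 2) '' Z = insert 0 L.Lam := by
    ext w
    constructor
    · rintro ⟨ρ, ⟨h1, h2⟩, rfl⟩
      rcases eq_or_ne ρ 0 with rfl | h0
      · left; simp
      · right
        by_contra h
        exact (h2.resolve_left h0) (L.isUnit_jostMatrix ⟨h1, h0⟩ h)
    · rintro (rfl | ⟨ρ, hρ, h0, rfl⟩)
      · exact ⟨0, ⟨le_rfl, Or.inl rfl⟩, by simp⟩
      · refine ⟨ρ, ⟨hρ.1, Or.inr ?_⟩, rfl⟩
        rw [Matrix.isUnit_iff_isUnit_det, h0]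
        exact not_isUnit_zero
  rw [← hI]
  refine IsCompact.image ?_ (by fun_prop)
  refine Metric.isCompact_of_isClosed_isBounded ?_ ?_
  -- The set where `J` is invertible is relatively open in `Ω`. With 0 added to its complement in
  -- `Ω`, the set `Z` is closed in the plane.
  · obtain ⟨V, hV, hVe⟩ := continuousOn_iff'.mp L.continuousOn_jostMatrix _ Units.isOpen
    have : Zᶜ = {ρ : ℂ | ρ.im < 0} ∪ (V ∩ {ρ | ρ ≠ 0}) ∩ {ρ | 0 ≤ ρ.im} := by
      ext ρ
      have h1 := Set.ext_iff.mp hVe ρ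
      simp only [mem_inter_iff, mem_preimage, mem_ofPred_eq, Omega] at h1
      simp only [hZ, mem_compl_iff, mem_ofPred_eq, mem_union, mem_inter_iff]
      by_cases hi : 0 ≤ ρ.im
      · have hi' : ¬ρ.im < 0 := not_lt.mpr hi
        by_cases h0 : ρ = 0 <;> simp [hi, hi', h0] at h1 ⊢
        exact h1
      · simp [hi, not_le.mp hi]
    rw [← isOpen_compl_iff]
    have : Zᶜ = {ρ : ℂ | ρ.im < 0} ∪ (V ∩ {ρ | ρ ≠ 0}) := by
      rw [this]
      ext ρ
      simp only [mem_union, mem_inter_iff, mem_ofPred_eq]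
      rcases lt_or_ge ρ.im 0 with h | h
      · simp [h]
      · simp [h]
    rw [this]
    exact (isOpen_lt Complex.continuous_im continuous_const).union
      (hV.inter isOpen_ne)
  · obtain ⟨R, hR, h⟩ := eventually_far_iff.mp L.isUnit_jostMatrix_far
    refine (Metric.isBounded_closedBall (x := (0 : ℂ)) (r := R)).subset fun ρ hρ => ?_
    rw [mem_closedBall_zero_iff]
    by_contra! hn
    have h0 : ρ ≠ 0 := fun h0 => by rw [h0, norm_zero] at hn; linarith
    exact (hρ.2.resolve_left h0) (h ρ ⟨hρ.1, h0⟩ hn.le 0 le_rfl).1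

end Problem

theorem differentiable_intervalIntegral {n : ℕ} {F : ℂ → ℝ → Mat n}
    (hc : Continuous fun z : ℂ × ℝ => F z.1 z.2) (hd : ∀ t, Differentiable ℂ fun μ => F μ t) {x : ℝ}
    (hx : 0 ≤ x) : Differentiable ℂ fun μ => ∫ t in (0 : ℝ)..x, F μ t := by
  rw [← differentiableOn_univ]
  simp only [intervalIntegral.integral_of_le hx]
  have hcμ : ∀ μ, Continuous (F μ) := fun μ => hc.comp (by fun_prop : Continuous fun t : ℝ => (μ, t))
  refine differentiableOn_integral isOpen_univ (fun μ _ => (hcμ μ).aestronglyMeasurable)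
    (Eventually.of_forall fun t => (hd t).differentiableOn) fun μ₀ _ => ?_
  obtain ⟨C, hC⟩ := ((isCompact_closedBall μ₀ 1).prod (isCompact_Icc (a := (0 : ℝ)) (b := x))
    ).exists_bound_of_continuousOn hc.continuousOn
  refine ⟨fun _ => C, by simp, Filter.mem_of_superset
    (Metric.closedBall_mem_nhds μ₀ one_pos) fun μ hμ => ?_⟩
  filter_upwards [ae_restrict_mem measurableSet_Ioc] with t ht
  exact hC (μ, t) ⟨hμ, Ioc_subset_Icc_self ht⟩

namespace Problem

variable {n : ℕ} (L K : Problem n)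

theorem differentiable_sol (x : ℝ) : Differentiable ℂ fun mu => L.sol mu x :=
  differentiable_cauchySol L.integrable_Q _ _ x

theorem differentiable_psi (x : ℝ) : Differentiable ℂ fun mu => L.psi mu x :=
  differentiable_cauchySol L.integrable_Q _ _ x

theorem differentiable_solStar (x : ℝ) : Differentiable ℂ fun mu => L.solStar mu x :=
  (transposeCLM n).differentiable.comp (L.tr.differentiable_sol x)

theorem continuous_psi : Continuous fun z : ℂ × ℝ => L.psi z.1 z.2 :=
  continuous_cauchySol L.integrable_Q _ _

theorem continuous_sol_right (lam : ℂ) : Continuous fun x => L.sol lam x :=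
  L.continuous_sol.comp (by fun_prop : Continuous fun t : ℝ => (lam, t))

theorem differentiable_D {x : ℝ} (hx : 0 ≤ x) (lam : ℂ) : Differentiable ℂ fun mu => L.D x lam mu := by
  simp only [L.D_eq hx]
  exact differentiable_intervalIntegral (F := fun mu t => L.solStar mu t * L.sol lam t)
    (L.continuous_solStar.mul ((L.continuous_sol_right lam).comp continuous_snd))
    (fun t => (L.differentiable_solStar t).mul_const _) hx

theorem differentiable_psiD {x : ℝ} (hx : 0 ≤ x) (lam : ℂ) :
    Differentiable ℂ fun mu => L.psiD x lam mu :=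
  differentiable_intervalIntegral (F := fun mu t => (L.tr.psi mu t).transpose * L.sol lam t)
    (((transposeCLM n).continuous.comp L.tr.continuous_psi).mul
      ((L.continuous_sol_right lam).comp continuous_snd))
    (fun t => ((transposeCLM n).differentiable.comp (L.tr.differentiable_psi t)).mul_const _) hx

end Problem

namespace Contour

variable {n : ℕ} {S : Set ℂ} (Γ : Contour S)

theorem integral_arc_sq {E : Type*} [NormedAddCommGroup E] [NormedSpace ℂ E] (R : ℝ) (G : ℂ → E) :
    ∫ θ in (0 : ℝ)..Real.pi, (Complex.I * arc R θ) • ((2 * arc R θ) • G (arc R θ ^ 2)) =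
      ∮ z in C(0, R ^ 2), G z := by
  rw [circleIntegral]
  have h2 := intervalIntegral.smul_integral_comp_mul_left (a := 0) (b := Real.pi)
    (fun θ => deriv (circleMap 0 (R ^ 2)) θ • G (circleMap 0 (R ^ 2) θ)) 2
  rw [mul_zero] at h2
  rw [← h2, ← intervalIntegral.integral_smul]
  refine intervalIntegral.integral_congr fun θ _ => ?_
  have e : circleMap 0 (R ^ 2) (2 * θ) = arc R θ ^ 2 := by
    rw [circleMap, arc, mul_pow, ← Complex.exp_nat_mul]
    push_cast
    ring_nf
  simp only [deriv_circleMap, e, ← Complex.coe_smul, smul_smul]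
  congr 1
  push_cast
  ring

theorem arc_mem_Omega {R : ℝ} (hR : 0 < R) {θ : ℝ} (hθ : θ ∈ Icc 0 Real.pi) : arc R θ ∈ Omega := by
  refine ⟨?_, fun h0 => ?_⟩
  · rw [arc_im]
    exact mul_nonneg hR.le (Real.sin_nonneg_of_nonneg_of_le_pi hθ.1 hθ.2)
  · have := norm_arc hR.le θ
    rw [h0, norm_zero] at this
    linarith

end Contour

/-! ### Evaluation of the contour integral. -/

open Asymptotics

namespace Contour

variable {n : ℕ} {S : Set ℂ} (Γ : Contour S)

/-- The integrals over large arcs of a function with the leading part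
`(λ - μ)⁻¹ (f(μ) - B)`. -/
theorem circleIntegral_cauchy {f e : ℂ → Mat n} (hf : Differentiable ℂ f) (he : Differentiable ℂ e)
    {lam : ℂ} {R : ℝ} (hR : ‖lam‖ < R) (B : Mat n) :
    (∮ z in C(0, R), (e z + (lam - z)⁻¹ • (f z - B))) =
      (2 * Real.pi * Complex.I : ℂ) • (B - f lam) := by
  have hR0 : 0 ≤ R := (norm_nonneg _).trans hR.le
  have hne : ∀ z ∈ Metric.sphere (0 : ℂ) R, lam - z ≠ 0 := fun z hz h0 => by
    rw [← sub_eq_zero.mp h0, mem_sphere_zero_iff_norm] at hz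
    exact hR.ne hz
  have hg : Differentiable ℂ fun z => f z - B := hf.sub_const B
  rw [circleIntegral.integral_add]
  · rw [Complex.circleIntegral_eq_zero_of_differentiable_on_off_countable hR0 countable_empty
      he.continuous.continuousOn fun z _ => he z, zero_add]
    have h1 := hg.diffContOnCl (s := Metric.ball 0 R) |>.circleIntegral_sub_inv_smul
      (mem_ball_zero_iff.mpr hR)
    have h2 : (∮ z in C(0, R), (lam - z)⁻¹ • (f z - B)) =
        ∮ z in C(0, R), -((z - lam)⁻¹ • (f z - B)) := by
      congr 1
      funext z
      rw [← neg_sub z lam, inv_neg, neg_smul]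
    rw [h2]
    have h3 : (∮ z in C(0, R), -((z - lam)⁻¹ • (f z - B))) =
        -∮ z in C(0, R), (z - lam)⁻¹ • (f z - B) := by
      simp only [circleIntegral, smul_neg, intervalIntegral.integral_neg]
    rw [h3, h1, ← smul_neg, neg_sub]
  · exact he.continuous.continuousOn.circleIntegrable hR0
  · exact ContinuousOn.circleIntegrable hR0 (ContinuousOn.smul (ContinuousOn.inv₀ (by fun_prop) hne)
      hg.continuous.continuousOn)

variable (L K : Problem n)

/-- The contour integral of `φ(x, μ) (M_L - M_K) D_K(x, λ, μ)`, where the difference of the Weyl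
matrices may be replaced by another function with the same values for large `ρ`. -/
theorem integral_sol_mul_D (hS : IsCompact S) (h0 : (0 : ℂ) ∈ S) (hA : K.A = L.A) {m : ℂ → Mat n}
    (hmc : ContinuousOn m {τ | τ ∈ Omega ∧ τ ^ 2 ∉ S})
    (hmd : DifferentiableOn ℂ m {τ | 0 < τ.im ∧ τ ^ 2 ∉ S})
    (hm : ∀ᶠ z : ℂ × ℝ in far, m z.1 = L.weylMatrix z.1 - K.weylMatrix z.1) (lam : ℂ) {x : ℝ}
    (hx : 0 ≤ x) (hint : Integrable fun s => deriv (fun t => Γ.ρ t ^ 2) s •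
      (L.sol (Γ.ρ s ^ 2) x * m (Γ.ρ s) * K.D x lam (Γ.ρ s ^ 2))) :
    ∫ s, deriv (fun t => Γ.ρ t ^ 2) s •
      (L.sol (Γ.ρ s ^ 2) x * m (Γ.ρ s) * K.D x lam (Γ.ρ s ^ 2)) =
      (2 * Real.pi * Complex.I : ℂ) • (K.sol lam x - L.sol lam x) := by
  set g : ℂ → Mat n := fun τ => L.sol (τ ^ 2) x * m τ * K.D x lam (τ ^ 2) with hg
  set e : ℂ → Mat n := fun μ => L.sol μ x * K.psiD x lam μ - L.psi μ x * K.D x lam μ with he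
  have hL := L.differentiable_sol x
  have hed : Differentiable ℂ e := (hL.mul (K.differentiable_psiD hx lam)).sub
    ((L.differentiable_psi x).mul (K.differentiable_D hx lam))
  have hsq : Differentiable ℂ fun τ : ℂ => τ ^ 2 := differentiable_id.pow 2
  have hgc : ContinuousOn (fun τ => (2 * τ) • g τ) {τ | τ ∈ Omega ∧ τ ^ 2 ∉ S} := by
    have h2 : ContinuousOn (fun τ : ℂ => 2 * τ) {τ | τ ∈ Omega ∧ τ ^ 2 ∉ S} := by fun_prop
    refine h2.smul ((ContinuousOn.mul ?_ hmc).mul ?_)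
    · exact (hL.comp hsq).continuous.continuousOn
    · exact ((K.differentiable_D hx lam).comp hsq).continuous.continuousOn
  have hgd : DifferentiableOn ℂ (fun τ => (2 * τ) • g τ) {τ | 0 < τ.im ∧ τ ^ 2 ∉ S} := by
    have h2 : DifferentiableOn ℂ (fun τ : ℂ => 2 * τ) {τ | 0 < τ.im ∧ τ ^ 2 ∉ S} := by fun_prop
    refine h2.smul ((DifferentiableOn.mul ?_ hmd).mul ?_)
    · exact (hL.comp hsq).differentiableOn
    · exact ((K.differentiable_D hx lam).comp hsq).differentiableOn
  obtain ⟨C₁, R₁, hC₁, hR₁, b1⟩ := isBigO_far_iff.mp (L.remOne_asymp K hA)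
  obtain ⟨C₂, R₂, hC₂, hR₂, b2⟩ := isBigO_far_iff.mp (L.remTwo_asymp K hA)
  obtain ⟨R₃, hR₃, b3⟩ := eventually_far_iff.mp ((hm.and (L.isUnit_jostMatrix_far)).and
    (K.isUnit_jostMatrix_far.and K.tr.isUnit_jostMatrix_far))
  obtain ⟨R₄, hR₄⟩ := hS.isBounded.exists_norm_le
  set C := C₁ * ‖K.sol lam x‖ + C₂ * ‖K.solDer lam x‖ with hC
  have hC0 : 0 ≤ C := by positivity
  have ha := Γ.a_pos
  -- the estimate on an arc
  have harc : ∀ T, 0 ≤ T → R₁ ≤ T → R₂ ≤ T → R₃ ≤ T → R₄ ≤ T → 2 * ‖lam‖ + 1 ≤ T →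
      ‖(∫ s in (-T)..(1 + T), deriv (fun t => Γ.ρ t ^ 2) s • g (Γ.ρ s)) -
        (2 * Real.pi * Complex.I : ℂ) • (K.sol lam x - L.sol lam x)‖ ≤ 4 * C * Real.pi * T⁻¹ := by
    intro T hT h1 h2 h3 h4 h5
    set R := Γ.a + T with hRdef
    have hTR : T ≤ R := by linarith
    have hT1 : 1 ≤ T := by linarith [norm_nonneg lam]
    have hR0 : 0 < R := by linarith
    have hRR : R ≤ R ^ 2 := by nlinarith
    have hlamR : 2 * ‖lam‖ < R ^ 2 := by linarith
    have hSR : ∀ w ∈ S, ‖w‖ < (Γ.a + T) ^ 2 := fun w hw => by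
      have := hR₄ w hw
      rw [← hRdef]; linarith
    have e1 : ∫ s in (-T)..(1 + T), deriv (fun t => Γ.ρ t ^ 2) s • g (Γ.ρ s) =
        ∫ s in (-T)..(1 + T), deriv Γ.ρ s • ((2 * Γ.ρ s) • g (Γ.ρ s)) := by
      refine intervalIntegral.integral_congr_ae ?_
      filter_upwards [Γ.ae_deriv_sq] with s hs _
      rw [hs, mul_smul]
    have e2 := Γ.integral_eq_arc hS.isClosed h0 hT hSR hgc hgd
    have e3 := circleIntegral_cauchy hL hed (by linarith [norm_nonneg lam] : ‖lam‖ < R ^ 2)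
      (K.sol lam x)
    have harcne : ∀ θ, lam - arc R θ ^ 2 ≠ 0 := fun θ h => by
      have h6 : ‖arc R θ ^ 2‖ = R ^ 2 := by rw [norm_pow, norm_arc hR0.le]
      rw [← sub_eq_zero.mp h] at h6
      linarith [norm_nonneg lam]
    have carc := continuous_arc R
    have i1 : IntervalIntegrable (fun θ => (Complex.I * arc R θ) • ((2 * arc R θ) • g (arc R θ)))
        volume 0 Real.pi := by
      refine ContinuousOn.intervalIntegrable ?_
      have h2 : ContinuousOn (fun θ => Complex.I * arc R θ) (uIcc 0 Real.pi) := by fun_prop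
      refine h2.smul (hgc.comp carc.continuousOn fun θ hθ => ?_)
      rw [uIcc_of_le Real.pi_pos.le] at hθ
      refine ⟨arc_mem_Omega hR0 hθ, fun h => ?_⟩
      have := hSR _ h
      rw [norm_pow, norm_arc hR0.le] at this
      exact lt_irrefl _ this
    have i2 : IntervalIntegrable (fun θ => (Complex.I * arc R θ) • ((2 * arc R θ) •
        (e (arc R θ ^ 2) + (lam - arc R θ ^ 2)⁻¹ • (L.sol (arc R θ ^ 2) x - K.sol lam x))))
        volume 0 Real.pi := by
      have ce := hed.continuous
      have cL := hL.continuous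
      have cinv : Continuous fun θ => (lam - arc R θ ^ 2)⁻¹ := Continuous.inv₀ (by fun_prop) harcne
      exact Continuous.intervalIntegrable (by fun_prop) _ _
    rw [e1, e2, ← e3, ← integral_arc_sq, ← intervalIntegral.integral_sub i1 i2]
    refine (intervalIntegral.norm_integral_le_of_norm_le_const (C := 4 * C * T⁻¹)
      fun θ hθ => ?_).trans (le_of_eq ?_)
    · rw [uIoc_of_le Real.pi_pos.le] at hθ
      have hO := arc_mem_Omega hR0 (Ioc_subset_Icc_self hθ)
      have hn := norm_arc hR0.le θ
      obtain ⟨⟨c1, c2⟩, c3, c4⟩ := b3 _ hO (by rw [hn]; linarith) x hx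
      have d1 := b1 _ hO (by rw [hn]; linarith) x hx
      have d2 := b2 _ hO (by rw [hn]; linarith) x hx
      simp only at c1 d1 d2
      rw [norm_inv, hn] at d1 d2
      set τ := arc R θ
      have hid := L.weyl_identity K hO c2.1 c3.1 c4.1 lam hx
      -- Division of `weyl_identity` by `λ - μ`. What remains is `O(R⁻³)`, while `dμ` contributes
      -- `2R² dθ`, so the error on the arc is `O(R⁻¹)`.
      have hgid : g τ - (e (τ ^ 2) + (lam - τ ^ 2)⁻¹ • (L.sol (τ ^ 2) x - K.sol lam x)) =
          (lam - τ ^ 2)⁻¹ • (L.remOne K (τ, x) * K.sol lam x - L.remTwo K (τ, x) * K.solDer lam x) := by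
        have h7 : ∀ {c : ℂ} {X Y Z W : Mat n}, c ≠ 0 → c • X = c • Y + Z + W →
            X - (Y + c⁻¹ • Z) = c⁻¹ • W := by
          intro c X Y Z W hc h
          have h8 := congrArg (fun B => c⁻¹ • B) h
          simp only [smul_add, inv_smul_smul₀ hc] at h8
          rw [h8]
          abel
        simp only [hg, he, c1]
        exact h7 (harcne θ) hid
      rw [← smul_sub, ← smul_sub, hgid, norm_smul, norm_smul, norm_smul, norm_mul, norm_mul,
        Complex.norm_I, one_mul, hn, Complex.norm_ofNat, norm_inv]
      have d3 : R ^ 2 / 2 ≤ ‖lam - τ ^ 2‖ := by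
        have := norm_sub_norm_le (τ ^ 2) lam
        rw [norm_sub_rev, norm_pow, hn] at this
        linarith
      have d4 : ‖lam - τ ^ 2‖⁻¹ ≤ 2 / R ^ 2 := by
        rw [← inv_div]
        exact inv_anti₀ (by positivity) d3
      have d5 : ‖L.remOne K (τ, x) * K.sol lam x - L.remTwo K (τ, x) * K.solDer lam x‖ ≤
          C * R⁻¹ := by
        refine (norm_sub_le _ _).trans ?_
        calc _ ≤ C₁ * R⁻¹ * ‖K.sol lam x‖ + C₂ * R⁻¹ * ‖K.solDer lam x‖ :=
              add_le_add ((norm_mul_le _ _).trans (mul_le_mul_of_nonneg_right d1 (norm_nonneg _)))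
                ((norm_mul_le _ _).trans (mul_le_mul_of_nonneg_right d2 (norm_nonneg _)))
          _ = _ := by rw [hC]; ring
      calc R * (2 * R * (‖lam - τ ^ 2‖⁻¹ * _)) ≤ R * (2 * R * (2 / R ^ 2 * (C * R⁻¹))) := by
            gcongr
        _ = 4 * C * R⁻¹ := by field_simp; ring
        _ ≤ 4 * C * T⁻¹ := by gcongr
    · rw [sub_zero, abs_of_pos Real.pi_pos]; ring
  -- Integrability on the whole contour makes the truncations converge to its integral, while the
  -- arc estimate gives their explicit limit.
  have ht1 := intervalIntegral_tendsto_integral hint (a := fun T : ℝ => -T) (b := fun T => 1 + T)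
    tendsto_neg_atTop_atBot
    (tendsto_atTop_add_const_left _ (1 : ℝ) tendsto_id)
  refine tendsto_nhds_unique ht1 ?_
  rw [tendsto_iff_norm_sub_tendsto_zero]
  refine squeeze_zero' (Eventually.of_forall fun T => norm_nonneg _) ?_
    (show Tendsto (fun T : ℝ => 4 * C * Real.pi * T⁻¹) atTop (𝓝 0) by
      simpa using tendsto_inv_atTop_zero.const_mul (4 * C * Real.pi))
  filter_upwards [eventually_ge_atTop 0, eventually_ge_atTop R₁, eventually_ge_atTop R₂,
    eventually_ge_atTop R₃, eventually_ge_atTop R₄, eventually_ge_atTop (2 * ‖lam‖ + 1)] with T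
    g1 g2 g3 g4 g5 g6
  exact harc T g1 g2 g3 g4 g5 g6

end Contour

/-! ### Kernels on the contour and the operators which they define on `X`. -/

namespace Contour

variable {n : ℕ} {S : Set ℂ} (Γ : Contour S)

/-- The majorant of the kernels on the contour. -/
def kap (P s : ℝ) : ℝ := ((1 + ‖Γ.ρ s‖) * (1 + |P - ‖Γ.ρ s‖|))⁻¹

theorem kap_nonneg (P s : ℝ) : 0 ≤ Γ.kap P s := by unfold kap; positivity

/-- An integrable majorant of `(1 + |P - ‖ρ(s)‖|)⁻²`. -/
def maj (P s : ℝ) : ℝ := (1 + (P - Γ.a + s) ^ 2)⁻¹ + (1 + (P - Γ.a + 1 - s) ^ 2)⁻¹ +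
  (Icc (0 : ℝ) 1).indicator 1 s

/-- On the two rays `‖ρ(s)‖` is `a - s` or `a + s - 1`, which leads to translates of `1 / (1 + u²)`.
On `[0, 1]` the trivial bound 1 is used. -/
theorem inv_sq_le_maj (P s : ℝ) : ((1 + |P - ‖Γ.ρ s‖|) ^ 2)⁻¹ ≤ Γ.maj P s := by
  have ha := Γ.a_pos
  have key : ∀ u : ℝ, ((1 + |u|) ^ 2)⁻¹ ≤ (1 + u ^ 2)⁻¹ := fun u => by
    refine inv_anti₀ (by positivity) ?_
    nlinarith [abs_nonneg u, sq_abs u]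
  have h1 : 0 ≤ (1 + (P - Γ.a + s) ^ 2)⁻¹ := by positivity
  have h2 : 0 ≤ (1 + (P - Γ.a + 1 - s) ^ 2)⁻¹ := by positivity
  have h3 : 0 ≤ (Icc (0 : ℝ) 1).indicator (1 : ℝ → ℝ) s := indicator_nonneg (fun _ _ => zero_le_one) s
  unfold maj
  rcases le_or_gt s 0 with h | h
  · have e : ‖Γ.ρ s‖ = Γ.a - s := by
      rw [Γ.ρ_upper s h, Complex.norm_real, Real.norm_of_nonneg (by linarith)]
    have := key (P - ‖Γ.ρ s‖)
    rw [e, show P - (Γ.a - s) = P - Γ.a + s by ring] at this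
    rw [e, show P - (Γ.a - s) = P - Γ.a + s by ring]
    linarith
  rcases le_or_gt s 1 with h' | h'
  · have : (Icc (0 : ℝ) 1).indicator (1 : ℝ → ℝ) s = 1 := indicator_of_mem (show s ∈ Icc (0 : ℝ) 1 from ⟨h.le, h'⟩) _
    rw [this]
    have : ((1 + |P - ‖Γ.ρ s‖|) ^ 2)⁻¹ ≤ 1 := inv_le_one_of_one_le₀ (by
      nlinarith [abs_nonneg (P - ‖Γ.ρ s‖)])
    linarith
  · have e : ‖Γ.ρ s‖ = Γ.a + s - 1 := by
      rw [Γ.ρ_lower s h'.le, Complex.norm_real, Real.norm_eq_abs, abs_of_neg (by linarith)]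
      ring
    have := key (P - ‖Γ.ρ s‖)
    rw [e, show P - (Γ.a + s - 1) = P - Γ.a + 1 - s by ring] at this
    rw [e, show P - (Γ.a + s - 1) = P - Γ.a + 1 - s by ring]
    linarith

/-- The inequality between geometric and arithmetic means separates the two factors. The integrals
of the two majorants do not depend on `P`, so the operator bound is uniform along the contour. -/
theorem kap_le (P s : ℝ) : Γ.kap P s ≤ Γ.maj 0 s + Γ.maj P s := by
  have h1 := Γ.inv_sq_le_maj 0 s
  have h2 := Γ.inv_sq_le_maj P s
  rw [zero_sub, abs_neg, abs_norm] at h1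
  refine le_trans ?_ (add_le_add h1 h2)
  rw [kap, mul_inv, ← inv_pow, ← inv_pow]
  nlinarith [sq_nonneg ((1 + ‖Γ.ρ s‖)⁻¹ - (1 + |P - ‖Γ.ρ s‖|)⁻¹),
    sq_nonneg ((1 + ‖Γ.ρ s‖)⁻¹), sq_nonneg ((1 + |P - ‖Γ.ρ s‖|)⁻¹)]

theorem integrable_maj (P : ℝ) : Integrable (Γ.maj P) := by
  refine Integrable.add (Integrable.add ?_ ?_) ?_
  · exact integrable_inv_one_add_sq.comp_add_left (P - Γ.a)
  · exact integrable_inv_one_add_sq.comp_sub_left (P - Γ.a + 1)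
  · exact (integrable_indicator_iff measurableSet_Icc).mpr continuous_one.integrableOn_Icc

theorem integral_maj (P : ℝ) : ∫ s, Γ.maj P s = 2 * Real.pi + 1 := by
  have i1 : Integrable fun s : ℝ => (1 + (P - Γ.a + s) ^ 2)⁻¹ :=
    integrable_inv_one_add_sq.comp_add_left (P - Γ.a)
  have i2 : Integrable fun s : ℝ => (1 + (P - Γ.a + 1 - s) ^ 2)⁻¹ :=
    integrable_inv_one_add_sq.comp_sub_left (P - Γ.a + 1)
  have i3 : Integrable ((Icc (0 : ℝ) 1).indicator (1 : ℝ → ℝ)) :=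
    (integrable_indicator_iff measurableSet_Icc).mpr continuous_one.integrableOn_Icc
  have e1 : ∫ s : ℝ, (1 + (P - Γ.a + s) ^ 2)⁻¹ = Real.pi := by
    rw [integral_add_left_eq_self (fun s : ℝ => (1 + s ^ 2)⁻¹) (P - Γ.a)]
    exact integral_univ_inv_one_add_sq
  have e2 : ∫ s : ℝ, (1 + (P - Γ.a + 1 - s) ^ 2)⁻¹ = Real.pi := by
    rw [integral_sub_left_eq_self (fun s : ℝ => (1 + s ^ 2)⁻¹) volume (P - Γ.a + 1)]
    exact integral_univ_inv_one_add_sq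
  have e3 : ∫ s : ℝ, (Icc (0 : ℝ) 1).indicator (1 : ℝ → ℝ) s = 1 := by
    rw [integral_indicator_one measurableSet_Icc]; simp
  unfold maj
  have h1 := integral_add (i1.add i2) i3
  simp only [Pi.add_apply] at h1
  rw [h1, integral_add i1 i2, e1, e2, e3]
  ring

theorem continuous_kap (P : ℝ) : Continuous (Γ.kap P) := by
  have := Γ.continuous_ρ
  unfold kap
  refine Continuous.inv₀ (by fun_prop) fun s => ?_
  positivity

theorem integrable_kap (P : ℝ) : Integrable (Γ.kap P) := by
  refine ((Γ.integrable_maj 0).add (Γ.integrable_maj P)).mono'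
    (Γ.continuous_kap P).aestronglyMeasurable (Eventually.of_forall fun s => ?_)
  rw [Real.norm_of_nonneg (Γ.kap_nonneg P s)]
  exact Γ.kap_le P s

theorem integral_kap_le (P : ℝ) : ∫ s, Γ.kap P s ≤ 2 * (2 * Real.pi + 1) := by
  have h := integral_mono (Γ.integrable_kap P) ((Γ.integrable_maj 0).add (Γ.integrable_maj P))
    (Γ.kap_le P)
  simp only [Pi.add_apply] at h
  rw [integral_add (Γ.integrable_maj 0) (Γ.integrable_maj P), Γ.integral_maj, Γ.integral_maj] at h
  linarith

/-- Gives one integrable majorant for all points near a given one, as dominated convergence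
requires. -/
theorem kap_le_two_mul {P P₀ : ℝ} (h : |P - P₀| ≤ 1) (s : ℝ) : Γ.kap P s ≤ 2 * Γ.kap P₀ s := by
  have h1 : 1 + |P₀ - ‖Γ.ρ s‖| ≤ 2 * (1 + |P - ‖Γ.ρ s‖|) := by
    have h2 := abs_sub_le P₀ P ‖Γ.ρ s‖
    rw [abs_sub_comm P₀ P] at h2
    linarith [abs_nonneg (P - ‖Γ.ρ s‖)]
  unfold kap
  rw [← div_eq_mul_inv, le_div_iff₀ (by positivity), inv_mul_le_iff₀ (by positivity)]
  nlinarith [norm_nonneg (Γ.ρ s)]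

theorem exists_deriv_sq_le : ∃ C : ℝ, 0 ≤ C ∧ ∀ᵐ s, ‖deriv (fun t => Γ.ρ t ^ 2) s‖ ≤
    C * (1 + ‖Γ.ρ s‖) := by
  obtain ⟨C, hC⟩ := Γ.ae_deriv
  refine ⟨2 * |C|, by positivity, ?_⟩
  filter_upwards [hC, Γ.ae_deriv_sq] with s hs h2
  rw [h2, norm_mul, norm_mul, Complex.norm_ofNat]
  have h3 := hs.2.trans (le_abs_self C)
  calc ‖deriv Γ.ρ s‖ * (2 * ‖Γ.ρ s‖) ≤ |C| * (2 * ‖Γ.ρ s‖) := by gcongr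
    _ ≤ _ := by nlinarith [abs_nonneg C]

theorem continuous_pt : Continuous Γ.pt := Γ.continuous_ρ.subtype_mk _

theorem continuous_weightInv (L : Problem n) : Continuous fun p : Γ.support => L.weightInv (p : ℂ) := by
  unfold Problem.weightInv
  have : Continuous fun p : Γ.support => (Complex.I * (p : ℂ))⁻¹ :=
    Continuous.inv₀ (by fun_prop) fun p => mul_ne_zero Complex.I_ne_zero (Γ.ne_zero p)
  fun_prop

theorem aestronglyMeasurable_form {F : Γ.support → Mat n} (hF : Continuous F) :
    AEStronglyMeasurable (Γ.form F) :=
  ((measurable_deriv fun t => Γ.ρ t ^ 2).aestronglyMeasurable (μ := volume)).smul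
    (hF.comp Γ.continuous_pt).aestronglyMeasurable

/-- A continuous kernel on the contour with the bound which makes it act on the space `X`. -/
structure IsKernel (L : Problem n) (G : Γ.support → Γ.support → Mat n) : Prop where
  cont : Continuous fun pq : Γ.support × Γ.support => G pq.1 pq.2
  bound : ∃ C : ℝ, ∀ p q : Γ.support, ‖L.weightInv (q : ℂ) * G p q * L.weight (p : ℂ)‖ ≤
    C * ((1 + ‖(q : ℂ)‖) ^ 2 * (1 + |‖(p : ℂ)‖ - ‖(q : ℂ)‖|))⁻¹

namespace IsKernel

variable {Γ} {L : Problem n} {G G₁ G₂ : Γ.support → Γ.support → Mat n}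

/-- Inserting the weight and its inverse at the inner point splits the integrand into the part
measured by the norm of `X` and the weighted kernel. The derivative of `ρ²` consumes one of the two
factors `(1 + ‖ρ‖)⁻¹`. -/
theorem exists_bound (h : Γ.IsKernel L G) : ∃ C : ℝ, 0 ≤ C ∧ ∀ᵐ s, ∀ (p : Γ.support) (B : Mat n),
    ‖deriv (fun t => Γ.ρ t ^ 2) s • (B * G p (Γ.pt s)) * L.weight (p : ℂ)‖ ≤
      C * ‖B * L.weight (Γ.ρ s)‖ * Γ.kap ‖(p : ℂ)‖ s := by
  obtain ⟨C, hC⟩ := h.bound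
  obtain ⟨D, hD0, hD⟩ := Γ.exists_deriv_sq_le
  refine ⟨D * |C|, by positivity, ?_⟩
  filter_upwards [hD] with s hs p B
  have e : B * G p (Γ.pt s) * L.weight (p : ℂ) =
      (B * L.weight (Γ.ρ s)) * (L.weightInv (Γ.ρ s) * G p (Γ.pt s) * L.weight (p : ℂ)) := by
    have h1 := L.weight_mul_weightInv (Γ.ne_zero (Γ.pt s))
    change L.weight (Γ.ρ s) * L.weightInv (Γ.ρ s) = 1 at h1
    rw [mul_assoc B (L.weight _), mul_assoc (L.weightInv _), ← mul_assoc (L.weight _), h1, one_mul,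
      mul_assoc]
  rw [smul_mul_assoc, e, norm_smul]
  have h2 := hC p (Γ.pt s)
  change _ ≤ C * ((1 + ‖Γ.ρ s‖) ^ 2 * (1 + |‖(p : ℂ)‖ - ‖Γ.ρ s‖|))⁻¹ at h2
  have h3 : ‖L.weightInv (Γ.ρ s) * G p (Γ.pt s) * L.weight (p : ℂ)‖ ≤
      |C| * ((1 + ‖Γ.ρ s‖) ^ 2 * (1 + |‖(p : ℂ)‖ - ‖Γ.ρ s‖|))⁻¹ :=
    h2.trans (mul_le_mul_of_nonneg_right (le_abs_self C) (by positivity))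
  calc _ ≤ (D * (1 + ‖Γ.ρ s‖)) * (‖B * L.weight (Γ.ρ s)‖ *
        (|C| * ((1 + ‖Γ.ρ s‖) ^ 2 * (1 + |‖(p : ℂ)‖ - ‖Γ.ρ s‖|))⁻¹)) := by
        refine mul_le_mul hs ((norm_mul_le _ _).trans (mul_le_mul_of_nonneg_left h3 (norm_nonneg _)))
          (norm_nonneg _) (by positivity)
    _ = _ := by
        rw [kap]
        have : 1 + ‖Γ.ρ s‖ ≠ 0 := by positivity
        field_simp

theorem norm_apply_le (z : XSpace L Γ) (p : Γ.support) : ‖z p * L.weight (p : ℂ)‖ ≤ ‖z‖ :=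
  (XSpace.weighted z).norm_coe_le_norm p

theorem continuous_left (h : Γ.IsKernel L G) (p : Γ.support) : Continuous (G p) :=
  h.cont.comp (by fun_prop : Continuous fun q : Γ.support => (p, q))

theorem continuous_right (h : Γ.IsKernel L G) (q : Γ.support) : Continuous fun p => G p q :=
  h.cont.comp (by fun_prop : Continuous fun p : Γ.support => (p, q))

/-- Integrability against a kernel. -/
theorem integrable (h : Γ.IsKernel L G) {z : Γ.support → Mat n} (hz : Continuous z) {B : ℝ}
    (hB : ∀ p, ‖z p * L.weight (p : ℂ)‖ ≤ B) (p : Γ.support) :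
    Integrable (Γ.form fun q => z q * G p q) := by
  obtain ⟨C, hC, hb⟩ := h.exists_bound
  have hm := Γ.aestronglyMeasurable_form (hz.mul (h.continuous_left p))
  have h1 : Integrable fun s => Γ.form (fun q => z q * G p q) s * L.weight (p : ℂ) := by
    refine ((Γ.integrable_kap ‖(p : ℂ)‖).const_mul (C * B)).mono' (hm.mul_const _) ?_
    filter_upwards [hb] with s hs
    refine (hs p _).trans (mul_le_mul_of_nonneg_right (mul_le_mul_of_nonneg_left ?_ hC)
      (Γ.kap_nonneg _ _))
    exact hB (Γ.pt s)
  refine (h1.mul_const (L.weightInv (p : ℂ))).congr (Eventually.of_forall fun s => ?_)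
  simp only
  rw [mul_assoc, L.weight_mul_weightInv (Γ.ne_zero p), mul_one]

theorem integral_mul_weight (h : Γ.IsKernel L G) {z : Γ.support → Mat n} (hz : Continuous z) {B : ℝ}
    (hB : ∀ p, ‖z p * L.weight (p : ℂ)‖ ≤ B) (p : Γ.support) :
    (Γ.integral fun q => z q * G p q) * L.weight (p : ℂ) =
      ∫ s, Γ.form (fun q => z q * G p q) s * L.weight (p : ℂ) :=
  (integral_mul_const_of_integrable (h.integrable hz hB p)).symm

theorem norm_integral_le (h : Γ.IsKernel L G) : ∃ C : ℝ, 0 ≤ C ∧ ∀ {z : Γ.support → Mat n},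
    Continuous z → ∀ {B : ℝ}, (∀ p, ‖z p * L.weight (p : ℂ)‖ ≤ B) → ∀ p : Γ.support,
    ‖(Γ.integral fun q => z q * G p q) * L.weight (p : ℂ)‖ ≤ C * B := by
  obtain ⟨C, hC, hb⟩ := h.exists_bound
  refine ⟨C * (2 * (2 * Real.pi + 1)), by positivity, fun {z} hz {B} hB p => ?_⟩
  have hB0 : 0 ≤ B := (norm_nonneg _).trans (hB p)
  rw [h.integral_mul_weight hz hB]
  refine (norm_integral_le_of_norm_le ((Γ.integrable_kap ‖(p : ℂ)‖).const_mul (C * B)) ?_).trans ?_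
  · filter_upwards [hb] with s hs
    refine (hs p _).trans (mul_le_mul_of_nonneg_right (mul_le_mul_of_nonneg_left ?_ hC)
      (Γ.kap_nonneg _ _))
    exact hB (Γ.pt s)
  · rw [integral_const_mul]
    have := Γ.integral_kap_le ‖(p : ℂ)‖
    have h0 : 0 ≤ C * B := by positivity
    calc _ ≤ C * B * (2 * (2 * Real.pi + 1)) := mul_le_mul_of_nonneg_left this h0
      _ = _ := by ring

theorem continuous_integral (h : Γ.IsKernel L G) {z : Γ.support → Mat n} (hz : Continuous z) {B : ℝ}
    (hB : ∀ p, ‖z p * L.weight (p : ℂ)‖ ≤ B) :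
    Continuous fun p : Γ.support => Γ.integral fun q => z q * G p q := by
  obtain ⟨C, hC, hb⟩ := h.exists_bound
  have hc : Continuous fun p : Γ.support =>
      (Γ.integral fun q => z q * G p q) * L.weight (p : ℂ) := by
    simp only [h.integral_mul_weight hz hB]
    rw [continuous_iff_continuousAt]
    intro p₀
    have hB0 : 0 ≤ B := (norm_nonneg _).trans (hB p₀)
    refine continuousAt_of_dominated (bound := fun s => C * B * (2 * Γ.kap ‖(p₀ : ℂ)‖ s)) ?_ ?_
      (((Γ.integrable_kap _).const_mul 2).const_mul _) ?_
    · exact Eventually.of_forall fun p =>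
        (Γ.aestronglyMeasurable_form (hz.mul (h.continuous_left p))).mul_const _
    · have hnear : ∀ᶠ p : Γ.support in 𝓝 p₀, |‖(p : ℂ)‖ - ‖(p₀ : ℂ)‖| ≤ 1 := by
        have : Continuous fun p : Γ.support => |‖(p : ℂ)‖ - ‖(p₀ : ℂ)‖| := by fun_prop
        exact this.tendsto p₀ |>.eventually (Iic_mem_nhds (by simp))
      filter_upwards [hnear] with p hp
      filter_upwards [hb] with s hs
      refine (hs p _).trans (mul_le_mul (mul_le_mul_of_nonneg_left (hB (Γ.pt s)) hC)
        (Γ.kap_le_two_mul hp s) (Γ.kap_nonneg _ _) (by positivity))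
    · refine Eventually.of_forall fun s => ?_
      have h1 := h.continuous_right (Γ.pt s)
      have h2 : Continuous fun p : Γ.support => L.weight (p : ℂ) := XSpace.continuous_weight
      simp only [form]
      exact Continuous.continuousAt (by fun_prop)
  refine (hc.mul (Γ.continuous_weightInv L)).congr fun p => ?_
  rw [Pi.mul_apply, mul_assoc, L.weight_mul_weightInv (Γ.ne_zero p), mul_one]

theorem absConv (h : Γ.IsKernel L G) (z : XSpace L Γ) (p : Γ.support) :
    Γ.AbsConv fun q => z q * G p q :=
  h.integrable z.1.continuous (norm_apply_le z) p

/-- The operator `z ↦ (1 / 2πi) ∫_γ z(μ) G(·, μ) dμ`, as a linear map. -/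
def opLin (h : Γ.IsKernel L G) : XSpace L Γ →ₗ[ℂ] XSpace L Γ where
  toFun z := ⟨⟨fun p => (2 * (Real.pi : ℂ) * Complex.I)⁻¹ •
      Γ.integral fun q => z q * G p q,
      Continuous.const_smul (g := fun p => Γ.integral fun q => z q * G p q)
        (h.continuous_integral z.1.continuous (norm_apply_le z))
        (2 * (Real.pi : ℂ) * Complex.I)⁻¹⟩, by
    obtain ⟨C, -, hb⟩ := h.norm_integral_le
    refine ⟨‖(2 * (Real.pi : ℂ) * Complex.I)⁻¹‖ * (C * ‖z‖), fun p => ?_⟩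
    change ‖((2 * (Real.pi : ℂ) * Complex.I)⁻¹ • Γ.integral (fun q => z q * G p q)) *
      L.weight (p : ℂ)‖ ≤ _
    rw [smul_mul_assoc, norm_smul]
    exact mul_le_mul_of_nonneg_left (hb z.1.continuous (norm_apply_le z) p) (norm_nonneg _)⟩
  map_add' z w := by
    apply Subtype.ext
    ext1 p
    change (2 * (Real.pi : ℂ) * Complex.I)⁻¹ • Γ.integral (fun q => (z q + w q) * G p q) =
      (2 * (Real.pi : ℂ) * Complex.I)⁻¹ • Γ.integral (fun q => z q * G p q) +
      (2 * (Real.pi : ℂ) * Complex.I)⁻¹ • Γ.integral (fun q => w q * G p q)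
    rw [← smul_add]
    congr 1
    rw [integral, integral, integral, ← integral_add (h.absConv z p) (h.absConv w p)]
    congr 1
    funext s
    simp only [form, add_mul, smul_add]
  map_smul' c z := by
    apply Subtype.ext
    ext1 p
    change (2 * (Real.pi : ℂ) * Complex.I)⁻¹ • Γ.integral (fun q => (c • z q) * G p q) =
      c • (2 * (Real.pi : ℂ) * Complex.I)⁻¹ • Γ.integral (fun q => z q * G p q)
    rw [smul_comm c]
    congr 1
    rw [integral, integral, ← integral_smul]
    congr 1
    funext s
    simp only [form, smul_mul_assoc]
    rw [smul_comm]

theorem opLin_apply (h : Γ.IsKernel L G) (z : XSpace L Γ) (p : Γ.support) : h.opLin z p =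
    (2 * (Real.pi : ℂ) * Complex.I)⁻¹ • Γ.integral fun q => z q * G p q := rfl

theorem norm_opLin_le (h : Γ.IsKernel L G) : ∃ C : ℝ, ∀ z : XSpace L Γ, ‖h.opLin z‖ ≤ C * ‖z‖ := by
  obtain ⟨C, hC, hb⟩ := h.norm_integral_le
  set c : ℂ := (2 * (Real.pi : ℂ) * Complex.I)⁻¹ with hc
  refine ⟨‖c‖ * C, fun z => ?_⟩
  have h0 : 0 ≤ ‖z‖ := norm_nonneg z
  have h1 : 0 ≤ ‖c‖ * C * ‖z‖ := by positivity
  have h2 : ∀ p : Γ.support, ‖h.opLin z p * L.weight (p : ℂ)‖ ≤ ‖c‖ * C * ‖z‖ := fun p => by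
    rw [opLin_apply, ← hc, smul_mul_assoc, norm_smul, mul_assoc]
    exact mul_le_mul_of_nonneg_left (hb z.1.continuous (norm_apply_le z) p) (norm_nonneg c)
  rw [XSpace.norm_eq (h.opLin z)]
  exact Real.iSup_le h2 h1

/-- The operator `z ↦ (1 / 2πi) ∫_γ z(μ) G(·, μ) dμ`. -/
def op (h : Γ.IsKernel L G) : XSpace L Γ →L[ℂ] XSpace L Γ :=
  LinearMap.mkContinuousOfExistsBound h.opLin h.norm_opLin_le

theorem op_apply (h : Γ.IsKernel L G) (z : XSpace L Γ) (p : Γ.support) : h.op z p =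
    (2 * (Real.pi : ℂ) * Complex.I)⁻¹ • Γ.integral fun q => z q * G p q := rfl

/-- For fixed `r` the function `G₂(·, r)` satisfies the weighted bound required of an element of
`X`, once the constant weight at `r` is split off. -/
theorem integrable_mul (h₁ : Γ.IsKernel L G₁) (h₂ : Γ.IsKernel L G₂) (p r : Γ.support) :
    Integrable (Γ.form fun q => G₂ q r * G₁ p q) := by
  obtain ⟨C, hC⟩ := h₂.bound
  refine h₁.integrable (h₂.continuous_right r) (B := ‖L.weight (r : ℂ)‖ * |C|) (fun q => ?_) p
  have e : G₂ q r * L.weight (q : ℂ) =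
      L.weight (r : ℂ) * (L.weightInv (r : ℂ) * G₂ q r * L.weight (q : ℂ)) := by
    rw [mul_assoc (L.weightInv _), ← mul_assoc (L.weight _), L.weight_mul_weightInv (Γ.ne_zero r),
      one_mul]
  rw [e]
  refine (norm_mul_le _ _).trans (mul_le_mul_of_nonneg_left ((hC q r).trans ?_) (norm_nonneg _))
  refine (mul_le_mul_of_nonneg_right (le_abs_self C) (by positivity)).trans
    (mul_le_of_le_one_right (abs_nonneg C) (inv_le_one_of_one_le₀ ?_))
  have h1 : 1 ≤ (1 + ‖(r : ℂ)‖) ^ 2 := by nlinarith [norm_nonneg (r : ℂ)]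
  have h2 : 1 ≤ 1 + |‖(q : ℂ)‖ - ‖(r : ℂ)‖| := by linarith [abs_nonneg (‖(q : ℂ)‖ - ‖(r : ℂ)‖)]
  nlinarith

/-- The product of two operators, by Fubini's theorem. -/
theorem integral_integral (h₁ : Γ.IsKernel L G₁) (h₂ : Γ.IsKernel L G₂) {z : Γ.support → Mat n}
    (hz : Continuous z) {B₀ : ℝ} (hB : ∀ p, ‖z p * L.weight (p : ℂ)‖ ≤ B₀) (p : Γ.support) :
    (Γ.integral fun q => (Γ.integral fun r => z r * G₂ q r) * G₁ p q) =
      Γ.integral fun r => z r * Γ.integral fun q => G₂ q r * G₁ p q := by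
  set w : ℝ → ℂ := deriv (fun t => Γ.ρ t ^ 2) with hw
  have hwm : Measurable w := measurable_deriv _
  set F : ℝ → ℝ → Mat n := fun s t => (w s * w t) •
    (z (Γ.pt t) * G₂ (Γ.pt s) (Γ.pt t) * G₁ p (Γ.pt s)) with hF
  have hB0 : 0 ≤ B₀ := (norm_nonneg _).trans (hB p)
  obtain ⟨C₁, hC₁, b₁⟩ := h₁.exists_bound
  obtain ⟨C₂, hC₂, b₂⟩ := h₂.exists_bound
  have hpt := Γ.continuous_pt
  have hmeas : AEStronglyMeasurable (fun st : ℝ × ℝ => F st.1 st.2) (volume.prod volume) := by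
    refine AEStronglyMeasurable.smul (f := fun st : ℝ × ℝ => w st.1 * w st.2)
      (((hwm.comp measurable_fst).mul (hwm.comp measurable_snd)).aestronglyMeasurable) ?_
    refine Continuous.aestronglyMeasurable ?_
    refine ((hz.comp (hpt.comp continuous_snd)).mul (h₂.cont.comp
      ((hpt.comp continuous_fst).prodMk (hpt.comp continuous_snd)))).mul
      ((h₁.continuous_left p).comp (hpt.comp continuous_fst))
  have hmul : ∀ B : Mat n, B * L.weight (p : ℂ) * L.weightInv (p : ℂ) = B := fun B => by
    rw [mul_assoc, L.weight_mul_weightInv (Γ.ne_zero p), mul_one]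
  have hbound : ∀ᵐ s, ∀ᵐ t, ‖F s t‖ ≤ (C₁ * C₂ * B₀ * ‖L.weightInv (p : ℂ)‖) *
      Γ.kap ‖(p : ℂ)‖ s * Γ.kap ‖Γ.ρ s‖ t := by
    filter_upwards [b₁] with s hs
    filter_upwards [b₂] with t ht
    have e : F s t = w s • ((w t • (z (Γ.pt t) * G₂ (Γ.pt s) (Γ.pt t))) * G₁ p (Γ.pt s)) *
        L.weight (p : ℂ) * L.weightInv (p : ℂ) := by
      rw [hmul, hF]
      simp only [smul_mul_assoc, smul_smul]
    rw [e]
    refine (norm_mul_le _ _).trans ?_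
    have h3 := hs p (w t • (z (Γ.pt t) * G₂ (Γ.pt s) (Γ.pt t)))
    have h4 := ht (Γ.pt s) (z (Γ.pt t))
    change ‖w t • (z (Γ.pt t) * G₂ (Γ.pt s) (Γ.pt t)) * L.weight (Γ.ρ s)‖ ≤
      C₂ * ‖z (Γ.pt t) * L.weight (Γ.ρ t)‖ * Γ.kap ‖Γ.ρ s‖ t at h4
    have h5 : ‖z (Γ.pt t) * L.weight (Γ.ρ t)‖ ≤ B₀ := hB (Γ.pt t)
    have k1 := Γ.kap_nonneg ‖(p : ℂ)‖ s
    have k2 := Γ.kap_nonneg ‖Γ.ρ s‖ t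
    calc _ ≤ (C₁ * (C₂ * B₀ * Γ.kap ‖Γ.ρ s‖ t) * Γ.kap ‖(p : ℂ)‖ s) * ‖L.weightInv (p : ℂ)‖ := by
          refine mul_le_mul_of_nonneg_right (h3.trans ?_) (norm_nonneg _)
          refine mul_le_mul_of_nonneg_right (mul_le_mul_of_nonneg_left (h4.trans ?_) hC₁) k1
          exact mul_le_mul_of_nonneg_right (mul_le_mul_of_nonneg_left h5 hC₂) k2
      _ = _ := by ring
  -- The inner integral of the majorant is bounded uniformly in `s`, and the remaining function of
  -- `s` is integrable.
  have hint : Integrable (fun st : ℝ × ℝ => F st.1 st.2) (volume.prod volume) := by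
    rw [integrable_prod_iff hmeas]
    set c := C₁ * C₂ * B₀ * ‖L.weightInv (p : ℂ)‖ with hc
    have hc0 : 0 ≤ c := by positivity
    constructor
    · filter_upwards [hbound, hmeas.prodMk_left] with s hs hm
      exact ((Γ.integrable_kap ‖Γ.ρ s‖).const_mul _).mono' hm hs
    · refine ((Γ.integrable_kap ‖(p : ℂ)‖).const_mul (c * (2 * (2 * Real.pi + 1)))).mono'
        hmeas.norm.integral_prod_right' ?_
      filter_upwards [hbound] with s hs
      refine (norm_integral_le_of_norm_le ((Γ.integrable_kap ‖Γ.ρ s‖).const_mul _)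
        (hs.mono fun t ht => by rwa [norm_norm])).trans ?_
      rw [integral_const_mul]
      calc _ ≤ c * Γ.kap ‖(p : ℂ)‖ s * (2 * (2 * Real.pi + 1)) :=
            mul_le_mul_of_nonneg_left (Γ.integral_kap_le _) (mul_nonneg hc0 (Γ.kap_nonneg _ _))
        _ = _ := by ring
  have hswap := integral_integral_swap (f := F) hint
  have e1 : ∀ s, ∫ t, F s t = Γ.form (fun q => (Γ.integral fun r => z r * G₂ q r) * G₁ p q) s := by
    intro s
    have h6 := h₂.integrable hz hB (Γ.pt s)
    change ∫ t, F s t = w s • ((∫ t, Γ.form (fun q => z q * G₂ (Γ.pt s) q) t) * G₁ p (Γ.pt s))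
    rw [← integral_mul_const_of_integrable h6, ← integral_smul]
    congr 1
    funext t
    simp only [hF, form, smul_mul_assoc, smul_smul, hw]
  have e2 : ∀ t, ∫ s, F s t = Γ.form (fun r => z r * Γ.integral fun q => G₂ q r * G₁ p q) t := by
    intro t
    have h6 := h₁.integrable_mul h₂ p (Γ.pt t)
    change ∫ s, F s t = w t • (z (Γ.pt t) * ∫ s, Γ.form (fun q => G₂ q (Γ.pt t) * G₁ p q) s)
    rw [← integral_const_mul_of_integrable h6, ← integral_smul]
    congr 1
    funext s
    simp only [hF, form, mul_smul_comm, smul_smul, hw, mul_assoc, mul_comm]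
  rw [integral, integral]
  simp only [← e1, ← e2]
  exact hswap

end IsKernel

end Contour

/-! ### Bounds along the whole contour. -/

open Asymptotics

namespace Contour

variable {n : ℕ} {S : Set ℂ} (Γ : Contour S)

/-- Outside a bounded parameter interval the contour lies where the asymptotic bound holds; on the
interval a local bound suffices. -/
theorem exists_bound_of_far {E : Type*} [NormedAddCommGroup E] {f : ℂ × ℝ → E} {x : ℝ}
    (hf : f =O[far] (fun _ => (1 : ℂ)))
    (hl : ∀ T, ∃ C : ℝ, ∀ s ∈ Icc (-T) T, ∀ t ∈ Icc 0 x, ‖f (Γ.ρ s, t)‖ ≤ C) :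
    ∃ C : ℝ, 0 ≤ C ∧ ∀ s, ∀ t ∈ Icc 0 x, ‖f (Γ.ρ s, t)‖ ≤ C := by
  obtain ⟨C₁, R, hC₁, hR, h1⟩ := isBigO_far_iff.mp hf
  obtain ⟨C₂, h2⟩ := hl (R + 1)
  have ha := Γ.a_pos
  refine ⟨C₁ + |C₂|, by positivity, fun s t ht => ?_⟩
  by_cases hs : s ∈ Icc (-(R + 1)) (R + 1)
  · linarith [h2 s hs t ht, le_abs_self C₂]
  · have hn : R ≤ ‖Γ.ρ s‖ := by
      rw [mem_Icc, not_and_or, not_le, not_le] at hs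
      rcases hs with hs | hs
      · rw [Γ.ρ_upper s (by linarith), Complex.norm_real]
        exact le_trans (by linarith) (le_abs_self _)
      · rw [Γ.ρ_lower s (by linarith), Complex.norm_real]
        exact le_trans (by linarith) (neg_le_abs _)
    have h3 := h1 _ (Γ.ρ_mem_Omega s) hn t ht.1
    rw [norm_one, mul_one] at h3
    linarith [abs_nonneg C₂]

theorem exists_bound_of_continuous {E : Type*} [NormedAddCommGroup E] {g : ℝ × ℝ → E}
    (hg : Continuous g) (x T : ℝ) : ∃ C : ℝ, ∀ s ∈ Icc (-T) T, ∀ t ∈ Icc 0 x, ‖g (s, t)‖ ≤ C := by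
  obtain ⟨C, hC⟩ := (isCompact_Icc.prod isCompact_Icc).exists_bound_of_continuousOn
    (hg.continuousOn (s := Icc (-T) T ×ˢ Icc (0 : ℝ) x))
  exact ⟨C, fun s hs t ht => hC (s, t) ⟨hs, ht⟩⟩

theorem one_add_norm_le : ∃ C : ℝ, 0 ≤ C ∧ ∀ s, 1 + ‖Γ.ρ s‖ ≤ C * ‖Γ.ρ s‖ := by
  have hne : ∀ s, Γ.ρ s ≠ 0 := fun s => Γ.ne_zero (Γ.pt s)
  have hρ := Γ.continuous_ρ
  obtain ⟨C, hC, h⟩ := Γ.exists_bound_of_far (f := fun z => z.1⁻¹) (x := 0) isBigO_far_inv_one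
    fun T => exists_bound_of_continuous (g := fun q : ℝ × ℝ => (Γ.ρ q.1)⁻¹)
      (Continuous.inv₀ (by fun_prop) fun q => hne q.1) 0 T
  refine ⟨C + 1, by positivity, fun s => ?_⟩
  have h1 := h s 0 ⟨le_rfl, le_rfl⟩
  rw [norm_inv] at h1
  have h2 : 0 < ‖Γ.ρ s‖ := norm_pos_iff.mpr (hne s)
  have h3 : 1 ≤ C * ‖Γ.ρ s‖ := by
    rw [← inv_mul_cancel₀ h2.ne']
    exact mul_le_mul_of_nonneg_right h1 h2.le
  linarith

/-- On the two rays `ρ` is real and the exponential has modulus 1; the arc is compact. -/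
theorem exists_exp_bound (x : ℝ) : ∃ C : ℝ, 0 ≤ C ∧ ∀ s, ∀ t ∈ Icc 0 x,
    ‖(Complex.exp (Complex.I * Γ.ρ s * t))⁻¹‖ ≤ C := by
  have hρ := Γ.continuous_ρ
  obtain ⟨C, hC⟩ := exists_bound_of_continuous
    (g := fun q : ℝ × ℝ => (Complex.exp (Complex.I * Γ.ρ q.1 * q.2))⁻¹)
    (Continuous.inv₀ (by fun_prop) fun q => Complex.exp_ne_zero _) x 1
  refine ⟨1 + |C|, by positivity, fun s t ht => ?_⟩
  have key : ∀ r : ℝ, Γ.ρ s = r → ‖(Complex.exp (Complex.I * Γ.ρ s * t))⁻¹‖ = 1 := fun r hr => by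
    rw [hr, norm_inv, Complex.norm_exp]
    simp
  rcases le_or_gt s 0 with h | h
  · rw [key _ (Γ.ρ_upper s h)]; linarith [abs_nonneg C]
  rcases le_or_gt 1 s with h' | h'
  · rw [key _ (Γ.ρ_lower s h')]; linarith [abs_nonneg C]
  · have := hC s ⟨by linarith, h'.le⟩ t ht
    linarith [le_abs_self C]

variable (K : Problem n)

theorem exists_sol_bound (x : ℝ) : ∃ C : ℝ, 0 ≤ C ∧ ∀ s, ∀ t ∈ Icc 0 x,
    ‖K.sol (Γ.ρ s ^ 2) t * K.weight (Γ.ρ s)‖ ≤ C := by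
  have hρ := Γ.continuous_ρ
  obtain ⟨E, hE, e1⟩ := Γ.exists_exp_bound x
  obtain ⟨C, hC, h⟩ := Γ.exists_bound_of_far (x := x) K.solW_isBigO fun T => by
    refine exists_bound_of_continuous (g := fun q : ℝ × ℝ => K.solW (Γ.ρ q.1, q.2)) ?_ x T
    have h1 : Continuous fun q : ℝ × ℝ => K.sol (Γ.ρ q.1 ^ 2) q.2 :=
      K.continuous_sol.comp (by fun_prop : Continuous fun q : ℝ × ℝ => (Γ.ρ q.1 ^ 2, q.2))
    have h2 : Continuous fun q : ℝ × ℝ => Complex.exp (Complex.I * Γ.ρ q.1 * q.2) := by fun_prop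
    have h3 : Continuous fun q : ℝ × ℝ => K.weight (Γ.ρ q.1) := by
      unfold Problem.weight; fun_prop
    exact h2.smul (h1.mul h3)
  refine ⟨E * C, by positivity, fun s t ht => ?_⟩
  have h2 : K.sol (Γ.ρ s ^ 2) t * K.weight (Γ.ρ s) =
      (Complex.exp (Complex.I * Γ.ρ s * t))⁻¹ • K.solW (Γ.ρ s, t) := by
    rw [Problem.solW, inv_smul_smul₀ (Complex.exp_ne_zero _)]
  rw [h2, norm_smul]
  exact mul_le_mul (e1 s t ht) (h s t ht) (norm_nonneg _) hE

/-- Joint continuity is at hand for `φ` and not for `φ'`, so the derivative is bounded through the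
integrated equation. -/
theorem exists_solDer_bound_of_mem_Icc (x T : ℝ) : ∃ C : ℝ, ∀ s ∈ Icc (-T) T, ∀ t ∈ Icc 0 x,
    ‖K.solDer (Γ.ρ s ^ 2) t‖ ≤ C := by
  have hρ := Γ.continuous_ρ
  obtain ⟨B, hB⟩ := exists_bound_of_continuous (g := fun q : ℝ × ℝ => K.sol (Γ.ρ q.1 ^ 2) q.2)
    (K.continuous_sol.comp (by fun_prop : Continuous fun q : ℝ × ℝ => (Γ.ρ q.1 ^ 2, q.2))) x T
  obtain ⟨R, hR⟩ := exists_bound_of_continuous (g := fun q : ℝ × ℝ => Γ.ρ q.1 ^ 2)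
    (by fun_prop) x T
  refine ⟨‖K.Aperp + K.h‖ + ∫ t in (0 : ℝ)..x, (‖K.Q t‖ * |B| + |R| * |B|), fun s hs t ht => ?_⟩
  obtain ⟨h1, -, h3⟩ := K.isSol_sol (Γ.ρ s ^ 2)
  have hx : 0 ≤ x := ht.1.trans ht.2
  have hi : ∀ y, 0 ≤ y → IntervalIntegrable (fun t => ‖K.Q t‖ * |B| + |R| * |B|) volume 0 y :=
    fun y hy => ((intervalIntegrable_Q K.integrable_Q hy).norm.mul_const _).add
      intervalIntegrable_const
  rw [h1.prim'.eq t ht.1, h3]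
  refine (norm_add_le _ _).trans (add_le_add le_rfl ?_)
  refine (intervalIntegral.norm_integral_le_of_norm_le (g := fun t => ‖K.Q t‖ * |B| + |R| * |B|)
    ht.1 (ae_of_all _ fun τ hτ => ?_) (hi t ht.1)).trans ?_
  · have hτ' : τ ∈ Icc 0 x := ⟨hτ.1.le, hτ.2.trans ht.2⟩
    have b1 := (hB s hs τ hτ').trans (le_abs_self B)
    have b2 := (hR s hs τ hτ').trans (le_abs_self R)
    refine (norm_sub_le _ _).trans (add_le_add ?_ ?_)
    · exact (norm_mul_le _ _).trans (mul_le_mul_of_nonneg_left b1 (norm_nonneg _))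
    · rw [norm_smul]
      exact mul_le_mul b2 b1 (norm_nonneg _) (abs_nonneg _)
  · refine intervalIntegral.integral_mono_interval le_rfl ht.1 ht.2
      (ae_of_all _ fun τ => ?_) (hi x hx)
    simp only [Pi.zero_apply]; positivity

theorem exists_solDer_bound (x : ℝ) : ∃ C : ℝ, 0 ≤ C ∧ ∀ s, ∀ t ∈ Icc 0 x,
    ‖K.solDer (Γ.ρ s ^ 2) t * K.weight (Γ.ρ s)‖ ≤ C * ‖Γ.ρ s‖ := by
  have hρ := Γ.continuous_ρ
  have hne : ∀ s, Γ.ρ s ≠ 0 := fun s => Γ.ne_zero (Γ.pt s)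
  obtain ⟨E, hE, e1⟩ := Γ.exists_exp_bound x
  obtain ⟨C, hC, h⟩ := Γ.exists_bound_of_far (x := x) K.solDerW_isBigO fun T => by
    obtain ⟨B, hB⟩ := Γ.exists_solDer_bound_of_mem_Icc K x T
    obtain ⟨G, hG⟩ := exists_bound_of_continuous (g := fun q : ℝ × ℝ => (Complex.I * Γ.ρ q.1)⁻¹ •
      Complex.exp (Complex.I * Γ.ρ q.1 * q.2) • K.weight (Γ.ρ q.1)) (by
        have h2 : Continuous fun q : ℝ × ℝ => Complex.exp (Complex.I * Γ.ρ q.1 * q.2) := by fun_prop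
        have h3 : Continuous fun q : ℝ × ℝ => K.weight (Γ.ρ q.1) := by
          unfold Problem.weight; fun_prop
        have h4 : Continuous fun q : ℝ × ℝ => (Complex.I * Γ.ρ q.1)⁻¹ :=
          Continuous.inv₀ (by fun_prop) fun q => mul_ne_zero Complex.I_ne_zero (hne q.1)
        exact h4.smul (h2.smul h3)) x T
    refine ⟨|B| * |G|, fun s hs t ht => ?_⟩
    have e : (Complex.I * Γ.ρ s)⁻¹ • K.solDerW (Γ.ρ s, t) = K.solDer (Γ.ρ s ^ 2) t *
        ((Complex.I * Γ.ρ s)⁻¹ • Complex.exp (Complex.I * Γ.ρ s * t) • K.weight (Γ.ρ s)) := by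
      rw [Problem.solDerW, mul_smul_comm, mul_smul_comm]
    rw [e]
    exact (norm_mul_le _ _).trans (mul_le_mul ((hB s hs t ht).trans (le_abs_self B))
      ((hG s hs t ht).trans (le_abs_self G)) (norm_nonneg _) (abs_nonneg _))
  refine ⟨E * C, by positivity, fun s t ht => ?_⟩
  have h2 : K.solDer (Γ.ρ s ^ 2) t * K.weight (Γ.ρ s) =
      (Complex.exp (Complex.I * Γ.ρ s * t))⁻¹ • (Complex.I * Γ.ρ s) •
        (Complex.I * Γ.ρ s)⁻¹ • K.solDerW (Γ.ρ s, t) := by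
    rw [smul_inv_smul₀ (mul_ne_zero Complex.I_ne_zero (hne s)), Problem.solDerW,
      inv_smul_smul₀ (Complex.exp_ne_zero _)]
  rw [h2, norm_smul, norm_smul, norm_mul, Complex.norm_I, one_mul]
  calc _ ≤ E * (‖Γ.ρ s‖ * C) := mul_le_mul (e1 s t ht)
        (mul_le_mul_of_nonneg_left (h s t ht) (norm_nonneg _)) (by positivity) hE
    _ = _ := by ring

theorem norm_transpose_le (B : Mat n) : ‖B.transpose‖ ≤ ‖transposeCLM n‖ * ‖B‖ :=
  (transposeCLM n).le_opNorm B

theorem exists_solStar_bound (x : ℝ) : ∃ C : ℝ, 0 ≤ C ∧ ∀ s, ∀ t ∈ Icc 0 x,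
    ‖K.weight (Γ.ρ s) * K.solStar (Γ.ρ s ^ 2) t‖ ≤ C := by
  obtain ⟨C, hC, h⟩ := Γ.exists_sol_bound K.tr x
  refine ⟨‖transposeCLM n‖ * C, by positivity, fun s t ht => ?_⟩
  have e : K.weight (Γ.ρ s) * K.solStar (Γ.ρ s ^ 2) t =
      (K.tr.sol (Γ.ρ s ^ 2) t * K.tr.weight (Γ.ρ s)).transpose := by
    rw [Matrix.transpose_mul, K.tr_weight, Matrix.transpose_transpose, Problem.solStar]
  rw [e]
  exact (norm_transpose_le _).trans (mul_le_mul_of_nonneg_left (h s t ht) (norm_nonneg _))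

theorem exists_solStarDer_bound (x : ℝ) : ∃ C : ℝ, 0 ≤ C ∧ ∀ s, ∀ t ∈ Icc 0 x,
    ‖K.weight (Γ.ρ s) * K.solStarDer (Γ.ρ s ^ 2) t‖ ≤ C * ‖Γ.ρ s‖ := by
  obtain ⟨C, hC, h⟩ := Γ.exists_solDer_bound K.tr x
  refine ⟨‖transposeCLM n‖ * C, by positivity, fun s t ht => ?_⟩
  have e : K.weight (Γ.ρ s) * K.solStarDer (Γ.ρ s ^ 2) t =
      (K.tr.solDer (Γ.ρ s ^ 2) t * K.tr.weight (Γ.ρ s)).transpose := by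
    rw [Matrix.transpose_mul, K.tr_weight, Matrix.transpose_transpose, Problem.solStarDer]
  rw [e, mul_assoc]
  exact (norm_transpose_le _).trans (mul_le_mul_of_nonneg_left (h s t ht) (norm_nonneg _))

/-- The bound for `D`. -/
theorem exists_D_bound (x : ℝ) : ∃ C : ℝ, 0 ≤ C ∧ ∀ s s', ∀ t ∈ Icc 0 x,
    ‖K.weight (Γ.ρ s') * K.D t (Γ.ρ s ^ 2) (Γ.ρ s' ^ 2) * K.weight (Γ.ρ s)‖ ≤
      C * (1 + |‖Γ.ρ s‖ - ‖Γ.ρ s'‖|)⁻¹ := by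
  obtain ⟨C₁, hC₁, h1⟩ := Γ.exists_sol_bound K x
  obtain ⟨C₂, hC₂, h2⟩ := Γ.exists_solDer_bound K x
  obtain ⟨C₃, hC₃, h3⟩ := Γ.exists_solStar_bound K x
  obtain ⟨C₄, hC₄, h4⟩ := Γ.exists_solStarDer_bound K x
  refine ⟨C₃ * C₁ * |x| + (C₄ * C₁ + C₃ * C₂), by positivity, fun s s' t ht => ?_⟩
  set Y := K.weight (Γ.ρ s') * K.D t (Γ.ρ s ^ 2) (Γ.ρ s' ^ 2) * K.weight (Γ.ρ s) with hY
  -- The direct bound by the integral of the two weighted solutions is effective for `‖ρ‖` close to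
  -- `‖ρ'‖`.
  have near : ‖Y‖ ≤ C₃ * C₁ * |x| := by
    have hi : IntervalIntegrable (fun τ => K.solStar (Γ.ρ s' ^ 2) τ * K.sol (Γ.ρ s ^ 2) τ)
        volume 0 t := by
      refine Continuous.intervalIntegrable (Continuous.mul ?_ ?_) _ _
      · exact K.continuous_solStar.comp (by fun_prop : Continuous fun τ : ℝ => (Γ.ρ s' ^ 2, τ))
      · exact K.continuous_sol.comp (by fun_prop : Continuous fun τ : ℝ => (Γ.ρ s ^ 2, τ))
    have hi2 : IntervalIntegrable (fun τ => K.weight (Γ.ρ s') * (K.solStar (Γ.ρ s' ^ 2) τ *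
        K.sol (Γ.ρ s ^ 2) τ)) volume 0 t := hi.const_mul _
    rw [hY, K.D_eq ht.1, ← intervalIntegral_const_mul _ hi, ← intervalIntegral_mul_const _ hi2]
    refine (intervalIntegral.norm_integral_le_of_norm_le_const (C := C₃ * C₁) fun τ hτ => ?_).trans ?_
    · rw [uIoc_of_le ht.1] at hτ
      have hτ' : τ ∈ Icc 0 x := ⟨hτ.1.le, hτ.2.trans ht.2⟩
      rw [← mul_assoc, mul_assoc (K.weight _ * _)]
      exact (norm_mul_le _ _).trans (mul_le_mul (h3 s' τ hτ') (h1 s τ hτ') (norm_nonneg _) hC₃)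
    · refine mul_le_mul_of_nonneg_left ?_ (by positivity)
      rw [sub_zero, abs_of_nonneg ht.1]
      exact ht.2.trans (le_abs_self x)
  have hsum : 0 < ‖Γ.ρ s‖ + ‖Γ.ρ s'‖ :=
    add_pos_of_pos_of_nonneg (norm_pos_iff.mpr (Γ.ne_zero (Γ.pt s))) (norm_nonneg _)
  -- The Wronskian is of order `‖ρ‖ + ‖ρ'‖`, as each term contains one derivative. Division by `|ρ²
  -- - ρ'²|`, which is at least `|‖ρ‖ - ‖ρ'‖| (‖ρ‖ + ‖ρ'‖)`, leaves the claimed decay.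
  have far : |‖Γ.ρ s‖ - ‖Γ.ρ s'‖| * ‖Y‖ ≤ C₄ * C₁ + C₃ * C₂ := by
    have e : (Γ.ρ s ^ 2 - Γ.ρ s' ^ 2) • Y =
        (K.weight (Γ.ρ s') * K.solStarDer (Γ.ρ s' ^ 2) t) *
          (K.sol (Γ.ρ s ^ 2) t * K.weight (Γ.ρ s)) -
        (K.weight (Γ.ρ s') * K.solStar (Γ.ρ s' ^ 2) t) *
          (K.solDer (Γ.ρ s ^ 2) t * K.weight (Γ.ρ s)) := by
      rw [hY, ← smul_mul_assoc, ← mul_smul_comm, K.sub_smul_D ht.1]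
      noncomm_ring
    have b1 : ‖Γ.ρ s ^ 2 - Γ.ρ s' ^ 2‖ * ‖Y‖ ≤
        C₄ * ‖Γ.ρ s'‖ * C₁ + C₃ * (C₂ * ‖Γ.ρ s‖) := by
      rw [← norm_smul, e]
      refine (norm_sub_le _ _).trans (add_le_add ?_ ?_)
      · exact (norm_mul_le _ _).trans (mul_le_mul (h4 s' t ht) (h1 s t ht) (norm_nonneg _)
          (by positivity))
      · exact (norm_mul_le _ _).trans (mul_le_mul (h3 s' t ht) (h2 s t ht) (norm_nonneg _) hC₃)
    have b2 : |‖Γ.ρ s‖ - ‖Γ.ρ s'‖| * (‖Γ.ρ s‖ + ‖Γ.ρ s'‖) ≤ ‖Γ.ρ s ^ 2 - Γ.ρ s' ^ 2‖ := by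
      have := abs_norm_sub_norm_le (Γ.ρ s ^ 2) (Γ.ρ s' ^ 2)
      rw [norm_pow, norm_pow, sq_sub_sq, abs_mul, abs_of_pos hsum, mul_comm] at this
      exact this
    refine le_of_mul_le_mul_right ?_ hsum
    calc |‖Γ.ρ s‖ - ‖Γ.ρ s'‖| * ‖Y‖ * (‖Γ.ρ s‖ + ‖Γ.ρ s'‖) =
          |‖Γ.ρ s‖ - ‖Γ.ρ s'‖| * (‖Γ.ρ s‖ + ‖Γ.ρ s'‖) * ‖Y‖ := by ring
      _ ≤ ‖Γ.ρ s ^ 2 - Γ.ρ s' ^ 2‖ * ‖Y‖ := mul_le_mul_of_nonneg_right b2 (norm_nonneg _)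
      _ ≤ _ := b1
      _ ≤ (C₄ * C₁ + C₃ * C₂) * (‖Γ.ρ s‖ + ‖Γ.ρ s'‖) := by
        have q1 : 0 ≤ C₄ * C₁ * ‖Γ.ρ s‖ := by positivity
        have q2 : 0 ≤ C₃ * C₂ * ‖Γ.ρ s'‖ := by positivity
        linarith
  rw [← div_eq_mul_inv, le_div_iff₀ (by positivity)]
  linarith

theorem weight_congr {L : Problem n} (hA : K.A = L.A) (ρ : ℂ) : K.weight ρ = L.weight ρ := by
  rw [Problem.weight, Problem.weight, Problem.Aperp, Problem.Aperp, hA]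

variable (L : Problem n)

theorem continuous_weylMatrix (hL : L.Lam ⊆ S) : Continuous fun s => L.weylMatrix (Γ.ρ s) :=
  L.continuousOn_weylMatrix.comp_continuous Γ.continuous_ρ fun s =>
    ⟨Γ.ρ_mem_Omega s, L.isUnit_jostMatrix (Γ.ρ_mem_Omega s) fun h => Γ.sq_notMem s (hL h)⟩

/-- The bound for the difference of the Weyl matrices. -/
theorem exists_weylMatrix_bound (hA : K.A = L.A) (hL : L.Lam ⊆ S) (hK : K.Lam ⊆ S) :
    ∃ C : ℝ, 0 ≤ C ∧ ∀ s, ‖L.weightInv (Γ.ρ s) * (L.weylMatrix (Γ.ρ s) - K.weylMatrix (Γ.ρ s)) *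
      L.weightInv (Γ.ρ s)‖ ≤ C * ((1 + ‖Γ.ρ s‖) ^ 2)⁻¹ := by
  have hρ := Γ.continuous_ρ
  have hne : ∀ s, Γ.ρ s ≠ 0 := fun s => Γ.ne_zero (Γ.pt s)
  set f : ℂ × ℝ → Mat n := fun z => z.1 ^ 2 • (L.weightInv z.1 *
    (L.weylMatrix z.1 - K.weylMatrix z.1) * L.weightInv z.1) with hf
  have hfar : f =O[far] (fun _ => (1 : ℂ)) := by
    have h1 := (isBigO_refl (fun z : ℂ × ℝ => z.1 ^ 2) far).smul (L.weylMatrix_sub_asymp K hA)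
    refine h1.trans (IsBigO.of_bound 1 (far_mem.mono fun z hz => ?_))
    have : z.1 ≠ 0 := hz.1.2
    rw [smul_eq_mul, show z.1 ^ 2 * (z.1⁻¹ * z.1⁻¹) = 1 by field_simp]
    simp
  have hcont : Continuous fun q : ℝ × ℝ => f (Γ.ρ q.1, q.2) := by
    have h1 : Continuous fun q : ℝ × ℝ => L.weightInv (Γ.ρ q.1) :=
      (Γ.continuous_weightInv L).comp (f := fun q : ℝ × ℝ => Γ.pt q.1)
        (Γ.continuous_pt.comp continuous_fst)
    have h2 : Continuous fun q : ℝ × ℝ => L.weylMatrix (Γ.ρ q.1) :=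
      (Γ.continuous_weylMatrix L hL).comp (f := fun q : ℝ × ℝ => q.1) continuous_fst
    have h3 : Continuous fun q : ℝ × ℝ => K.weylMatrix (Γ.ρ q.1) :=
      (Γ.continuous_weylMatrix K hK).comp (f := fun q : ℝ × ℝ => q.1) continuous_fst
    have h4 : Continuous fun q : ℝ × ℝ => Γ.ρ q.1 ^ 2 := by fun_prop
    have h5 := (h1.mul (h2.sub h3)).mul h1
    exact h4.smul h5
  obtain ⟨C, hC, h⟩ := Γ.exists_bound_of_far (x := 0) hfar fun T =>
    exists_bound_of_continuous hcont 0 T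
  obtain ⟨B, hB, hb⟩ := Γ.one_add_norm_le
  refine ⟨C * B ^ 2, by positivity, fun s => ?_⟩
  have h1 := h s 0 ⟨le_rfl, le_rfl⟩
  simp only [hf, norm_smul, norm_pow] at h1
  rw [← div_eq_mul_inv, le_div_iff₀ (by positivity)]
  set y := ‖L.weightInv (Γ.ρ s) * (L.weylMatrix (Γ.ρ s) - K.weylMatrix (Γ.ρ s)) *
      L.weightInv (Γ.ρ s)‖ with hy
  have hy0 : 0 ≤ y := norm_nonneg _
  calc y * (1 + ‖Γ.ρ s‖) ^ 2 ≤ y * (B * ‖Γ.ρ s‖) ^ 2 :=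
        mul_le_mul_of_nonneg_left (pow_le_pow_left₀ (by positivity) (hb s) 2) hy0
    _ = (‖Γ.ρ s‖ ^ 2 * y) * B ^ 2 := by ring
    _ ≤ C * B ^ 2 := mul_le_mul_of_nonneg_right h1 (by positivity)

end Contour

/-! ### The difference of the Weyl matrices and its transpose in the contour integral. -/

open Asymptotics

variable {n : ℕ}

namespace Problem

variable (L : Problem n)

theorem tr_solStar (mu : ℂ) (x : ℝ) : L.tr.solStar mu x = (L.sol mu x).transpose := by
  rw [solStar, tr_tr]

theorem tr_D {x : ℝ} (hx : 0 ≤ x) (lam mu : ℂ) : (L.tr.D x mu lam).transpose = L.D x lam mu := by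
  rw [L.D_eq hx, L.tr.D_eq hx, ← transposeCLM_apply,
    ← ContinuousLinearMap.intervalIntegral_comp_comm]
  · refine intervalIntegral.integral_congr fun t _ => ?_
    simp only [transposeCLM_apply, Matrix.transpose_mul, tr_solStar, Matrix.transpose_transpose]
    rfl
  · refine Continuous.intervalIntegrable (Continuous.mul ?_ ?_) _ _
    · exact L.tr.continuous_solStar.comp (by fun_prop : Continuous fun τ : ℝ => (lam, τ))
    · exact L.tr.continuous_sol.comp (by fun_prop : Continuous fun τ : ℝ => (mu, τ))

/-- The integral of `φ* φ`. -/
def solD (z : ℂ × ℂ) (x : ℝ) : Mat n := ∫ t in (0 : ℝ)..x, L.solStar z.2 t * L.sol z.1 t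

theorem continuous_solStar_mul_sol :
    Continuous fun z : (ℂ × ℂ) × ℝ => L.solStar z.1.2 z.2 * L.sol z.1.1 z.2 := by
  refine Continuous.mul ?_ ?_
  · exact L.continuous_solStar.comp (by fun_prop : Continuous fun z : (ℂ × ℂ) × ℝ => (z.1.2, z.2))
  · exact L.continuous_sol.comp (by fun_prop : Continuous fun z : (ℂ × ℂ) × ℝ => (z.1.1, z.2))

theorem continuous_solD : Continuous fun z : (ℂ × ℂ) × ℝ => L.solD z.1 z.2 :=
  intervalIntegral.continuous_parametric_primitive_of_continuous
    (f := fun (z : ℂ × ℂ) t => L.solStar z.2 t * L.sol z.1 t) L.continuous_solStar_mul_sol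

theorem isPrim_solD (z : ℂ × ℂ) : IsPrim (L.solD z) (fun t => L.solStar z.2 t * L.sol z.1 t) := by
  have hc : Continuous fun t => L.solStar z.2 t * L.sol z.1 t :=
    L.continuous_solStar_mul_sol.comp (by fun_prop : Continuous fun t : ℝ => (z, t))
  refine (IsPrim.of_integral 0 fun x _ => hc.intervalIntegrable 0 x).congr
    (fun x _ => ?_) fun _ _ => rfl
  rw [zero_add, solD]

theorem solD_zero (z : ℂ × ℂ) : L.solD z 0 = 0 := intervalIntegral.integral_same

end Problem

namespace Contour

variable {S : Set ℂ} (Γ : Contour S)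

/-- `m` is continuous and holomorphic off `S`, has the values `M_L - M_K` for large `ρ` and decays
along the contour. -/
structure IsWeylDiff (L K : Problem n) (m : ℂ → Mat n) : Prop where
  A_eq : K.A = L.A
  cont : ContinuousOn m {τ | τ ∈ Omega ∧ τ ^ 2 ∉ S}
  diff : DifferentiableOn ℂ m {τ | 0 < τ.im ∧ τ ^ 2 ∉ S}
  far : ∀ᶠ z : ℂ × ℝ in far, m z.1 = L.weylMatrix z.1 - K.weylMatrix z.1
  bound : ∃ C : ℝ, 0 ≤ C ∧ ∀ s, ‖L.weightInv (Γ.ρ s) * m (Γ.ρ s) * L.weightInv (Γ.ρ s)‖ ≤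
    C * ((1 + ‖Γ.ρ s‖) ^ 2)⁻¹

variable {Γ} {L K : Problem n}

theorem isWeylDiff (hA : K.A = L.A) (hL : L.Lam ⊆ S) (hK : K.Lam ⊆ S) :
    Γ.IsWeylDiff L K fun τ => L.weylMatrix τ - K.weylMatrix τ where
  A_eq := hA
  cont := (L.continuousOn_weylMatrix.mono fun _ hτ =>
      ⟨hτ.1, L.isUnit_jostMatrix hτ.1 fun h => hτ.2 (hL h)⟩).sub
    (K.continuousOn_weylMatrix.mono fun _ hτ =>
      ⟨hτ.1, K.isUnit_jostMatrix hτ.1 fun h => hτ.2 (hK h)⟩)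
  diff := (L.differentiableOn_weylMatrix.mono fun _ hτ =>
      ⟨hτ.1, L.isUnit_jostMatrix (upper_subset_Omega hτ.1) fun h => hτ.2 (hL h)⟩).sub
    (K.differentiableOn_weylMatrix.mono fun _ hτ =>
      ⟨hτ.1, K.isUnit_jostMatrix (upper_subset_Omega hτ.1) fun h => hτ.2 (hK h)⟩)
  far := Eventually.of_forall fun _ => rfl
  bound := Γ.exists_weylMatrix_bound K L hA hL hK

/-- `weylMatrix_tr` needs invertible Jost matrices of all four problems, which is known for large
`ρ`. This is why `IsWeylDiff` asks for equality with the difference of the Weyl matrices only there.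
-/
theorem weylMatrix_sub_tr_far : ∀ᶠ z : ℂ × ℝ in far, (L.weylMatrix z.1 - K.weylMatrix z.1).transpose =
    L.tr.weylMatrix z.1 - K.tr.weylMatrix z.1 := by
  filter_upwards [far_mem, L.isUnit_jostMatrix_far, L.tr.isUnit_jostMatrix_far,
    K.isUnit_jostMatrix_far, K.tr.isUnit_jostMatrix_far] with z h0 h1 h2 h3 h4
  rw [← L.weylMatrix_tr h0.1 h1.1 h2.1, ← K.weylMatrix_tr h0.1 h3.1 h4.1, Matrix.transpose_sub,
    Matrix.transpose_transpose, Matrix.transpose_transpose]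

theorem norm_tr_weightInv_mul_le (B : Mat n) (ρ : ℂ) :
    ‖L.tr.weightInv ρ * B.transpose * L.tr.weightInv ρ‖ ≤
      ‖transposeCLM n‖ * ‖L.weightInv ρ * B * L.weightInv ρ‖ := by
  have e : L.tr.weightInv ρ * B.transpose * L.tr.weightInv ρ =
      (L.weightInv ρ * B * L.weightInv ρ).transpose := by
    rw [L.tr_weightInv, Matrix.transpose_mul, Matrix.transpose_mul, mul_assoc]
  rw [e]
  exact norm_transpose_le _

theorem exists_weylMatrix_tr_bound (hA : K.A = L.A) (hL : L.Lam ⊆ S) (hK : K.Lam ⊆ S) :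
    ∃ C : ℝ, 0 ≤ C ∧ ∀ s, ‖L.tr.weightInv (Γ.ρ s) *
      (L.weylMatrix (Γ.ρ s) - K.weylMatrix (Γ.ρ s)).transpose * L.tr.weightInv (Γ.ρ s)‖ ≤
        C * ((1 + ‖Γ.ρ s‖) ^ 2)⁻¹ := by
  obtain ⟨C, hC, h⟩ := Γ.exists_weylMatrix_bound K L hA hL hK
  have hT : 0 ≤ ‖transposeCLM n‖ := norm_nonneg _
  refine ⟨‖transposeCLM n‖ * C, mul_nonneg hT hC, fun s => ?_⟩
  rw [mul_assoc ‖transposeCLM n‖]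
  exact (norm_tr_weightInv_mul_le _ _).trans (mul_le_mul_of_nonneg_left (h s) hT)

/-- Continuity, holomorphy and decay are inherited from `M̂` itself by transposition, so the zeros
of the transposed Jost determinants need not be located. -/
theorem isWeylDiff_tr (hA : K.A = L.A) (hL : L.Lam ⊆ S) (hK : K.Lam ⊆ S) :
    Γ.IsWeylDiff L.tr K.tr fun τ => (L.weylMatrix τ - K.weylMatrix τ).transpose where
  A_eq := congrArg Matrix.transpose hA
  cont := (transposeCLM n).continuous.comp_continuousOn
    (f := fun τ => L.weylMatrix τ - K.weylMatrix τ) (isWeylDiff (Γ := Γ) hA hL hK).cont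
  diff := (transposeCLM n).differentiable.comp_differentiableOn
    (f := fun τ => L.weylMatrix τ - K.weylMatrix τ) (isWeylDiff (Γ := Γ) hA hL hK).diff
  far := weylMatrix_sub_tr_far
  bound := exists_weylMatrix_tr_bound hA hL hK

namespace IsWeylDiff

variable {m : ℂ → Mat n}

theorem continuous_comp (h : Γ.IsWeylDiff L K m) : Continuous fun s => m (Γ.ρ s) :=
  h.cont.comp_continuous Γ.continuous_ρ fun s => ⟨Γ.ρ_mem_Omega s, Γ.sq_notMem s⟩

theorem mul_D_bound (h : Γ.IsWeylDiff L K m) (x : ℝ) : ∃ C : ℝ, 0 ≤ C ∧ ∀ s s', ∀ t ∈ Icc 0 x,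
    ‖L.weightInv (Γ.ρ s) * (m (Γ.ρ s) * K.D t (Γ.ρ s' ^ 2) (Γ.ρ s ^ 2)) * L.weight (Γ.ρ s')‖ ≤
      C * ((1 + ‖Γ.ρ s‖) ^ 2 * (1 + |‖Γ.ρ s'‖ - ‖Γ.ρ s‖|))⁻¹ := by
  obtain ⟨C₁, hC₁, h1⟩ := h.bound
  obtain ⟨C₂, hC₂, h2⟩ := Γ.exists_D_bound K x
  refine ⟨C₁ * C₂, by positivity, fun s s' t ht => ?_⟩
  have e : L.weightInv (Γ.ρ s) * (m (Γ.ρ s) * K.D t (Γ.ρ s' ^ 2) (Γ.ρ s ^ 2)) *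
      L.weight (Γ.ρ s') = (L.weightInv (Γ.ρ s) * m (Γ.ρ s) * L.weightInv (Γ.ρ s)) *
      (K.weight (Γ.ρ s) * K.D t (Γ.ρ s' ^ 2) (Γ.ρ s ^ 2) * K.weight (Γ.ρ s')) := by
    have h3 : L.weightInv (Γ.ρ s) * L.weight (Γ.ρ s) = 1 :=
      L.weightInv_mul_weight (Γ.ne_zero (Γ.pt s))
    rw [weight_congr K h.A_eq, weight_congr K h.A_eq, mul_assoc (L.weight _),
      mul_assoc (L.weightInv _ * m _), ← mul_assoc (L.weightInv _) (L.weight _), h3, one_mul]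
    simp only [mul_assoc]
  rw [e, mul_inv]
  calc _ ≤ (C₁ * ((1 + ‖Γ.ρ s‖) ^ 2)⁻¹) * (C₂ * (1 + |‖Γ.ρ s'‖ - ‖Γ.ρ s‖|)⁻¹) :=
        (norm_mul_le _ _).trans (mul_le_mul (h1 s) (h2 s' s t ht) (norm_nonneg _) (by positivity))
    _ = _ := by ring

theorem isKernel (h : Γ.IsWeylDiff L K m) {x : ℝ} (hx : 0 ≤ x) :
    Γ.IsKernel L fun p q => m q * K.D x ((p : ℂ) ^ 2) ((q : ℂ) ^ 2) where
  cont := by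
    have h1 : Continuous fun p : Γ.support => m p :=
      h.cont.comp_continuous continuous_subtype_val fun p => by
        obtain ⟨w, s, rfl⟩ := p
        exact ⟨Γ.ρ_mem_Omega s, Γ.sq_notMem s⟩
    have h2 : Continuous fun pq : Γ.support × Γ.support =>
        K.solD ((pq.1 : ℂ) ^ 2, (pq.2 : ℂ) ^ 2) x :=
      K.continuous_solD.comp (f := fun pq : Γ.support × Γ.support =>
        (((pq.1 : ℂ) ^ 2, (pq.2 : ℂ) ^ 2), x)) (by fun_prop)
    simp only [K.D_eq hx]
    exact (h1.comp continuous_snd).mul h2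
  bound := by
    obtain ⟨C, -, hb⟩ := h.mul_D_bound x
    refine ⟨C, fun p q => ?_⟩
    obtain ⟨w, s, rfl⟩ := p
    obtain ⟨w', s', rfl⟩ := q
    exact hb s' s x ⟨hx, le_rfl⟩

/-- The bound is uniform in `t ∈ [0, x]`; this permits interchanging the integrals over `t` and over
the contour. -/
theorem sol_mul_D_bound (h : Γ.IsWeylDiff L K m) (x : ℝ) (s' : ℝ) : ∃ C : ℝ, 0 ≤ C ∧
    ∀ᵐ s, ∀ t ∈ Icc 0 x, ‖deriv (fun t => Γ.ρ t ^ 2) s •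
      (L.sol (Γ.ρ s ^ 2) t * m (Γ.ρ s) * K.D t (Γ.ρ s' ^ 2) (Γ.ρ s ^ 2))‖ ≤
        C * Γ.kap ‖Γ.ρ s'‖ s := by
  obtain ⟨C₁, hC₁, h1⟩ := Γ.exists_sol_bound L x
  obtain ⟨C₂, hC₂, h2⟩ := h.mul_D_bound x
  obtain ⟨C₃, hC₃, h3⟩ := Γ.exists_deriv_sq_le
  refine ⟨C₃ * C₁ * C₂ * ‖L.weightInv (Γ.ρ s')‖, by positivity, ?_⟩
  filter_upwards [h3] with s hs t ht
  have e : L.sol (Γ.ρ s ^ 2) t * m (Γ.ρ s) * K.D t (Γ.ρ s' ^ 2) (Γ.ρ s ^ 2) =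
      (L.sol (Γ.ρ s ^ 2) t * L.weight (Γ.ρ s)) * (L.weightInv (Γ.ρ s) *
        (m (Γ.ρ s) * K.D t (Γ.ρ s' ^ 2) (Γ.ρ s ^ 2)) * L.weight (Γ.ρ s')) *
        L.weightInv (Γ.ρ s') := by
    have h4 : L.weight (Γ.ρ s) * L.weightInv (Γ.ρ s) = 1 :=
      L.weight_mul_weightInv (Γ.ne_zero (Γ.pt s))
    have h5 : L.weight (Γ.ρ s') * L.weightInv (Γ.ρ s') = 1 :=
      L.weight_mul_weightInv (Γ.ne_zero (Γ.pt s'))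
    rw [← mul_assoc, mul_assoc _ (L.weight (Γ.ρ s')), h5, mul_one, ← mul_assoc,
      mul_assoc _ (L.weight (Γ.ρ s)), h4, mul_one, mul_assoc]
  rw [e, norm_smul]
  have h6 := (norm_mul_le (L.sol (Γ.ρ s ^ 2) t * L.weight (Γ.ρ s)) _).trans
    (mul_le_mul (h1 s t ht) (h2 s s' t ht) (norm_nonneg _) hC₁)
  calc _ ≤ (C₃ * (1 + ‖Γ.ρ s‖)) * ((C₁ * (C₂ * ((1 + ‖Γ.ρ s‖) ^ 2 *
        (1 + |‖Γ.ρ s'‖ - ‖Γ.ρ s‖|))⁻¹)) * ‖L.weightInv (Γ.ρ s')‖) :=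
        mul_le_mul hs ((norm_mul_le _ _).trans (mul_le_mul_of_nonneg_right h6 (norm_nonneg _)))
          (norm_nonneg _) (by positivity)
    _ = _ := by
        rw [kap]
        have : 1 + ‖Γ.ρ s‖ ≠ 0 := by positivity
        field_simp

theorem continuous_sol_mul_solD (h : Γ.IsWeylDiff L K m) (lam : ℂ) : Continuous fun q : ℝ × ℝ =>
    L.sol (Γ.ρ q.1 ^ 2) q.2 * m (Γ.ρ q.1) * K.solD (lam, Γ.ρ q.1 ^ 2) q.2 := by
  have hρ := Γ.continuous_ρ
  refine Continuous.mul (Continuous.mul ?_ (h.continuous_comp.comp continuous_fst)) ?_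
  · exact L.continuous_sol.comp (by fun_prop : Continuous fun q : ℝ × ℝ => (Γ.ρ q.1 ^ 2, q.2))
  · exact Continuous.comp (g := fun z : (ℂ × ℂ) × ℝ => K.solD z.1 z.2)
      (f := fun q : ℝ × ℝ => ((lam, Γ.ρ q.1 ^ 2), q.2)) K.continuous_solD (by fun_prop)

theorem integrable (h : Γ.IsWeylDiff L K m) {x : ℝ} (hx : 0 ≤ x) (s' : ℝ) :
    Integrable fun s => deriv (fun t => Γ.ρ t ^ 2) s •
      (L.sol (Γ.ρ s ^ 2) x * m (Γ.ρ s) * K.D x (Γ.ρ s' ^ 2) (Γ.ρ s ^ 2)) := by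
  obtain ⟨C, hC, hb⟩ := h.sol_mul_D_bound x s'
  refine ((Γ.integrable_kap ‖Γ.ρ s'‖).const_mul C).mono' ?_
    (hb.mono fun s hs => hs x ⟨hx, le_rfl⟩)
  have hc : Continuous fun s => L.sol (Γ.ρ s ^ 2) x * m (Γ.ρ s) *
      K.D x (Γ.ρ s' ^ 2) (Γ.ρ s ^ 2) := by
    simp only [K.D_eq hx]
    exact Continuous.comp (g := fun q : ℝ × ℝ => L.sol (Γ.ρ q.1 ^ 2) q.2 * m (Γ.ρ q.1) *
      K.solD (Γ.ρ s' ^ 2, Γ.ρ q.1 ^ 2) q.2) (f := fun s : ℝ => (s, x))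
      (h.continuous_sol_mul_solD (Γ.ρ s' ^ 2)) (by fun_prop)
  exact ((measurable_deriv fun t => Γ.ρ t ^ 2).aestronglyMeasurable (μ := volume)).smul
    hc.aestronglyMeasurable

theorem integral_eq (h : Γ.IsWeylDiff L K m) (hS : IsCompact S) (h0 : (0 : ℂ) ∈ S) {x : ℝ}
    (hx : 0 ≤ x) (s' : ℝ) : ∫ s, deriv (fun t => Γ.ρ t ^ 2) s •
      (L.sol (Γ.ρ s ^ 2) x * m (Γ.ρ s) * K.D x (Γ.ρ s' ^ 2) (Γ.ρ s ^ 2)) =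
      (2 * Real.pi * Complex.I : ℂ) • (K.sol (Γ.ρ s' ^ 2) x - L.sol (Γ.ρ s' ^ 2) x) :=
  Γ.integral_sol_mul_D L K hS h0 h.A_eq h.cont h.diff h.far _ hx (h.integrable hx s')

end IsWeylDiff

end Contour

/-! ### The relation between the integrals `D` of the two problems. -/

variable {n : ℕ}

namespace Contour

variable {S : Set ℂ} {Γ : Contour S} {L K : Problem n}

/-- The bound for the adjoint integrand, obtained by transposition. -/
theorem exists_star_bound (hA : K.A = L.A) (hL : L.Lam ⊆ S) (hK : K.Lam ⊆ S) {x : ℝ} (s' : ℝ) :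
    ∃ C : ℝ, 0 ≤ C ∧ ∀ᵐ s, ∀ t ∈ Icc 0 x, ‖deriv (fun t => Γ.ρ t ^ 2) s •
      (L.D t (Γ.ρ s ^ 2) (Γ.ρ s' ^ 2) * (L.weylMatrix (Γ.ρ s) - K.weylMatrix (Γ.ρ s)) *
        K.solStar (Γ.ρ s ^ 2) t)‖ ≤ C * Γ.kap ‖Γ.ρ s'‖ s := by
  obtain ⟨C, hC, h⟩ := (isWeylDiff_tr (Γ := Γ) hA.symm hK hL).sol_mul_D_bound x s'
  have hT : 0 ≤ ‖transposeCLM n‖ := norm_nonneg _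
  refine ⟨‖transposeCLM n‖ * C, mul_nonneg hT hC, ?_⟩
  filter_upwards [h] with s hs t ht
  have e : deriv (fun t => Γ.ρ t ^ 2) s •
      (L.D t (Γ.ρ s ^ 2) (Γ.ρ s' ^ 2) * (L.weylMatrix (Γ.ρ s) - K.weylMatrix (Γ.ρ s)) *
        K.solStar (Γ.ρ s ^ 2) t) = -(deriv (fun t => Γ.ρ t ^ 2) s •
      (K.tr.sol (Γ.ρ s ^ 2) t * (K.weylMatrix (Γ.ρ s) - L.weylMatrix (Γ.ρ s)).transpose *
        L.tr.D t (Γ.ρ s' ^ 2) (Γ.ρ s ^ 2))).transpose := by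
    rw [Matrix.transpose_smul, Matrix.transpose_mul, Matrix.transpose_mul,
      Matrix.transpose_transpose, L.tr_D ht.1, Problem.solStar, ← smul_neg, ← mul_assoc,
      ← neg_sub (L.weylMatrix _), mul_neg, neg_mul, neg_neg]
  rw [e, norm_neg, mul_assoc ‖transposeCLM n‖]
  exact (norm_transpose_le _).trans (mul_le_mul_of_nonneg_left (hs t ht) hT)

/-- The transpose of the contour formula for the pair of transposed problems. The roles of `L` and
`K` are exchanged in it, so that `D` of the first problem stands next to `φ*` of the second; this
changes the sign of `M̂`. -/
theorem integral_star (hS : IsCompact S) (h0 : (0 : ℂ) ∈ S) (hA : K.A = L.A) (hL : L.Lam ⊆ S)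
    (hK : K.Lam ⊆ S) {x : ℝ} (hx : 0 ≤ x) (s' : ℝ) : (∫ s, deriv (fun t => Γ.ρ t ^ 2) s •
      (L.D x (Γ.ρ s ^ 2) (Γ.ρ s' ^ 2) * (L.weylMatrix (Γ.ρ s) - K.weylMatrix (Γ.ρ s)) *
        K.solStar (Γ.ρ s ^ 2) x)) =
      (2 * Real.pi * Complex.I : ℂ) • (K.solStar (Γ.ρ s' ^ 2) x - L.solStar (Γ.ρ s' ^ 2) x) := by
  have h := isWeylDiff_tr (Γ := Γ) hA.symm hK hL
  have h1 := congrArg (transposeCLM n) (h.integral_eq hS h0 hx s')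
  rw [← ContinuousLinearMap.integral_comp_comm _ (h.integrable hx s'), map_smul, map_sub] at h1
  have e : ∀ s, deriv (fun t => Γ.ρ t ^ 2) s •
      (L.D x (Γ.ρ s ^ 2) (Γ.ρ s' ^ 2) * (L.weylMatrix (Γ.ρ s) - K.weylMatrix (Γ.ρ s)) *
        K.solStar (Γ.ρ s ^ 2) x) = -transposeCLM n (deriv (fun t => Γ.ρ t ^ 2) s •
      (K.tr.sol (Γ.ρ s ^ 2) x * (K.weylMatrix (Γ.ρ s) - L.weylMatrix (Γ.ρ s)).transpose *
        L.tr.D x (Γ.ρ s' ^ 2) (Γ.ρ s ^ 2))) := fun s => by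
    rw [transposeCLM_apply, Matrix.transpose_smul, Matrix.transpose_mul, Matrix.transpose_mul,
      Matrix.transpose_transpose, L.tr_D hx, Problem.solStar, ← smul_neg, ← mul_assoc,
      ← neg_sub (L.weylMatrix _), mul_neg, neg_mul, neg_neg]
  simp only [e]
  rw [integral_neg, h1, ← smul_neg, neg_sub]
  rfl

/-- Fubini's theorem in the form needed for the product rule. -/
theorem integral_intervalIntegral_eq {w : ℝ → ℂ} (hw : Measurable w) {A B : ℝ × ℝ → Mat n}
    (hA : Continuous A) (hB : Continuous B) {U V : ℝ → Mat n} (hU : Continuous U)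
    (hV : Continuous V) {x : ℝ} (hx : 0 ≤ x) {a b : ℝ → ℝ} (ha : Integrable a) (hb : Integrable b)
    (bA : ∀ᵐ s, ∀ t ∈ Icc 0 x, ‖w s • A (t, s)‖ ≤ a s)
    (bB : ∀ᵐ s, ∀ t ∈ Icc 0 x, ‖w s • B (t, s)‖ ≤ b s) :
    (∫ s, ∫ t in (0 : ℝ)..x, (U t * (w s • A (t, s)) + (w s • B (t, s)) * V t)) =
      ∫ t in (0 : ℝ)..x, (U t * (∫ s, w s • A (t, s)) + (∫ s, w s • B (t, s)) * V t) := by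
  obtain ⟨G, hG⟩ := isCompact_Icc.exists_bound_of_continuousOn (hU.continuousOn (s := Icc 0 x))
  obtain ⟨H, hH⟩ := isCompact_Icc.exists_bound_of_continuousOn (hV.continuousOn (s := Icc 0 x))
  have slice : ∀ {A : ℝ × ℝ → Mat n} {a : ℝ → ℝ}, Continuous A → Integrable a →
      (∀ᵐ s, ∀ t ∈ Icc 0 x, ‖w s • A (t, s)‖ ≤ a s) → ∀ t ∈ Icc 0 x,
      Integrable fun s => w s • A (t, s) := fun {A a} hA ha bA t ht => by
    have h1 : Continuous fun s => A (t, s) := hA.comp (by fun_prop : Continuous fun s : ℝ => (t, s))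
    exact ha.mono' ((hw.aestronglyMeasurable (μ := volume)).smul h1.aestronglyMeasurable)
      (bA.mono fun s hs => hs t ht)
  rw [← intervalIntegral_integral_swap]
  · refine intervalIntegral.integral_congr fun t ht => ?_
    rw [uIcc_of_le hx] at ht
    have i1 := slice hA ha bA t ht
    have i2 := slice hB hb bB t ht
    have h1 : Integrable fun s => U t * (w s • A (t, s)) := i1.const_mul _
    have h2 : Integrable fun s => (w s • B (t, s)) * V t := i2.mul_const _
    rw [integral_add h1 h2, integral_const_mul_of_integrable i1, integral_mul_const_of_integrable i2]
  · have hK := (ha.const_mul |G|).add (hb.const_mul |H|)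
    have hfin : IsFiniteMeasure (volume.restrict (uIoc 0 x)) := by
      rw [uIoc_of_le hx]; infer_instance
    refine (hK.comp_snd (volume.restrict (uIoc 0 x))).mono' ?_ ?_
    · have hw2 : AEStronglyMeasurable (fun q : ℝ × ℝ => w q.2)
          ((volume.restrict (uIoc 0 x)).prod volume) := (hw.comp measurable_snd).aestronglyMeasurable
      have c1 : Continuous fun q : ℝ × ℝ => U q.1 := hU.comp continuous_fst
      have c2 : Continuous fun q : ℝ × ℝ => V q.1 := hV.comp continuous_fst
      exact (c1.aestronglyMeasurable.mul (hw2.smul hA.aestronglyMeasurable)).add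
        ((hw2.smul hB.aestronglyMeasurable).mul c2.aestronglyMeasurable)
    · have hq : ∀ᵐ q : ℝ × ℝ ∂(volume.restrict (uIoc 0 x)).prod volume,
          q.1 ∈ Icc 0 x ∧ ((∀ t ∈ Icc 0 x, ‖w q.2 • A (t, q.2)‖ ≤ a q.2) ∧
            ∀ t ∈ Icc 0 x, ‖w q.2 • B (t, q.2)‖ ≤ b q.2) := by
        have q1 : ∀ᵐ t ∂volume.restrict (uIoc 0 x), t ∈ Icc 0 x := by
          filter_upwards [ae_restrict_mem measurableSet_uIoc] with t ht
          rw [uIoc_of_le hx] at ht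
          exact Ioc_subset_Icc_self ht
        exact (Measure.quasiMeasurePreserving_fst.ae q1).and
          (Measure.quasiMeasurePreserving_snd.ae (bA.and bB))
      filter_upwards [hq] with q hq
      obtain ⟨ht, h1, h2⟩ := hq
      refine (norm_add_le _ _).trans (add_le_add ?_ ?_)
      · exact (norm_mul_le _ _).trans (mul_le_mul ((hG _ ht).trans (le_abs_self G)) (h1 _ ht)
          (norm_nonneg _) (abs_nonneg _))
      · refine (norm_mul_le _ _).trans ?_
        rw [mul_comm]
        exact mul_le_mul ((hH _ ht).trans (le_abs_self H)) (h2 _ ht) (norm_nonneg _) (abs_nonneg _)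

theorem continuous_solD_mul_solStar (hA : K.A = L.A) (hL : L.Lam ⊆ S) (hK : K.Lam ⊆ S) (xi : ℂ) :
    Continuous fun q : ℝ × ℝ => L.solD (Γ.ρ q.2 ^ 2, xi) q.1 *
      (L.weylMatrix (Γ.ρ q.2) - K.weylMatrix (Γ.ρ q.2)) * K.solStar (Γ.ρ q.2 ^ 2) q.1 := by
  have hρ := Γ.continuous_ρ
  have hm := (isWeylDiff (Γ := Γ) hA hL hK).continuous_comp
  refine Continuous.mul (Continuous.mul ?_ (hm.comp continuous_snd)) ?_
  · exact Continuous.comp (g := fun z : (ℂ × ℂ) × ℝ => L.solD z.1 z.2)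
      (f := fun q : ℝ × ℝ => ((Γ.ρ q.2 ^ 2, xi), q.1)) L.continuous_solD (by fun_prop)
  · exact Continuous.comp (g := fun z : ℂ × ℝ => K.solStar z.1 z.2)
      (f := fun q : ℝ × ℝ => (Γ.ρ q.2 ^ 2, q.1)) K.continuous_solStar (by fun_prop)

/-- The product rule for `D M̂ D`. -/
theorem smul_solD_mul_solD (c : ℂ) (m : Mat n) (lam mu xi : ℂ) {x : ℝ} (hx : 0 ≤ x) :
    c • (L.solD (mu, xi) x * m * K.solD (lam, mu) x) = ∫ t in (0 : ℝ)..x,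
      (L.solStar xi t * (c • (L.sol mu t * m * K.solD (lam, mu) t)) +
        (c • (L.solD (mu, xi) t * m * K.solStar mu t)) * K.sol lam t) := by
  have h1 := ((L.isPrim_solD (mu, xi)).mul (IsPrim.const (c • m))).mul (K.isPrim_solD (lam, mu))
  have h2 := h1.eq x hx
  simp only [Problem.solD_zero, zero_mul, zero_add, mul_zero, add_zero] at h2
  rw [mul_smul_comm, smul_mul_assoc] at h2
  rw [h2]
  refine intervalIntegral.integral_congr fun t _ => ?_
  simp only [mul_smul_comm, smul_mul_assoc, mul_assoc]

/-- The integral equation which connects the functions `D` of the two problems. -/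
theorem integral_D_mul_D (hS : IsCompact S) (h0 : (0 : ℂ) ∈ S) (hA : K.A = L.A) (hL : L.Lam ⊆ S)
    (hK : K.Lam ⊆ S) {x : ℝ} (hx : 0 ≤ x) (s₁ s₂ : ℝ) : (∫ s, deriv (fun t => Γ.ρ t ^ 2) s •
      (L.D x (Γ.ρ s ^ 2) (Γ.ρ s₂ ^ 2) * (L.weylMatrix (Γ.ρ s) - K.weylMatrix (Γ.ρ s)) *
        K.D x (Γ.ρ s₁ ^ 2) (Γ.ρ s ^ 2))) = (2 * Real.pi * Complex.I : ℂ) •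
        (K.D x (Γ.ρ s₁ ^ 2) (Γ.ρ s₂ ^ 2) - L.D x (Γ.ρ s₁ ^ 2) (Γ.ρ s₂ ^ 2)) := by
  have hm := isWeylDiff (Γ := Γ) hA hL hK
  obtain ⟨Ca, hCa, ba⟩ := hm.sol_mul_D_bound x s₁
  obtain ⟨Cb, hCb, bb⟩ := exists_star_bound (Γ := Γ) hA hL hK (x := x) s₂
  have va := fun (t : ℝ) (ht : 0 ≤ t) => hm.integral_eq hS h0 ht s₁
  have vb := fun (t : ℝ) (ht : 0 ≤ t) => integral_star (Γ := Γ) hS h0 hA hL hK ht s₂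
  have cstar : Continuous fun t => L.solStar (Γ.ρ s₂ ^ 2) t :=
    L.continuous_solStar.comp (by fun_prop : Continuous fun t : ℝ => (Γ.ρ s₂ ^ 2, t))
  have csol : Continuous fun t => K.sol (Γ.ρ s₁ ^ 2) t := K.continuous_sol_right _
  have ca : Continuous fun q : ℝ × ℝ => L.sol (Γ.ρ q.2 ^ 2) q.1 *
      (L.weylMatrix (Γ.ρ q.2) - K.weylMatrix (Γ.ρ q.2)) *
      K.solD (Γ.ρ s₁ ^ 2, Γ.ρ q.2 ^ 2) q.1 :=
    Continuous.comp (g := fun q : ℝ × ℝ => L.sol (Γ.ρ q.1 ^ 2) q.2 *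
      (L.weylMatrix (Γ.ρ q.1) - K.weylMatrix (Γ.ρ q.1)) *
      K.solD (Γ.ρ s₁ ^ 2, Γ.ρ q.1 ^ 2) q.2) (f := fun q : ℝ × ℝ => (q.2, q.1))
      (hm.continuous_sol_mul_solD (Γ.ρ s₁ ^ 2)) (by fun_prop)
  have cb := continuous_solD_mul_solStar (Γ := Γ) hA hL hK (Γ.ρ s₂ ^ 2)
  -- `D M̂ D̃` is written as the integral over `t` of its derivative, and the integral over the
  -- contour is taken inside. The two derivative terms are then those of `IsWeylDiff.integral_eq`
  -- and `integral_star`.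
  have key := integral_intervalIntegral_eq (measurable_deriv fun t => Γ.ρ t ^ 2) ca cb cstar csol hx
    ((Γ.integrable_kap ‖Γ.ρ s₁‖).const_mul Ca) ((Γ.integrable_kap ‖Γ.ρ s₂‖).const_mul Cb)
    (by
      filter_upwards [ba] with s hs t ht
      have := hs t ht
      rwa [K.D_eq ht.1] at this)
    (by
      filter_upwards [bb] with s hs t ht
      have := hs t ht
      rwa [L.D_eq ht.1] at this)
  simp only at key
  simp only [← smul_solD_mul_solD _ _ _ _ _ hx] at key
  have e1 : ∀ s, L.D x (Γ.ρ s ^ 2) (Γ.ρ s₂ ^ 2) = L.solD (Γ.ρ s ^ 2, Γ.ρ s₂ ^ 2) x :=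
    fun s => L.D_eq hx _ _
  have e2 : ∀ s, K.D x (Γ.ρ s₁ ^ 2) (Γ.ρ s ^ 2) = K.solD (Γ.ρ s₁ ^ 2, Γ.ρ s ^ 2) x :=
    fun s => K.D_eq hx _ _
  simp only [e1, e2]
  rw [key]
  have i1 : IntervalIntegrable (fun t => K.solStar (Γ.ρ s₂ ^ 2) t * K.sol (Γ.ρ s₁ ^ 2) t)
      volume 0 x := Continuous.intervalIntegrable (K.continuous_solStar_mul_sol.comp
    (by fun_prop : Continuous fun t : ℝ => ((Γ.ρ s₁ ^ 2, Γ.ρ s₂ ^ 2), t))) _ _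
  have i2 : IntervalIntegrable (fun t => L.solStar (Γ.ρ s₂ ^ 2) t * L.sol (Γ.ρ s₁ ^ 2) t)
      volume 0 x := Continuous.intervalIntegrable (L.continuous_solStar_mul_sol.comp
    (by fun_prop : Continuous fun t : ℝ => ((Γ.ρ s₁ ^ 2, Γ.ρ s₂ ^ 2), t))) _ _
  rw [Problem.solD, Problem.solD, ← intervalIntegral.integral_sub i1 i2,
    ← intervalIntegral.integral_smul]
  refine intervalIntegral.integral_congr fun t ht => ?_
  rw [uIcc_of_le hx] at ht
  have h1 := va t ht.1
  have h2 := vb t ht.1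
  simp only [K.D_eq ht.1] at h1
  simp only [L.D_eq ht.1] at h2
  simp only [Problem.solD]
  -- The sum telescopes: `φ* (φ̃ - φ) + (φ̃* - φ*) φ̃ = φ̃* φ̃ - φ* φ`.
  rw [h1, h2, mul_smul_comm, smul_mul_assoc, ← smul_add]
  congr 1
  noncomm_ring

end Contour

/-! ### The resolvent identities and the inverse operator. -/

variable {n : ℕ}

namespace Contour

variable {S : Set ℂ} {Γ : Contour S} {L K : Problem n}

theorem IsKernel.neg_congr {G : Γ.support → Γ.support → Mat n} (h : Γ.IsKernel K G)
    (hA : K.A = L.A) : Γ.IsKernel L fun p q => -G p q where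
  cont := h.cont.neg
  bound := by
    obtain ⟨C, hC⟩ := h.bound
    refine ⟨C, fun p q => ?_⟩
    rw [mul_neg, neg_mul, norm_neg, ← weight_congr K hA, ← L.weightInv_congr K hA]
    exact hC p q

theorem isKernel_kernel (hA : K.A = L.A) (hL : L.Lam ⊆ S) (hK : K.Lam ⊆ S) {x : ℝ} (hx : 0 ≤ x) :
    Γ.IsKernel L fun p q => kernel L K K x ((p : ℂ) ^ 2) q :=
  (isWeylDiff (Γ := Γ) hA hL hK).isKernel hx

/-- Exchanging the problems only changes the sign of `M̂`, so `r` is minus the kernel of the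
exchanged pair. -/
theorem isKernel_kernel' (hA : K.A = L.A) (hL : L.Lam ⊆ S) (hK : K.Lam ⊆ S) {x : ℝ} (hx : 0 ≤ x) :
    Γ.IsKernel L fun p q => kernel L K L x ((p : ℂ) ^ 2) q := by
  have h := (isKernel_kernel (Γ := Γ) hA.symm hK hL hx).neg_congr hA
  have e : (fun p q : Γ.support => -kernel K L L x ((p : ℂ) ^ 2) (q : ℂ)) =
      fun p q : Γ.support => kernel L K L x ((p : ℂ) ^ 2) (q : ℂ) := by
    funext p q
    rw [kernel, kernel, ← neg_mul, neg_sub]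
  rwa [e] at h

theorem integrable_D_mul_kernel (hA : K.A = L.A) (hL : L.Lam ⊆ S) (hK : K.Lam ⊆ S) {x : ℝ}
    (hx : 0 ≤ x) (p r : Γ.support) : Integrable (Γ.form fun q =>
      L.D x ((q : ℂ) ^ 2) ((r : ℂ) ^ 2) * kernel L K K x ((p : ℂ) ^ 2) q) := by
  obtain ⟨C, hC, hb⟩ := Γ.exists_D_bound L x
  refine (isKernel_kernel (Γ := Γ) hA hL hK hx).integrable
    (z := fun q => L.D x ((q : ℂ) ^ 2) ((r : ℂ) ^ 2)) ?_ (B := ‖L.weightInv (r : ℂ)‖ * C)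
    (fun q => ?_) p
  · simp only [L.D_eq hx]
    exact L.continuous_solD.comp (f := fun q : Γ.support => (((q : ℂ) ^ 2, (r : ℂ) ^ 2), x))
      (by fun_prop)
  · obtain ⟨w, s, rfl⟩ := q
    obtain ⟨w', s', rfl⟩ := r
    have h1 : L.weightInv (Γ.ρ s') * L.weight (Γ.ρ s') = 1 :=
      L.weightInv_mul_weight (Γ.ne_zero (Γ.pt s'))
    have e : L.D x (Γ.ρ s ^ 2) (Γ.ρ s' ^ 2) * L.weight (Γ.ρ s) = L.weightInv (Γ.ρ s') *
        (L.weight (Γ.ρ s') * L.D x (Γ.ρ s ^ 2) (Γ.ρ s' ^ 2) * L.weight (Γ.ρ s)) := by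
      rw [mul_assoc (L.weight _), ← mul_assoc (L.weightInv _), h1, one_mul]
    change ‖L.D x (Γ.ρ s ^ 2) (Γ.ρ s' ^ 2) * L.weight (Γ.ρ s)‖ ≤ ‖L.weightInv (Γ.ρ s')‖ * C
    rw [e]
    refine (norm_mul_le _ _).trans (mul_le_mul_of_nonneg_left
      ((hb s s' x ⟨hx, le_rfl⟩).trans (mul_le_of_le_one_right hC (inv_le_one_of_one_le₀ ?_)))
      (norm_nonneg _))
    linarith [abs_nonneg (‖Γ.ρ s‖ - ‖Γ.ρ s'‖)]

theorem integral_D_mul_kernel (hS : IsCompact S) (h0 : (0 : ℂ) ∈ S) (hA : K.A = L.A)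
    (hL : L.Lam ⊆ S) (hK : K.Lam ⊆ S) {x : ℝ} (hx : 0 ≤ x) (p r : Γ.support) :
    (2 * (Real.pi : ℂ) * Complex.I)⁻¹ • (Γ.integral fun q =>
      L.D x ((q : ℂ) ^ 2) ((r : ℂ) ^ 2) * kernel L K K x ((p : ℂ) ^ 2) q) =
      K.D x ((p : ℂ) ^ 2) ((r : ℂ) ^ 2) - L.D x ((p : ℂ) ^ 2) ((r : ℂ) ^ 2) := by
  obtain ⟨w, s₁, rfl⟩ := p
  obtain ⟨w', s₂, rfl⟩ := r
  have h := integral_D_mul_D (Γ := Γ) hS h0 hA hL hK hx s₁ s₂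
  rw [inv_smul_eq_iff₀ Complex.two_pi_I_ne_zero, ← h]
  simp only [integral, form, kernel, ← mul_assoc]
  rfl

/-- The relation between the two functions `D`, multiplied from the left by `M̂` at the outer point
`r`. -/
theorem integral_kernel_mul_kernel (hS : IsCompact S) (h0 : (0 : ℂ) ∈ S) (hA : K.A = L.A)
    (hL : L.Lam ⊆ S) (hK : K.Lam ⊆ S) {x : ℝ} (hx : 0 ≤ x) (p r : Γ.support) :
    (2 * (Real.pi : ℂ) * Complex.I)⁻¹ • (Γ.integral fun q =>
      kernel L K L x ((q : ℂ) ^ 2) r * kernel L K K x ((p : ℂ) ^ 2) q) =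
      kernel L K K x ((p : ℂ) ^ 2) r - kernel L K L x ((p : ℂ) ^ 2) r := by
  have h1 := integrable_D_mul_kernel (Γ := Γ) hA hL hK hx p r
  have h2 := integral_D_mul_kernel (Γ := Γ) hS h0 hA hL hK hx p r
  have e : (Γ.integral fun q => kernel L K L x ((q : ℂ) ^ 2) r * kernel L K K x ((p : ℂ) ^ 2) q) =
      (L.weylMatrix r - K.weylMatrix r) * Γ.integral fun q =>
        L.D x ((q : ℂ) ^ 2) ((r : ℂ) ^ 2) * kernel L K K x ((p : ℂ) ^ 2) q := by
    rw [integral, integral, ← integral_const_mul_of_integrable h1]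
    refine integral_congr_ae (ae_of_all _ fun s => ?_)
    simp only [form, mul_smul_comm]
    rw [kernel, mul_assoc]
  rw [e, ← mul_smul_comm, h2, kernel, kernel, mul_sub]

/-- The previous identity with the problems exchanged. The two sign changes cancel in the product,
while on the right they swap the two terms back. -/
theorem integral_kernel_mul_kernel' (hS : IsCompact S) (h0 : (0 : ℂ) ∈ S) (hA : K.A = L.A)
    (hL : L.Lam ⊆ S) (hK : K.Lam ⊆ S) {x : ℝ} (hx : 0 ≤ x) (p r : Γ.support) :
    (2 * (Real.pi : ℂ) * Complex.I)⁻¹ • (Γ.integral fun q =>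
      kernel L K K x ((q : ℂ) ^ 2) r * kernel L K L x ((p : ℂ) ^ 2) q) =
      kernel L K K x ((p : ℂ) ^ 2) r - kernel L K L x ((p : ℂ) ^ 2) r := by
  have h := integral_kernel_mul_kernel (Γ := Γ) hS h0 hA.symm hK hL hx p r
  have e : ∀ (M : Problem n) (lam τ : ℂ), kernel K L M x lam τ = -kernel L K M x lam τ :=
    fun M lam τ => by rw [kernel, kernel, ← neg_mul, neg_sub]
  simp only [e, neg_mul_neg] at h
  rw [h]
  abel

/-- By Fubini's theorem the composition has the kernel given by the inner integral, so an identity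
of kernels becomes one of operators. The operator applied first contributes the left factor, since
`z` is multiplied from the left. -/
theorem IsKernel.op_op {G₁ G₂ G₃ G₄ : Γ.support → Γ.support → Mat n} (h₁ : Γ.IsKernel L G₁)
    (h₂ : Γ.IsKernel L G₂) (h₃ : Γ.IsKernel L G₃) (h₄ : Γ.IsKernel L G₄)
    (h : ∀ p r, (2 * (Real.pi : ℂ) * Complex.I)⁻¹ • (Γ.integral fun q => G₂ q r * G₁ p q) =
      G₃ p r - G₄ p r) (z : XSpace L Γ) : h₁.op (h₂.op z) = h₃.op z - h₄.op z := by
  apply Subtype.ext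
  ext1 p
  change h₁.op (h₂.op z) p = h₃.op z p - h₄.op z p
  rw [op_apply, op_apply, op_apply, ← smul_sub]
  congr 1
  simp only [op_apply, smul_mul_assoc]
  have e1 : (Γ.integral fun q => (2 * (Real.pi : ℂ) * Complex.I)⁻¹ •
      ((Γ.integral fun r => z r * G₂ q r) * G₁ p q)) = (2 * (Real.pi : ℂ) * Complex.I)⁻¹ •
      Γ.integral fun q => (Γ.integral fun r => z r * G₂ q r) * G₁ p q := by
    rw [integral, integral, ← integral_smul]
    refine integral_congr_ae (ae_of_all _ fun s => ?_)
    simp only [form]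
    rw [smul_comm]
  rw [e1, integral_integral h₁ h₂ z.1.continuous (norm_apply_le z) p]
  have e2 : (2 * (Real.pi : ℂ) * Complex.I)⁻¹ •
      (Γ.integral fun r => z r * Γ.integral fun q => G₂ q r * G₁ p q) =
      Γ.integral fun r => z r * (G₃ p r - G₄ p r) := by
    rw [integral, integral, ← integral_smul]
    refine integral_congr_ae (ae_of_all _ fun s => ?_)
    simp only [form]
    rw [smul_comm, ← mul_smul_comm, h]
  rw [e2]
  have e3 := integral_sub (h₃.absConv z p) (h₄.absConv z p)
  rw [integral, integral, integral, ← e3]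
  refine integral_congr_ae (ae_of_all _ fun s => ?_)
  simp only [form, mul_sub, smul_sub]

/-- The operator of the main equation together with its inverse. -/
def mainEquiv (hS : IsCompact S) (h0 : (0 : ℂ) ∈ S) (hA : K.A = L.A) (hL : L.Lam ⊆ S)
    (hK : K.Lam ⊆ S) {x : ℝ} (hx : 0 ≤ x) : XSpace L Γ ≃L[ℂ] XSpace L Γ :=
  ContinuousLinearEquiv.equivOfInverse
    (ContinuousLinearMap.id ℂ _ + (isKernel_kernel (Γ := Γ) hA hL hK hx).op)
    (ContinuousLinearMap.id ℂ _ - (isKernel_kernel' (Γ := Γ) hA hL hK hx).op)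
    -- With `R̃` and `R` the operators of `r̃` and `r`, the identity `R R̃ = R̃ - R` gives `(1 -
    -- R)(1 + R̃) = 1`. The second verification uses `R̃ R = R̃ - R`.
    (fun z => by
      have h := (isKernel_kernel' (Γ := Γ) hA hL hK hx).op_op (isKernel_kernel hA hL hK hx)
        (isKernel_kernel hA hL hK hx) (isKernel_kernel' hA hL hK hx)
        (integral_kernel_mul_kernel' hS h0 hA hL hK hx) z
      simp only [add_apply, sub_apply,
        ContinuousLinearMap.id_apply, map_add, h]
      abel)
    (fun z => by
      have h := (isKernel_kernel (Γ := Γ) hA hL hK hx).op_op (isKernel_kernel' hA hL hK hx)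
        (isKernel_kernel hA hL hK hx) (isKernel_kernel' hA hL hK hx)
        (integral_kernel_mul_kernel hS h0 hA hL hK hx) z
      simp only [add_apply, sub_apply,
        ContinuousLinearMap.id_apply, map_sub, h]
      abel)

/-- The solution `φ(x, ·)` as an element of `X`. -/
def phiX (Γ : Contour S) (L : Problem n) {x : ℝ} (hx : 0 ≤ x) : XSpace L Γ :=
  ⟨⟨fun p => L.sol ((p : ℂ) ^ 2) x, L.continuous_sol.comp
    (f := fun p : Γ.support => ((p : ℂ) ^ 2, x)) (by fun_prop)⟩, by
    obtain ⟨C, -, h⟩ := Γ.exists_sol_bound L x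
    refine ⟨C, fun p => ?_⟩
    obtain ⟨w, s, rfl⟩ := p
    exact h s x ⟨hx, le_rfl⟩⟩

theorem phiX_apply {x : ℝ} (hx : 0 ≤ x) (p : Γ.support) :
    phiX Γ L hx p = L.sol ((p : ℂ) ^ 2) x := rfl

theorem phiX_add_integral (hS : IsCompact S) (h0 : (0 : ℂ) ∈ S) (hA : K.A = L.A) (hL : L.Lam ⊆ S)
    (hK : K.Lam ⊆ S) {x : ℝ} (hx : 0 ≤ x) (p : Γ.support) :
    K.sol ((p : ℂ) ^ 2) x = phiX Γ L hx p + (2 * (Real.pi : ℂ) * Complex.I)⁻¹ •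
      Γ.integral fun q => phiX Γ L hx q * kernel L K K x ((p : ℂ) ^ 2) q := by
  obtain ⟨w, s, rfl⟩ := p
  have h := (isWeylDiff (Γ := Γ) hA hL hK).integral_eq hS h0 hx s
  have e : (Γ.integral fun q => phiX Γ L hx q * kernel L K K x (Γ.ρ s ^ 2) q) =
      (2 * Real.pi * Complex.I : ℂ) • (K.sol (Γ.ρ s ^ 2) x - L.sol (Γ.ρ s ^ 2) x) := by
    rw [← h]
    simp only [integral, form, kernel, ← mul_assoc]
    rfl
  simp only [e]
  rw [inv_smul_smul₀ Complex.two_pi_I_ne_zero, phiX_apply]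
  simp

end Contour

end MatrixSchrodinger

/-! ### The theorem. -/

theorem mainTheorem3 (n : ℕ) (L L' : MatrixSchrodinger.Problem n) (hA : L'.A = L.A)
    (Γ : MatrixSchrodinger.Contour (L.Lam ∪ L'.Lam ∪ {0})) (x : ℝ) (hx : 0 ≤ x) :
    -- absolute convergence of the integrals
    (∀ (z : MatrixSchrodinger.XSpace L Γ) (p : Γ.support),
      Γ.AbsConv (fun q => z q * MatrixSchrodinger.kernel L L' L' x ((p : ℂ) ^ 2) q) ∧
      Γ.AbsConv (fun q => z q * MatrixSchrodinger.kernel L L' L x ((p : ℂ) ^ 2) q)) ∧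
    -- the main equation has the unique solution `φ(x, ·)` in `X`
    (∃ z : MatrixSchrodinger.XSpace L Γ, (∀ p : Γ.support, z p = L.phi x ((p : ℂ) ^ 2)) ∧
      MatrixSchrodinger.SolvesMainEquation L L' Γ x z ∧
      ∀ w : MatrixSchrodinger.XSpace L Γ,
        MatrixSchrodinger.SolvesMainEquation L L' Γ x w → w = z) ∧
    -- the operator of the main equation is bounded and has an explicit bounded inverse
    (∃ T : MatrixSchrodinger.XSpace L Γ ≃L[ℂ] MatrixSchrodinger.XSpace L Γ,
      (∀ (z : MatrixSchrodinger.XSpace L Γ) (p : Γ.support),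
        T z p = z p + (2 * (Real.pi : ℂ) * Complex.I)⁻¹ •
          Γ.integral fun q => z q * MatrixSchrodinger.kernel L L' L' x ((p : ℂ) ^ 2) q) ∧
      (∀ (z : MatrixSchrodinger.XSpace L Γ) (p : Γ.support),
        T.symm z p = z p - (2 * (Real.pi : ℂ) * Complex.I)⁻¹ •
          Γ.integral fun q => z q * MatrixSchrodinger.kernel L L' L x ((p : ℂ) ^ 2) q)) := by
  have hS : IsCompact (L.Lam ∪ L'.Lam ∪ {0}) := by
    have e : L.Lam ∪ L'.Lam ∪ {0} = insert 0 L.Lam ∪ insert 0 L'.Lam := by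
      ext w
      simp only [Set.mem_union, Set.mem_insert_iff, Set.mem_singleton_iff]
      tauto
    rw [e]
    exact L.isCompact_insert_Lam.union L'.isCompact_insert_Lam
  have h0 : (0 : ℂ) ∈ L.Lam ∪ L'.Lam ∪ {0} := Or.inr rfl
  have hL : L.Lam ⊆ L.Lam ∪ L'.Lam ∪ {0} := fun _ hw => Or.inl (Or.inl hw)
  have hL' : L'.Lam ⊆ L.Lam ∪ L'.Lam ∪ {0} := fun _ hw => Or.inl (Or.inr hw)
  have h1 := MatrixSchrodinger.Contour.isKernel_kernel (Γ := Γ) hA hL hL' hx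
  have h2 := MatrixSchrodinger.Contour.isKernel_kernel' (Γ := Γ) hA hL hL' hx
  let T := MatrixSchrodinger.Contour.mainEquiv (Γ := Γ) hS h0 hA hL hL' hx
  have hT1 : ∀ (z : MatrixSchrodinger.XSpace L Γ) (p : Γ.support),
      T z p = z p + (2 * (Real.pi : ℂ) * Complex.I)⁻¹ •
        Γ.integral fun q => z q * MatrixSchrodinger.kernel L L' L' x ((p : ℂ) ^ 2) q :=
    fun z p => rfl
  have hT2 : ∀ (z : MatrixSchrodinger.XSpace L Γ) (p : Γ.support),
      T.symm z p = z p - (2 * (Real.pi : ℂ) * Complex.I)⁻¹ •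
        Γ.integral fun q => z q * MatrixSchrodinger.kernel L L' L x ((p : ℂ) ^ 2) q :=
    fun z p => rfl
  have hmain : MatrixSchrodinger.SolvesMainEquation L L' Γ x
      (MatrixSchrodinger.Contour.phiX Γ L hx) := fun p => by
    rw [L'.phi_eq hx]
    exact MatrixSchrodinger.Contour.phiX_add_integral hS h0 hA hL hL' hx p
  refine ⟨fun z p => ⟨h1.absConv z p, h2.absConv z p⟩,
    ⟨MatrixSchrodinger.Contour.phiX Γ L hx, fun p => ?_, hmain, fun w hw => ?_⟩, T, hT1, hT2⟩
  · rw [L.phi_eq hx, MatrixSchrodinger.Contour.phiX_apply]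
  -- Both functions have the image `φ̃(x, ·)` under the operator of the main equation.
  · apply T.injective
    apply Subtype.ext
    ext1 p
    exact (hT1 w p).trans ((hw p).symm.trans ((hmain p).trans (hT1 _ p).symm))
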